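/- **Model.** Let $V>0$, $H>0$, $0\le q<1/2$, and let $(\eta^x_t)_{t\ge 0,\,x\in\mathbb R^d}$ be a time-homogeneous Markov family on $\mathbb R^d$ (realised jointly measurably on a probability space, $\eta^x_0=x$), with semigroup $\mathcal T_tf(x)=\mathbb E f(\eta^x_t)$. Consider the branching particle system with immigration that starts from no particles: new particles arrive according to a Poisson random field on $[0,\infty)\times\mathbb R^d$ with intensity $H$ times Lebesgue measure; every particle moves independently according to the Markov family, lives for an exponential time with parameter $V$, and at its death is replaced, at its place of death, by two particles with probability $q$ and by none with probability $1-q$. Let $N_t$ be the empirical measure of the particles alive at time $t$ and $$\langle Y_T(t),\varphi\rangle=\frac1{F_T}\int_0^{Tt}\langle N_s,\varphi\rangle\,ds,\qquad F_T=T,\quad t\in[0,1].$$ **Assumptions.** (A1) For all $r,\epsilon>0$: $\liminf_{s\to0}\inf_{|x|\le r}\mathbb P(\eta^x_s\in B(x,\epsilon))=1$. (A2) $\mathcal S(\mathbb R^d)$ is contained in the domain of the infinitesimal operator of $(\mathcal T_t)$ on $C_0(\mathbb R^d)$. (A3) For every $\varphi\in\mathcal S(\mathbb R^d)$ the semigroup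 $\mathcal T^\varphi_tf(x)=\mathbb E\big[\exp\{\int_0^t\varphi(\eta^x_s)\,ds\}f(\eta^x_t)\big]$ is Feller, i.e. maps $C_0(\mathbb R^d)$ into itself and is strongly continuous there. **Notation.** Fix $\varphi\in\mathcal S(\mathbb R^d)$, $\varphi\ge0$, $\varphi\not\equiv0$. Put $Q=V(1-2q)$, $\mathcal T^Q_t=e^{-Qt}\mathcal T_t$, $Q_0=V\big(1-2\sqrt{q(1-q)}\big)$ and $\theta_0=Q_0/\|\varphi\|_\infty$. For $\theta<\theta_0$ let $v_\varphi(x,t,\theta)$ be the measurable solution, bounded on $\mathbb R^d\times[0,t]$ for every $t$, of $$v(x,t)=\int_0^t\mathcal T^Q_{t-s}[\theta\varphi](x)\,ds+\int_0^t\mathcal T^Q_{t-s}\big[\theta\varphi(\cdot)\,v(\cdot,s)+Vq\,v(\cdot,s)^2\big](x)\,ds,$$ and let $v_\varphi(x,\theta)=\lim_{t\to\infty}v_\varphi(x,t,\theta)$. Let $$A=\lim_{\theta\uparrow\theta_0}\int_{\mathbb R^d}\frac{\partial}{\partial\theta}v_\varphi(x,\theta)\,dx\in[0,\infty].$$ For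 a finite signed Borel measure $\nu$ on $[0,1]$ let $\chi_\nu(s)=\nu((s,1])$, let $B=\{\nu:\sup_{s\in[0,1]}\chi_\nu(s)<\theta_0\}$, and for $\nu\in B$ put $$\Lambda(\nu)=H\int_0^1\int_{\mathbb R^d}v_\varphi(x,\chi_\nu(t))\,dx\,dt .$$ The integral is an extended real number, the integral of the positive part minus that of the negative part, with value $-\infty$ if both are infinite. For $f\in\mathcal C([0,1],\mathbb R)$ let $$\Lambda^*(f)=\sup_{\nu\in B}\Big[\int f\,d\nu-\Lambda(\nu)\Big]\in[0,\infty].$$ Finally, $\mathcal C_{0,HA}$ is the set of $f\in\mathcal C([0,1],\mathbb R)$ that are differentiable on $[0,1]$ (one-sidedly at the end points) with $0<f'(x)<HA$ for all $x\in[0,1]$. **Theorem.** Assume (A1)–(A3). For $\theta<\theta_0$ the equation has a unique solution (in the class above), the limit $v_\varphi(x,\theta)$ exists and is finite, and it is differentiable in $\theta$. Moreover: 1. For every open $U\subset\mathcal C([0,1],\mathbb R)$, $$\liminf_{T\to\infty}T^{-1}\log\mathbb P(\langle Y_T,\varphi\rangle\in U)\ \ge\ -\inf_{f\in U\cap\mathcal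 C_{0,HA}}\Lambda^*(f).$$ 2. For every $f\in\mathcal C_{0,HA}$ with $\Lambda^*(f)<\infty$ and every $\delta>0$ there is $r>0$ such that $$\limsup_{T\to\infty}T^{-1}\log\mathbb P(\langle Y_T,\varphi\rangle\in B(f,r))\ \le\ \delta-\Lambda^*(f),$$ where $B(f,r)$ is the ball of radius $r$ around $f$ in $\mathcal C([0,1],\mathbb R)$. If $f\in\mathcal C_{0,HA}$ and $\Lambda^*(f)=\infty$, then for every real $M$ there is $r>0$ such that the left-hand side is at most $-M$. Here $\{\langle Y_T,\varphi\rangle\in G\}$ is the event that the path $t\mapsto\langle Y_T(t),\varphi\rangle$, $t\in[0,1]$, is finite and belongs to $G$; $\log 0=-\infty$ and $\inf\emptyset=+\infty$. -/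

import Mathlib

open MeasureTheory ProbabilityTheory Filter Set Topology
open scoped ENNReal NNReal SchwartzMap ZeroAtInfty

noncomputable section

namespace BranchingLDP

/-- Euclidean space of dimension `d`. -/
abbrev Space (d : ℕ) : Type := EuclideanSpace ℝ (Fin d)

variable {d : ℕ} {S : Type*} [MeasurableSpace S] {Ω : Type*} [MeasurableSpace Ω]

section Motion

/-- A time-homogeneous Markov family on `ℝ^d`. The variable `η x t`, on the probability space
`(S, m)`, is the position at time `t` of the process started at `x`, and the transition function
is `P_t(x, B) = m (η x t ∈ B)`. The field `markov` is the Markov property with respect to the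
natural filtration: `P(η^x_{t+s} ∈ B | η^x_r, r ≤ t) = P_s(η^x_t, B)`. -/
structure IsMarkovFamily (m : Measure S) (η : Space d → ℝ≥0 → S → Space d) : Prop where
  measurable : Measurable fun p : Space d × ℝ≥0 × S => η p.1 p.2.1 p.2.2
  start : ∀ x, ∀ᵐ w ∂m, η x 0 w = x
  markov : ∀ (x : Space d) (t s : ℝ≥0) (B : Set (Space d)), MeasurableSet B →
    ∀ C : Set S,
      MeasurableSet[⨆ r : Iic t, MeasurableSpace.comap (η x r) inferInstance] C →
      m (C ∩ {w | η x (t + s) w ∈ B}) = ∫⁻ w in C, m {w' | η (η x t w) s w' ∈ B} ∂m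

variable (m : Measure S) (η : Space d → ℝ≥0 → S → Space d)

/-- The transition semigroup `T_t f(x) = E f(η^x_t)`. -/
def semigroup (t : ℝ≥0) (f : Space d → ℝ) (x : Space d) : ℝ :=
  ∫ w, f (η x t w) ∂m

/-- The Feynman-Kac semigroup `T_t^φ f(x) = E [exp (∫_0^t φ(η^x_s) ds) f(η^x_t)]`. -/
def feynmanKac (φ : Space d → ℝ) (t : ℝ≥0) (f : Space d → ℝ) (x : Space d) : ℝ :=
  ∫ w, Real.exp (∫ s in (0 : ℝ)..t, φ (η x s.toNNReal w)) * f (η x t w) ∂m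

/-- Almost uniform stochastic continuity. -/
def AlmostUniformlyStochCont : Prop :=
  ∀ r : ℝ, 0 < r → ∀ ε : ℝ, 0 < ε →
    liminf (fun s : ℝ≥0 => ⨅ x ∈ {x : Space d | ‖x‖ ≤ r}, m {w | η x s w ∈ Metric.ball x ε})
      (𝓝[>] 0) = 1

/-- Every Schwartz function is in the domain of the infinitesimal operator of the semigroup
`T_t` on `C₀(ℝ^d)`: the difference quotients converge uniformly to an element of `C₀(ℝ^d)`. -/
def SchwartzSubsetDomain : Prop :=
  ∀ φ : 𝓢(Space d, ℝ), ∃ g : C₀(Space d, ℝ),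
    TendstoUniformly (fun (t : ℝ≥0) x => (semigroup m η t φ x - φ x) / t) g (𝓝[>] 0)

/-- For every Schwartz function `φ`, the semigroup `T_t^φ` is a Feller semigroup, i.e. a strongly
continuous semigroup on `C₀(ℝ^d)`. -/
def FeynmanKacFeller : Prop :=
  ∀ (φ : 𝓢(Space d, ℝ)) (f : C₀(Space d, ℝ)),
    (∀ t : ℝ≥0, ∃ g : C₀(Space d, ℝ), ∀ x, g x = feynmanKac m η φ t f x) ∧
    TendstoUniformly (fun (t : ℝ≥0) x => feynmanKac m η φ t f x) f (𝓝[>] 0)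

end Motion

section ParticleSystem

/-- The random field `∑ n, δ_{ξ n}` on `X` is a Poisson random field with intensity `Λ`. -/
structure IsPoissonField {X : Type*} [MeasurableSpace X] (P : Measure Ω) (ξ : ℕ → Ω → X)
    (Λ : Measure X) : Prop where
  measurable : ∀ n, Measurable (ξ n)
  count_law : ∀ B : Set X, MeasurableSet B → Λ B ≠ ∞ → ∀ k : ℕ,
    P {ω | {n | ξ n ω ∈ B}.encard = k} = poissonMeasure (Λ B).toNNReal {k}
  count_indep : ∀ (k : ℕ) (B : Fin k → Set X), (∀ i, MeasurableSet (B i)) →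
    Pairwise (fun i j => Disjoint (B i) (B j)) →
    iIndepFun (fun i ω => {n | ξ n ω ∈ B i}.encard) P

/-- The data attached to one particle: the noise that drives its motion, its lifetime, and whether
it splits into two particles when it dies. -/
abbrev Mark (S : Type*) : Type _ := S × ℝ × Bool

/-- The law on `Bool` with masses `q` at `true` (two children) and `1 - q` at `false` (no child);
the generating function of the number of children is `F(s) = q s² + (1 - q)`. -/
def splitLaw (q : ℝ) : Measure Bool :=
  ENNReal.ofReal q • Measure.dirac true + ENNReal.ofReal (1 - q) • Measure.dirac false

/-- The randomness of the branching particle system with immigration. The `n`-th immigrant arrives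
at the time and place `ξ n`; these points form a Poisson random field on `[0,∞) × ℝ^d` with
intensity `H` times Lebesgue measure. Each particle is labelled by its immigrant `n` and a finite
binary word `u`, and carries the mark `Z (n, u)`. The marks are i.i.d. and independent of the
immigration, with independent components: motion noise of law `m`, exponential lifetime with
parameter `V`, and splitting with probability `q`. -/
structure IsBranchingData (P : Measure Ω) (m : Measure S) (V q H : ℝ)
    (ξ : ℕ → Ω → ℝ × Space d) (Z : ℕ × List Bool → Ω → Mark S) : Prop where
  immigration : IsPoissonField P ξ
    (ENNReal.ofReal H • ((volume.restrict (Ici (0 : ℝ))).prod (volume : Measure (Space d))))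
  mark_measurable : ∀ p, Measurable (Z p)
  mark_law : ∀ p, P.map (Z p) = m.prod ((expMeasure V).prod (splitLaw q))
  mark_indep : iIndepFun Z P
  indep : IndepFun (fun ω n => ξ n ω) (fun ω p => Z p ω) P

variable (η : Space d → ℝ≥0 → S → Space d)

/-- Time and place of birth of the particle with label `u`, in the family of a particle born at
time `p.1` and place `p.2`; the value is `none` if this particle is never born. The marks of the
family are `z`. The two children of a particle that splits are born at the time of its death, at
the place of its death. -/
def birth : (List Bool → Mark S) → ℝ × Space d → List Bool → Option (ℝ × Space d)
  | _, p, [] => some p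
  | z, p, b :: u =>
    if (z []).2.2 = true then
      birth (fun w => z (b :: w)) (p.1 + (z []).2.1, η p.2 (z []).2.1.toNNReal (z []).1) u
    else none

/-- The contribution at time `t` of a particle to the empirical measure, given its birth and its
mark: the unit mass at its position if it is alive at time `t`, and zero otherwise. -/
def particleMeasure (t : ℝ) : Option (ℝ × Space d) → Mark S → Measure (Space d)
  | none, _ => 0
  | some p, z =>
    open Classical in
    if p.1 ≤ t ∧ t < p.1 + z.2.1 then Measure.dirac (η p.2 (t - p.1).toNNReal z.1) else 0

/-- The empirical measure `N_t` of the system, for immigrants `ξ` and marks `z`. -/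
def population (ξ : ℕ → ℝ × Space d) (z : ℕ × List Bool → Mark S) (t : ℝ) :
    Measure (Space d) :=
  Measure.sum fun p : ℕ × List Bool =>
    particleMeasure η t (birth η (fun u => z (p.1, u)) (ξ p.1) p.2) (z p)

/-- `⟨Y_T(t), φ⟩ = F_T⁻¹ ∫_0^{Tt} ⟨N_s, φ⟩ ds` for `φ ≥ 0`, as an element of `[0,∞]`. Here `FT`
is the norming `F_T`. -/
def occupation (N : ℝ → Measure (Space d)) (φ : Space d → ℝ) (FT T t : ℝ) : ℝ≥0∞ :=
  (∫⁻ s in Icc 0 (T * t), ∫⁻ x, ENNReal.ofReal (φ x) ∂(N s)) / ENNReal.ofReal FT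

/-- The event that the path `t ↦ ⟨Y_T(t), φ⟩`, `t ∈ [0,1]`, is (finite and) an element of the set
`G` of continuous functions, with norming `F_T = T`. -/
def occupationEvent (ξ : ℕ → Ω → ℝ × Space d) (Z : ℕ × List Bool → Ω → Mark S)
    (φ : Space d → ℝ) (T : ℝ) (G : Set C(unitInterval, ℝ)) : Set Ω :=
  {ω | ∃ g ∈ G, ∀ t : unitInterval,
    ((occupation (population η (fun n => ξ n ω) (fun p => Z p ω)) φ T T t : ℝ≥0∞) : EReal)
      = ((g t : ℝ) : EReal)}

end ParticleSystem

section RateFunction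

variable (m : Measure S) (η : Space d → ℝ≥0 → S → Space d) (V q H : ℝ) (φ : Space d → ℝ)

/-- `Q = V (1 - 2q)`. -/
def killRate : ℝ := V * (1 - 2 * q)

/-- `Q₀ = V (1 - 2 √(q (1 - q)))`. -/
def criticalRate : ℝ := V * (1 - 2 * √(q * (1 - q)))

/-- The supremum norm of `φ`. -/
def supNorm : ℝ := ⨆ x, |φ x|

/-- The critical parameter `Q₀ / ‖φ‖_∞`. -/
def thetaMax : ℝ := criticalRate V q / supNorm φ

/-- `T_t^Q f(x) = exp (-Q t) T_t f(x)`. -/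
def killedSemigroup (t : ℝ≥0) (f : Space d → ℝ) (x : Space d) : ℝ :=
  Real.exp (-killRate V q * t) * semigroup m η t f x

/-- The function `v(x, t)` is a measurable and locally bounded (in `t`, uniformly in `x`) solution
of the one-particle equation
`v(x,t) = ∫_0^t T^Q_{t-s} (θφ) (x) ds + ∫_0^t T^Q_{t-s} (θφ(·) v(·,s) + V q v(·,s)²)(x) ds`. -/
structure IsOneParticleSolution (θ : ℝ) (v : Space d → ℝ≥0 → ℝ) : Prop where
  measurable : Measurable (Function.uncurry v)
  bounded : ∀ t : ℝ≥0, ∃ K : ℝ, ∀ s ≤ t, ∀ x, |v x s| ≤ K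
  equation : ∀ x (t : ℝ≥0), v x t =
    (∫ s in (0 : ℝ)..t, killedSemigroup m η V q (t - s.toNNReal) (fun y => θ * φ y) x) +
    ∫ s in (0 : ℝ)..t, killedSemigroup m η V q (t - s.toNNReal)
      (fun y => θ * φ y * v y s.toNNReal + V * q * v y s.toNNReal ^ 2) x

open Classical in
/-- The solution `v_φ(x, t, θ)` of the one-particle equation (zero if there is none). -/
def oneParticle (θ : ℝ) : Space d → ℝ≥0 → ℝ :=
  if h : ∃ v, IsOneParticleSolution m η V q φ θ v then h.choose else 0

/-- `v_φ(x, θ) = lim_{t → ∞} v_φ(x, t, θ)`. -/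
def vLim (x : Space d) (θ : ℝ) : ℝ :=
  limUnder atTop fun t : ℝ≥0 => oneParticle m η V q φ θ x t

/-- `A = lim ∫ ∂/∂θ v_φ(x, θ) dx` as `θ` increases to `Q₀ / ‖φ‖_∞`, in `[0,∞]` (the integral is
nondecreasing in `θ`). -/
def slopeA : ℝ≥0∞ :=
  limsup (fun θ => ∫⁻ x, ENNReal.ofReal (deriv (fun ϑ => vLim m η V q φ x ϑ) θ))
    (𝓝[<] thetaMax V q φ)

/-- `χ_ν(s) = ν((s, 1])` for a finite signed measure `ν` on `[0,1]`. -/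
def chi (ν : SignedMeasure unitInterval) (s : unitInterval) : ℝ := ν (Ioi s)

/-- `⟨f, ν⟩ = ∫ f dν`. -/
def pairing (f : C(unitInterval, ℝ)) (ν : SignedMeasure unitInterval) : ℝ :=
  (∫ t, f t ∂ν.toJordanDecomposition.posPart) - ∫ t, f t ∂ν.toJordanDecomposition.negPart

/-- The finite signed measures `ν` on `[0,1]` with `sup χ_ν < Q₀ / ‖φ‖_∞`. -/
def admissible : Set (SignedMeasure unitInterval) :=
  {ν | ∃ c < thetaMax V q φ, ∀ s, chi ν s ≤ c}

/-- `Λ(ν) = H ∫_0^1 ∫ v_φ(x, χ_ν(t)) dx dt`, as an extended real number: the integral of the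
positive part minus the integral of the negative part. -/
def Lambda (ν : SignedMeasure unitInterval) : EReal :=
  ((ENNReal.ofReal H * ∫⁻ t : unitInterval, ∫⁻ x, ENNReal.ofReal (vLim m η V q φ x (chi ν t)) : ℝ≥0∞) : EReal)
  - ((ENNReal.ofReal H * ∫⁻ t : unitInterval, ∫⁻ x, ENNReal.ofReal (-vLim m η V q φ x (chi ν t)) : ℝ≥0∞) :
      EReal)

/-- `Λ*(f) = sup (⟨f, ν⟩ - Λ(ν))` over the admissible signed measures `ν`. -/
def LambdaStar (f : C(unitInterval, ℝ)) : EReal :=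
  ⨆ ν ∈ admissible V q φ, ((pairing f ν : ℝ) : EReal) - Lambda m η V q H φ ν

/-- The continuous functions on `[0,1]` that are differentiable at each point of `[0,1]` (one-sided
at the end points) with derivative in `(a, b)`. -/
def slopeClass (a b : EReal) : Set C(unitInterval, ℝ) :=
  {f | ∃ f' : ℝ → ℝ, ∀ x ∈ Icc (0 : ℝ) 1,
    HasDerivWithinAt (IccExtend zero_le_one f) (f' x) (Icc 0 1) x ∧ a < f' x ∧ (f' x : EReal) < b}

end RateFunction

end BranchingLDP

end

open BranchingLDP

noncomputable section
set_option linter.unusedSectionVars false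
namespace BranchingLDP

/-! The immigrants and their families form a marked Poisson field, so exponential moments of the
occupation are explicit. Let `J` be the total occupation `∫ ⟨N_u, φ⟩ du` of the family of one
particle started at `x`. The solution of the one-particle equation is `E exp (θ J_t) - 1`, where
`J_t` is the occupation up to time `t`, and its limit is `v_φ(x, θ) = E exp (θ J) - 1`. This is a
moment generating function, hence differentiable below the threshold. Its finiteness there is a
Galton-Watson estimate: `Q₀` is the value at which a quadratic supersolution of the branching
recursion stops existing (`exists_moment_bound`, `lintegral_expE_famOcc_le`). The equation itself
comes from decomposing at the death of the first particle and from Duhamel's formula for Feynman-Kac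
functionals (`laplace_renewal`, `mild_of_renewal`).

For a weight `χ` on `[0, 1)`, the exponential formula for marked Poisson fields gives `T⁻¹ log E exp
(∫ χ(s/T) ⟨N_s, φ⟩ ds)` as an integral over macroscopic birth times `σ` and birth places `x` of the
exponential moment of one family minus one (`popExp_eq_exp`). A family lives on the microscopic time
scale, so its weight freezes at `χ(σ)` as `T → ∞`. Dominated convergence yields the limit `∫_0^1
G(χ(σ)) dσ` with `G(θ) = H ∫ v_φ(x, θ) dx` (`tendsto_scaledCgf`, `limitCgf_eq`), which is `Λ(ν)`
when `χ = χ_ν`.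

The envelope needs integrability over all of space, and here a dichotomy enters. If `∫ E(1 - exp
(-J)) dx` is finite, then `exp (θ J) - 1` is integrable for every subcritical `θ`
(`integrable_exp_sub_one`). For `θ > 0` the reason is a two-sided comparison with the mean
occupation `R_Q φ`. From above, the quadratic term of the stationary equation is absorbed with the
help of resolvent inequalities (`exists_gain_le_meanOcc`). From below, the linear part of the
Laplace transform dominates at a small parameter (`exists_meanOcc_le`). If that integral is
infinite, the weight `-1` shows that `Λ*` is identically infinite and that every ball has
superexponentially small probability, so all bounds hold trivially.

The upper bound is Chernoff's inequality with a nearly optimal `ν`, since `⟨Y_T, ν⟩` is the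
occupation with weight `χ_ν`, up to scaling (`lintegral_occupation`).

For the lower bound, `[0, 1)` is cut into `n` cells. The increments of `⟨Y_T, φ⟩` have the limiting
cumulant generating function `(1/n) ∑ G(θ_i)`. By the mean value theorem the increment of `f` over a
cell is `s_i / n` with `0 < s_i < HA`, and by Darboux's theorem `s_i = G'(θ_i)` for some subcritical
`θ_i` (`exists_cgfDeriv_eq`). Exponential tilting by these `θ_i` makes the increments of `f` typical
(`eventually_le_measure_of_tilting`). The cost is `∑ θ_i Δ_i f - (1/n) ∑ G(θ_i)`, which is at most
`Λ*(f)` because step functions are tail functions of admissible measures. Since occupation paths are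
increasing, closeness at grid points gives uniform closeness. -/

/-- The marks of the particles of one family. -/
abbrev Marks (S : Type*) : Type _ := List Bool → Mark S

/-! ### Exponentials of integrals of bounded measurable functions. -/

section Calculus

/-- Measurability of interval integrals depending on a parameter. -/
lemma measurable_intervalIntegral_param {α : Type*} [MeasurableSpace α] {f : α → ℝ → ℝ}
    {a b : α → ℝ} (hf : Measurable (Function.uncurry f)) (ha : Measurable a) (hb : Measurable b) :
    Measurable fun x => ∫ v in a x..b x, f x v := by
  have key : ∀ {a b : α → ℝ}, Measurable a → Measurable b →
      Measurable fun x => ∫ v in Ioc (a x) (b x), f x v := by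
    intro a b ha hb
    have h1 : ∀ x, ∫ v in Ioc (a x) (b x), f x v =
        ∫ v, {p : α × ℝ | a p.1 < p.2 ∧ p.2 ≤ b p.1}.indicator (Function.uncurry f) (x, v) := by
      intro x
      rw [← integral_indicator measurableSet_Ioc]
      rfl
    simp_rw [h1]
    have hs : MeasurableSet {p : α × ℝ | a p.1 < p.2 ∧ p.2 ≤ b p.1} :=
      (measurableSet_lt (ha.comp measurable_fst) measurable_snd).inter
        (measurableSet_le measurable_snd (hb.comp measurable_fst))
    exact ((hf.indicator hs).stronglyMeasurable.integral_prod_right').measurable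
  simp only [intervalIntegral]
  exact (key ha hb).sub (key hb ha)

lemma intervalIntegrable_of_bounded {c : ℝ → ℝ} (hc : Measurable c) {K : ℝ} (hK : ∀ u, |c u| ≤ K)
    (a b : ℝ) : IntervalIntegrable c volume a b := by
  refine (intervalIntegrable_const (c := K)).mono_fun hc.aestronglyMeasurable ?_
  refine ae_of_all _ fun u => ?_
  simpa using (hK u).trans (le_abs_self K)

lemma abs_intervalIntegral_le {c : ℝ → ℝ} {K : ℝ} (hK : ∀ u, |c u| ≤ K)
    {a b : ℝ} (hab : a ≤ b) : |∫ u in a..b, c u| ≤ K * (b - a) := by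
  have := intervalIntegral.norm_integral_le_of_norm_le_const (f := c) (a := a) (b := b) (C := K)
    fun x _ => hK x
  rwa [Real.norm_eq_abs, abs_of_nonneg (sub_nonneg.2 hab)] at this

/-- The exponential of an indefinite integral solves the corresponding linear equation. -/
lemma integral_mul_exp_integral {c : ℝ → ℝ} (hc : Measurable c) {K : ℝ} (hK : ∀ u, |c u| ≤ K)
    {a b : ℝ} (hab : a ≤ b) :
    ∫ u in a..b, c u * Real.exp (∫ v in a..u, c v) = Real.exp (∫ v in a..b, c v) - 1 := by
  have hint := intervalIntegrable_of_bounded hc hK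
  have hK0 : 0 ≤ K := (abs_nonneg _).trans (hK 0)
  set g : ℝ → ℝ := fun u => ∫ v in a..u, c v with hg
  have hgL : ∀ u v, |g u - g v| ≤ K * |u - v| := by
    intro u v
    rw [hg]
    simp only
    rw [intervalIntegral.integral_interval_sub_left (hint _ _) (hint _ _)]
    exact intervalIntegral.norm_integral_le_of_norm_le_const (f := c) (C := K) fun x _ => hK x
  set M : ℝ := K * (b - a) with hM
  have hgM : ∀ u ∈ uIcc a b, |g u| ≤ M := by
    intro u hu
    rw [uIcc_of_le hab] at hu
    refine (abs_intervalIntegral_le hK hu.1).trans ?_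
    exact mul_le_mul_of_nonneg_left (by linarith [hu.2]) hK0
  have hexpL : ∀ s t : ℝ, |s| ≤ M → |t| ≤ M → |Real.exp s - Real.exp t| ≤ Real.exp M * |s - t| := by
    have : ∀ s t : ℝ, t ≤ s → s ≤ M → Real.exp s - Real.exp t ≤ Real.exp M * (s - t) := by
      intro s t hts hs
      have h1 : Real.exp t = Real.exp s * Real.exp (t - s) := by rw [← Real.exp_add]; ring_nf
      have h2 := Real.add_one_le_exp (t - s)
      have h3 := Real.exp_le_exp.2 hs
      have h4 := Real.exp_pos s
      nlinarith
    intro s t hs ht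
    rcases le_total t s with h | h
    · rw [abs_of_nonneg (sub_nonneg.2 (Real.exp_le_exp.2 h)), abs_of_nonneg (sub_nonneg.2 h)]
      exact this s t h (abs_le.1 hs).2
    · rw [abs_sub_comm, abs_of_nonneg (sub_nonneg.2 (Real.exp_le_exp.2 h)), abs_sub_comm,
        abs_of_nonneg (sub_nonneg.2 h)]
      exact this t s h (abs_le.1 ht).2
  -- Since `c` is only measurable, the fundamental theorem is applied through absolute continuity.
  -- The exponential of the primitive is Lipschitz on `[a, b]`, and Lebesgue differentiation gives
  -- its derivative almost everywhere.
  have hF : AbsolutelyContinuousOnInterval (fun u => Real.exp (g u)) a b := by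
    have : LipschitzOnWith (Real.toNNReal (Real.exp M * K)) (fun u => Real.exp (g u)) (uIcc a b) := by
      refine LipschitzOnWith.of_dist_le_mul fun u hu v hv => ?_
      rw [Real.coe_toNNReal _ (by positivity), Real.dist_eq, Real.dist_eq]
      refine (hexpL _ _ (hgM u hu) (hgM v hv)).trans ?_
      rw [mul_assoc]
      gcongr
      exact hgL u v
    exact this.absolutelyContinuousOnInterval
  have h0 := hF.integral_deriv_eq_sub
  have h1 : g a = 0 := by simp [hg]
  simp only [h1, Real.exp_zero] at h0
  rw [← h0]
  refine intervalIntegral.integral_congr_ae ?_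
  filter_upwards [(hint a b).ae_hasDerivAt_integral] with u hu hu'
  have := (hu (uIoc_subset_uIcc hu') a left_mem_uIcc).exp
  rw [this.deriv, mul_comm]

/-- Backward version: the exponential over `[u, b]` equals the one over `[a, b]` times the
exponential of the integral of `-c` over `[a, u]`, which reduces the claim to the forward version
for `-c`. -/
lemma integral_mul_exp_integral' {c : ℝ → ℝ} (hc : Measurable c) {K : ℝ} (hK : ∀ u, |c u| ≤ K)
    {a b : ℝ} (hab : a ≤ b) :
    ∫ u in a..b, c u * Real.exp (∫ v in u..b, c v) = Real.exp (∫ v in a..b, c v) - 1 := by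
  have hint := intervalIntegrable_of_bounded hc hK
  have h := integral_mul_exp_integral hc.neg (K := K) (by simpa using hK) hab
  have h2 : ∀ u, c u * Real.exp (∫ v in u..b, c v) =
      - Real.exp (∫ v in a..b, c v) *
        ((-c) u * Real.exp (∫ v in a..u, (-c) v)) := by
    intro u
    rw [← intervalIntegral.integral_add_adjacent_intervals (hint a u) (hint u b)]
    simp only [Pi.neg_apply, intervalIntegral.integral_neg, Real.exp_add, Real.exp_neg]
    field_simp
  simp_rw [h2]
  rw [intervalIntegral.integral_const_mul, h]
  simp only [Pi.neg_apply, intervalIntegral.integral_neg, Real.exp_neg]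
  field_simp
  ring

end Calculus

/-! ### The Markov property for exponential functionals of the past. -/

section Markov

variable {d : ℕ} {S : Type*} [MeasurableSpace S] {m : Measure S}
  {η : Space d → ℝ≥0 → S → Space d}

lemma IsMarkovFamily.measurable_comp (hη : IsMarkovFamily m η) {α : Type*} [MeasurableSpace α]
    {f : α → Space d} {g : α → ℝ≥0} {h : α → S} (hf : Measurable f) (hg : Measurable g)
    (hh : Measurable h) : Measurable fun a => η (f a) (g a) (h a) :=
  hη.measurable.comp (hf.prodMk (hg.prodMk hh))

lemma measurable_semigroup [IsProbabilityMeasure m] (hη : IsMarkovFamily m η) {α : Type*}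
    [MeasurableSpace α]
    {f : α → Space d} {t : α → ℝ≥0} {g : α → Space d → ℝ} (hf : Measurable f) (ht : Measurable t)
    (hg : Measurable (Function.uncurry g)) : Measurable fun a => semigroup m η (t a) (g a) (f a) := by
  have : Measurable fun p : α × S => g p.1 (η (f p.1) (t p.1) p.2) :=
    hg.comp (measurable_fst.prodMk (hη.measurable_comp (hf.comp measurable_fst)
      (ht.comp measurable_fst) measurable_snd))
  exact (this.stronglyMeasurable.integral_prod_right').measurable

lemma abs_integral_le_of_abs_le [IsProbabilityMeasure m] {f : S → ℝ} {K : ℝ} (h : ∀ w, |f w| ≤ K) :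
    |∫ w, f w ∂m| ≤ K := by
  simpa using norm_integral_le_of_norm_le_const (μ := m) (f := f) (C := K) (ae_of_all _ h)

lemma abs_semigroup_le [IsProbabilityMeasure m] {g : Space d → ℝ} {K : ℝ} (hK : ∀ y, |g y| ≤ K)
    (t : ℝ≥0) (x : Space d) : |semigroup m η t g x| ≤ K :=
  abs_integral_le_of_abs_le fun _ => hK _

lemma integrable_of_bounded' [IsFiniteMeasure m] {f : S → ℝ} (hf : Measurable f) {K : ℝ}
    (h : ∀ w, |f w| ≤ K) : Integrable f m :=
  Integrable.of_bound hf.aestronglyMeasurable K (ae_of_all _ h)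

/-- A function of the past up to time `t`, in the sense that it is bounded, measurable, and the
Markov property at time `t` holds with respect to it. -/
structure IsPast (m : Measure S) (η : Space d → ℝ≥0 → S → Space d) (x : Space d) (t : ℝ≥0)
    (Φ : S → ℝ) : Prop where
  measurable : Measurable Φ
  bounded : ∃ C, ∀ w, |Φ w| ≤ C
  markov : ∀ (s : ℝ≥0) (g : Space d → ℝ), Measurable g → (∃ K, ∀ y, |g y| ≤ K) →
    ∫ w, Φ w * g (η x (t + s) w) ∂m = ∫ w, Φ w * semigroup m η s g (η x t w) ∂m

/-- The natural filtration. -/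
@[reducible] def past (η : Space d → ℝ≥0 → S → Space d) (x : Space d) (t : ℝ≥0) : MeasurableSpace S :=
  ⨆ r : Iic t, MeasurableSpace.comap (η x r) inferInstance

lemma past_le (hη : IsMarkovFamily m η) (x : Space d) (t : ℝ≥0) : past η x t ≤ ‹_› := by
  refine iSup_le fun r => ?_
  exact (hη.measurable_comp measurable_const measurable_const measurable_id).comap_le

omit [MeasurableSpace S] in
lemma measurable_past (x : Space d) {r t : ℝ≥0} (h : r ≤ t) : Measurable[past η x t] (η x r) := by
  refine Measurable.of_comap_le ?_
  exact le_iSup (fun r : Iic t => MeasurableSpace.comap (η x r) inferInstance) ⟨r, h⟩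

/-- The Markov property for sets identifies two image measures: that of `m.restrict C` under `η x (t
+ s)`, and that of `(m.restrict C).prod m` under an independent restart from `η x t`. The function
`g` is integrated against both. -/
lemma setIntegral_markov [IsProbabilityMeasure m] (hη : IsMarkovFamily m η) (x : Space d)
    (t s : ℝ≥0) {g : Space d → ℝ} (hg : Measurable g) (hK : ∃ K, ∀ y, |g y| ≤ K) {C : Set S}
    (hC : MeasurableSet[past η x t] C) :
    ∫ w in C, g (η x (t + s) w) ∂m = ∫ w in C, semigroup m η s g (η x t w) ∂m := by
  obtain ⟨K, hK⟩ := hK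
  have hm1 : Measurable (η x (t + s)) :=
    hη.measurable_comp measurable_const measurable_const measurable_id
  have hmt : Measurable (η x t) :=
    hη.measurable_comp measurable_const measurable_const measurable_id
  have hm2 : Measurable fun p : S × S => η (η x t p.1) s p.2 :=
    hη.measurable_comp (hmt.comp measurable_fst) measurable_const measurable_snd
  have heq : (m.restrict C).map (η x (t + s)) =
      ((m.restrict C).prod m).map fun p : S × S => η (η x t p.1) s p.2 := by
    ext B hB
    rw [Measure.map_apply hm1 hB, Measure.map_apply hm2 hB,
      Measure.restrict_apply (hm1 hB), Measure.prod_apply (hm2 hB), inter_comm]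
    exact hη.markov x t s B hB C hC
  have h1 : ∫ w in C, g (η x (t + s) w) ∂m = ∫ y, g y ∂((m.restrict C).map (η x (t + s))) :=
    (integral_map hm1.aemeasurable hg.aestronglyMeasurable).symm
  rw [h1, heq, integral_map hm2.aemeasurable hg.aestronglyMeasurable, integral_prod]
  · rfl
  · exact Integrable.of_bound (hg.comp hm2).aestronglyMeasurable K (ae_of_all _ fun _ => hK _)

/-- By the Markov property, `semigroup m η s g (η x t ·)` is a version of the conditional
expectation of `g (η x (t + s) ·)` given the past, and a bounded past-measurable factor can be
pulled out of it. -/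
lemma isPast_of_measurable [IsProbabilityMeasure m] (hη : IsMarkovFamily m η) (x : Space d)
    (t : ℝ≥0) {Φ : S → ℝ} (hΦ : Measurable[past η x t] Φ) (hb : ∃ C, ∀ w, |Φ w| ≤ C) :
    IsPast m η x t Φ := by
  refine ⟨hΦ.mono (past_le hη x t) le_rfl, hb, fun s g hg hK => ?_⟩
  obtain ⟨C, hC⟩ := hb
  obtain ⟨K, hK'⟩ := id hK
  have hle := past_le hη x t
  have hm1 : Measurable (η x (t + s)) :=
    hη.measurable_comp measurable_const measurable_const measurable_id
  have hmt : Measurable (η x t) :=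
    hη.measurable_comp measurable_const measurable_const measurable_id
  have hΦ' : Measurable Φ := hΦ.mono hle le_rfl
  have hTg : Measurable (semigroup m η s g) :=
    measurable_semigroup hη measurable_id measurable_const (hg.comp measurable_snd)
  have hint : Integrable (fun w => g (η x (t + s) w)) m :=
    integrable_of_bounded' (hg.comp hm1) fun _ => hK' _
  have hce : (fun w => semigroup m η s g (η x t w)) =ᵐ[m] m[fun w => g (η x (t + s) w) | past η x t] := by
    refine ae_eq_condExp_of_forall_setIntegral_eq hle hint (fun C _ _ => ?_) (fun C hC _ => ?_) ?_
    · exact (integrable_of_bounded' (hTg.comp hmt) fun _ => abs_semigroup_le hK' _ _).integrableOn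
    · exact (setIntegral_markov hη x t s hg hK hC).symm
    · exact (hTg.comp (measurable_past x le_rfl)).aestronglyMeasurable
  have hprod : Integrable (fun w => Φ w * g (η x (t + s) w)) m :=
    integrable_of_bounded' (hΦ'.mul (hg.comp hm1)) (K := C * K) fun w => by
      rw [abs_mul]
      exact mul_le_mul (hC _) (hK' _) (abs_nonneg _) ((abs_nonneg _).trans (hC w))
  have h2 := condExp_mul_of_stronglyMeasurable_left (μ := m) (m := past η x t)
    hΦ.stronglyMeasurable hprod hint
  calc ∫ w, Φ w * g (η x (t + s) w) ∂m
      = ∫ w, (m[fun w => Φ w * g (η x (t + s) w) | past η x t]) w ∂m := (integral_condExp hle).symm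
    _ = ∫ w, Φ w * semigroup m η s g (η x t w) ∂m := by
        refine integral_congr_ae ?_
        filter_upwards [h2, hce] with w h2 hce
        have h2' : (m[fun w => Φ w * g (η x (t + s) w) | past η x t]) w =
          Φ w * (m[fun w => g (η x (t + s) w) | past η x t]) w := h2
        rw [h2', ← hce]

lemma integral_intervalIntegral_swap_of_bounded {α : Type*} [MeasurableSpace α] {μ : Measure α}
    [IsFiniteMeasure μ] {F : ℝ → α → ℝ} (hF : Measurable (Function.uncurry F)) {K : ℝ}
    (hK : ∀ u w, |F u w| ≤ K) (a b : ℝ) :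
    ∫ w, (∫ u in a..b, F u w) ∂μ = ∫ u in a..b, ∫ w, F u w ∂μ := by
  refine (intervalIntegral_integral_swap ?_).symm
  have : IsFiniteMeasure (volume.restrict (uIoc a b)) :=
    inferInstanceAs (IsFiniteMeasure (volume.restrict (Ioc (min a b) (max a b))))
  exact Integrable.of_bound hF.aestronglyMeasurable K (ae_of_all _ fun p => hK p.1 p.2)

lemma measurable_integral_param {α β : Type*} [MeasurableSpace α] [MeasurableSpace β]
    {μ : Measure β} [SFinite μ] {F : α → β → ℝ} (hF : Measurable (Function.uncurry F)) :
    Measurable fun a => ∫ b, F a b ∂μ :=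
  (hF.stronglyMeasurable.integral_prod_right').measurable

lemma abs_mul_le_mul {a b A B : ℝ} (ha : |a| ≤ A) (hb : |b| ≤ B) : |a * b| ≤ A * B := by
  rw [abs_mul]
  exact mul_le_mul ha hb (abs_nonneg _) ((abs_nonneg _).trans ha)

variable [IsProbabilityMeasure m]

omit [IsProbabilityMeasure m] in
lemma IsPast.const_mul {x : Space d} {t : ℝ≥0} {Φ : S → ℝ} (h : IsPast m η x t Φ) (a : ℝ) :
    IsPast m η x t fun w => a * Φ w := by
  obtain ⟨C, hC⟩ := h.bounded
  refine ⟨h.measurable.const_mul a, ⟨|a| * C, fun w => abs_mul_le_mul le_rfl (hC w)⟩,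
    fun s g hg hK => ?_⟩
  simp_rw [mul_assoc, integral_const_mul]
  rw [h.markov s g hg hK]

lemma IsPast.sum (hη : IsMarkovFamily m η) {x : Space d} {t : ℝ≥0} {ι : Type*} (I : Finset ι)
    {Φ : ι → S → ℝ} (h : ∀ i, IsPast m η x t (Φ i)) : IsPast m η x t fun w => ∑ i ∈ I, Φ i w := by
  have hmη := hη.measurable
  choose C hC using fun i => (h i).bounded
  have hm := fun i => (h i).measurable
  refine ⟨Finset.measurable_sum _ fun i _ => hm i, ⟨∑ i ∈ I, C i, fun w => ?_⟩,
    fun s g hg hK => ?_⟩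
  · exact (Finset.abs_sum_le_sum_abs _ _).trans (Finset.sum_le_sum fun i _ => hC i w)
  obtain ⟨K, hK'⟩ := id hK
  have hTg : Measurable (semigroup m η s g) :=
    measurable_semigroup hη measurable_id measurable_const (hg.comp measurable_snd)
  simp_rw [Finset.sum_mul]
  rw [integral_finsetSum, integral_finsetSum]
  · exact Finset.sum_congr rfl fun i _ => (h i).markov s g hg hK
  · intro i _
    have := hm i
    exact integrable_of_bounded' (by fun_prop)
      fun w => abs_mul_le_mul (hC i w) (abs_semigroup_le hK' s _)
  · intro i _
    have := hm i
    exact integrable_of_bounded' (by fun_prop) fun w => abs_mul_le_mul (hC i w) (hK' _)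

/-- Closure under parameter integrals is the reason for using `IsPast` instead of measurability with
respect to the natural filtration. The paths are only jointly measurable, so a time integral of
functions of the past need not be measurable for the raw filtration, but its Markov identity
survives Fubini. -/
lemma IsPast.integral (hη : IsMarkovFamily m η) {x : Space d} {t : ℝ≥0} {α : Type*}
    [MeasurableSpace α] (ν : Measure α) [IsFiniteMeasure ν] {F : α → S → ℝ}
    (hF : Measurable (Function.uncurry F)) {C : ℝ} (hC : ∀ u w, |F u w| ≤ C)
    (h : ∀ u, IsPast m η x t (F u)) : IsPast m η x t fun w => ∫ u, F u w ∂ν := by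
  have hmη := hη.measurable
  have hFs : Measurable (Function.uncurry fun w u => F u w) := hF.comp measurable_swap
  refine ⟨measurable_integral_param hFs, ⟨C * ν.real univ, fun w => ?_⟩, fun s g hg hK => ?_⟩
  · exact norm_integral_le_of_norm_le_const (f := fun u => F u w) (ae_of_all _ fun u => hC u w)
  obtain ⟨K, hK'⟩ := id hK
  have hTg : Measurable (semigroup m η s g) :=
    measurable_semigroup hη measurable_id measurable_const (hg.comp measurable_snd)
  have hF' : Measurable fun p : S × α => F p.2 p.1 := hFs
  simp_rw [← integral_mul_const]
  have e1 : Integrable (Function.uncurry fun w u => F u w * g (η x (t + s) w)) (m.prod ν) := by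
    refine Integrable.of_bound (C := C * K) ?_ (ae_of_all _ fun p => ?_)
    · simp only [Function.uncurry_def]
      exact Measurable.aestronglyMeasurable (by fun_prop)
    · exact abs_mul_le_mul (hC _ _) (hK' _)
  have e2 : Integrable (Function.uncurry fun w u => F u w * semigroup m η s g (η x t w))
      (m.prod ν) := by
    refine Integrable.of_bound (C := C * K) ?_ (ae_of_all _ fun p => ?_)
    · simp only [Function.uncurry_def]
      exact Measurable.aestronglyMeasurable (by fun_prop)
    · exact abs_mul_le_mul (hC _ _) (abs_semigroup_le hK' s _)
  rw [integral_integral_swap e1, integral_integral_swap e2]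
  exact integral_congr_ae (ae_of_all _ fun u => (h u).markov s g hg hK)

lemma IsPast.tendsto (hη : IsMarkovFamily m η) {x : Space d} {t : ℝ≥0} {F : ℕ → S → ℝ} {Φ : S → ℝ}
    {C : ℝ} (hC : ∀ n w, |F n w| ≤ C) (h : ∀ n, IsPast m η x t (F n))
    (hlim : ∀ w, Tendsto (fun n => F n w) atTop (𝓝 (Φ w))) : IsPast m η x t Φ := by
  have hmη := hη.measurable
  have hm := fun n => (h n).measurable
  refine ⟨measurable_of_tendsto_metrizable hm (tendsto_pi_nhds.2 hlim), ⟨C, fun w => ?_⟩,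
    fun s g hg hK => ?_⟩
  · exact le_of_tendsto (hlim w).abs (Eventually.of_forall fun n => hC n w)
  obtain ⟨K, hK'⟩ := id hK
  have hTg : Measurable (semigroup m η s g) :=
    measurable_semigroup hη measurable_id measurable_const (hg.comp measurable_snd)
  have h1 : Tendsto (fun n => ∫ w, F n w * g (η x (t + s) w) ∂m) atTop
      (𝓝 (∫ w, Φ w * g (η x (t + s) w) ∂m)) := by
    refine tendsto_integral_of_dominated_convergence (fun _ => C * K) (fun n => ?_)
      (integrable_const _) (fun n => ae_of_all _ fun w => ?_) (ae_of_all _ fun w => ?_)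
    · have := hm n
      exact Measurable.aestronglyMeasurable (by fun_prop)
    · exact abs_mul_le_mul (hC _ _) (hK' _)
    · exact (hlim w).mul_const _
  have h2 : Tendsto (fun n => ∫ w, F n w * semigroup m η s g (η x t w) ∂m) atTop
      (𝓝 (∫ w, Φ w * semigroup m η s g (η x t w) ∂m)) := by
    refine tendsto_integral_of_dominated_convergence (fun _ => C * K) (fun n => ?_)
      (integrable_const _) (fun n => ae_of_all _ fun w => ?_) (ae_of_all _ fun w => ?_)
    · have := hm n
      exact Measurable.aestronglyMeasurable (by fun_prop)
    · exact abs_mul_le_mul (hC _ _) (abs_semigroup_le hK' s _)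
    · exact (hlim w).mul_const _
  exact tendsto_nhds_unique h1 (h2.congr fun n => ((h n).markov s g hg hK).symm)

/-- The `n`-th power of a time integral is an integral over `n`-tuples of times of a product that
involves finitely many positions up to time `t`. Each such product is measurable with respect to the
past. -/
lemma isPast_pow (hη : IsMarkovFamily m η) (x : Space d) {r t : ℝ≥0} (hrt : r ≤ t)
    {ψ ψ' c : Space d → ℝ} (hψ : Measurable ψ) (hψ' : Measurable ψ') (hc : Measurable c)
    {Kψ Kψ' Kc : ℝ} (bψ : ∀ y, |ψ y| ≤ Kψ) (bψ' : ∀ y, |ψ' y| ≤ Kψ') (bc : ∀ y, |c y| ≤ Kc) (n : ℕ) :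
    IsPast m η x t fun w => ψ (η x r w) * (∫ v in (r : ℝ)..t, c (η x v.toNNReal w)) ^ n *
      ψ' (η x t w) := by
  have hmη := hη.measurable
  have hrt' : (r : ℝ) ≤ t := hrt
  -- Capping the times at `t` changes nothing on the domain of integration, but makes the integrand
  -- a function of the past for every tuple `u`.
  have key : ∀ w, ψ (η x r w) * (∫ v in (r : ℝ)..t, c (η x v.toNNReal w)) ^ n * ψ' (η x t w) =
      ∫ u : Fin n → ℝ, ψ (η x r w) * (∏ i, c (η x (min (u i).toNNReal t) w)) * ψ' (η x t w)
        ∂(Measure.pi fun _ => volume.restrict (Ioc (r : ℝ) t)) := by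
    intro w
    rw [integral_mul_const, integral_const_mul, integral_fintype_prod_eq_prod
      (f := fun _ (v : ℝ) => c (η x (min v.toNNReal t) w)), Finset.prod_const, Finset.card_univ,
      Fintype.card_fin, intervalIntegral.integral_of_le hrt']
    congr 3
    refine setIntegral_congr_fun measurableSet_Ioc fun v hv => ?_
    have : min v.toNNReal t = v.toNNReal := min_eq_left (Real.toNNReal_le_iff_le_coe.2 hv.2)
    simp only [this]
  simp_rw [key]
  have hb : ∀ (u : Fin n → ℝ) w,
      |ψ (η x r w) * (∏ i, c (η x (min (u i).toNNReal t) w)) * ψ' (η x t w)| ≤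
      Kψ * Kc ^ n * Kψ' := by
    intro u w
    refine abs_mul_le_mul (abs_mul_le_mul (bψ _) ?_) (bψ' _)
    rw [Finset.abs_prod]
    refine (Finset.prod_le_prod (fun _ _ => abs_nonneg _) fun i _ => bc _).trans ?_
    simp
  refine IsPast.integral hη _ ?_ hb fun u => ?_
  · simp only [Function.uncurry_def]
    refine Measurable.mul (Measurable.mul (by fun_prop) ?_) (by fun_prop)
    exact Finset.measurable_prod _ fun i _ => by fun_prop
  · refine isPast_of_measurable hη x t ?_ ⟨_, hb u⟩
    refine Measurable.mul (Measurable.mul ?_ ?_) ?_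
    · exact hψ.comp (measurable_past x hrt)
    · exact Finset.measurable_prod _ fun i _ => hc.comp (measurable_past x (min_le_right _ _))
    · exact hψ'.comp (measurable_past x le_rfl)

/-- The partial sums of the exponential series are combinations of the powers treated in
`isPast_pow`. They are uniformly bounded and converge pointwise. -/
lemma isPast_exp (hη : IsMarkovFamily m η) (x : Space d) {r t : ℝ≥0} (hrt : r ≤ t)
    {ψ ψ' c : Space d → ℝ} (hψ : Measurable ψ) (hψ' : Measurable ψ') (hc : Measurable c)
    {Kψ Kψ' Kc : ℝ} (bψ : ∀ y, |ψ y| ≤ Kψ) (bψ' : ∀ y, |ψ' y| ≤ Kψ') (bc : ∀ y, |c y| ≤ Kc) :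
    IsPast m η x t fun w => ψ (η x r w) * Real.exp (∫ v in (r : ℝ)..t, c (η x v.toNNReal w)) *
      ψ' (η x t w) := by
  set A : S → ℝ := fun w => ∫ v in (r : ℝ)..t, c (η x v.toNNReal w) with hA
  have hAb : ∀ w, |A w| ≤ Kc * (t - r) := fun w =>
    abs_intervalIntegral_le (fun u => bc _) (NNReal.coe_le_coe.2 hrt)
  refine IsPast.tendsto hη (F := fun N w => ∑ k ∈ Finset.range N, ((k.factorial : ℝ)⁻¹ *
    (ψ (η x r w) * A w ^ k * ψ' (η x t w)))) (C := Kψ * Real.exp (Kc * (t - r)) * Kψ') ?_ ?_ ?_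
  · intro N w
    have : ∑ k ∈ Finset.range N, ((k.factorial : ℝ)⁻¹ * (ψ (η x r w) * A w ^ k * ψ' (η x t w))) =
      ψ (η x r w) * (∑ k ∈ Finset.range N, A w ^ k / k.factorial) * ψ' (η x t w) := by
      rw [Finset.mul_sum, Finset.sum_mul]
      exact Finset.sum_congr rfl fun k _ => by ring
    rw [this]
    refine abs_mul_le_mul (abs_mul_le_mul (bψ _) ?_) (bψ' _)
    calc |∑ k ∈ Finset.range N, A w ^ k / k.factorial|
        ≤ ∑ k ∈ Finset.range N, |A w| ^ k / k.factorial := by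
          refine (Finset.abs_sum_le_sum_abs _ _).trans (le_of_eq ?_)
          refine Finset.sum_congr rfl fun k _ => ?_
          rw [abs_div, abs_pow, Nat.abs_cast]
      _ ≤ Real.exp |A w| := Real.sum_le_exp_of_nonneg (abs_nonneg _) _
      _ ≤ _ := Real.exp_le_exp.2 (hAb w)
  · intro N
    exact IsPast.sum hη _ fun k => (isPast_pow hη x hrt hψ hψ' hc bψ bψ' bc k).const_mul _
  · intro w
    have h1 : Tendsto (fun N => ∑ k ∈ Finset.range N, A w ^ k / k.factorial) atTop
        (𝓝 (Real.exp (A w))) := by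
      have := (NormedSpace.expSeries_div_hasSum_exp (𝔸 := ℝ) (A w)).tendsto_sum_nat
      rwa [← Real.exp_eq_exp_ℝ] at this
    have h2 := (h1.const_mul (ψ (η x r w))).mul_const (ψ' (η x t w))
    refine h2.congr fun N => ?_
    rw [Finset.mul_sum, Finset.sum_mul]
    exact Finset.sum_congr rfl fun k _ => by ring

/-- The Feynman-Kac functional of the path after time `r`, weighted by a function of the position
at time `r`. -/
def delayedFK (m : Measure S) (η : Space d → ℝ≥0 → S → Space d) (x : Space d) (r : ℝ≥0)
    (ψ c : Space d → ℝ) (t : ℝ≥0) (g : Space d → ℝ) : ℝ :=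
  ∫ w, ψ (η x r w) * Real.exp (∫ v in (r : ℝ)..(r + t : ℝ≥0), c (η x v.toNNReal w)) *
    g (η x (r + t) w) ∂m

omit [MeasurableSpace S] in
lemma abs_exp_integral_le {c : Space d → ℝ} {Kc : ℝ} (bc : ∀ y, |c y| ≤ Kc) (x : Space d) (w : S)
    {a b : ℝ} (hab : a ≤ b) {T : ℝ} (hT : b - a ≤ T) :
    |Real.exp (∫ v in a..b, c (η x v.toNNReal w))| ≤ Real.exp (Kc * T) := by
  rw [Real.abs_exp]
  refine Real.exp_le_exp.2 ((le_abs_self _).trans ?_)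
  refine (abs_intervalIntegral_le (fun u => bc _) hab).trans ?_
  exact mul_le_mul_of_nonneg_left hT ((abs_nonneg _).trans (bc x))

lemma abs_delayedFK_le {x : Space d} {r : ℝ≥0} {ψ c : Space d → ℝ}
    {Kψ Kc K : ℝ} (bψ : ∀ y, |ψ y| ≤ Kψ) (bc : ∀ y, |c y| ≤ Kc) {t : ℝ≥0} {g : Space d → ℝ}
    (bg : ∀ y, |g y| ≤ K) {T : ℝ} (hT : t ≤ T) :
    |delayedFK m η x r ψ c t g| ≤ Kψ * Real.exp (Kc * T) * K := by
  refine abs_integral_le_of_abs_le fun w => abs_mul_le_mul (abs_mul_le_mul (bψ _) ?_) (bg _)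
  exact abs_exp_integral_le bc x w (by simp) (by push_cast; linarith)

omit [IsProbabilityMeasure m] in
lemma measurable_exp_integral (hη : IsMarkovFamily m η) {c : Space d → ℝ} (hc : Measurable c)
    {α : Type*} [MeasurableSpace α] {a b : α → ℝ} {f : α → Space d} {W : α → S}
    (ha : Measurable a) (hb : Measurable b) (hf : Measurable f) (hW : Measurable W) :
    Measurable fun p => Real.exp (∫ v in a p..b p, c (η (f p) v.toNNReal (W p))) := by
  refine Real.measurable_exp.comp (measurable_intervalIntegral_param ?_ ha hb)
  have hmη := hη.measurable
  simp only [Function.uncurry_def]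
  fun_prop

/-- The exponential is expanded forwards as `1 + ∫ c(η_{r+u}) exp (∫_r^{r+u} c) du`, and the Markov
property is used at time `r + u`. The exponential that remains involves only the past of that time,
and the future enters only through one position, so `isPast_exp` suffices. -/
lemma delayedFK_rec (hη : IsMarkovFamily m η) (x : Space d) (r : ℝ≥0)
    {ψ c : Space d → ℝ} (hψ : Measurable ψ) (hc : Measurable c)
    {Kψ Kc : ℝ} (bψ : ∀ y, |ψ y| ≤ Kψ) (bc : ∀ y, |c y| ≤ Kc) (t : ℝ≥0) {g : Space d → ℝ}
    (hg : Measurable g) {K : ℝ} (bg : ∀ y, |g y| ≤ K) :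
    delayedFK m η x r ψ c t g = ∫ w, ψ (η x r w) * semigroup m η t g (η x r w) ∂m +
      ∫ u in (0 : ℝ)..t, delayedFK m η x r ψ c u.toNNReal
        (fun y => c y * semigroup m η (t - u.toNNReal) g y) := by
  have hmη := hη.measurable
  have hK : ∃ K, ∀ y, |g y| ≤ K := ⟨K, bg⟩
  -- the path identity
  have h1 : ∀ w, ψ (η x r w) * Real.exp (∫ v in (r : ℝ)..(r + t : ℝ≥0), c (η x v.toNNReal w)) *
      g (η x (r + t) w) = ψ (η x r w) * g (η x (r + t) w) +
      ∫ u in (0 : ℝ)..t, ψ (η x r w) * Real.exp (∫ v in (r : ℝ)..(r + max u 0), c (η x v.toNNReal w)) *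
        c (η x (r + u).toNNReal w) * g (η x (r + t) w) := by
    intro w
    have h2 := integral_mul_exp_integral (c := fun v => c (η x v.toNNReal w)) (by fun_prop)
      (fun u => bc _) (a := r) (b := (r + t : ℝ≥0)) (by simp)
    rw [← sub_eq_iff_eq_add.2 h2.symm.symm, intervalIntegral.integral_mul_const] 
    have h3 : ∫ u in (0 : ℝ)..t, ψ (η x r w) * Real.exp (∫ v in (r : ℝ)..(r + max u 0), c (η x v.toNNReal w)) *
        c (η x (r + u).toNNReal w) = ψ (η x r w) * ∫ u in (0 : ℝ)..t, c (η x (r + u).toNNReal w) *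
          Real.exp (∫ v in (r : ℝ)..(r + u), c (η x v.toNNReal w)) := by
      rw [← intervalIntegral.integral_const_mul]
      refine intervalIntegral.integral_congr fun u hu => ?_
      rw [uIcc_of_le t.coe_nonneg] at hu
      simp only [max_eq_left hu.1]
      ring
    rw [h3, intervalIntegral.integral_comp_add_left (fun u => c (η x u.toNNReal w) *
      Real.exp (∫ v in (r : ℝ)..u, c (η x v.toNNReal w)))]
    push_cast
    simp only [add_zero]
    ring
  have hF : Measurable (Function.uncurry fun (u : ℝ) w => ψ (η x r w) *
      Real.exp (∫ v in (r : ℝ)..(r + max u 0), c (η x v.toNNReal w)) *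
        c (η x (r + u).toNNReal w) * g (η x (r + t) w)) := by
    have := measurable_exp_integral hη hc (α := ℝ × S) (a := fun _ => (r : ℝ))
      (b := fun p => r + max p.1 0) (f := fun _ => x) (W := fun p => p.2) (by fun_prop)
      (by fun_prop) (by fun_prop) (by fun_prop)
    simp only [Function.uncurry_def]
    fun_prop
  -- only the times in `[0, t]` matter
  have hFm : Measurable (Function.uncurry fun (u : ℝ) w => ψ (η x r w) *
      Real.exp (∫ v in (r : ℝ)..(r + max (min u t) 0), c (η x v.toNNReal w)) *
        c (η x (r + u).toNNReal w) * g (η x (r + t) w)) := by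
    have := measurable_exp_integral hη hc (α := ℝ × S) (a := fun _ => (r : ℝ))
      (b := fun p => r + max (min p.1 t) 0) (f := fun _ => x) (W := fun p => p.2) (by fun_prop)
      (by fun_prop) (by fun_prop) (by fun_prop)
    simp only [Function.uncurry_def]
    fun_prop
  have hFb : ∀ (u : ℝ) w, |ψ (η x r w) *
      Real.exp (∫ v in (r : ℝ)..(r + max (min u t) 0), c (η x v.toNNReal w)) *
        c (η x (r + u).toNNReal w) * g (η x (r + t) w)| ≤ Kψ * Real.exp (Kc * t) * Kc * K := by
    intro u w
    refine abs_mul_le_mul (abs_mul_le_mul (abs_mul_le_mul (bψ _) ?_) (bc _)) (bg _)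
    exact abs_exp_integral_le bc x w (by simp) (by simp)
  have h4 : ∀ w, ∫ u in (0 : ℝ)..t, ψ (η x r w) *
      Real.exp (∫ v in (r : ℝ)..(r + max u 0), c (η x v.toNNReal w)) *
        c (η x (r + u).toNNReal w) * g (η x (r + t) w) = ∫ u in (0 : ℝ)..t, ψ (η x r w) *
      Real.exp (∫ v in (r : ℝ)..(r + max (min u t) 0), c (η x v.toNNReal w)) *
        c (η x (r + u).toNNReal w) * g (η x (r + t) w) := by
    intro w
    refine intervalIntegral.integral_congr fun u hu => ?_
    rw [uIcc_of_le t.coe_nonneg] at hu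
    simp only [min_eq_left hu.2]
  rw [delayedFK]
  simp_rw [h1, h4]
  rw [integral_add, integral_intervalIntegral_swap_of_bounded hFm hFb]
  · congr 1
    · have := (isPast_exp hη x (le_refl r) (ψ := ψ) (ψ' := fun _ => 1) (c := fun _ => 0) hψ
        measurable_const measurable_const bψ (fun _ => (abs_one).le) (fun _ => (abs_zero).le)).markov
        t g hg hK
      simpa using this
    · refine intervalIntegral.integral_congr fun u hu => ?_
      rw [uIcc_of_le t.coe_nonneg] at hu
      simp only [min_eq_left hu.2, max_eq_left hu.1, delayedFK]
      lift u to ℝ≥0 using hu.1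
      have hut : u ≤ t := hu.2
      have := (isPast_exp hη x (le_self_add : r ≤ r + u) hψ hc hc bψ bc bc).markov (t - u) g hg hK
      have e1 : r + u + (t - u) = r + t := by rw [add_assoc, add_tsub_cancel_of_le hut]
      rw [e1] at this
      have e2 : ((r : ℝ) + u).toNNReal = r + u := by
        rw [← NNReal.coe_add, Real.toNNReal_coe]
      simp only [e2, Real.toNNReal_coe]
      push_cast at this ⊢
      rw [this]
      refine integral_congr_ae (ae_of_all _ fun w => ?_)
      simp only
      ring
  · exact integrable_of_bounded' (by fun_prop) fun w => abs_mul_le_mul (bψ _) (bg _)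
  · have hFs : Measurable (Function.uncurry fun w (u : ℝ) => ψ (η x r w) *
      Real.exp (∫ v in (r : ℝ)..(r + max (min u t) 0), c (η x v.toNNReal w)) *
        c (η x (r + u).toNNReal w) * g (η x (r + t) w)) := hFm.comp measurable_swap
    refine integrable_of_bounded' (measurable_intervalIntegral_param hFs measurable_const
      measurable_const) fun w => abs_intervalIntegral_le (fun u => hFb u w) t.coe_nonneg

end Markov

/-! ### Duhamel's formula and the passage from renewal to mild equations. -/

section Duhamel

variable {d : ℕ} {S : Type*} [MeasurableSpace S] {m : Measure S} [IsProbabilityMeasure m]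
  {η : Space d → ℝ≥0 → S → Space d}

/-- Fubini on the triangle `0 ≤ u ≤ r ≤ t`, followed by `r = u + s`. The bound holds only on the
triangle, so `f` is cut off by an indicator before Fubini is applied on the square. -/
lemma integral_triangle_swap {f : ℝ → ℝ → ℝ} (hf : Measurable (Function.uncurry f)) {t K : ℝ}
    (ht : 0 ≤ t) (hK0 : 0 ≤ K) (hK : ∀ r u, 0 ≤ u → u ≤ r → r ≤ t → |f r u| ≤ K) :
    ∫ r in (0 : ℝ)..t, ∫ u in (0 : ℝ)..r, f r u =
      ∫ u in (0 : ℝ)..t, ∫ s in (0 : ℝ)..(t - u), f (u + s) u := by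
  classical
  set D : Set (ℝ × ℝ) := {p | 0 ≤ p.2 ∧ p.2 ≤ p.1 ∧ p.1 ≤ t} with hD
  have hDm : MeasurableSet D :=
    (measurableSet_le measurable_const measurable_snd).inter
      ((measurableSet_le measurable_snd measurable_fst).inter
        (measurableSet_le measurable_fst measurable_const))
  set g : ℝ → ℝ → ℝ := fun r u => D.indicator (Function.uncurry f) (r, u) with hg
  have hgm : Measurable (Function.uncurry g) := hf.indicator hDm
  have hgb : ∀ r u, |g r u| ≤ K := by
    intro r u
    by_cases h : (r, u) ∈ D
    · simp only [hg, indicator_of_mem h]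
      exact hK r u h.1 h.2.1 h.2.2
    · simp only [hg, indicator_of_notMem h, abs_zero, hK0]
  have hgu : ∀ r a b, IntervalIntegrable (fun u => g r u) volume a b := fun r a b =>
    intervalIntegrable_of_bounded (c := fun u => g r u) (by fun_prop) (hgb r) a b
  have hgr : ∀ u a b, IntervalIntegrable (fun r => g r u) volume a b := fun u a b =>
    intervalIntegrable_of_bounded (c := fun r => g r u) (by fun_prop) (fun r => hgb r u) a b
  have h1 : ∀ r ∈ uIcc 0 t, ∫ u in (0 : ℝ)..r, f r u = ∫ u in (0 : ℝ)..t, g r u := by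
    intro r hr
    rw [uIcc_of_le ht] at hr
    rw [← intervalIntegral.integral_add_adjacent_intervals (hgu r 0 r) (hgu r r t)]
    have e1 : ∫ u in (0 : ℝ)..r, f r u = ∫ u in (0 : ℝ)..r, g r u := by
      refine intervalIntegral.integral_congr fun u hu => ?_
      rw [uIcc_of_le hr.1] at hu
      simp only [hg]
      rw [indicator_of_mem (show (r, u) ∈ D from ⟨hu.1, hu.2, hr.2⟩)]
      rfl
    have e2 : ∫ u in r..t, g r u = 0 := by
      rw [intervalIntegral.integral_of_le hr.2]
      refine setIntegral_eq_zero_of_forall_eq_zero fun u hu => ?_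
      exact indicator_of_notMem (fun h => absurd h.2.1 (not_le.2 hu.1)) _
    rw [e1, e2, add_zero]
  have h2 : ∀ u ∈ uIcc 0 t, ∫ s in (0 : ℝ)..(t - u), f (u + s) u = ∫ r in (0 : ℝ)..t, g r u := by
    intro u hu
    rw [uIcc_of_le ht] at hu
    rw [intervalIntegral.integral_comp_add_left (fun r => f r u),
      ← intervalIntegral.integral_add_adjacent_intervals (hgr u 0 u) (hgr u u t), add_zero,
      add_sub_cancel]
    have e1 : ∫ r in u..t, f r u = ∫ r in u..t, g r u := by
      refine intervalIntegral.integral_congr fun r hr => ?_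
      rw [uIcc_of_le hu.2] at hr
      simp only [hg]
      rw [indicator_of_mem (show (r, u) ∈ D from ⟨hu.1, hr.1, hr.2⟩)]
      rfl
    have e2 : ∫ r in (0 : ℝ)..u, g r u = 0 := by
      rw [intervalIntegral.integral_of_le hu.1]
      have : ∀ᵐ r ∂volume.restrict (Ioc 0 u), g r u = 0 := by
        have h3 : ∀ᵐ r : ℝ, r ≠ u := by simp [ae_iff]
        filter_upwards [ae_restrict_of_ae h3, ae_restrict_mem measurableSet_Ioc] with r h3 h4
        exact indicator_of_notMem (fun h => h3 (le_antisymm h4.2 h.2.1)) _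
      rw [integral_congr_ae this]
      simp
    rw [e1, e2, zero_add]
  rw [intervalIntegral.integral_congr h1, intervalIntegral.integral_congr h2]
  rw [intervalIntegral.integral_of_le ht, intervalIntegral.integral_of_le ht,
    integral_intervalIntegral_swap_of_bounded (μ := volume.restrict (Ioc 0 t)) (F := fun u r => g r u)
      (hgm.comp measurable_swap) (fun u r => hgb r u), intervalIntegral.integral_of_le ht]
  refine integral_congr_ae (ae_of_all _ fun u => ?_)
  simp only
  rw [intervalIntegral.integral_of_le ht]

lemma measurable_feynmanKac (hη : IsMarkovFamily m η) {c : Space d → ℝ} (hc : Measurable c)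
    {α : Type*} [MeasurableSpace α] {f : α → Space d} {t : α → ℝ≥0} {g : α → Space d → ℝ}
    (hf : Measurable f) (ht : Measurable t) (hg : Measurable (Function.uncurry g)) :
    Measurable fun a => feynmanKac m η c (t a) (g a) (f a) := by
  have hmη := hη.measurable
  refine measurable_integral_param ?_
  have h1 := measurable_exp_integral hη hc (α := α × S) (a := fun _ => 0)
      (b := fun p => t p.1) (f := fun p => f p.1) (W := fun p => p.2) (by fun_prop)
      (by fun_prop) (by fun_prop) (by fun_prop)
  simp only [Function.uncurry_def]
  have h2 : Measurable fun p : α × S => g p.1 (η (f p.1) (t p.1) p.2) :=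
    hg.comp (measurable_fst.prodMk (by fun_prop))
  exact h1.mul h2

lemma abs_feynmanKac_le {c : Space d → ℝ} {Kc K : ℝ} (bc : ∀ y, |c y| ≤ Kc) {t : ℝ≥0}
    {g : Space d → ℝ} (bg : ∀ y, |g y| ≤ K) {T : ℝ} (hT : t ≤ T) (y : Space d) :
    |feynmanKac m η c t g y| ≤ Real.exp (Kc * T) * K := by
  refine abs_integral_le_of_abs_le fun w => abs_mul_le_mul ?_ (bg _)
  exact abs_exp_integral_le bc y w t.coe_nonneg (by simpa using hT)

lemma feynmanKac_rec (hη : IsMarkovFamily m η) {c : Space d → ℝ} (hc : Measurable c)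
    {Kc : ℝ} (bc : ∀ y, |c y| ≤ Kc) (t : ℝ≥0) {g : Space d → ℝ}
    (hg : Measurable g) {K : ℝ} (bg : ∀ y, |g y| ≤ K) (y : Space d) :
    feynmanKac m η c t g y = semigroup m η t g y +
      ∫ u in (0 : ℝ)..t, feynmanKac m η c u.toNNReal
        (fun z => c z * semigroup m η (t - u.toNNReal) g z) y := by
  have h := delayedFK_rec hη y 0 (ψ := fun _ => 1) measurable_const hc (fun _ => abs_one.le) bc t
    hg bg
  have h1 : ∫ w, semigroup m η t g (η y 0 w) ∂m = semigroup m η t g y := by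
    have : ∀ᵐ w ∂m, semigroup m η t g (η y 0 w) = semigroup m η t g y := by
      filter_upwards [hη.start y] with w hw
      rw [hw]
    rw [integral_congr_ae this]
    simp
  simp only [delayedFK, one_mul, zero_add, NNReal.coe_zero, h1] at h
  simpa only [feynmanKac] using h

/-- The Markov property for exponential functionals of the path after time `r`. -/
lemma delayedFK_eq (hη : IsMarkovFamily m η) (x : Space d) (r : ℝ≥0)
    {ψ c : Space d → ℝ} (hψ : Measurable ψ) (hc : Measurable c)
    {Kψ Kc : ℝ} (bψ : ∀ y, |ψ y| ≤ Kψ) (bc : ∀ y, |c y| ≤ Kc) (t : ℝ≥0) {g : Space d → ℝ}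
    (hg : Measurable g) {K : ℝ} (bg : ∀ y, |g y| ≤ K) :
    delayedFK m η x r ψ c t g = ∫ w, ψ (η x r w) * feynmanKac m η c t g (η x r w) ∂m := by
  have hmη := hη.measurable
  have hKc : 0 ≤ Kc := (abs_nonneg _).trans (bc x)
  have hKψ : 0 ≤ Kψ := (abs_nonneg _).trans (bψ x)
  set R : ℝ≥0 → (Space d → ℝ) → ℝ := fun t g =>
    ∫ w, ψ (η x r w) * feynmanKac m η c t g (η x r w) ∂m with hR
  have hcT : ∀ (t : ℝ≥0) {g : Space d → ℝ}, Measurable g →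
      Measurable (Function.uncurry fun (u : ℝ) z => c z * semigroup m η (t - u.toNNReal) g z) := by
    intro t g hg
    have := measurable_semigroup hη (α := ℝ × Space d) (f := fun p => p.2)
      (t := fun p => t - p.1.toNNReal) (g := fun _ => g) (by fun_prop) (by fun_prop)
      (hg.comp measurable_snd)
    simp only [Function.uncurry_def]
    fun_prop
  -- The right-hand side obeys the same linear recursion in the pair of time and test function as
  -- the left-hand side in `delayedFK_rec`. The identity thus follows from uniqueness for that
  -- recursion.
  have hRrec : ∀ (t : ℝ≥0) (g : Space d → ℝ) (K : ℝ), Measurable g → (∀ y, |g y| ≤ K) →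
      R t g = ∫ w, ψ (η x r w) * semigroup m η t g (η x r w) ∂m +
        ∫ u in (0 : ℝ)..t, R u.toNNReal (fun y => c y * semigroup m η (t - u.toNNReal) g y) := by
    intro t g K hg bg
    have hFm : Measurable (Function.uncurry fun (u : ℝ) w => ψ (η x r w) *
        feynmanKac m η c (min u t).toNNReal (fun z => c z * semigroup m η (t - u.toNNReal) g z)
          (η x r w)) := by
      have := measurable_feynmanKac hη hc (α := ℝ × S) (f := fun p => η x r p.2)
        (t := fun p => (min p.1 t).toNNReal)
        (g := fun p z => c z * semigroup m η (t - p.1.toNNReal) g z) (by fun_prop) (by fun_prop)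
        ((hcT t hg).comp (by fun_prop : Measurable fun q : (ℝ × S) × Space d => (q.1.1, q.2)))
      simp only [Function.uncurry_def]
      fun_prop
    have hFb : ∀ (u : ℝ) w, |ψ (η x r w) *
        feynmanKac m η c (min u t).toNNReal (fun z => c z * semigroup m η (t - u.toNNReal) g z)
          (η x r w)| ≤ Kψ * (Real.exp (Kc * t) * (Kc * K)) := by
      intro u w
      refine abs_mul_le_mul (bψ _) (abs_feynmanKac_le bc (fun y => abs_mul_le_mul (bc _)
        (abs_semigroup_le bg _ _)) ?_ _)
      rw [NNReal.coe_le_coe]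
      exact Real.toNNReal_le_iff_le_coe.2 (min_le_right _ _)
    have hTm : Measurable (semigroup m η t g) :=
      measurable_semigroup hη measurable_id measurable_const (hg.comp measurable_snd)
    have h1 : ∀ w, ψ (η x r w) * feynmanKac m η c t g (η x r w) =
        ψ (η x r w) * semigroup m η t g (η x r w) + ∫ u in (0 : ℝ)..t, ψ (η x r w) *
        feynmanKac m η c (min u t).toNNReal (fun z => c z * semigroup m η (t - u.toNNReal) g z)
          (η x r w) := by
      intro w
      rw [feynmanKac_rec hη hc bc t hg bg, mul_add, intervalIntegral.integral_const_mul]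
      congr 2
      refine intervalIntegral.integral_congr fun u hu => ?_
      rw [uIcc_of_le t.coe_nonneg] at hu
      simp only [min_eq_left hu.2]
    simp only [hR]
    simp_rw [h1]
    rw [integral_add, integral_intervalIntegral_swap_of_bounded hFm hFb]
    · congr 1
      refine intervalIntegral.integral_congr fun u hu => ?_
      rw [uIcc_of_le t.coe_nonneg] at hu
      simp only [min_eq_left hu.2]
    · exact integrable_of_bounded' (by fun_prop) fun w => abs_mul_le_mul (bψ _)
        (abs_semigroup_le bg t _)
    · refine integrable_of_bounded' (measurable_intervalIntegral_param
        (hFm.comp measurable_swap) measurable_const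
        measurable_const) fun w => abs_intervalIntegral_le (fun u => hFb u w) t.coe_nonneg
  have hRb : ∀ (s : ℝ≥0) (g : Space d → ℝ) (K : ℝ), s ≤ t → (∀ y, |g y| ≤ K) →
      |R s g| ≤ Kψ * Real.exp (Kc * t) * K := by
    intro s g K hs bg
    rw [mul_assoc]
    exact abs_integral_le_of_abs_le fun w => abs_mul_le_mul (bψ _)
      (abs_feynmanKac_le bc bg (NNReal.coe_le_coe.2 hs) _)
  set B : ℝ := 2 * (Kψ * Real.exp (Kc * t)) with hB
  have hB0 : 0 ≤ B := by positivity
  -- Each use of the recursion replaces the bound `K` of the test function by `Kc * K` and adds one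
  -- time integration. After `n` uses this leaves `(Kc s)^n / n!`, so the difference vanishes.
  have claim : ∀ (n : ℕ) (s : ℝ≥0) (g : Space d → ℝ) (K : ℝ), s ≤ t → Measurable g →
      (∀ y, |g y| ≤ K) →
      |delayedFK m η x r ψ c s g - R s g| ≤ B * K * ((Kc * s) ^ n / n.factorial) := by
    intro n
    induction n with
    | zero =>
      intro s g K hs hg bg
      have h1 := abs_delayedFK_le (m := m) (η := η) (x := x) (r := r) bψ bc bg
        (NNReal.coe_le_coe.2 hs)
      have h2 := hRb s g K hs bg
      have := abs_sub (delayedFK m η x r ψ c s g) (R s g)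
      simp only [pow_zero, Nat.factorial_zero, Nat.cast_one, div_one, mul_one, hB]
      linarith
    | succ n ih =>
      intro s g K hs hg bg
      have hK0 : 0 ≤ K := (abs_nonneg _).trans (bg x)
      rw [delayedFK_rec hη x r hψ hc bψ bc s hg bg, hRrec s g K hg bg, add_sub_add_left_eq_sub,
        ← intervalIntegral.integral_sub]
      · have hbd : ∀ u ∈ Ioc (0 : ℝ) s, ‖delayedFK m η x r ψ c u.toNNReal
            (fun y => c y * semigroup m η (s - u.toNNReal) g y) -
            R u.toNNReal (fun y => c y * semigroup m η (s - u.toNNReal) g y)‖ ≤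
            B * (Kc * K) * ((Kc * u) ^ n / n.factorial) := by
          intro u hu
          have h1 := ih u.toNNReal (fun y => c y * semigroup m η (s - u.toNNReal) g y) (Kc * K)
            ((Real.toNNReal_le_iff_le_coe.2 hu.2).trans hs)
            ((hcT s hg).comp (by fun_prop : Measurable fun z : Space d => (u, z)))
            (fun y => abs_mul_le_mul (bc _) (abs_semigroup_le bg _ _))
          rwa [Real.coe_toNNReal _ hu.1.le] at h1
        have h3 := intervalIntegral.norm_integral_le_of_norm_le (μ := volume) s.coe_nonneg
          (ae_of_all _ hbd) (Continuous.intervalIntegrable (by fun_prop) _ _)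
        refine h3.trans (le_of_eq ?_)
        have h4 : ∀ u : ℝ, B * (Kc * K) * ((Kc * u) ^ n / n.factorial) =
            B * K * (Kc ^ (n + 1) / n.factorial) * u ^ n := by
          intro u
          rw [mul_pow]
          ring
        simp_rw [h4]
        rw [intervalIntegral.integral_const_mul, integral_pow, Nat.factorial_succ]
        push_cast
        field_simp
        ring
      · have hm : Measurable fun u : ℝ => delayedFK m η x r ψ c (min u s).toNNReal
            (fun y => c y * semigroup m η (s - u.toNNReal) g y) := by
          refine measurable_integral_param ?_
          have h1 := measurable_exp_integral hη hc (α := ℝ × S) (a := fun _ => r)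
            (b := fun p => (r + (min p.1 s).toNNReal : ℝ≥0)) (f := fun p => x) (W := fun p => p.2)
            (by fun_prop) (by fun_prop) (by fun_prop) (by fun_prop)
          have h2 : Measurable fun p : ℝ × S => c (η x (r + (min p.1 s).toNNReal) p.2) *
              semigroup m η (s - p.1.toNNReal) g (η x (r + (min p.1 s).toNNReal) p.2) :=
            (hcT s hg).comp (by fun_prop :
              Measurable fun p : ℝ × S => (p.1, η x (r + (min p.1 s).toNNReal) p.2))
          simp only [Function.uncurry_def]
          fun_prop
        have hb : ∀ u : ℝ, |delayedFK m η x r ψ c (min u s).toNNReal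
            (fun y => c y * semigroup m η (s - u.toNNReal) g y)| ≤
            Kψ * Real.exp (Kc * s) * (Kc * K) := fun u =>
          abs_delayedFK_le bψ bc (fun y => abs_mul_le_mul (bc _) (abs_semigroup_le bg _ _))
            (NNReal.coe_le_coe.2 (Real.toNNReal_le_iff_le_coe.2 (min_le_right _ _)))
        refine (intervalIntegrable_of_bounded hm hb 0 s).congr fun u hu => ?_
        rw [uIoc_of_le s.coe_nonneg] at hu
        simp only [min_eq_left hu.2]
      · have hm : Measurable fun u : ℝ => R (min u s).toNNReal
            (fun y => c y * semigroup m η (s - u.toNNReal) g y) := by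
          refine measurable_integral_param ?_
          have := measurable_feynmanKac hη hc (α := ℝ × S) (f := fun p => η x r p.2)
            (t := fun p => (min p.1 s).toNNReal)
            (g := fun p z => c z * semigroup m η (s - p.1.toNNReal) g z) (by fun_prop) (by fun_prop)
            ((hcT s hg).comp (by fun_prop : Measurable fun q : (ℝ × S) × Space d => (q.1.1, q.2)))
          simp only [Function.uncurry_def]
          fun_prop
        have hb : ∀ u : ℝ, |R (min u s).toNNReal
            (fun y => c y * semigroup m η (s - u.toNNReal) g y)| ≤
            Kψ * Real.exp (Kc * t) * (Kc * K) := fun u =>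
          hRb _ _ _ ((Real.toNNReal_le_iff_le_coe.2 (min_le_right _ _)).trans hs)
            (fun y => abs_mul_le_mul (bc _) (abs_semigroup_le bg _ _))
        refine (intervalIntegrable_of_bounded hm hb 0 s).congr fun u hu => ?_
        rw [uIoc_of_le s.coe_nonneg] at hu
        simp only [min_eq_left hu.2]
  have hlim : Tendsto (fun n : ℕ => B * K * ((Kc * t) ^ n / n.factorial)) atTop (𝓝 (B * K * 0)) :=
    (FloorSemiring.tendsto_pow_div_factorial_atTop (Kc * (t : ℝ))).const_mul _
  rw [mul_zero] at hlim
  have h0 := ge_of_tendsto hlim (Eventually.of_forall fun n => claim n t g K le_rfl hg bg)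
  exact sub_eq_zero.1 (abs_nonpos_iff.1 h0)

/-- Duhamel's formula for the Feynman-Kac semigroup. -/
lemma feynmanKac_duhamel (hη : IsMarkovFamily m η) {c : Space d → ℝ} (hc : Measurable c)
    {Kc : ℝ} (bc : ∀ y, |c y| ≤ Kc) (t : ℝ≥0) {g : Space d → ℝ}
    (hg : Measurable g) {K : ℝ} (bg : ∀ y, |g y| ≤ K) (x : Space d) :
    feynmanKac m η c t g x = semigroup m η t g x +
      ∫ u in (0 : ℝ)..t, semigroup m η u.toNNReal
        (fun z => c z * feynmanKac m η c (t - u.toNNReal) g z) x := by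
  have hmη := hη.measurable
  -- The expansion is now backward from `t`, so `c(η_u)` is multiplied by a functional of the path
  -- after `u`, to which `delayedFK_eq` applies. The `min` only controls the integrand for `u > t`.
  have h1 : ∀ w, Real.exp (∫ v in (0 : ℝ)..t, c (η x v.toNNReal w)) * g (η x t w) = g (η x t w) +
      ∫ u in (0 : ℝ)..t, c (η x u.toNNReal w) *
        Real.exp (∫ v in (min u t)..t, c (η x v.toNNReal w)) * g (η x t w) := by
    intro w
    have h2 := integral_mul_exp_integral' (c := fun v => c (η x v.toNNReal w)) (by fun_prop)
      (fun u => bc _) (a := 0) (b := t) t.coe_nonneg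
    rw [← sub_eq_iff_eq_add.2 h2.symm.symm, intervalIntegral.integral_mul_const]
    have h3 : ∫ u in (0 : ℝ)..t, c (η x u.toNNReal w) *
        Real.exp (∫ v in (min u t)..t, c (η x v.toNNReal w)) = ∫ u in (0 : ℝ)..t, c (η x u.toNNReal w) *
        Real.exp (∫ v in u..t, c (η x v.toNNReal w)) := by
      refine intervalIntegral.integral_congr fun u hu => ?_
      rw [uIcc_of_le t.coe_nonneg] at hu
      simp only [min_eq_left hu.2]
    rw [h3]
    ring
  have hFm : Measurable (Function.uncurry fun (u : ℝ) w => c (η x u.toNNReal w) *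
        Real.exp (∫ v in (max (min u t) 0)..t, c (η x v.toNNReal w)) * g (η x t w)) := by
    have := measurable_exp_integral hη hc (α := ℝ × S) (b := fun _ => (t : ℝ))
      (a := fun p => max (min p.1 t) 0) (f := fun _ => x) (W := fun p => p.2) (by fun_prop)
      (by fun_prop) (by fun_prop) (by fun_prop)
    simp only [Function.uncurry_def]
    fun_prop
  have hFb : ∀ (u : ℝ) w, |c (η x u.toNNReal w) *
        Real.exp (∫ v in (max (min u t) 0)..t, c (η x v.toNNReal w)) * g (η x t w)| ≤
        Kc * Real.exp (Kc * t) * K := by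
    intro u w
    refine abs_mul_le_mul (abs_mul_le_mul (bc _) ?_) (bg _)
    exact abs_exp_integral_le bc x w (by simp) (by simp)
  have h4 : ∀ w, ∫ u in (0 : ℝ)..t, c (η x u.toNNReal w) *
        Real.exp (∫ v in (min u t)..t, c (η x v.toNNReal w)) * g (η x t w) =
        ∫ u in (0 : ℝ)..t, c (η x u.toNNReal w) *
        Real.exp (∫ v in (max (min u t) 0)..t, c (η x v.toNNReal w)) * g (η x t w) := by
    intro w
    refine intervalIntegral.integral_congr fun u hu => ?_
    rw [uIcc_of_le t.coe_nonneg] at hu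
    simp only [min_eq_left hu.2, max_eq_left hu.1]
  rw [feynmanKac]
  simp_rw [h1, h4]
  rw [integral_add, integral_intervalIntegral_swap_of_bounded hFm hFb]
  · congr 1
    refine intervalIntegral.integral_congr fun u hu => ?_
    rw [uIcc_of_le t.coe_nonneg] at hu
    simp only [min_eq_left hu.2, max_eq_left hu.1]
    lift u to ℝ≥0 using hu.1
    have hut : u ≤ t := hu.2
    have := delayedFK_eq hη x u hc hc bc bc (t - u) hg bg
    rw [delayedFK, add_tsub_cancel_of_le hut] at this
    simp only [Real.toNNReal_coe]
    exact this
  · exact integrable_of_bounded' (by fun_prop) fun w => bg _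
  · refine integrable_of_bounded' (measurable_intervalIntegral_param (hFm.comp measurable_swap)
      measurable_const measurable_const) fun w => abs_intervalIntegral_le (fun u => hFb u w) t.coe_nonneg

/-- A solution of the renewal equation of Feynman-Kac type solves the mild equation. -/
lemma mild_of_renewal (hη : IsMarkovFamily m η) {c : Space d → ℝ} (hc : Measurable c)
    {Kc : ℝ} (bc : ∀ y, |c y| ≤ Kc) (κ : ℝ) {M F : Space d → ℝ≥0 → ℝ}
    (hF : Measurable (Function.uncurry F)) (t : ℝ≥0) {KF : ℝ} (bF : ∀ y, ∀ s ≤ t, |F y s| ≤ KF)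
    (hM : ∀ x, ∀ s ≤ t, M x s = Real.exp (-κ * s) * feynmanKac m η c s (fun _ => 1) x +
      ∫ r in (0 : ℝ)..s, Real.exp (-κ * r) *
        feynmanKac m η c r.toNNReal (fun y => F y (s - r.toNNReal)) x) (x : Space d) :
    M x t = Real.exp (-κ * t) + ∫ u in (0 : ℝ)..t, Real.exp (-κ * u) *
      semigroup m η u.toNNReal (fun y => c y * M y (t - u.toNNReal) + F y (t - u.toNNReal)) x := by
  have hmη := hη.measurable
  have hKc : 0 ≤ Kc := (abs_nonneg _).trans (bc x)
  have hKF : 0 ≤ KF := (abs_nonneg _).trans (bF x 0 zero_le)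
  set κ' := |κ| with hκ'
  have hκ : ∀ r : ℝ, 0 ≤ r → r ≤ t → |Real.exp (-κ * r)| ≤ Real.exp (κ' * t) := by
    intro r h0 h1
    rw [Real.abs_exp]
    refine Real.exp_le_exp.2 ?_
    calc -κ * r ≤ κ' * r := mul_le_mul_of_nonneg_right (neg_le_abs κ) h0
      _ ≤ κ' * t := mul_le_mul_of_nonneg_left h1 (abs_nonneg _)
  have hFt : ∀ r : ℝ, Measurable fun y => F y (t - r.toNNReal) := fun r =>
    hF.comp (measurable_id.prodMk measurable_const)
  have bFt : ∀ (r : ℝ) y, |F y (t - r.toNNReal)| ≤ KF := fun r y => bF y _ tsub_le_self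
  have m1 : Measurable fun _ : Space d => (1 : ℝ) := measurable_const
  have b1 : ∀ y : Space d, |(fun _ => (1 : ℝ)) y| ≤ 1 := fun _ => abs_one.le
  have hsemi1 : semigroup m η t (fun _ => 1) x = 1 := by simp [semigroup]
  rw [hM x t le_rfl, feynmanKac_duhamel hη hc bc t m1 b1, hsemi1]
  -- first perturbation
  set f : ℝ → ℝ → ℝ := fun r u => Real.exp (-κ * r) * semigroup m η u.toNNReal
    (fun z => c z * feynmanKac m η c (r.toNNReal - u.toNNReal) (fun y => F y (t - r.toNNReal)) z) x
    with hf
  have hfk : Measurable fun q : (ℝ × ℝ) × Space d => feynmanKac m η c (q.1.1.toNNReal - q.1.2.toNNReal)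
      (fun y => F y (t - q.1.1.toNNReal)) q.2 := by
    refine measurable_feynmanKac hη hc (α := (ℝ × ℝ) × Space d) (f := fun q => q.2)
      (t := fun q => q.1.1.toNNReal - q.1.2.toNNReal)
      (g := fun q y => F y (t - q.1.1.toNNReal)) (by fun_prop) (by fun_prop) ?_
    exact hF.comp (by fun_prop : Measurable fun q : ((ℝ × ℝ) × Space d) × Space d =>
      (q.2, t - q.1.1.1.toNNReal))
  have hfm : Measurable (Function.uncurry f) := by
    have := measurable_semigroup hη (α := ℝ × ℝ) (f := fun _ => x) (t := fun p => p.2.toNNReal)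
      (g := fun p z => c z * feynmanKac m η c (p.1.toNNReal - p.2.toNNReal)
        (fun y => F y (t - p.1.toNNReal)) z) (by fun_prop) (by fun_prop)
        ((hc.comp measurable_snd).mul hfk)
    simp only [Function.uncurry_def, hf]
    fun_prop
  have hfb : ∀ r u : ℝ, 0 ≤ u → u ≤ r → r ≤ t →
      |f r u| ≤ Real.exp (κ' * t) * (Kc * (Real.exp (Kc * t) * KF)) := by
    intro r u h0 hur hrt
    refine abs_mul_le_mul (hκ r (h0.trans hur) hrt) (abs_semigroup_le (fun y => ?_) _ _)
    refine abs_mul_le_mul (bc _) (abs_feynmanKac_le bc (bFt r) ?_ _)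
    rw [NNReal.coe_le_coe]
    exact tsub_le_self.trans (Real.toNNReal_le_iff_le_coe.2 hrt)
  have hTm : Measurable fun r : ℝ => semigroup m η r.toNNReal (fun y => F y (t - r.toNNReal)) x := by
    refine measurable_semigroup hη (α := ℝ) (f := fun _ => x) (t := fun r => r.toNNReal)
      (g := fun r y => F y (t - r.toNNReal)) (by fun_prop) (by fun_prop) ?_
    exact hF.comp (by fun_prop : Measurable fun q : ℝ × Space d => (q.2, t - q.1.toNNReal))
  have iT : IntervalIntegrable (fun r : ℝ => Real.exp (-κ * r) *
      semigroup m η r.toNNReal (fun y => F y (t - r.toNNReal)) x) volume 0 t := by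
    refine (intervalIntegrable_of_bounded hTm (fun u => abs_semigroup_le (bFt u) _ _) 0 t).continuousOn_mul ?_
    fun_prop
  have e1 : ∫ r in (0 : ℝ)..t, Real.exp (-κ * r) *
        feynmanKac m η c r.toNNReal (fun y => F y (t - r.toNNReal)) x =
      (∫ r in (0 : ℝ)..t, Real.exp (-κ * r) * semigroup m η r.toNNReal (fun y => F y (t - r.toNNReal)) x) +
      ∫ r in (0 : ℝ)..t, ∫ u in (0 : ℝ)..r, f r u := by
    rw [← intervalIntegral.integral_add iT]
    · refine intervalIntegral.integral_congr fun r hr => ?_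
      rw [uIcc_of_le t.coe_nonneg] at hr
      simp only [hf]
      rw [feynmanKac_duhamel hη hc bc _ (hFt r) (bFt r), intervalIntegral.integral_const_mul,
        Real.coe_toNNReal _ hr.1]
      ring
    · have hm : Measurable fun r : ℝ => ∫ u in (0 : ℝ)..r, f r u :=
        measurable_intervalIntegral_param hfm measurable_const measurable_id
      refine IntervalIntegrable.mono_fun (g := fun r => ∫ u in (0 : ℝ)..r, f r u)
        (intervalIntegrable_const (c := Real.exp (κ' * t) * (Kc * (Real.exp (Kc * t) * KF)) * t))
        hm.aestronglyMeasurable ?_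
      filter_upwards [ae_restrict_mem measurableSet_uIoc] with r hr
      rw [uIoc_of_le t.coe_nonneg] at hr
      have := intervalIntegral.norm_integral_le_of_norm_le_const (f := f r) (a := 0) (b := r)
        (C := Real.exp (κ' * t) * (Kc * (Real.exp (Kc * t) * KF))) (fun u hu => by
          rw [uIoc_of_le hr.1.le] at hu
          exact hfb r u hu.1.le hu.2 hr.2)
      refine this.trans (le_trans ?_ (le_abs_self _))
      rw [sub_zero, abs_of_pos hr.1]
      exact mul_le_mul_of_nonneg_left hr.2 (by positivity)
  -- After the exchange the outer variable is the time `u` of the perturbation. The inner integral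
  -- over `s` is then the source part of the renewal equation for `M` at time `t - u`, so the terms
  -- reassemble into `c M + F`.
  rw [e1, integral_triangle_swap hfm t.coe_nonneg (by positivity) hfb]
  have hMm : Measurable fun q : ℝ × Space d => feynmanKac m η c (t - q.1.toNNReal) (fun _ => 1) q.2 :=
    measurable_feynmanKac hη hc (α := ℝ × Space d) (f := fun q => q.2) (t := fun q => t - q.1.toNNReal)
      (g := fun _ _ => 1) (by fun_prop) (by fun_prop) measurable_const
  have bM1 : ∀ (u : ℝ) y, |feynmanKac m η c (t - u.toNNReal) (fun _ => 1) y| ≤ Real.exp (Kc * t) * 1 :=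
    fun u y => abs_feynmanKac_le bc b1 (NNReal.coe_le_coe.2 tsub_le_self) _
  have hA : Measurable fun u : ℝ => semigroup m η u.toNNReal
      (fun z => c z * feynmanKac m η c (t - u.toNNReal) (fun _ => 1) z) x :=
    measurable_semigroup hη (α := ℝ) (f := fun _ => x) (t := fun r => r.toNNReal)
      (g := fun u z => c z * feynmanKac m η c (t - u.toNNReal) (fun _ => 1) z) (by fun_prop)
      (by fun_prop) ((hc.comp measurable_snd).mul hMm)
  have iA : IntervalIntegrable (fun u : ℝ => semigroup m η u.toNNReal
      (fun z => c z * feynmanKac m η c (t - u.toNNReal) (fun _ => 1) z) x) volume 0 t :=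
    intervalIntegrable_of_bounded hA (K := Kc * (Real.exp (Kc * t) * 1)) (fun u =>
      abs_semigroup_le (fun y => abs_mul_le_mul (bc _) (bM1 u y)) _ _) 0 t
  have hBm : Measurable fun u : ℝ => ∫ s in (0 : ℝ)..(t - u), f (u + s) u := by
    refine measurable_intervalIntegral_param ?_ measurable_const (by fun_prop)
    exact hfm.comp (by fun_prop : Measurable fun q : ℝ × ℝ => (q.1 + q.2, q.1))
  have iB : IntervalIntegrable (fun u : ℝ => ∫ s in (0 : ℝ)..(t - u), f (u + s) u) volume 0 t := by
    refine IntervalIntegrable.mono_fun (g := fun u => ∫ s in (0 : ℝ)..(t - u), f (u + s) u)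
      (intervalIntegrable_const (c := Real.exp (κ' * t) * (Kc * (Real.exp (Kc * t) * KF)) * t))
      hBm.aestronglyMeasurable ?_
    filter_upwards [ae_restrict_mem measurableSet_uIoc] with u hu
    rw [uIoc_of_le t.coe_nonneg] at hu
    have := intervalIntegral.norm_integral_le_of_norm_le_const (f := fun s => f (u + s) u) (a := 0)
      (b := t - u) (C := Real.exp (κ' * t) * (Kc * (Real.exp (Kc * t) * KF))) (fun s hs => by
        rw [uIoc_of_le (by linarith [hu.2])] at hs
        exact hfb _ u hu.1.le (by linarith [hs.1]) (by linarith [hs.2]))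
    refine this.trans (le_trans ?_ (le_abs_self _))
    rw [sub_zero, abs_of_nonneg (by linarith [hu.2])]
    exact mul_le_mul_of_nonneg_left (by linarith [hu.1]) (by positivity)
  have iA' := iA.const_mul (Real.exp (-κ * t))
  rw [mul_add, mul_one, add_assoc, ← intervalIntegral.integral_const_mul,
    ← intervalIntegral.integral_add iT iB, ← intervalIntegral.integral_add iA' (iT.add iB)]
  congr 1
  refine intervalIntegral.integral_congr fun u hu => ?_
  rw [uIcc_of_le t.coe_nonneg] at hu
  lift u to ℝ≥0 using hu.1
  have hut : u ≤ t := hu.2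
  have htu : ((t - u : ℝ≥0) : ℝ) = t - u := NNReal.coe_sub hut
  simp only [Real.toNNReal_coe]
  -- the integrand at time `u`
  have e2 : ∀ y, M y (t - u) = Real.exp (-κ * (t - u)) * feynmanKac m η c (t - u) (fun _ => 1) y +
      ∫ s in (0 : ℝ)..(t - u), Real.exp (-κ * s) * feynmanKac m η c (min s.toNNReal t)
        (fun z => F z (t - (u + s).toNNReal)) y := by
    intro y
    rw [hM y (t - u) tsub_le_self, htu]
    congr 1
    refine intervalIntegral.integral_congr fun s hs => ?_
    rw [uIcc_of_le (by linarith [hu.2])] at hs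
    lift s to ℝ≥0 using hs.1
    have h3 : s ≤ t := by
      rw [← NNReal.coe_le_coe]
      have := hs.2
      have := u.coe_nonneg
      linarith
    have h4 : ((u : ℝ) + s).toNNReal = u + s := by rw [← NNReal.coe_add, Real.toNNReal_coe]
    simp only [Real.toNNReal_coe, h4, min_eq_left h3]
    rw [tsub_tsub]
  have hGm : Measurable (Function.uncurry fun (s : ℝ) y => Real.exp (-κ * s) *
      feynmanKac m η c (min s.toNNReal t) (fun z => F z (t - ((u : ℝ) + s).toNNReal)) y) := by
    have := measurable_feynmanKac hη hc (α := ℝ × Space d) (f := fun q => q.2)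
      (t := fun q => min q.1.toNNReal t)
      (g := fun q z => F z (t - ((u : ℝ) + q.1).toNNReal)) (by fun_prop) (by fun_prop)
      (hF.comp (by fun_prop : Measurable fun q : (ℝ × Space d) × Space d =>
        (q.2, t - ((u : ℝ) + q.1.1).toNNReal)))
    simp only [Function.uncurry_def]
    fun_prop
  have hGm' : Measurable fun y => ∫ s in (0 : ℝ)..(t - u), Real.exp (-κ * s) *
      feynmanKac m η c (min s.toNNReal t) (fun z => F z (t - ((u : ℝ) + s).toNNReal)) y :=
    measurable_intervalIntegral_param (hGm.comp measurable_swap) measurable_const measurable_const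
  have hG0b : ∀ s y, |feynmanKac m η c (min s t) (fun z => F z (t - (u + s : ℝ≥0))) y| ≤
      Real.exp (Kc * t) * KF := fun s y =>
    abs_feynmanKac_le bc (fun y => bF y _ tsub_le_self) (NNReal.coe_le_coe.2 (min_le_right _ _)) _
  -- This version of the integrand is bounded for all real `s`, as the Fubini lemma requires, and
  -- agrees with the original one on `[0, t - u]`.
  set Gc : ℝ → Space d → ℝ := fun s y => Real.exp (-κ * max (min s t) 0) *
      feynmanKac m η c (min s.toNNReal t) (fun z => F z (t - ((u : ℝ) + s).toNNReal)) y with hGc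
  have hGcm : Measurable (Function.uncurry Gc) := by
    have := measurable_feynmanKac hη hc (α := ℝ × Space d) (f := fun q => q.2)
      (t := fun q => min q.1.toNNReal t)
      (g := fun q z => F z (t - ((u : ℝ) + q.1).toNNReal)) (by fun_prop) (by fun_prop)
      (hF.comp (by fun_prop : Measurable fun q : (ℝ × Space d) × Space d =>
        (q.2, t - ((u : ℝ) + q.1.1).toNNReal)))
    simp only [Function.uncurry_def, hGc]
    fun_prop
  have hGcb : ∀ (s : ℝ) y, |Gc s y| ≤ Real.exp (κ' * t) * (Real.exp (Kc * t) * KF) := by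
    intro s y
    refine abs_mul_le_mul (hκ _ (le_max_right _ _) (max_le (min_le_right _ _) t.coe_nonneg)) ?_
    exact abs_feynmanKac_le bc (fun y => bF y _ tsub_le_self)
      (NNReal.coe_le_coe.2 (min_le_right _ _)) _
  have e3 : ∀ y, ∫ s in (0 : ℝ)..(t - u), Real.exp (-κ * s) * feynmanKac m η c (min s.toNNReal t)
        (fun z => F z (t - (u + s).toNNReal)) y = ∫ s in (0 : ℝ)..(t - u), Gc s y := by
    intro y
    refine intervalIntegral.integral_congr fun s hs => ?_
    rw [uIcc_of_le (by linarith [hu.2])] at hs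
    have := u.coe_nonneg
    simp only [hGc, min_eq_left (show s ≤ t by linarith [hs.2]), max_eq_left hs.1]
  have hGcm' : Measurable fun y => ∫ s in (0 : ℝ)..(t - u), Gc s y :=
    measurable_intervalIntegral_param (hGcm.comp measurable_swap) measurable_const measurable_const
  have hGcb' : ∀ y, |∫ s in (0 : ℝ)..(t - u), Gc s y| ≤
      Real.exp (κ' * t) * (Real.exp (Kc * t) * KF) * (t - u - 0) := fun y =>
    abs_intervalIntegral_le (fun s => hGcb s y) (by linarith [hu.2])
  have hMu : Measurable fun y => feynmanKac m η c (t - u) (fun _ => 1) y := by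
    have := hMm.comp (by fun_prop : Measurable fun y : Space d => ((u : ℝ), y))
    simpa [Function.comp_def] using this
  have bMu : ∀ y, |feynmanKac m η c (t - u) (fun _ => 1) y| ≤ Real.exp (Kc * t) * 1 := fun y => by
    simpa using bM1 u y
  have hFu : Measurable fun y => F y (t - u) := by simpa using hFt u
  have bFu : ∀ y, |F y (t - u)| ≤ KF := fun y => bF y _ tsub_le_self
  -- expand the semigroup
  have hmu : Measurable (η x u) := hη.measurable_comp measurable_const measurable_const measurable_id
  have e4 : semigroup m η u (fun y => c y * M y (t - u) + F y (t - u)) x =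
      Real.exp (-κ * (t - u)) * semigroup m η u
        (fun y => c y * feynmanKac m η c (t - u) (fun _ => 1) y) x +
      semigroup m η u (fun y => F y (t - u)) x +
      ∫ s in (0 : ℝ)..(t - u), semigroup m η u (fun y => c y * Gc s y) x := by
    have h5 : ∫ s in (0 : ℝ)..(t - u), semigroup m η u (fun y => c y * Gc s y) x =
        semigroup m η u (fun y => c y * ∫ s in (0 : ℝ)..(t - u), Gc s y) x := by
      simp only [semigroup]
      rw [← integral_intervalIntegral_swap_of_bounded (F := fun s w => c (η x u w) * Gc s (η x u w))
        (K := Kc * (Real.exp (κ' * t) * (Real.exp (Kc * t) * KF)))]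
      · refine integral_congr_ae (ae_of_all _ fun w => ?_)
        simp only
        rw [intervalIntegral.integral_const_mul]
      · simp only [Function.uncurry_def]
        exact (hc.comp (hmu.comp measurable_snd)).mul (hGcm.comp (by fun_prop :
          Measurable fun p : ℝ × S => (p.1, η x u p.2)))
      · exact fun s w => abs_mul_le_mul (bc _) (hGcb _ _)
    rw [h5]
    simp only [semigroup]
    rw [← integral_const_mul, ← integral_add, ← integral_add]
    · refine integral_congr_ae (ae_of_all _ fun w => ?_)
      simp only
      rw [e2, e3]
      ring
    · exact ((integrable_of_bounded' ((hc.comp hmu).mul (hMu.comp hmu)) (fun w =>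
        abs_mul_le_mul (bc _) (bMu _))).const_mul _).add
        (integrable_of_bounded' (hFu.comp hmu) fun w => bFu _)
    · exact integrable_of_bounded' ((hc.comp hmu).mul (hGcm'.comp hmu)) (fun w =>
        abs_mul_le_mul (bc _) (hGcb' _))
    · exact (integrable_of_bounded' ((hc.comp hmu).mul (hMu.comp hmu)) (fun w =>
        abs_mul_le_mul (bc _) (bMu _))).const_mul _
    · exact integrable_of_bounded' (hFu.comp hmu) fun w => bFu _
  have e5 : ∫ s in (0 : ℝ)..(t - u), f (u + s) u =
      Real.exp (-κ * u) * ∫ s in (0 : ℝ)..(t - u), semigroup m η u (fun y => c y * Gc s y) x := by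
    rw [← intervalIntegral.integral_const_mul]
    refine intervalIntegral.integral_congr fun s hs => ?_
    rw [uIcc_of_le (by linarith [hu.2])] at hs
    have hu0 := u.coe_nonneg
    have h6 : s ≤ t := by linarith [hs.2]
    simp only [hGc, hf, min_eq_left h6, max_eq_left hs.1]
    lift s to ℝ≥0 using hs.1
    have h4 : ((u : ℝ) + s).toNNReal = u + s := by rw [← NNReal.coe_add, Real.toNNReal_coe]
    have h7 : s ≤ t := h6
    simp only [Real.toNNReal_coe, h4, min_eq_left h7, add_tsub_cancel_left, semigroup]
    rw [mul_add, Real.exp_add, mul_assoc, ← integral_const_mul]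
    congr 2
    funext w
    ring
  rw [e5, e4]
  have e6 : Real.exp (-κ * t) = Real.exp (-κ * u) * Real.exp (-κ * (t - u)) := by
    rw [← Real.exp_add]
    ring_nf
  rw [e6]
  ring

end Duhamel

/-! ### The occupation of a family and its recursion over generations. -/

section Family

variable {d : ℕ} {S : Type*} [MeasurableSpace S] {m : Measure S}
  {η : Space d → ℝ≥0 → S → Space d} {φ : Space d → ℝ}

/-- The contribution to `⟨N_u, φ⟩` of the particle with label `w`, in the family of a particle born
at time `0` and place `x`. -/
def contrib (η : Space d → ℝ≥0 → S → Space d) (φ : Space d → ℝ) :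
    List Bool → Space d → (Marks S) → ℝ → ℝ≥0∞
  | [], x, z, u =>
    if 0 ≤ u ∧ u < (z []).2.1 then ENNReal.ofReal (φ (η x u.toNNReal (z []).1)) else 0
  | b :: w, x, z, u =>
    if (z []).2.2 = true then
      contrib η φ w (η x (z []).2.1.toNNReal (z []).1) (fun v => z (b :: v)) (u - (z []).2.1)
    else 0

lemma lintegral_particleMeasure (hφ : Measurable φ) (w : List Bool) (p : ℝ × Space d)
    (z : Marks S) (t : ℝ) :
    ∫⁻ y, ENNReal.ofReal (φ y) ∂(particleMeasure η t (birth η z p w) (z w)) =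
      contrib η φ w p.2 z (t - p.1) := by
  induction w generalizing p z with
  | nil =>
    simp only [birth, particleMeasure, contrib]
    have : (p.1 ≤ t ∧ t < p.1 + (z []).2.1) ↔ (0 ≤ t - p.1 ∧ t - p.1 < (z []).2.1) := by
      constructor <;> rintro ⟨h1, h2⟩ <;> constructor <;> linarith
    simp only [this]
    split_ifs
    · rw [lintegral_dirac' _ hφ.ennreal_ofReal]
    · simp
  | cons b w ih =>
    simp only [birth, contrib]
    split_ifs
    · have := ih (p.1 + (z []).2.1, η p.2 (z []).2.1.toNNReal (z []).1) (fun v => z (b :: v))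
      simp only at this
      rw [this]
      congr 1
      ring
    · simp [particleMeasure]

lemma measurable_contrib (hη : IsMarkovFamily m η) (hφ : Measurable φ) (w : List Bool) :
    Measurable fun p : Space d × (Marks S) × ℝ => contrib η φ w p.1 p.2.1 p.2.2 := by
  have hmη := hη.measurable
  induction w with
  | nil =>
    simp only [contrib]
    refine Measurable.ite ?_ (by fun_prop) measurable_const
    have h1 : Measurable fun p : Space d × (Marks S) × ℝ => p.2.2 := by fun_prop
    have h2 : Measurable fun p : Space d × (Marks S) × ℝ => (p.2.1 []).2.1 := by fun_prop
    exact (measurableSet_le measurable_const h1).inter (measurableSet_lt h1 h2)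
  | cons b w ih =>
    simp only [contrib]
    refine Measurable.ite ?_ ?_ measurable_const
    · exact (by fun_prop : Measurable fun p : Space d × (Marks S) × ℝ =>
        (p.2.1 []).2.2) (measurableSet_singleton true)
    · refine ih.comp (f := fun p : Space d × (Marks S) × ℝ =>
        (η p.1 (p.2.1 []).2.1.toNNReal (p.2.1 []).1, fun v => p.2.1 (b :: v),
          p.2.2 - (p.2.1 []).2.1)) ?_
      fun_prop

/-- The value of `⟨N_u, φ⟩` for the family of one particle born at time `0` and place `x`, restricted
to the first `n` generations. -/
def dens (η : Space d → ℝ≥0 → S → Space d) (φ : Space d → ℝ) (n : ℕ∞) (x : Space d)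
    (z : Marks S) (u : ℝ) : ℝ≥0∞ :=
  ∑' w : List Bool, if (w.length : ℕ∞) < n then contrib η φ w x z u else 0

lemma measurable_dens (hη : IsMarkovFamily m η) (hφ : Measurable φ) (n : ℕ∞) :
    Measurable fun p : Space d × (Marks S) × ℝ => dens η φ n p.1 p.2.1 p.2.2 := by
  refine Measurable.tsum fun w => ?_
  by_cases h : (w.length : ℕ∞) < n
  · simp only [h, if_true]
    exact measurable_contrib hη hφ w
  · simp only [h, if_false]
    exact measurable_const

lemma tsum_list_bool (f : List Bool → ℝ≥0∞) :
    ∑' w, f w = f [] + (∑' w, f (true :: w) + ∑' w, f (false :: w)) := by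
  rw [ENNReal.tsum_eq_add_tsum_ite []]
  congr 1
  have hinj : Function.Injective fun p : Bool × List Bool => p.1 :: p.2 := by
    rintro ⟨a, u⟩ ⟨b, v⟩ h
    simpa using h
  rw [← hinj.tsum_eq]
  · simp only [reduceCtorEq, if_false]
    rw [ENNReal.tsum_prod (f := fun (b : Bool) (w : List Bool) => f (b :: w)), tsum_fintype,
      Fintype.sum_bool]
  · intro w hw
    cases w with
    | nil => simp at hw
    | cons b w => exact ⟨(b, w), rfl⟩

/-- Words split into the empty one and those starting with `true` or `false`, and removing the first
letter lowers the generation by one. As `n` ranges over `ℕ∞` and `⊤ + 1 = ⊤`, the same identity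
describes truncated and full families. -/
lemma dens_succ (n : ℕ∞) (x : Space d) (z : Marks S) (u : ℝ) :
    dens η φ (n + 1) x z u = contrib η φ [] x z u +
      if (z []).2.2 = true then
        dens η φ n (η x (z []).2.1.toNNReal (z []).1) (fun v => z (true :: v)) (u - (z []).2.1) +
        dens η φ n (η x (z []).2.1.toNNReal (z []).1) (fun v => z (false :: v)) (u - (z []).2.1)
      else 0 := by
  have hlt : ∀ k : ℕ, ((k + 1 : ℕ) : ℕ∞) < n + 1 ↔ (k : ℕ∞) < n := by
    intro k
    push_cast
    exact ENat.add_lt_add_iff_right (by simp)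
  rw [dens, tsum_list_bool]
  simp only [List.length_nil, List.length_cons, hlt]
  congr 1
  · have : ((0 : ℕ) : ℕ∞) < n + 1 := by
      push_cast
      exact (by simp : (0 : ℕ∞) < 1).trans_le le_add_self
    rw [if_pos this]
  · simp only [contrib]
    split_ifs with h
    · rfl
    · simp

lemma dens_zero (x : Space d) (z : Marks S) (u : ℝ) : dens η φ 0 x z u = 0 := by
  simp [dens]

lemma dens_mono {n k : ℕ∞} (h : n ≤ k) (x : Space d) (z : Marks S) (u : ℝ) :
    dens η φ n x z u ≤ dens η φ k x z u := by
  refine ENNReal.tsum_le_tsum fun w => ?_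
  split_ifs with h1 h2
  · exact le_rfl
  · exact absurd (h1.trans_le h) h2
  · exact zero_le
  · exact le_rfl

/-- Every finite set of words has bounded length, so each finite partial sum is already contained in
a truncation. -/
lemma dens_top (x : Space d) (z : Marks S) (u : ℝ) :
    dens η φ ⊤ x z u = ⨆ n : ℕ, dens η φ n x z u := by
  refine le_antisymm ?_ (iSup_le fun n => dens_mono le_top _ _ _)
  rw [dens, ENNReal.tsum_eq_iSup_sum]
  refine iSup_le fun s => ?_
  refine le_iSup_of_le (s.sup List.length + 1) ?_
  refine le_trans ?_ (ENNReal.sum_le_tsum s)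
  refine Finset.sum_le_sum fun w hw => ?_
  have h1 : w.length < s.sup List.length + 1 := Nat.lt_succ_of_le (Finset.le_sup (f := List.length) hw)
  have : (w.length : ℕ∞) < ((s.sup List.length + 1 : ℕ) : ℕ∞) := by exact_mod_cast h1
  rw [if_pos this]
  split_ifs
  exacts [le_rfl, zero_le]

/-- The occupation functional `∫ g(u) ⟨N_u, φ⟩ du` of the family of one particle born at time `0`
and place `x`, restricted to the first `n` generations. -/
def famOcc (η : Space d → ℝ≥0 → S → Space d) (φ : Space d → ℝ) (g : ℝ → ℝ≥0∞) (n : ℕ∞) (x : Space d)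
    (z : Marks S) : ℝ≥0∞ :=
  ∫⁻ u, g u * dens η φ n x z u

/-- The contribution of the first particle to the occupation functional. -/
def ownOcc (η : Space d → ℝ≥0 → S → Space d) (φ : Space d → ℝ) (g : ℝ → ℝ≥0∞) (x : Space d)
    (a : Mark S) : ℝ≥0∞ :=
  ∫⁻ u in Ico 0 a.2.1, g u * ENNReal.ofReal (φ (η x u.toNNReal a.1))

lemma measurable_dens_time (hη : IsMarkovFamily m η) (hφ : Measurable φ) (n : ℕ∞) (x : Space d)
    (z : Marks S) : Measurable fun u => dens η φ n x z u :=
  (measurable_dens hη hφ n).comp (by fun_prop : Measurable fun u : ℝ => (x, z, u))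

lemma measurable_famOcc (hη : IsMarkovFamily m η) (hφ : Measurable φ) {α : Type*}
    [MeasurableSpace α] {g : α → ℝ → ℝ≥0∞} (hg : Measurable (Function.uncurry g)) (n : ℕ∞)
    {f : α → Space d} {z : α → Marks S} (hf : Measurable f) (hz : Measurable z) :
    Measurable fun a => famOcc η φ (g a) n (f a) (z a) := by
  refine Measurable.lintegral_prod_right' (f := fun p : α × ℝ => g p.1 p.2 *
    dens η φ n (f p.1) (z p.1) p.2) ?_
  exact hg.mul ((measurable_dens hη hφ n).comp
    (by fun_prop : Measurable fun p : α × ℝ => (f p.1, z p.1, p.2)))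

lemma famOcc_zero (g : ℝ → ℝ≥0∞) (x : Space d) (z : Marks S) :
    famOcc η φ g 0 x z = 0 := by
  simp [famOcc, dens_zero]

/-- The clock of the children starts at the death of the parent, so translation of the time variable
transfers the lifetime of the parent to the weight `g`. -/
lemma famOcc_succ (hη : IsMarkovFamily m η) (hφ : Measurable φ) {g : ℝ → ℝ≥0∞} (hg : Measurable g)
    (n : ℕ∞) (x : Space d) (z : Marks S) :
    famOcc η φ g (n + 1) x z = ownOcc η φ g x (z []) +
      if (z []).2.2 = true then
        famOcc η φ (fun u => g (u + (z []).2.1)) n (η x (z []).2.1.toNNReal (z []).1)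
          (fun v => z (true :: v)) +
        famOcc η φ (fun u => g (u + (z []).2.1)) n (η x (z []).2.1.toNNReal (z []).1)
          (fun v => z (false :: v))
      else 0 := by
  have hc : Measurable fun u => contrib η φ [] x z u :=
    (measurable_contrib hη hφ []).comp (by fun_prop : Measurable fun u : ℝ => (x, z, u))
  have hd : ∀ x z, Measurable fun u => dens η φ n x z u := measurable_dens_time hη hφ n
  have hshift : ∀ (x' : Space d) (z' : Marks S),
      ∫⁻ u, g u * dens η φ n x' z' (u - (z []).2.1) =
        famOcc η φ (fun u => g (u + (z []).2.1)) n x' z' := by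
    intro x' z'
    rw [famOcc, ← lintegral_sub_right_eq_self (fun u => g (u + (z []).2.1) * dens η φ n x' z' u)
      (z []).2.1]
    simp
  simp only [famOcc, dens_succ, mul_add]
  rw [lintegral_add_left (show Measurable fun u => g u * contrib η φ [] x z u from hg.mul hc)]
  congr 1
  · rw [ownOcc, ← lintegral_indicator measurableSet_Ico]
    refine lintegral_congr fun u => ?_
    simp only [contrib, indicator, mem_Ico]
    split_ifs <;> simp
  · split_ifs with h
    · simp only [mul_add]
      rw [lintegral_add_left, hshift, hshift]
      · rfl
      · exact hg.mul ((hd _ _).comp (by fun_prop : Measurable fun u : ℝ => u - (z []).2.1))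
    · simp

lemma famOcc_top (hη : IsMarkovFamily m η) (hφ : Measurable φ) {g : ℝ → ℝ≥0∞} (hg : Measurable g)
    (x : Space d) (z : Marks S) :
    famOcc η φ g ⊤ x z = ⨆ n : ℕ, famOcc η φ g n x z := by
  simp only [famOcc]
  rw [← lintegral_iSup (f := fun (n : ℕ) u => g u * dens η φ n x z u)
    (fun n => hg.mul (measurable_dens_time hη hφ n x z))]
  · simp only [dens_top, ENNReal.mul_iSup]
  · intro a b hab u
    exact mul_le_mul_right (dens_mono (by exact_mod_cast hab) _ _ _) _

lemma famOcc_mono_gen {n k : ℕ∞} (h : n ≤ k) (g : ℝ → ℝ≥0∞) (x : Space d) (z : Marks S) :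
    famOcc η φ g n x z ≤ famOcc η φ g k x z :=
  lintegral_mono fun _ => mul_le_mul_right (dens_mono h _ _ _) _

lemma famOcc_mono {g g' : ℝ → ℝ≥0∞} (h : ∀ u, g u ≤ g' u) (n : ℕ∞) (x : Space d)
    (z : Marks S) : famOcc η φ g n x z ≤ famOcc η φ g' n x z :=
  lintegral_mono fun u => mul_le_mul_left (h u) _

end Family

/-! ### Independent marks on the binary tree. -/

section Law

variable {S : Type*} [MeasurableSpace S]

/-- The law of the mark of a particle. -/
def markLaw (m : Measure S) (V q : ℝ) : Measure (Mark S) := m.prod ((expMeasure V).prod (splitLaw q))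

/-- The law of the marks of a family. -/
def famLaw (m : Measure S) (V q : ℝ) : Measure (Marks S) :=
  Measure.infinitePi fun _ => markLaw m V q

lemma isProbabilityMeasure_splitLaw {q : ℝ} (h0 : 0 ≤ q) (h1 : q < 1 / 2) :
    IsProbabilityMeasure (splitLaw q) := by
  constructor
  simp only [splitLaw, Measure.coe_add, Measure.coe_smul, Pi.add_apply, Pi.smul_apply,
    measure_univ, smul_eq_mul, mul_one]
  rw [← ENNReal.ofReal_add h0 (by linarith)]
  simp

lemma isProbabilityMeasure_markLaw (m : Measure S) [IsProbabilityMeasure m] {V q : ℝ} (hV : 0 < V)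
    (h0 : 0 ≤ q) (h1 : q < 1 / 2) : IsProbabilityMeasure (markLaw m V q) := by
  have := isProbabilityMeasure_splitLaw h0 h1
  have := isProbabilityMeasure_expMeasure hV
  unfold markLaw
  infer_instance

/-- The marks of a family, assembled from the mark of the first particle and the marks of the
families of its two potential children. -/
def glue {A : Type*} (p : A × (List Bool → A) × (List Bool → A)) : List Bool → A
  | [] => p.1
  | true :: w => p.2.1 w
  | false :: w => p.2.2 w

@[simp] lemma glue_nil {A : Type*} (p : A × (List Bool → A) × (List Bool → A)) :
    glue p [] = p.1 := rfl

@[simp] lemma glue_true {A : Type*} (p : A × (List Bool → A) × (List Bool → A)) (w : List Bool) :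
    glue p (true :: w) = p.2.1 w := rfl

@[simp] lemma glue_false {A : Type*} (p : A × (List Bool → A) × (List Bool → A)) (w : List Bool) :
    glue p (false :: w) = p.2.2 w := rfl

lemma measurable_glue {A : Type*} [MeasurableSpace A] : Measurable (glue (A := A)) := by
  refine measurable_pi_iff.2 fun w => ?_
  match w with
  | [] => exact measurable_fst
  | true :: w => exact (measurable_pi_apply w).comp (measurable_fst.comp measurable_snd)
  | false :: w => exact (measurable_pi_apply w).comp (measurable_snd.comp measurable_snd)

/-- An i.i.d. family indexed by binary words consists of the mark at the root and two independent
copies of the whole family. This is the branching property at the level of marks. It is enough to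
check it on cylinders. -/
lemma map_glue {A : Type*} [MeasurableSpace A] (ρ : Measure A) [IsProbabilityMeasure ρ] :
    (ρ.prod ((Measure.infinitePi fun _ : List Bool => ρ).prod
      (Measure.infinitePi fun _ : List Bool => ρ))).map glue =
      Measure.infinitePi fun _ : List Bool => ρ := by
  classical
  refine Measure.eq_infinitePi _ fun s t ht => ?_
  -- Unconstrained coordinates are given the full space, so the factor at the root can be split off
  -- whether or not the cylinder constrains it.
  set t' : List Bool → Set A := fun w => if w ∈ s then t w else univ with ht'
  have mt' : ∀ w, MeasurableSet (t' w) := fun w => by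
    simp only [ht']
    split_ifs
    exacts [ht w, MeasurableSet.univ]
  set s1 : Finset (List Bool) := s.preimage (fun w => true :: w) (by simp [Set.InjOn]) with hs1
  set s0 : Finset (List Bool) := s.preimage (fun w => false :: w) (by simp [Set.InjOn]) with hs0
  have m1 : ∀ w, w ∈ s1 ↔ true :: w ∈ s := fun w => Finset.mem_preimage
  have m0 : ∀ w, w ∈ s0 ↔ false :: w ∈ s := fun w => Finset.mem_preimage
  clear_value s1 s0
  have hpre : glue ⁻¹' (Set.pi s t) = t' [] ×ˢ (Set.pi (s1 : Set (List Bool)) (fun w => t' (true :: w)) ×ˢ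
      Set.pi (s0 : Set (List Bool)) (fun w => t' (false :: w))) := by
    ext ⟨a, z1, z0⟩
    simp only [mem_preimage, Set.mem_pi, Finset.mem_coe, mem_prod]
    constructor
    · intro h
      refine ⟨?_, fun w hw => ?_, fun w hw => ?_⟩
      · by_cases h0 : [] ∈ s
        · simpa [ht', h0] using h [] h0
        · simp [ht', h0]
      · have hw' : true :: w ∈ s := (m1 w).1 hw
        simpa [ht', hw'] using h _ hw'
      · have hw' : false :: w ∈ s := (m0 w).1 hw
        simpa [ht', hw'] using h _ hw'
    · rintro ⟨h0, h1, h2⟩ w hw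
      match w, hw with
      | [], hw => simpa [ht', hw] using h0
      | true :: w, hw =>
        have := h1 w ((m1 w).2 hw)
        simpa [ht', hw] using this
      | false :: w, hw =>
        have := h2 w ((m0 w).2 hw)
        simpa [ht', hw] using this
  have hset : insert [] s = insert [] (s1.image (fun w => true :: w) ∪ s0.image (fun w => false :: w)) := by
    ext w
    match w with
    | [] => simp
    | true :: w => simp [m1]
    | false :: w => simp [m0]
  have hprod : ∏ w ∈ s, ρ (t w) = ∏ w ∈ insert [] s, ρ (t' w) := by
    by_cases h0 : [] ∈ s
    · rw [Finset.insert_eq_of_mem h0]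
      exact Finset.prod_congr rfl fun w hw => by simp [ht', hw]
    · rw [Finset.prod_insert h0]
      simp only [ht', h0, if_false, measure_univ, one_mul]
      exact Finset.prod_congr rfl fun w hw => by simp [hw]
  rw [Measure.map_apply measurable_glue (MeasurableSet.pi s.countable_toSet fun _ _ => ht _), hpre,
    Measure.prod_prod, Measure.prod_prod, Measure.infinitePi_pi _ (fun _ _ => mt' _),
    Measure.infinitePi_pi _ (fun _ _ => mt' _), hprod, hset, Finset.prod_insert,
    Finset.prod_union, Finset.prod_image, Finset.prod_image]
  · simp [Set.InjOn]
  · simp [Set.InjOn]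
  · rw [Finset.disjoint_left]
    simp
  · simp

lemma lintegral_famLaw (m : Measure S) [IsProbabilityMeasure m] {V q : ℝ} (hV : 0 < V)
    (h0 : 0 ≤ q) (h1 : q < 1 / 2) {f : Mark S → (Marks S) → (Marks S) → ℝ≥0∞}
    (hf : Measurable fun p : Mark S × (Marks S) × (Marks S) =>
      f p.1 p.2.1 p.2.2) :
    ∫⁻ z, f (z []) (fun v => z (true :: v)) (fun v => z (false :: v)) ∂(famLaw m V q) =
      ∫⁻ a, ∫⁻ z₁, ∫⁻ z₀, f a z₁ z₀ ∂(famLaw m V q) ∂(famLaw m V q) ∂(markLaw m V q) := by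
  have := isProbabilityMeasure_markLaw m hV h0 h1
  have hP : IsProbabilityMeasure (famLaw m V q) := by unfold famLaw; infer_instance
  conv_lhs => rw [famLaw, ← map_glue]
  rw [lintegral_map ?_ measurable_glue]
  · change ∫⁻ p, f p.1 p.2.1 p.2.2 ∂((markLaw m V q).prod ((famLaw m V q).prod (famLaw m V q))) = _
    rw [lintegral_prod _ hf.aemeasurable]
    refine lintegral_congr fun a => ?_
    rw [lintegral_prod]
    exact (hf.comp (by fun_prop : Measurable fun p : (Marks S) × (Marks S) =>
      (a, p.1, p.2))).aemeasurable
  · exact hf.comp (by fun_prop : Measurable fun z : Marks S =>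
      (z [], (fun v => z (true :: v)), (fun v => z (false :: v))))

end Law

/-! ### Exponentials on the extended half-line. -/

section ExpENNReal

/-- The exponential function on `[0,∞]`. -/
def expE (j : ℝ≥0∞) : ℝ≥0∞ := EReal.exp (j : EReal)

/-- The function `exp (-j)` on `[0,∞]`. -/
def negE (j : ℝ≥0∞) : ℝ≥0∞ := EReal.exp (-(j : EReal))

@[simp] lemma expE_zero : expE 0 = 1 := by simp [expE]
@[simp] lemma negE_zero : negE 0 = 1 := by simp [negE]

lemma expE_add (a b : ℝ≥0∞) : expE (a + b) = expE a * expE b := by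
  simp [expE, EReal.coe_ennreal_add, EReal.exp_add]

lemma negE_add (a b : ℝ≥0∞) : negE (a + b) = negE a * negE b := by
  rw [negE, negE, negE, EReal.coe_ennreal_add, EReal.neg_add, sub_eq_add_neg, EReal.exp_add]
  · exact Or.inl (EReal.coe_ennreal_ne_bot _)
  · exact Or.inr (EReal.coe_ennreal_ne_bot _)

lemma continuous_expE : Continuous expE :=
  ENNReal.continuous_exp.comp continuous_coe_ennreal_ereal

lemma continuous_negE : Continuous negE :=
  ENNReal.continuous_exp.comp (continuous_neg.comp continuous_coe_ennreal_ereal)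

lemma measurable_expE : Measurable expE := continuous_expE.measurable
lemma measurable_negE : Measurable negE := continuous_negE.measurable

lemma expE_mono : Monotone expE := fun _ _ h =>
  EReal.exp_monotone (EReal.coe_ennreal_le_coe_ennreal_iff.2 h)

lemma negE_anti : Antitone negE := fun _ _ h =>
  EReal.exp_monotone (EReal.neg_le_neg_iff.2 (EReal.coe_ennreal_le_coe_ennreal_iff.2 h))

lemma one_le_expE (a : ℝ≥0∞) : 1 ≤ expE a := by
  simpa using expE_mono (zero_le : 0 ≤ a)

lemma negE_le_one (a : ℝ≥0∞) : negE a ≤ 1 := by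
  simpa using negE_anti (zero_le : 0 ≤ a)

lemma expE_ofReal {r : ℝ} (hr : 0 ≤ r) : expE (ENNReal.ofReal r) = ENNReal.ofReal (Real.exp r) := by
  rw [expE, EReal.coe_ennreal_ofReal, max_eq_left hr, EReal.exp_coe]

lemma negE_ofReal {r : ℝ} (hr : 0 ≤ r) :
    negE (ENNReal.ofReal r) = ENNReal.ofReal (Real.exp (-r)) := by
  rw [negE, EReal.coe_ennreal_ofReal, max_eq_left hr, ← EReal.coe_neg, EReal.exp_coe]

lemma expE_top : expE ∞ = ∞ := by simp [expE]

lemma expE_iSup {f : ℕ → ℝ≥0∞} (hf : Monotone f) : expE (⨆ n, f n) = ⨆ n, expE (f n) :=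
  tendsto_nhds_unique ((continuous_expE.tendsto _).comp (tendsto_atTop_iSup hf))
    (tendsto_atTop_iSup (expE_mono.comp hf))

end ExpENNReal

/-! ### The critical parameter of the branching mechanism. -/

section Parameters

variable {V q : ℝ}

lemma criticalRate_le (hV : 0 < V) (q : ℝ) : criticalRate V q ≤ V := by
  rw [criticalRate]
  nlinarith [Real.sqrt_nonneg (q * (1 - q))]

lemma criticalRate_pos (hV : 0 < V) (hq0 : 0 ≤ q) (hq : q < 1 / 2) : 0 < criticalRate V q := by
  rw [criticalRate]
  have h : √(q * (1 - q)) < √((1 / 2) ^ 2) :=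
    Real.sqrt_lt_sqrt (mul_nonneg hq0 (by linarith)) (by nlinarith [sq_pos_of_pos (sub_pos.2 hq)])
  rw [Real.sqrt_sq (by norm_num)] at h
  apply mul_pos hV
  linarith

/-- A bound for the exponential moments of the total occupation, below the critical parameter. -/
lemma exists_moment_bound (hV : 0 < V) (hq0 : 0 ≤ q) (hq : q < 1 / 2) {a : ℝ} (ha : 0 < a)
    (haQ : a < criticalRate V q) :
    a < V ∧ ∃ M : ℝ, 1 ≤ M ∧ V / (V - a) * (q * M ^ 2 + (1 - q)) ≤ M ∧
      2 * (V * q) * (M - 1) < killRate V q := by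
  have haV : a < V := haQ.trans_le (criticalRate_le hV q)
  refine ⟨haV, ?_⟩
  have hVa : 0 < V - a := sub_pos.2 haV
  -- Without branching there is no quadratic term, and `M` is the exponential moment of one
  -- lifetime.
  rcases hq0.eq_or_lt with rfl | hq0
  · refine ⟨V / (V - a), ?_, by simp, by simp [killRate, hV]⟩
    rw [le_div_iff₀ hVa]
    linarith
  · have hs : 0 ≤ √(q * (1 - q)) := Real.sqrt_nonneg _
    have hs2 : √(q * (1 - q)) ^ 2 = q * (1 - q) := Real.sq_sqrt (mul_nonneg hq0.le (by linarith))
    set s := √(q * (1 - q)) with hsd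
    rw [criticalRate] at haQ
    have h1 : 2 * V * s < V - a := by nlinarith
    have hqs : q < s := by
      by_contra h
      push Not at h
      have : s ^ 2 ≤ q ^ 2 := by gcongr
      nlinarith
    -- This `M` is the vertex of `V q M² - (V - a) M + V (1 - q)`. The value there is nonpositive
    -- when `(V - a)² ≥ 4 V² q (1 - q)`, which is guaranteed by `a < Q₀`. Moreover `2 V q (M - 1) =
    -- V - a - 2 V q` is below `Q` because `a > 0`, and `q < √(q (1 - q))` gives `M ≥ 1`.
    refine ⟨(V - a) / (2 * V * q), ?_, ?_, ?_⟩
    · rw [le_div_iff₀ (by positivity)]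
      nlinarith
    · have h2 : (2 * V * s) ^ 2 ≤ (V - a) ^ 2 := by
        have : 0 ≤ 2 * V * s := by positivity
        gcongr
      have h3 : 4 * V ^ 2 * (q * (1 - q)) ≤ (V - a) ^ 2 := by
        rw [← hs2]
        linarith
      rw [div_mul_eq_mul_div, div_le_div_iff₀ hVa (by positivity)]
      have : V * (q * ((V - a) / (2 * V * q)) ^ 2 + (1 - q)) * (2 * V * q) =
          (V - a) ^ 2 / 2 + 2 * V ^ 2 * (q * (1 - q)) := by
        field_simp
      rw [this]
      linarith
    · rw [killRate]
      have : 2 * (V * q) * ((V - a) / (2 * V * q) - 1) = V - a - 2 * V * q := by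
        field_simp
      rw [this]
      linarith

end Parameters

/-! ### Exponential moments of the occupation of a family. -/

section Moments

variable {d : ℕ} {S : Type*} [MeasurableSpace S] {m : Measure S} [IsProbabilityMeasure m]
  {η : Space d → ℝ≥0 → S → Space d} {φ : Space d → ℝ} {V q : ℝ}

lemma lintegral_expMeasure (V : ℝ) {f : ℝ → ℝ≥0∞} (hf : Measurable f) :
    ∫⁻ t, f t ∂(expMeasure V) = ∫⁻ t in Ici 0, ENNReal.ofReal (V * Real.exp (-(V * t))) * f t := by
  have h : expMeasure V = volume.withDensity (exponentialPDF V) := rfl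
  have hm : Measurable (exponentialPDF V) := (measurable_exponentialPDFReal V).ennreal_ofReal
  rw [h, lintegral_withDensity_eq_lintegral_mul _ hm hf, ← lintegral_indicator measurableSet_Ici]
  refine lintegral_congr fun t => ?_
  by_cases ht : 0 ≤ t
  · simp [indicator, ht, exponentialPDF_of_nonneg ht]
  · simp [indicator, ht, exponentialPDF_of_neg (not_le.1 ht)]

lemma ae_nonneg_expMeasure (V : ℝ) : ∀ᵐ t ∂(expMeasure V), 0 ≤ t := by
  rw [ae_iff]
  have h : {t : ℝ | ¬ 0 ≤ t} = Iio 0 := by ext; simp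
  rw [h, ← lintegral_indicator_one measurableSet_Iio,
    lintegral_expMeasure V (measurable_one.indicator measurableSet_Iio)]
  rw [setLIntegral_congr_fun (g := fun _ => 0) measurableSet_Ici]
  · simp
  · intro t ht
    have : t ∉ Iio (0 : ℝ) := fun h => absurd (mem_Ici.1 ht) (not_le.2 h)
    simp [indicator_of_notMem this]

lemma lintegral_exp_expMeasure {a V : ℝ} (hV : 0 < V) (h : a < V) :
    ∫⁻ t, ENNReal.ofReal (Real.exp (a * t)) ∂(expMeasure V) = ENNReal.ofReal (V / (V - a)) := by
  have hVa : 0 < V - a := sub_pos.2 h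
  rw [lintegral_expMeasure V (by fun_prop)]
  have h1 := lintegral_expMeasure (V - a) (f := fun _ => 1) measurable_const
  have := isProbabilityMeasure_expMeasure hVa
  simp only [lintegral_one, measure_univ, mul_one] at h1
  have h2 : ∀ t, ENNReal.ofReal (V * Real.exp (-(V * t))) * ENNReal.ofReal (Real.exp (a * t)) =
      ENNReal.ofReal (V / (V - a)) * ENNReal.ofReal ((V - a) * Real.exp (-((V - a) * t))) := by
    intro t
    rw [← ENNReal.ofReal_mul (by positivity), ← ENNReal.ofReal_mul (by positivity)]
    congr 1
    rw [mul_assoc, ← Real.exp_add]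
    field_simp
    congr 1
    ring
  simp_rw [h2]
  rw [lintegral_const_mul _ (by fun_prop), ← h1, mul_one]

lemma lintegral_markLaw (hV : 0 < V) (h0 : 0 ≤ q) (h1 : q < 1 / 2)
    {f : S → ℝ → Bool → ℝ≥0∞} (hf : Measurable fun a : Mark S => f a.1 a.2.1 a.2.2) :
    ∫⁻ a, f a.1 a.2.1 a.2.2 ∂(markLaw m V q) =
      ∫⁻ w, ∫⁻ t, ENNReal.ofReal q * f w t true + ENNReal.ofReal (1 - q) * f w t false
        ∂(expMeasure V) ∂m := by
  have := isProbabilityMeasure_splitLaw h0 h1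
  have := isProbabilityMeasure_expMeasure hV
  rw [markLaw, lintegral_prod _ hf.aemeasurable]
  refine lintegral_congr fun w => ?_
  have hfw : Measurable fun p : ℝ × Bool => f w p.1 p.2 :=
    hf.comp (by fun_prop : Measurable fun p : ℝ × Bool => (w, p.1, p.2))
  rw [lintegral_prod _ hfw.aemeasurable]
  refine lintegral_congr fun t => ?_
  simp [splitLaw]

lemma ownOcc_le {g : ℝ → ℝ≥0∞} {θ b : ℝ} (hg : ∀ u, g u ≤ ENNReal.ofReal θ)
    (hθ : 0 ≤ θ) (hφb : ∀ x, φ x ≤ b) (x : Space d) (a : Mark S) :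
    ownOcc η φ g x a ≤ ENNReal.ofReal (θ * b * a.2.1) := by
  rcases le_or_gt a.2.1 0 with h | h
  · simp [ownOcc, Ico_eq_empty (not_lt.2 h)]
  · calc ownOcc η φ g x a ≤ ∫⁻ u in Ico 0 a.2.1, ENNReal.ofReal θ * ENNReal.ofReal b :=
        lintegral_mono fun u => mul_le_mul' (hg u) (ENNReal.ofReal_le_ofReal (hφb _))
      _ = ENNReal.ofReal (θ * b * a.2.1) := by
        rw [lintegral_const, Measure.restrict_apply_univ, Real.volume_Ico, sub_zero,
          ← ENNReal.ofReal_mul hθ, ← ENNReal.ofReal_mul' h.le]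

lemma measurable_ownOcc (hη : IsMarkovFamily m η) (hφ : Measurable φ) {α : Type*}
    [MeasurableSpace α] {g : α → ℝ → ℝ≥0∞} (hg : Measurable (Function.uncurry g))
    {f : α → Space d} {a : α → Mark S} (hf : Measurable f) (ha : Measurable a) :
    Measurable fun p => ownOcc η φ (g p) (f p) (a p) := by
  have hmη := hη.measurable
  have h1 : ∀ p, ownOcc η φ (g p) (f p) (a p) = ∫⁻ u,
      {r : α × ℝ | 0 ≤ r.2 ∧ r.2 < (a r.1).2.1}.indicator
        (fun r => g r.1 r.2 * ENNReal.ofReal (φ (η (f r.1) r.2.toNNReal (a r.1).1))) (p, u) := by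
    intro p
    rw [ownOcc, ← lintegral_indicator measurableSet_Ico]
    rfl
  simp_rw [h1]
  refine Measurable.lintegral_prod_right' ?_
  refine Measurable.indicator ?_ ?_
  · have hg' : Measurable fun r : α × ℝ => g r.1 r.2 := hg
    fun_prop
  · have h2 : Measurable fun r : α × ℝ => (a r.1).2.1 := by fun_prop
    exact (measurableSet_le measurable_const measurable_snd).inter
      (measurableSet_lt measurable_snd h2)

lemma measurable_expE_famOcc (hη : IsMarkovFamily m η) (hφ : Measurable φ) {g : ℝ → ℝ≥0∞}
    (hg : Measurable g) (n : ℕ∞) :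
    Measurable fun p : Space d × (Marks S) => expE (famOcc η φ g n p.1 p.2) :=
  measurable_expE.comp (measurable_famOcc hη hφ (g := fun _ => g) (hg.comp measurable_snd) n
    measurable_fst measurable_snd)

/-- Induction over generations. The first particle contributes at most `exp (θ b τ)` with an
exponential lifetime `τ`, and if it splits, two independent families contribute at most `M` each.
The hypothesis `hM` says that `M` is a supersolution of this recursion. -/
lemma lintegral_expE_famOcc_le_nat (hη : IsMarkovFamily m η) (hφ : Measurable φ)
    (hV : 0 < V) (h0 : 0 ≤ q) (h1 : q < 1 / 2) {θ b : ℝ} (hθ : 0 ≤ θ)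
    (hb : 0 ≤ b) (hφb : ∀ x, φ x ≤ b) (hVa : θ * b < V) {M : ℝ} (hM1 : 1 ≤ M)
    (hM : V / (V - θ * b) * (q * M ^ 2 + (1 - q)) ≤ M) (n : ℕ) {g : ℝ → ℝ≥0∞} (hg : Measurable g)
    (hgθ : ∀ u, g u ≤ ENNReal.ofReal θ) (x : Space d) :
    ∫⁻ z, expE (famOcc η φ g n x z) ∂(famLaw m V q) ≤ ENNReal.ofReal M := by
  have := isProbabilityMeasure_markLaw m hV h0 h1
  have hP : IsProbabilityMeasure (famLaw m V q) := by unfold famLaw; infer_instance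
  have hmη := hη.measurable
  -- The children see the weight shifted by the lifetime of their parent and start elsewhere, so
  -- both must vary.
  induction n generalizing g x with
  | zero =>
    simp only [Nat.cast_zero, famOcc_zero, expE_zero, lintegral_const, measure_univ, mul_one]
    simpa using ENNReal.ofReal_le_ofReal hM1
  | succ n ih =>
    push_cast
    simp_rw [famOcc_succ hη hφ hg]
    have hgs : ∀ a : Mark S, Measurable fun u => g (u + a.2.1) := fun a => by fun_prop
    have hme : ∀ (a : Mark S) (y : Space d), Measurable fun z =>
        expE (famOcc η φ (fun u => g (u + a.2.1)) n y z) := fun a y =>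
      (measurable_expE_famOcc hη hφ (hgs a) n).comp
        (by fun_prop : Measurable fun z : Marks S => (y, z))
    have hsplit : Measurable fun p : Mark S × (Marks S) × (Marks S) =>
        expE (ownOcc η φ g x p.1 + if p.1.2.2 = true then
          famOcc η φ (fun u => g (u + p.1.2.1)) n (η x p.1.2.1.toNNReal p.1.1) p.2.1 +
          famOcc η φ (fun u => g (u + p.1.2.1)) n (η x p.1.2.1.toNNReal p.1.1) p.2.2 else 0) := by
      refine measurable_expE.comp (Measurable.add ?_ (Measurable.ite ?_ (Measurable.add ?_ ?_)
        measurable_const))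
      · exact measurable_ownOcc hη hφ (g := fun _ => g) (hg.comp measurable_snd) measurable_const
          measurable_fst
      · exact (by fun_prop : Measurable fun p : Mark S × (Marks S) × (Marks S) =>
          p.1.2.2) (measurableSet_singleton true)
      · refine measurable_famOcc hη hφ (α := Mark S × (Marks S) × (Marks S))
          (g := fun p u => g (u + p.1.2.1)) ?_ n (by fun_prop) (by fun_prop)
        simp only [Function.uncurry_def]
        fun_prop
      · refine measurable_famOcc hη hφ (α := Mark S × (Marks S) × (Marks S))
          (g := fun p u => g (u + p.1.2.1)) ?_ n (by fun_prop) (by fun_prop)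
        simp only [Function.uncurry_def]
        fun_prop
    rw [lintegral_famLaw m hV h0 h1 (f := fun a z₁ z₀ => expE (ownOcc η φ g x a +
      if a.2.2 = true then famOcc η φ (fun u => g (u + a.2.1)) n (η x a.2.1.toNNReal a.1) z₁ +
        famOcc η φ (fun u => g (u + a.2.1)) n (η x a.2.1.toNNReal a.1) z₀ else 0)) hsplit]
    have hle : ∀ a : Mark S, ∫⁻ z₁, ∫⁻ z₀, expE (ownOcc η φ g x a +
      if a.2.2 = true then famOcc η φ (fun u => g (u + a.2.1)) n (η x a.2.1.toNNReal a.1) z₁ +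
        famOcc η φ (fun u => g (u + a.2.1)) n (η x a.2.1.toNNReal a.1) z₀ else 0)
        ∂(famLaw m V q) ∂(famLaw m V q) ≤
        (fun (_ : S) (t : ℝ) (s : Bool) => expE (ENNReal.ofReal (θ * b * t)) *
          (if s = true then ENNReal.ofReal (M ^ 2) else 1)) a.1 a.2.1 a.2.2 := by
      intro a
      simp only [expE_add]
      split_ifs
      · simp only [expE_add]
        have h3 := ih (hgs a) (fun u => hgθ _) (η x a.2.1.toNNReal a.1)
        have h4 : ∀ z₁, ∫⁻ z₀, expE (ownOcc η φ g x a) *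
            (expE (famOcc η φ (fun u => g (u + a.2.1)) n (η x a.2.1.toNNReal a.1) z₁) *
            expE (famOcc η φ (fun u => g (u + a.2.1)) n (η x a.2.1.toNNReal a.1) z₀)) ∂(famLaw m V q) =
            expE (ownOcc η φ g x a) *
            (expE (famOcc η φ (fun u => g (u + a.2.1)) n (η x a.2.1.toNNReal a.1) z₁) * 
            ∫⁻ z₀, expE (famOcc η φ (fun u => g (u + a.2.1)) n (η x a.2.1.toNNReal a.1) z₀)
              ∂(famLaw m V q)) := by
          intro z₁
          rw [lintegral_const_mul _ ((hme _ _).const_mul _), lintegral_const_mul _ (hme _ _)]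
        simp_rw [h4]
        rw [lintegral_const_mul _ ((hme _ _).mul_const _), lintegral_mul_const _ (hme _ _)]
        refine mul_le_mul' (expE_mono (ownOcc_le hgθ hθ hφb x a)) ?_
        rw [pow_two, ENNReal.ofReal_mul (by linarith)]
        exact mul_le_mul' h3 h3
      · simp only [expE_zero, mul_one, lintegral_const, measure_univ]
        exact expE_mono (ownOcc_le hgθ hθ hφb x a)
    refine (lintegral_mono hle).trans ?_
    rw [lintegral_markLaw hV h0 h1 (f := fun (_ : S) (t : ℝ) (s : Bool) =>
      expE (ENNReal.ofReal (θ * b * t)) * (if s = true then ENNReal.ofReal (M ^ 2) else 1))]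
    swap
    · refine Measurable.mul ?_ (Measurable.ite ?_ measurable_const measurable_const)
      · exact measurable_expE.comp (by fun_prop)
      · exact (by fun_prop : Measurable fun p : Mark S => p.2.2) (measurableSet_singleton true)
    simp only [if_true, Bool.false_eq_true, if_false, mul_one]
    have h5 : ∀ᵐ t ∂(expMeasure V), ENNReal.ofReal q * (expE (ENNReal.ofReal (θ * b * t)) *
        ENNReal.ofReal (M ^ 2)) + ENNReal.ofReal (1 - q) * expE (ENNReal.ofReal (θ * b * t)) =
        ENNReal.ofReal (Real.exp (θ * b * t)) * ENNReal.ofReal (q * M ^ 2 + (1 - q)) := by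
      filter_upwards [ae_nonneg_expMeasure V] with t ht
      rw [expE_ofReal (by positivity), ENNReal.ofReal_add (by positivity) (by linarith),
        ENNReal.ofReal_mul h0]
      ring
    rw [lintegral_congr fun w => lintegral_congr_ae h5, lintegral_const, measure_univ, mul_one,
      lintegral_mul_const _ (by fun_prop), lintegral_exp_expMeasure hV hVa,
      ← ENNReal.ofReal_mul (by have := sub_pos.2 hVa; positivity)]
    exact ENNReal.ofReal_le_ofReal hM

/-- Exponential moments of the occupation functional of a family. -/
lemma lintegral_expE_famOcc_le (hη : IsMarkovFamily m η) (hφ : Measurable φ)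
    (hV : 0 < V) (h0 : 0 ≤ q) (h1 : q < 1 / 2) {θ b : ℝ} (hθ : 0 ≤ θ)
    (hb : 0 ≤ b) (hφb : ∀ x, φ x ≤ b) (hVa : θ * b < V) {M : ℝ} (hM1 : 1 ≤ M)
    (hM : V / (V - θ * b) * (q * M ^ 2 + (1 - q)) ≤ M) {g : ℝ → ℝ≥0∞} (hg : Measurable g)
    (hgθ : ∀ u, g u ≤ ENNReal.ofReal θ) (x : Space d) :
    ∫⁻ z, expE (famOcc η φ g ⊤ x z) ∂(famLaw m V q) ≤ ENNReal.ofReal M := by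
  have hmono : Monotone fun (n : ℕ) z => famOcc η φ g n x z := fun a b hab z =>
    famOcc_mono_gen (by exact_mod_cast hab) _ _ _
  have h2 : ∀ z, expE (famOcc η φ g ⊤ x z) = ⨆ n : ℕ, expE (famOcc η φ g n x z) := fun z => by
    rw [famOcc_top hη hφ hg, expE_iSup fun a b hab => hmono hab z]
  simp_rw [h2]
  rw [lintegral_iSup]
  · exact iSup_le fun n => lintegral_expE_famOcc_le_nat hη hφ hV h0 h1 hθ hb hφb hVa hM1 hM n hg hgθ x
  · exact fun n => (measurable_expE_famOcc hη hφ hg n).comp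
      (by fun_prop : Measurable fun z : Marks S => (x, z))
  · exact fun a b hab z => expE_mono (hmono hab z)

end Moments

/-! ### The branching decomposition of the Laplace transform in `[0,∞]`. -/

section Renewal

/-- The standing assumptions on the motion, the test function, and the branching mechanism. -/
structure Setting {d : ℕ} {S : Type*} [MeasurableSpace S] (m : Measure S)
    (η : Space d → ℝ≥0 → S → Space d) (φ : Space d → ℝ) (V q b : ℝ) : Prop where
  prob : IsProbabilityMeasure m
  markov : IsMarkovFamily m η
  measurable : Measurable φ
  nonneg : ∀ x, 0 ≤ φ x
  pos : 0 < b
  bound : ∀ x, φ x ≤ b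
  hV : 0 < V
  hq0 : 0 ≤ q
  hq : q < 1 / 2

variable {d : ℕ} {S : Type*} [MeasurableSpace S] {m : Measure S}
  {η : Space d → ℝ≥0 → S → Space d} {φ : Space d → ℝ} {V q b : ℝ}

lemma Setting.isProb_famLaw (h : Setting m η φ V q b) : IsProbabilityMeasure (famLaw m V q) := by
  have := h.prob
  have := isProbabilityMeasure_markLaw m h.hV h.hq0 h.hq
  unfold famLaw
  infer_instance

lemma Setting.abs_le (h : Setting m η φ V q b) (x : Space d) : |φ x| ≤ b := by
  rw [abs_of_nonneg (h.nonneg x)]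
  exact h.bound x

/-- The weight `1_{(-∞, t]}`. -/
def upTo (t : ℝ) : ℝ → ℝ≥0∞ := (Iic t).indicator 1

lemma measurable_upTo (t : ℝ) : Measurable (upTo t) := measurable_one.indicator measurableSet_Iic

lemma upTo_le_one (t u : ℝ) : upTo t u ≤ 1 := indicator_le_self' (by simp) u

lemma measurable_upTo_uncurry : Measurable (Function.uncurry upTo) := by
  have : Function.uncurry upTo = {p : ℝ × ℝ | p.2 ≤ p.1}.indicator 1 := by
    ext p
    rfl
  rw [this]
  exact measurable_one.indicator (measurableSet_le measurable_snd measurable_fst)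

/-- The total occupation of a family, in `[0,∞]`. -/
def totOcc (η : Space d → ℝ≥0 → S → Space d) (φ : Space d → ℝ) (x : Space d)
    (z : Marks S) : ℝ≥0∞ := famOcc η φ (fun _ => 1) ⊤ x z

/-- The total occupation of a family, as a real number. -/
def jTot (η : Space d → ℝ≥0 → S → Space d) (φ : Space d → ℝ) (x : Space d)
    (z : Marks S) : ℝ := (totOcc η φ x z).toReal

/-- The occupation of a family up to time `t`, as a real number. -/
def jOcc (η : Space d → ℝ≥0 → S → Space d) (φ : Space d → ℝ) (t : ℝ) (x : Space d)
    (z : Marks S) : ℝ := (famOcc η φ (upTo t) ⊤ x z).toReal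

lemma measurable_totOcc (h : Setting m η φ V q b) :
    Measurable fun p : Space d × (Marks S) => totOcc η φ p.1 p.2 :=
  measurable_famOcc h.markov h.measurable (g := fun _ _ => 1) measurable_const ⊤ measurable_fst
    measurable_snd

lemma measurable_jTot (h : Setting m η φ V q b) :
    Measurable fun p : Space d × (Marks S) => jTot η φ p.1 p.2 :=
  (measurable_totOcc h).ennreal_toReal

lemma measurable_jOcc (h : Setting m η φ V q b) {α : Type*} [MeasurableSpace α] {t : α → ℝ}
    {f : α → Space d} {z : α → Marks S} (ht : Measurable t) (hf : Measurable f)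
    (hz : Measurable z) : Measurable fun a => jOcc η φ (t a) (f a) (z a) := by
  refine (measurable_famOcc h.markov h.measurable (g := fun a => upTo (t a)) ?_ ⊤ hf hz).ennreal_toReal
  exact measurable_upTo_uncurry.comp (by fun_prop : Measurable fun p : α × ℝ => (t p.1, p.2))

lemma famOcc_const_mul (h : Setting m η φ V q b) (c : ℝ≥0∞) {g : ℝ → ℝ≥0∞} (hg : Measurable g)
    (n : ℕ∞) (x : Space d) (z : Marks S) :
    famOcc η φ (fun u => c * g u) n x z = c * famOcc η φ g n x z := by
  simp only [famOcc, mul_assoc]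
  exact lintegral_const_mul _ (hg.mul (measurable_dens_time h.markov h.measurable n x z))

/-- Besides a bound uniform in `x`, this records `2 V q (M - 1) < Q`, the smallness that later
allows the quadratic term of the stationary equation to be absorbed. -/
lemma lintegral_expE_totOcc_le (h : Setting m η φ V q b) {θ : ℝ} (hθ : 0 < θ)
    (hc : θ * b < criticalRate V q) :
    ∃ M : ℝ, 1 ≤ M ∧ 2 * (V * q) * (M - 1) < killRate V q ∧
      ∀ x, ∫⁻ z, expE (ENNReal.ofReal θ * totOcc η φ x z) ∂(famLaw m V q) ≤ ENNReal.ofReal M := by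
  have := h.prob
  obtain ⟨hV, M, h1, h2, h3⟩ := exists_moment_bound h.hV h.hq0 h.hq (mul_pos hθ h.pos) hc
  refine ⟨M, h1, h3, fun x => ?_⟩
  have := lintegral_expE_famOcc_le h.markov h.measurable h.hV h.hq0 h.hq hθ.le h.pos.le h.bound hV h1 h2
    (g := fun _ => ENNReal.ofReal θ * 1) measurable_const (fun _ => by simp) x
  have heq : ∀ z, famOcc η φ (fun _ => ENNReal.ofReal θ * 1) ⊤ x z =
      ENNReal.ofReal θ * totOcc η φ x z := fun z =>
    famOcc_const_mul h (ENNReal.ofReal θ) (g := fun _ => 1) measurable_const ⊤ x z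
  simp_rw [heq] at this
  exact this

lemma exists_subcritical (h : Setting m η φ V q b) : ∃ θ : ℝ, 0 < θ ∧ θ * b < criticalRate V q := by
  have := criticalRate_pos h.hV h.hq0 h.hq
  have hb := h.pos
  refine ⟨criticalRate V q / (2 * b), by positivity, ?_⟩
  have : criticalRate V q / (2 * b) * b = criticalRate V q / 2 := by field_simp
  linarith

lemma totOcc_lt_top (h : Setting m η φ V q b) (x : Space d) :
    ∀ᵐ z ∂(famLaw m V q), totOcc η φ x z < ∞ := by
  obtain ⟨θ, hθ, hc⟩ := exists_subcritical h
  obtain ⟨M, -, -, hM⟩ := lintegral_expE_totOcc_le h hθ hc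
  have hm : Measurable fun z => totOcc η φ x z :=
    (measurable_totOcc h).comp (by fun_prop : Measurable fun z : Marks S => (x, z))
  have := ae_lt_top (measurable_expE.comp (hm.const_mul (ENNReal.ofReal θ)))
    ((hM x).trans_lt ENNReal.ofReal_lt_top).ne
  filter_upwards [this] with z hz
  by_contra hcon
  rw [not_lt, top_le_iff] at hcon
  simp [hcon, ENNReal.mul_top, ENNReal.ofReal_eq_zero, not_le.2 hθ, expE_top] at hz

lemma famOcc_upTo_le (t : ℝ) (x : Space d) (z : Marks S) :
    famOcc η φ (upTo t) ⊤ x z ≤ totOcc η φ x z := famOcc_mono (upTo_le_one t) _ _ _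

lemma jOcc_nonneg (t : ℝ) (x : Space d) (z : Marks S) : 0 ≤ jOcc η φ t x z :=
  ENNReal.toReal_nonneg

lemma jTot_nonneg (x : Space d) (z : Marks S) : 0 ≤ jTot η φ x z :=
  ENNReal.toReal_nonneg

lemma jOcc_le_jTot {t : ℝ} {x : Space d} {z : Marks S} (hz : totOcc η φ x z < ∞) :
    jOcc η φ t x z ≤ jTot η φ x z := ENNReal.toReal_mono hz.ne (famOcc_upTo_le t x z)

/-- The Laplace transform of the occupation up to time `t`, in `[0,∞]`. -/
def laplaceE (m : Measure S) (η : Space d → ℝ≥0 → S → Space d) (φ : Space d → ℝ) (V q θ t : ℝ)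
    (x : Space d) : ℝ≥0∞ := ∫⁻ z, ENNReal.ofReal (Real.exp (θ * jOcc η φ t x z)) ∂(famLaw m V q)

lemma measurable_laplaceE (h : Setting m η φ V q b) (θ : ℝ) {α : Type*} [MeasurableSpace α]
    {t : α → ℝ} {f : α → Space d} (ht : Measurable t) (hf : Measurable f) :
    Measurable fun a => laplaceE m η φ V q θ (t a) (f a) := by
  have := h.isProb_famLaw
  refine Measurable.lintegral_prod_right' (f := fun r : α × (Marks S) =>
    ENNReal.ofReal (Real.exp (θ * jOcc η φ (t r.1) (f r.1) r.2))) ?_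
  have := measurable_jOcc h (α := α × (Marks S)) (t := fun r => t r.1)
    (f := fun r => f r.1) (z := fun r => r.2) (by fun_prop) (by fun_prop) (by fun_prop)
  fun_prop

lemma ofReal_exp_jTot {θ : ℝ} (hθ : 0 ≤ θ) {x : Space d} {z : Marks S}
    (hz : totOcc η φ x z < ∞) :
    ENNReal.ofReal (Real.exp (θ * jTot η φ x z)) = expE (ENNReal.ofReal θ * totOcc η φ x z) := by
  rw [← expE_ofReal (mul_nonneg hθ (jTot_nonneg _ _)), ENNReal.ofReal_mul hθ, jTot,
    ENNReal.ofReal_toReal hz.ne]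

lemma exists_laplaceE_le (h : Setting m η φ V q b) {θ : ℝ} (hc : θ * b < criticalRate V q) :
    ∃ M : ℝ, 1 ≤ M ∧ ∀ t x, laplaceE m η φ V q θ t x ≤ ENNReal.ofReal M := by
  obtain ⟨θ', hθ', hc', hle⟩ : ∃ θ' : ℝ, 0 < θ' ∧ θ' * b < criticalRate V q ∧ θ ≤ θ' := by
    rcases le_or_gt θ 0 with h0 | h0
    · obtain ⟨θ', h1, h2⟩ := exists_subcritical h
      exact ⟨θ', h1, h2, h0.trans h1.le⟩
    · exact ⟨θ, h0, hc, le_rfl⟩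
  obtain ⟨M, h1, -, hM⟩ := lintegral_expE_totOcc_le h hθ' hc'
  refine ⟨M, h1, fun t x => le_trans ?_ (hM x)⟩
  refine lintegral_mono_ae ?_
  filter_upwards [totOcc_lt_top h x] with z hz
  rw [← ofReal_exp_jTot hθ'.le hz]
  refine ENNReal.ofReal_le_ofReal (Real.exp_le_exp.2 ?_)
  calc θ * jOcc η φ t x z ≤ θ' * jOcc η φ t x z := mul_le_mul_of_nonneg_right hle (jOcc_nonneg _ _ _)
    _ ≤ θ' * jTot η φ x z := mul_le_mul_of_nonneg_left (jOcc_le_jTot hz) hθ'.le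

lemma upTo_shift (t s : ℝ) : (fun u => upTo t (u + s)) = upTo (t - s) := by
  funext u
  simp only [upTo, indicator, mem_Iic, le_sub_iff_add_le]
  rfl

lemma dens_neg (n : ℕ∞) (x : Space d) (z : Marks S) {u : ℝ} (hu : u < 0)
    (hz : ∀ w, 0 ≤ (z w).2.1) : dens η φ n x z u = 0 := by
  have key : ∀ (w : List Bool) (x : Space d) (z : Marks S) (u : ℝ), u < 0 →
      (∀ w, 0 ≤ (z w).2.1) → contrib η φ w x z u = 0 := by
    intro w
    induction w with
    | nil =>
      intro x z u hu _
      simp [contrib, not_le.2 hu]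
    | cons b w ih =>
      intro x z u hu hz
      simp only [contrib]
      split_ifs
      · exact ih _ _ _ (by linarith [hz []]) fun v => hz _
      · rfl
  rw [dens, ENNReal.tsum_eq_zero]
  intro w
  split_ifs
  exacts [key w x z u hu hz, rfl]

lemma ae_lifetime_nonneg (h : Setting m η φ V q b) :
    ∀ᵐ z ∂(famLaw m V q), ∀ w, 0 ≤ (z w).2.1 := by
  have := h.prob
  have := isProbabilityMeasure_markLaw m h.hV h.hq0 h.hq
  have := isProbabilityMeasure_splitLaw h.hq0 h.hq
  have := isProbabilityMeasure_expMeasure h.hV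
  rw [ae_all_iff]
  intro w
  have h1 : (famLaw m V q).map (fun z => z w) = markLaw m V q :=
    Measure.infinitePi_map_eval (fun _ => markLaw m V q) w
  have h2 : ∀ᵐ a ∂(markLaw m V q), 0 ≤ a.2.1 := by
    have hm : MeasurableSet {t : ℝ | 0 ≤ t} := measurableSet_Ici
    have h3 : ∀ᵐ r ∂((expMeasure V).prod (splitLaw q)), 0 ≤ r.1 :=
      (Measure.quasiMeasurePreserving_fst (μ := expMeasure V) (ν := splitLaw q)).ae
        (p := fun t : ℝ => 0 ≤ t) (ae_nonneg_expMeasure V)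
    exact (Measure.quasiMeasurePreserving_snd (μ := m)
      (ν := (expMeasure V).prod (splitLaw q))).ae (p := fun r : ℝ × Bool => 0 ≤ r.1) h3
  rw [← h1] at h2
  exact ae_of_ae_map (measurable_pi_apply w).aemeasurable h2

/-- The decomposition at the first death evaluates the transform at `t` minus a lifetime, which can
be negative. Nothing has accrued by then, because lifetimes are almost surely nonnegative. -/
lemma laplaceE_of_neg (h : Setting m η φ V q b) (θ : ℝ) {t : ℝ} (ht : t < 0) (x : Space d) :
    laplaceE m η φ V q θ t x = 1 := by
  have := h.isProb_famLaw
  have : ∀ᵐ z ∂(famLaw m V q), ENNReal.ofReal (Real.exp (θ * jOcc η φ t x z)) = 1 := by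
    filter_upwards [ae_lifetime_nonneg h] with z hz
    have : famOcc η φ (upTo t) ⊤ x z = 0 := by
      rw [famOcc, lintegral_eq_zero_iff']
      · refine ae_of_all _ fun u => ?_
        rcases lt_or_ge t u with hu | hu
        · simp [upTo, indicator, not_le.2 hu]
        · simp [dens_neg ⊤ x z (hu.trans_lt ht) hz]
      · exact ((measurable_upTo t).mul
          (measurable_dens_time h.markov h.measurable ⊤ x z)).aemeasurable
    simp [jOcc, this]
  rw [laplaceE, lintegral_congr_ae this]
  simp

/-- Given the mark of the first particle, the families of its children are independent copies, so
the exponential of the summed occupation factorises. Almost sure finiteness of the total occupation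
lets the sum be split in real numbers, so `θ` may have either sign. -/
lemma laplaceE_renewal (h : Setting m η φ V q b) (θ t : ℝ) (x : Space d) :
    laplaceE m η φ V q θ t x = ∫⁻ a, ENNReal.ofReal (Real.exp (θ * (ownOcc η φ (upTo t) x a).toReal)) *
      (if a.2.2 = true then laplaceE m η φ V q θ (t - a.2.1) (η x a.2.1.toNNReal a.1) ^ 2 else 1)
      ∂(markLaw m V q) := by
  have := h.prob
  have := h.isProb_famLaw
  have hη := h.markov
  have hmη := hη.measurable
  have hφ := h.measurable
  set E : ℝ → Space d → (Marks S) → ℝ≥0∞ := fun t x z =>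
    ENNReal.ofReal (Real.exp (θ * jOcc η φ t x z)) with hE
  have hEm : ∀ t x, Measurable (E t x) := fun t x => by
    have := measurable_jOcc h (α := Marks S) (t := fun _ => t) (f := fun _ => x)
      (z := fun z => z) (by fun_prop) (by fun_prop) (by fun_prop)
    simp only [hE]
    fun_prop
  have hae : ∀ᵐ z ∂(famLaw m V q), E t x z =
      (fun (a : Mark S) z₁ z₀ => ENNReal.ofReal (Real.exp (θ * (ownOcc η φ (upTo t) x a).toReal)) *
        (if a.2.2 = true then E (t - a.2.1) (η x a.2.1.toNNReal a.1) z₁ *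
          E (t - a.2.1) (η x a.2.1.toNNReal a.1) z₀ else 1))
        (z []) (fun v => z (true :: v)) (fun v => z (false :: v)) := by
    filter_upwards [totOcc_lt_top h x] with z hz
    have h1 := famOcc_succ hη hφ (measurable_upTo t) ⊤ x z
    rw [top_add, upTo_shift] at h1
    have h2 : famOcc η φ (upTo t) ⊤ x z ≠ ∞ := ((famOcc_upTo_le t x z).trans_lt hz).ne
    simp only [hE, jOcc]
    rw [h1] at h2 ⊢
    obtain ⟨h3, h4⟩ := ENNReal.add_ne_top.1 h2
    rw [ENNReal.toReal_add h3 h4, mul_add, Real.exp_add, ENNReal.ofReal_mul (Real.exp_pos _).le]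
    congr 1
    split_ifs with hs
    · rw [if_pos hs] at h4
      obtain ⟨h5, h6⟩ := ENNReal.add_ne_top.1 h4
      rw [ENNReal.toReal_add h5 h6, mul_add, Real.exp_add, ENNReal.ofReal_mul (Real.exp_pos _).le]
    · simp
  rw [laplaceE, lintegral_congr_ae hae]
  have hown : Measurable fun p : Mark S × (Marks S) × (Marks S) =>
      ownOcc η φ (upTo t) x p.1 :=
    measurable_ownOcc hη hφ (g := fun _ => upTo t) ((measurable_upTo t).comp measurable_snd)
      measurable_const measurable_fst
  have hm1 := measurable_jOcc h (α := Mark S × (Marks S) × (Marks S))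
    (t := fun p => t - p.1.2.1) (f := fun p => η x p.1.2.1.toNNReal p.1.1) (z := fun p => p.2.1)
    (by fun_prop) (by fun_prop) (by fun_prop)
  have hm0 := measurable_jOcc h (α := Mark S × (Marks S) × (Marks S))
    (t := fun p => t - p.1.2.1) (f := fun p => η x p.1.2.1.toNNReal p.1.1) (z := fun p => p.2.2)
    (by fun_prop) (by fun_prop) (by fun_prop)
  rw [lintegral_famLaw m h.hV h.hq0 h.hq (f := fun (a : Mark S) z₁ z₀ =>
    ENNReal.ofReal (Real.exp (θ * (ownOcc η φ (upTo t) x a).toReal)) *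
        (if a.2.2 = true then E (t - a.2.1) (η x a.2.1.toNNReal a.1) z₁ *
          E (t - a.2.1) (η x a.2.1.toNNReal a.1) z₀ else 1))]
  · refine lintegral_congr fun a => ?_
    split_ifs with hs
    · have h4 : ∀ z₁, ∫⁻ z₀, ENNReal.ofReal (Real.exp (θ * (ownOcc η φ (upTo t) x a).toReal)) *
          (E (t - a.2.1) (η x a.2.1.toNNReal a.1) z₁ * E (t - a.2.1) (η x a.2.1.toNNReal a.1) z₀)
            ∂(famLaw m V q) = ENNReal.ofReal (Real.exp (θ * (ownOcc η φ (upTo t) x a).toReal)) *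
          (E (t - a.2.1) (η x a.2.1.toNNReal a.1) z₁ *
            laplaceE m η φ V q θ (t - a.2.1) (η x a.2.1.toNNReal a.1)) := by
        intro z₁
        rw [lintegral_const_mul _ ((hEm _ _).const_mul _), lintegral_const_mul _ (hEm _ _)]
        rfl
      simp_rw [h4]
      rw [lintegral_const_mul _ ((hEm _ _).mul_const _), lintegral_mul_const _ (hEm _ _), pow_two]
      rfl
    · simp
  · refine Measurable.mul (by fun_prop) (Measurable.ite ?_ ?_ measurable_const)
    · exact (by fun_prop : Measurable fun p : Mark S × (Marks S) × (Marks S) =>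
          p.1.2.2) (measurableSet_singleton true)
    · simp only [hE]
      fun_prop

end Renewal

/-! ### The one-particle equation: existence, uniqueness and the limit. -/

section RealRenewal

variable {d : ℕ} {S : Type*} [MeasurableSpace S] {m : Measure S}
  {η : Space d → ℝ≥0 → S → Space d} {φ : Space d → ℝ} {V q b : ℝ}

lemma toReal_ownOcc (h : Setting m η φ V q b) (x : Space d) (a : Mark S) {t : ℝ} :
    (ownOcc η φ (upTo t) x a).toReal =
      ∫ v in Ico 0 a.2.1 ∩ Iic t, φ (η x v.toNNReal a.1) := by
  have hmη := h.markov.measurable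
  have hφ := h.measurable
  rw [integral_eq_lintegral_of_nonneg_ae (ae_of_all _ fun v => h.nonneg _)
    (by fun_prop : Measurable fun v : ℝ => φ (η x v.toNNReal a.1)).aestronglyMeasurable, ownOcc]
  congr 1
  rw [inter_comm, ← Measure.restrict_restrict measurableSet_Iic, ← lintegral_indicator measurableSet_Iic]
  refine lintegral_congr fun u => ?_
  simp only [upTo, indicator]
  split_ifs <;> simp

lemma toReal_ownOcc_of_le (h : Setting m η φ V q b) (x : Space d) (a : Mark S) {t : ℝ}
    (h0 : 0 ≤ a.2.1) (h1 : a.2.1 ≤ t) :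
    (ownOcc η φ (upTo t) x a).toReal = ∫ v in (0 : ℝ)..a.2.1, φ (η x v.toNNReal a.1) := by
  rw [toReal_ownOcc h, intervalIntegral.integral_of_le h0, inter_eq_left.2]
  · exact setIntegral_congr_set Ico_ae_eq_Ioc
  · exact fun v hv => hv.2.le.trans h1

lemma toReal_ownOcc_of_gt (h : Setting m η φ V q b) (x : Space d) (a : Mark S) {t : ℝ}
    (h0 : 0 ≤ t) (h1 : t < a.2.1) :
    (ownOcc η φ (upTo t) x a).toReal = ∫ v in (0 : ℝ)..t, φ (η x v.toNNReal a.1) := by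
  rw [toReal_ownOcc h, intervalIntegral.integral_of_le h0]
  have : Ico 0 a.2.1 ∩ Iic t = Icc 0 t := by
    ext v
    simp only [mem_inter_iff, mem_Ico, mem_Iic, mem_Icc]
    exact ⟨fun h => ⟨h.1.1, h.2⟩, fun h => ⟨⟨h.1, h.2.trans_lt h1⟩, h.2⟩⟩
  rw [this]
  exact setIntegral_congr_set Ioc_ae_eq_Icc.symm

/-- The Laplace transform of the occupation up to time `t`. -/
def laplace (m : Measure S) (η : Space d → ℝ≥0 → S → Space d) (φ : Space d → ℝ) (V q θ : ℝ)
    (x : Space d) (t : ℝ≥0) : ℝ := (laplaceE m η φ V q θ t x).toReal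

lemma laplace_nonneg {θ : ℝ} (x : Space d) (t : ℝ≥0) : 0 ≤ laplace m η φ V q θ x t :=
  ENNReal.toReal_nonneg

lemma measurable_laplace (h : Setting m η φ V q b) (θ : ℝ) {α : Type*} [MeasurableSpace α]
    {t : α → ℝ≥0} {f : α → Space d} (ht : Measurable t) (hf : Measurable f) :
    Measurable fun a => laplace m η φ V q θ (f a) (t a) := by
  have h1 : Measurable fun a => (t a : ℝ) := by fun_prop
  exact (measurable_laplaceE h θ h1 hf).ennreal_toReal

lemma exists_laplace_le (h : Setting m η φ V q b) {θ : ℝ} (hc : θ * b < criticalRate V q) :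
    ∃ M : ℝ, 1 ≤ M ∧ ∀ x t, |laplace m η φ V q θ x t| ≤ M := by
  obtain ⟨M, h1, hM⟩ := exists_laplaceE_le h hc
  refine ⟨M, h1, fun x t => ?_⟩
  rw [laplace, abs_of_nonneg ENNReal.toReal_nonneg]
  exact ENNReal.toReal_le_of_le_ofReal (by linarith) (hM t x)

lemma laplaceE_eq_ofReal (h : Setting m η φ V q b) {θ : ℝ} (hc : θ * b < criticalRate V q)
    {t : ℝ} (ht : 0 ≤ t) (x : Space d) :
    laplaceE m η φ V q θ t x = ENNReal.ofReal (laplace m η φ V q θ x t.toNNReal) := by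
  obtain ⟨M, h1, hM⟩ := exists_laplaceE_le h hc
  rw [laplace, ENNReal.ofReal_toReal, Real.coe_toNNReal t ht]
  exact ((hM _ x).trans_lt ENNReal.ofReal_lt_top).ne

lemma lintegral_exp_tail {V : ℝ} (hV : 0 < V) (t : ℝ) :
    ∫⁻ r in Ioi t, ENNReal.ofReal (V * Real.exp (-(V * r))) = ENNReal.ofReal (Real.exp (-(V * t))) := by
  have hi : IntegrableOn (fun r => V * Real.exp (-(V * r))) (Ioi t) := by
    have := (integrableOn_exp_mul_Ioi (a := -V) (by linarith) t).const_mul V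
    simp only [neg_mul] at this
    exact this
  rw [← ofReal_integral_eq_lintegral_ofReal hi (ae_of_all _ fun r => by positivity)]
  congr 1
  have := integral_exp_mul_Ioi (a := -V) (by linarith) t
  rw [integral_const_mul]
  simp only [neg_mul] at this
  rw [this]
  field_simp

lemma measurable_ownOcc_upTo (h : Setting m η φ V q b) (t : ℝ) (x : Space d) {α : Type*}
    [MeasurableSpace α] {a : α → Mark S} (ha : Measurable a) :
    Measurable fun p => ownOcc η φ (upTo t) x (a p) := by
  have := h.prob
  exact measurable_ownOcc h.markov h.measurable (g := fun _ => upTo t)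
    ((measurable_upTo t).comp measurable_snd) measurable_const ha

/-- The decomposition of the Laplace transform at the death of the first particle. -/
lemma laplace_renewal (h : Setting m η φ V q b) {θ : ℝ} (hc : θ * b < criticalRate V q)
    (t : ℝ≥0) (x : Space d) :
    laplace m η φ V q θ x t = ∫ w, (Real.exp (-(V * t)) *
        Real.exp (∫ v in (0 : ℝ)..t, θ * φ (η x v.toNNReal w)) +
      ∫ r in (0 : ℝ)..t, V * Real.exp (-(V * r)) * (Real.exp (∫ v in (0 : ℝ)..r, θ * φ (η x v.toNNReal w)) *
        (q * laplace m η φ V q θ (η x r.toNNReal w) (t - r.toNNReal) ^ 2 + (1 - q)))) ∂m := by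
  have := h.prob
  have hη := h.markov
  have hmη := hη.measurable
  have hφ := h.measurable
  have hq0 := h.hq0
  have hq1 : 0 ≤ 1 - q := by linarith [h.hq]
  have hV := h.hV
  obtain ⟨M, hM1, hM⟩ := exists_laplace_le h hc
  have hLEm' : Measurable fun a : Mark S =>
      laplaceE m η φ V q θ (t - a.2.1) (η x a.2.1.toNNReal a.1) :=
    measurable_laplaceE h θ (by fun_prop) (by fun_prop)
  have hex : Measurable fun p : ℝ × S => Real.exp (∫ v in (0 : ℝ)..p.1, θ * φ (η x v.toNNReal p.2)) :=
    measurable_exp_integral hη (c := fun y => θ * φ y) (by fun_prop) (α := ℝ × S)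
      (a := fun _ => 0) (b := fun p => p.1) (f := fun _ => x) (W := fun p => p.2) (by fun_prop)
      (by fun_prop) (by fun_prop) (by fun_prop)
  have bc : ∀ y, |θ * φ y| ≤ |θ| * b := fun y => by
    rw [abs_mul]
    exact mul_le_mul_of_nonneg_left (h.abs_le y) (abs_nonneg _)
  set R : S → ℝ → ℝ := fun w r => V * Real.exp (-(V * r)) *
      (Real.exp (∫ v in (0 : ℝ)..r, θ * φ (η x v.toNNReal w)) *
        (q * laplace m η φ V q θ (η x r.toNNReal w) (t - r.toNNReal) ^ 2 + (1 - q))) with hR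
  have hRm : Measurable (Function.uncurry R) := by
    have h2 : Measurable fun p : S × ℝ => laplace m η φ V q θ (η x p.2.toNNReal p.1) (t - p.2.toNNReal) :=
      measurable_laplace h θ (by fun_prop) (by fun_prop)
    have h3 : Measurable fun p : S × ℝ =>
        Real.exp (∫ v in (0 : ℝ)..p.2, θ * φ (η x v.toNNReal p.1)) :=
      hex.comp (by fun_prop : Measurable fun p : S × ℝ => (p.2, p.1))
    simp only [Function.uncurry_def, hR]
    fun_prop
  have hR0 : ∀ w r, 0 ≤ R w r := fun w r => by simp only [hR]; positivity
  have hRb : ∀ (w : S) (r : ℝ), 0 ≤ r → r ≤ t → |R w r| ≤ V * (Real.exp (|θ| * b * t) * (q * M ^ 2 + (1 - q))) := by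
    intro w r h0 h1
    refine abs_mul_le_mul ?_ (abs_mul_le_mul (abs_exp_integral_le bc x w h0 (by simpa using h1)) ?_)
    · rw [abs_of_nonneg (by positivity)]
      have : Real.exp (-(V * r)) ≤ 1 := Real.exp_le_one_iff.2 (by have := mul_nonneg hV.le h0; linarith)
      nlinarith
    · rw [abs_of_nonneg (by positivity)]
      have : laplace m η φ V q θ (η x r.toNNReal w) (t - r.toNNReal) ^ 2 ≤ M ^ 2 :=
        sq_le_sq' (neg_le_of_abs_le (hM _ _)) (le_of_abs_le (hM _ _))
      nlinarith
  have hRi : ∀ w, IntegrableOn (R w) (Ioc 0 t) := by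
    intro w
    refine Measure.integrableOn_of_bounded (M := V * (Real.exp (|θ| * b * t) * (q * M ^ 2 + (1 - q)))) ?_ ?_ ?_
    · simp
    · exact (hRm.comp (by fun_prop : Measurable fun r : ℝ => (w, r))).aestronglyMeasurable
    · rw [ae_restrict_iff' measurableSet_Ioc]
      exact ae_of_all _ fun r hr => hRb w r hr.1.le hr.2
  set I : S → ℝ := fun w => Real.exp (-(V * t)) * Real.exp (∫ v in (0 : ℝ)..t, θ * φ (η x v.toNNReal w)) +
      ∫ r in (0 : ℝ)..t, R w r with hI
  have hI0 : ∀ w, 0 ≤ I w := fun w =>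
    add_nonneg (by positivity) (intervalIntegral.integral_nonneg t.coe_nonneg fun r _ => hR0 w r)
  have hIm : Measurable I := by
    refine Measurable.add ?_ ?_
    · exact measurable_const.mul (hex.comp (by fun_prop : Measurable fun w : S => ((t : ℝ), w)))
    · exact measurable_intervalIntegral_param hRm measurable_const measurable_const
  have key : laplaceE m η φ V q θ t x = ∫⁻ w, ENNReal.ofReal (I w) ∂m := by
    rw [laplaceE_renewal h, lintegral_markLaw hV hq0 h.hq (f := fun w τ s =>
      ENNReal.ofReal (Real.exp (θ * (ownOcc η φ (upTo t) x (w, τ, s)).toReal)) *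
      (if s = true then laplaceE m η φ V q θ (t - τ) (η x τ.toNNReal w) ^ 2 else 1))]
    swap
    · refine Measurable.mul ?_ (Measurable.ite ?_ (hLEm'.pow_const 2) measurable_const)
      · have : Measurable fun a : Mark S => ownOcc η φ (upTo t) x (a.1, a.2.1, a.2.2) :=
          measurable_ownOcc_upTo h t x (by fun_prop)
        fun_prop
      · exact (by fun_prop : Measurable fun p : Mark S => p.2.2) (measurableSet_singleton true)
    refine lintegral_congr fun w => ?_
    simp only [if_true, Bool.false_eq_true, if_false, mul_one]
    have m1 : ∀ s : Bool, Measurable fun τ : ℝ => ownOcc η φ (upTo t) x (w, τ, s) := fun s =>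
      measurable_ownOcc_upTo h t x (by fun_prop)
    have m2 : Measurable fun τ : ℝ => laplaceE m η φ V q θ (t - τ) (η x τ.toNNReal w) :=
      measurable_laplaceE h θ (by fun_prop) (by fun_prop)
    have m1t := m1 true
    have m1f := m1 false
    -- The lifetime is split at `t`. If death occurs by time `t`, the branching factor `q L² + (1 -
    -- q)` appears. Otherwise the family consists of one particle up to `t`, both splitting outcomes
    -- give the same value, and the tail of the lifetime contributes `exp (-V t)`.
    rw [lintegral_expMeasure V (by fun_prop), ← Icc_union_Ioi_eq_Ici t.coe_nonneg,
      lintegral_union measurableSet_Ioi (by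
        rw [Set.disjoint_left]
        exact fun r h1 h2 => not_lt.2 h1.2 h2)]
    have e1 : ∫⁻ τ in Icc (0 : ℝ) t, ENNReal.ofReal (V * Real.exp (-(V * τ))) *
        (ENNReal.ofReal q * (ENNReal.ofReal (Real.exp (θ * (ownOcc η φ (upTo t) x (w, τ, true)).toReal)) *
            laplaceE m η φ V q θ (t - τ) (η x τ.toNNReal w) ^ 2) +
          ENNReal.ofReal (1 - q) *
            ENNReal.ofReal (Real.exp (θ * (ownOcc η φ (upTo t) x (w, τ, false)).toReal))) =
        ENNReal.ofReal (∫ r in (0 : ℝ)..t, R w r) := by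
      rw [intervalIntegral.integral_of_le t.coe_nonneg,
        ofReal_integral_eq_lintegral_ofReal (hRi w) (ae_of_all _ fun r => hR0 w r),
        setLIntegral_congr Ioc_ae_eq_Icc]
      refine setLIntegral_congr_fun measurableSet_Icc fun r hr => ?_
      simp only [hR]
      rw [toReal_ownOcc_of_le h x (w, r, true) hr.1 hr.2, toReal_ownOcc_of_le h x (w, r, false) hr.1 hr.2,
        laplaceE_eq_ofReal h hc (sub_nonneg.2 hr.2), intervalIntegral.integral_const_mul,
        ← ENNReal.ofReal_pow (laplace_nonneg _ _)]
      have : ((t : ℝ) - r).toNNReal = t - r.toNNReal := by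
        rw [NNReal.sub_def, Real.coe_toNNReal r hr.1]
      rw [this, ← ENNReal.ofReal_mul (by positivity), ← ENNReal.ofReal_mul hq0,
        ← ENNReal.ofReal_mul hq1, ← ENNReal.ofReal_add (by positivity) (by positivity),
        ← ENNReal.ofReal_mul (by positivity)]
      congr 1
      ring
    have e2 : ∫⁻ τ in Ioi (t : ℝ), ENNReal.ofReal (V * Real.exp (-(V * τ))) *
        (ENNReal.ofReal q * (ENNReal.ofReal (Real.exp (θ * (ownOcc η φ (upTo t) x (w, τ, true)).toReal)) *
            laplaceE m η φ V q θ (t - τ) (η x τ.toNNReal w) ^ 2) +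
          ENNReal.ofReal (1 - q) *
            ENNReal.ofReal (Real.exp (θ * (ownOcc η φ (upTo t) x (w, τ, false)).toReal))) =
        ENNReal.ofReal (Real.exp (-(V * t)) *
          Real.exp (∫ v in (0 : ℝ)..t, θ * φ (η x v.toNNReal w))) := by
      rw [ENNReal.ofReal_mul (by positivity), ← lintegral_exp_tail hV, ← lintegral_mul_const _ (by fun_prop)]
      refine setLIntegral_congr_fun measurableSet_Ioi fun r hr => ?_
      rw [toReal_ownOcc_of_gt h x (w, r, true) t.coe_nonneg hr,
        toReal_ownOcc_of_gt h x (w, r, false) t.coe_nonneg hr,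
        laplaceE_of_neg h θ (sub_neg.2 hr), intervalIntegral.integral_const_mul, one_pow, mul_one,
        ← add_mul, ← ENNReal.ofReal_add hq0 hq1]
      simp
    rw [e1, e2, ← ENNReal.ofReal_add (intervalIntegral.integral_nonneg t.coe_nonneg fun r _ => hR0 w r)
      (by positivity), add_comm]
  rw [laplace, key, integral_eq_lintegral_of_nonneg_ae (ae_of_all _ hI0) hIm.aestronglyMeasurable]

/-- The Laplace transform solves the mild equation. -/
lemma laplace_mild (h : Setting m η φ V q b) {θ : ℝ} (hc : θ * b < criticalRate V q)
    (t : ℝ≥0) (x : Space d) :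
    laplace m η φ V q θ x t = Real.exp (-killRate V q * t) + ∫ u in (0 : ℝ)..t,
      Real.exp (-killRate V q * u) * semigroup m η u.toNNReal (fun y =>
        (θ * φ y - 2 * V * q) * laplace m η φ V q θ y (t - u.toNNReal) +
          (V * (1 - q) + V * q * laplace m η φ V q θ y (t - u.toNNReal) ^ 2)) x := by
  have := h.prob
  have hη := h.markov
  have hmη := hη.measurable
  have hφ := h.measurable
  have hV := h.hV
  obtain ⟨M, hM1, hM⟩ := exists_laplace_le h hc
  have bc : ∀ y, |θ * φ y - 2 * V * q| ≤ |θ| * b + |2 * V * q| := fun y => by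
    refine (abs_sub _ _).trans (add_le_add ?_ le_rfl)
    rw [abs_mul]
    exact mul_le_mul_of_nonneg_left (h.abs_le y) (abs_nonneg _)
  have bF : ∀ y s, |V * (1 - q) + V * q * laplace m η φ V q θ y s ^ 2| ≤
      |V * (1 - q)| + |V * q| * M ^ 2 := fun y s => by
    refine (abs_add_le _ _).trans (add_le_add le_rfl ?_)
    refine abs_mul_le_mul le_rfl ?_
    rw [abs_pow]
    exact pow_le_pow_left₀ (abs_nonneg _) (hM _ _) 2
  -- The killing rate is split as `V = Q + 2 V q`, and the part `2 V q` is put into the potential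
  -- `θφ - 2 V q`. The mild equation then involves exactly the semigroup `T^Q`.
  refine mild_of_renewal hη (c := fun y => θ * φ y - 2 * V * q) (by fun_prop) bc (killRate V q)
    (M := laplace m η φ V q θ)
    (F := fun y s => V * (1 - q) + V * q * laplace m η φ V q θ y s ^ 2) (by
      have := measurable_laplace h θ (α := Space d × ℝ≥0) measurable_snd measurable_fst
      simp only [Function.uncurry_def]
      fun_prop) t (fun y s _ => bF y s) ?_ x
  intro x s _
  set A : ℝ → S → ℝ := fun r w => ∫ v in (0 : ℝ)..r, θ * φ (η x v.toNNReal w) with hA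
  have hAc : ∀ w (r : ℝ), 0 ≤ r → ∫ v in (0 : ℝ)..r, (θ * φ (η x v.toNNReal w) - 2 * V * q) =
      A r w - 2 * V * q * r := by
    intro w r hr
    rw [intervalIntegral.integral_sub, intervalIntegral.integral_const]
    · simp [hA]
      ring
    · refine intervalIntegrable_of_bounded (K := |θ| * b) (by fun_prop) (fun u => ?_) _ _
      rw [abs_mul]
      exact mul_le_mul_of_nonneg_left (h.abs_le _) (abs_nonneg _)
    · exact intervalIntegrable_const
  have hex : Measurable fun p : ℝ × S => Real.exp (∫ v in (0 : ℝ)..p.1, (θ * φ (η x v.toNNReal p.2) - 2 * V * q)) :=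
    measurable_exp_integral hη (c := fun y => θ * φ y - 2 * V * q) (by fun_prop) (α := ℝ × S)
      (a := fun _ => 0) (b := fun p => p.1) (f := fun _ => x) (W := fun p => p.2) (by fun_prop)
      (by fun_prop) (by fun_prop) (by fun_prop)
  have hexp : ∀ w (r : ℝ), 0 ≤ r → Real.exp (-(V * r)) * Real.exp (A r w) = Real.exp (-killRate V q * r) *
      Real.exp (∫ v in (0 : ℝ)..r, (θ * φ (η x v.toNNReal w) - 2 * V * q)) := by
    intro w r hr
    rw [hAc w r hr, ← Real.exp_add, ← Real.exp_add, killRate]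
    congr 1
    ring
  set R : ℝ → S → ℝ := fun r w => (Icc (0 : ℝ) s).indicator (fun r => Real.exp (-killRate V q * r) *
    (Real.exp (∫ v in (0 : ℝ)..r, (θ * φ (η x v.toNNReal w) - 2 * V * q)) *
      (V * (1 - q) + V * q * laplace m η φ V q θ (η x r.toNNReal w) (s - r.toNNReal) ^ 2))) r with hR
  have hRm : Measurable (Function.uncurry R) := by
    have h2 : Measurable fun p : ℝ × S => laplace m η φ V q θ (η x p.1.toNNReal p.2) (s - p.1.toNNReal) :=
      measurable_laplace h θ (by fun_prop) (by fun_prop)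
    have h3 : Function.uncurry R = (Prod.fst ⁻¹' Icc (0 : ℝ) s).indicator fun p : ℝ × S =>
        Real.exp (-killRate V q * p.1) *
    (Real.exp (∫ v in (0 : ℝ)..p.1, (θ * φ (η x v.toNNReal p.2) - 2 * V * q)) *
      (V * (1 - q) + V * q * laplace m η φ V q θ (η x p.1.toNNReal p.2) (s - p.1.toNNReal) ^ 2)) := by
      ext ⟨r, w⟩
      rfl
    rw [h3]
    exact Measurable.indicator (by fun_prop) (measurable_fst measurableSet_Icc)
  have hRb : ∀ r w, |R r w| ≤ Real.exp (|killRate V q| * s) * (Real.exp ((|θ| * b + |2 * V * q|) * s) *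
      (|V * (1 - q)| + |V * q| * M ^ 2)) := by
    intro r w
    simp only [hR, indicator]
    split_ifs with hr
    · refine abs_mul_le_mul ?_ (abs_mul_le_mul (abs_exp_integral_le bc x w hr.1 (by simpa using hr.2)) (bF _ _))
      rw [Real.abs_exp]
      refine Real.exp_le_exp.2 ?_
      exact (mul_le_mul_of_nonneg_right (neg_le_abs _) hr.1).trans
        (mul_le_mul_of_nonneg_left hr.2 (abs_nonneg _))
    · rw [abs_zero]
      positivity
  rw [laplace_renewal h hc]
  have e1 : ∀ w, ∫ r in (0 : ℝ)..s, V * Real.exp (-(V * r)) *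
      (Real.exp (∫ v in (0 : ℝ)..r, θ * φ (η x v.toNNReal w)) *
        (q * laplace m η φ V q θ (η x r.toNNReal w) (s - r.toNNReal) ^ 2 + (1 - q))) =
      ∫ r in (0 : ℝ)..s, R r w := by
    intro w
    refine intervalIntegral.integral_congr fun r hr => ?_
    rw [uIcc_of_le s.coe_nonneg] at hr
    simp only [hR, indicator_of_mem hr]
    have := hexp w r hr.1
    simp only [hA] at this
    rw [← mul_assoc (Real.exp (-killRate V q * r)), ← this]
    ring
  simp_rw [e1]
  have e2 : ∀ w, Real.exp (-(V * s)) * Real.exp (∫ v in (0 : ℝ)..s, θ * φ (η x v.toNNReal w)) =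
      Real.exp (-killRate V q * s) *
      Real.exp (∫ v in (0 : ℝ)..s, (θ * φ (η x v.toNNReal w) - 2 * V * q)) := fun w =>
    hexp w s s.coe_nonneg
  simp_rw [e2]
  rw [integral_add, integral_intervalIntegral_swap_of_bounded hRm hRb, integral_const_mul]
  · congr 1
    · simp [feynmanKac]
    · refine intervalIntegral.integral_congr fun r hr => ?_
      rw [uIcc_of_le s.coe_nonneg] at hr
      simp only [hR, indicator_of_mem hr]
      rw [integral_const_mul, feynmanKac, Real.coe_toNNReal r hr.1]
  · refine Integrable.const_mul (integrable_of_bounded' (K := Real.exp ((|θ| * b + |2 * V * q|) * s)) ?_ fun w => ?_) _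
    · exact hex.comp (by fun_prop : Measurable fun w : S => ((s : ℝ), w))
    · exact abs_exp_integral_le bc x w s.coe_nonneg (by simp)
  · refine integrable_of_bounded' (K := Real.exp (|killRate V q| * s) * (Real.exp ((|θ| * b + |2 * V * q|) * s) *
      (|V * (1 - q)| + |V * q| * M ^ 2)) * (s - 0)) ?_ fun w => ?_
    · refine measurable_intervalIntegral_param (f := fun w r => R r w) ?_ measurable_const measurable_const
      exact hRm.comp (by fun_prop : Measurable fun p : S × ℝ => (p.2, p.1))
    · exact abs_intervalIntegral_le (fun u => hRb u w) s.coe_nonneg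

lemma Setting.killRate_pos (h : Setting m η φ V q b) : 0 < killRate V q :=
  mul_pos h.hV (by linarith [h.hq])

lemma semigroup_add (h : Setting m η φ V q b) {f g : Space d → ℝ} (hf : Measurable f)
    (hg : Measurable g) {Kf Kg : ℝ} (bf : ∀ y, |f y| ≤ Kf) (bg : ∀ y, |g y| ≤ Kg) (t : ℝ≥0) (x : Space d) :
    semigroup m η t (fun y => f y + g y) x = semigroup m η t f x + semigroup m η t g x := by
  have := h.prob
  have hmη := h.markov.measurable
  exact integral_add (integrable_of_bounded' (by fun_prop) fun w => bf _)
    (integrable_of_bounded' (by fun_prop) fun w => bg _)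

lemma semigroup_sub (h : Setting m η φ V q b) {f g : Space d → ℝ} (hf : Measurable f)
    (hg : Measurable g) {Kf Kg : ℝ} (bf : ∀ y, |f y| ≤ Kf) (bg : ∀ y, |g y| ≤ Kg) (t : ℝ≥0) (x : Space d) :
    semigroup m η t (fun y => f y - g y) x = semigroup m η t f x - semigroup m η t g x := by
  have := h.prob
  have hmη := h.markov.measurable
  exact integral_sub (integrable_of_bounded' (by fun_prop) fun w => bf _)
    (integrable_of_bounded' (by fun_prop) fun w => bg _)

lemma measurable_killedSemigroup (h : Setting m η φ V q b) {g : ℝ → Space d → ℝ}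
    (hg : Measurable (Function.uncurry g)) (t : ℝ≥0) (x : Space d) :
    Measurable fun s : ℝ => killedSemigroup m η V q (t - s.toNNReal) (g s) x := by
  have := h.prob
  have h1 := measurable_semigroup h.markov (α := ℝ) (f := fun _ => x) (t := fun s => t - s.toNNReal)
    (g := g) (by fun_prop) (by fun_prop) hg
  simp only [killedSemigroup]
  fun_prop

lemma abs_killedSemigroup_le (h : Setting m η φ V q b) {g : Space d → ℝ} {K : ℝ}
    (bg : ∀ y, |g y| ≤ K) (t : ℝ≥0) (x : Space d) : |killedSemigroup m η V q t g x| ≤ K := by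
  have := h.prob
  rw [killedSemigroup, ← one_mul K]
  refine abs_mul_le_mul ?_ (abs_semigroup_le bg t x)
  rw [Real.abs_exp]
  refine Real.exp_le_one_iff.2 ?_
  have := mul_nonneg h.killRate_pos.le t.coe_nonneg
  linarith

lemma reaction_le (h : Setting m η φ V q b) {θ K v : ℝ} (y : Space d) (hv : |v| ≤ K) :
    |θ * φ y * v + V * q * v ^ 2| ≤ |θ| * b * K + V * q * K ^ 2 := by
  have hV := h.hV
  have hq := h.hq0
  refine (abs_add_le _ _).trans (add_le_add (abs_mul_le_mul (abs_mul_le_mul le_rfl (h.abs_le y)) hv)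
    (abs_mul_le_mul (by rw [abs_of_nonneg (by positivity)]) ?_))
  rw [abs_pow]
  exact pow_le_pow_left₀ (abs_nonneg _) hv 2

lemma abs_const_mul_le (h : Setting m η φ V q b) (θ : ℝ) (y : Space d) : |θ * φ y| ≤ |θ| * b :=
  abs_mul_le_mul le_rfl (h.abs_le y)

/-- The one-particle equation, with both integrals collected. -/
lemma equation_iff (h : Setting m η φ V q b) {θ : ℝ} {v : Space d → ℝ≥0 → ℝ}
    (hv : Measurable (Function.uncurry v)) (t : ℝ≥0) {K : ℝ} (hK : ∀ s ≤ t, ∀ x, |v x s| ≤ K)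
    (x : Space d) :
    (∫ s in (0 : ℝ)..t, killedSemigroup m η V q (t - s.toNNReal) (fun y => θ * φ y) x) +
      (∫ s in (0 : ℝ)..t, killedSemigroup m η V q (t - s.toNNReal)
        (fun y => θ * φ y * v y s.toNNReal + V * q * v y s.toNNReal ^ 2) x) =
    ∫ u in (0 : ℝ)..t, Real.exp (-killRate V q * u) * semigroup m η u.toNNReal
      (fun y => θ * φ y + (θ * φ y * v y (t - u.toNNReal) + V * q * v y (t - u.toNNReal) ^ 2)) x := by
  have := h.prob
  have hφ := h.measurable
  have hK0 : 0 ≤ K := (abs_nonneg _).trans (hK 0 zero_le x)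
  have hvm : ∀ {α : Type} [MeasurableSpace α] {f : α → Space d} {s : α → ℝ≥0}, Measurable f →
      Measurable s → Measurable fun a => v (f a) (s a) := fun hf hs => hv.comp (hf.prodMk hs)
  have hrefl : ∀ g : ℝ → Space d → ℝ, (∫ s in (0 : ℝ)..t, killedSemigroup m η V q (t - s.toNNReal)
      (g s) x) = ∫ u in (0 : ℝ)..t, Real.exp (-killRate V q * u) *
        semigroup m η u.toNNReal (g (t - u)) x := by
    intro g
    have := intervalIntegral.integral_comp_sub_left (a := 0) (b := t)
      (fun s => killedSemigroup m η V q (t - s.toNNReal) (g s) x) (t : ℝ)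
    rw [sub_self, sub_zero] at this
    rw [← this]
    refine intervalIntegral.integral_congr fun u hu => ?_
    rw [uIcc_of_le t.coe_nonneg] at hu
    have h1 : t - ((t : ℝ) - u).toNNReal = u.toNNReal := by
      rw [NNReal.sub_def, Real.coe_toNNReal _ (sub_nonneg.2 hu.2)]
      simp
    simp only [killedSemigroup, h1, Real.coe_toNNReal _ hu.1]
  have hmin : ∀ s : ℝ, min s.toNNReal t ≤ t := fun s => min_le_right _ _
  have hm2 : Measurable (Function.uncurry fun (s : ℝ) (y : Space d) =>
      θ * φ y * v y (min s.toNNReal t) + V * q * v y (min s.toNNReal t) ^ 2) := by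
    have := hvm (α := ℝ × Space d) (f := fun p => p.2) (s := fun p => min p.1.toNNReal t)
      (by fun_prop) (by fun_prop)
    simp only [Function.uncurry_def]
    fun_prop
  have hcongr : (∫ s in (0 : ℝ)..t, killedSemigroup m η V q (t - s.toNNReal)
        (fun y => θ * φ y * v y s.toNNReal + V * q * v y s.toNNReal ^ 2) x) =
      ∫ s in (0 : ℝ)..t, killedSemigroup m η V q (t - s.toNNReal)
        (fun y => θ * φ y * v y (min s.toNNReal t) + V * q * v y (min s.toNNReal t) ^ 2) x := by
    refine intervalIntegral.integral_congr fun s hs => ?_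
    rw [uIcc_of_le t.coe_nonneg] at hs
    have h1 : s.toNNReal ≤ t := Real.toNNReal_le_iff_le_coe.2 hs.2
    simp only [min_eq_left h1]
  rw [hcongr, ← intervalIntegral.integral_add, ← intervalIntegral.integral_congr
    (g := fun u => Real.exp (-killRate V q * u) * semigroup m η u.toNNReal
      (fun y => θ * φ y + (θ * φ y * v y (t - u.toNNReal) + V * q * v y (t - u.toNNReal) ^ 2)) x)
    (f := fun u => Real.exp (-killRate V q * u) * semigroup m η u.toNNReal
      ((fun s y => θ * φ y + (θ * φ y * v y (min s.toNNReal t) + V * q * v y (min s.toNNReal t) ^ 2))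
        (t - u)) x), ← hrefl fun s y => θ * φ y +
      (θ * φ y * v y (min s.toNNReal t) + V * q * v y (min s.toNNReal t) ^ 2)]
  · refine intervalIntegral.integral_congr fun s _ => ?_
    simp only [killedSemigroup]
    rw [← mul_add, ← semigroup_add h (f := fun y => θ * φ y) (g := fun y => θ * φ y *
      v y (min s.toNNReal t) + V * q * v y (min s.toNNReal t) ^ 2) (by fun_prop)
      (hm2.comp (by fun_prop : Measurable fun y : Space d => (s, y)))
      (abs_const_mul_le h θ) (fun y => reaction_le h y (hK _ (hmin s) y))]
  · intro u hu
    rw [uIcc_of_le t.coe_nonneg] at hu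
    have h1 : ((t : ℝ) - u).toNNReal = t - u.toNNReal := by
      rw [NNReal.sub_def, Real.coe_toNNReal u hu.1]
    simp only [h1, min_eq_left (tsub_le_self : t - u.toNNReal ≤ t)]
  · exact intervalIntegrable_of_bounded (measurable_killedSemigroup h (by
      simp only [Function.uncurry_def]; fun_prop) t x)
      (fun u => abs_killedSemigroup_le h (abs_const_mul_le h θ) _ _) _ _
  · exact intervalIntegrable_of_bounded (measurable_killedSemigroup h hm2 t x)
      (fun u => abs_killedSemigroup_le h (fun y => reaction_le h y (hK _ (hmin u) y)) _ _) _ _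

/-- With `L = 1 + v` the square completes: `(θφ - 2Vq) L + V(1 - q) + V q L²` equals `θφ + θφ v + V
q v² + Q`. The constant `Q` integrates against `exp (-Q u)` to `1 - exp (-Q t)`, which accounts for
the initial value `L = 1`. -/
lemma isOneParticleSolution_laplace (h : Setting m η φ V q b) {θ : ℝ}
    (hc : θ * b < criticalRate V q) :
    IsOneParticleSolution m η V q φ θ fun x t => laplace m η φ V q θ x t - 1 := by
  have := h.prob
  have hφ := h.measurable
  obtain ⟨M, hM1, hM⟩ := exists_laplace_le h hc
  have hm : Measurable (Function.uncurry fun x t => laplace m η φ V q θ x t - 1) :=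
    (measurable_laplace h θ measurable_snd measurable_fst).sub_const 1
  have hb : ∀ x t, |laplace m η φ V q θ x t - 1| ≤ M + 1 := fun x t =>
    (abs_sub _ _).trans (add_le_add (hM x t) abs_one.le)
  refine ⟨hm, fun t => ⟨M + 1, fun s _ x => hb x s⟩, fun x t => ?_⟩
  rw [equation_iff h hm t (fun s _ x => hb x s), laplace_mild h hc]
  have hQ := h.killRate_pos
  have e1 : ∀ u : ℝ, Real.exp (-killRate V q * u) * semigroup m η u.toNNReal (fun y =>
        (θ * φ y - 2 * V * q) * laplace m η φ V q θ y (t - u.toNNReal) +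
          (V * (1 - q) + V * q * laplace m η φ V q θ y (t - u.toNNReal) ^ 2)) x =
      Real.exp (-killRate V q * u) * semigroup m η u.toNNReal
      (fun y => θ * φ y + (θ * φ y * (laplace m η φ V q θ y (t - u.toNNReal) - 1) +
        V * q * (laplace m η φ V q θ y (t - u.toNNReal) - 1) ^ 2)) x +
      killRate V q * Real.exp (-killRate V q * u) := by
    intro u
    have h1 := measurable_laplace h θ (α := Space d) (t := fun _ => t - u.toNNReal)
      (f := fun y => y) measurable_const measurable_id
    have h2 := semigroup_add h (f := fun y => θ * φ y +
      (θ * φ y * (laplace m η φ V q θ y (t - u.toNNReal) - 1) +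
        V * q * (laplace m η φ V q θ y (t - u.toNNReal) - 1) ^ 2)) (g := fun _ => killRate V q)
        (Kf := |θ| * b + (|θ| * b * (M + 1) + V * q * (M + 1) ^ 2)) (Kg := |killRate V q|)
        (by fun_prop) (by fun_prop)
        (fun y => (abs_add_le _ _).trans (add_le_add (abs_const_mul_le h θ y)
          (reaction_le h y (hb y _)))) (fun _ => le_rfl) u.toNNReal x
    have h3 : semigroup m η u.toNNReal (fun _ => killRate V q) x = killRate V q := by
      simp [semigroup]
    rw [h3] at h2
    have h4 : (fun y => (θ * φ y - 2 * V * q) * laplace m η φ V q θ y (t - u.toNNReal) +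
          (V * (1 - q) + V * q * laplace m η φ V q θ y (t - u.toNNReal) ^ 2)) =
        fun y => θ * φ y + (θ * φ y * (laplace m η φ V q θ y (t - u.toNNReal) - 1) +
        V * q * (laplace m η φ V q θ y (t - u.toNNReal) - 1) ^ 2) + killRate V q := by
      funext y
      rw [killRate]
      ring
    rw [h4, h2]
    ring
  simp_rw [e1]
  have e2 : ∫ u in (0 : ℝ)..t, killRate V q * Real.exp (-killRate V q * u) =
      1 - Real.exp (-killRate V q * t) := by
    have hd : ∀ u ∈ uIcc (0 : ℝ) t, HasDerivAt (fun u => -Real.exp (-killRate V q * u))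
        (killRate V q * Real.exp (-killRate V q * u)) u := fun u _ => by
      have h1 : HasDerivAt (fun u : ℝ => -killRate V q * u) (-killRate V q) u := by
        simpa using (hasDerivAt_id u).const_mul (-killRate V q)
      have h2 := h1.exp.neg
      rwa [mul_neg, neg_neg, mul_comm] at h2
    rw [intervalIntegral.integral_eq_sub_of_hasDerivAt hd]
    · simp only [mul_zero, Real.exp_zero]
      ring
    · exact Continuous.intervalIntegrable (by fun_prop) _ _
  rw [intervalIntegral.integral_add, e2]
  · ring
  · refine IntervalIntegrable.continuousOn_mul (g := fun u : ℝ => Real.exp (-killRate V q * u))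
      (f := fun u : ℝ => semigroup m η u.toNNReal
      (fun y => θ * φ y + (θ * φ y * (laplace m η φ V q θ y (t - u.toNNReal) - 1) +
        V * q * (laplace m η φ V q θ y (t - u.toNNReal) - 1) ^ 2)) x) ?_ (by fun_prop)
    refine intervalIntegrable_of_bounded (K := |θ| * b + (|θ| * b * (M + 1) + V * q * (M + 1) ^ 2)) ?_
      (fun u => abs_semigroup_le (fun y => (abs_add_le _ _).trans
        (add_le_add (abs_const_mul_le h θ y) (reaction_le h y (hb y _)))) _ _) _ _
    refine measurable_semigroup h.markov (f := fun _ => x) (t := fun u : ℝ => u.toNNReal)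
      (g := fun u y => θ * φ y + (θ * φ y * (laplace m η φ V q θ y (t - u.toNNReal) - 1) +
        V * q * (laplace m η φ V q θ y (t - u.toNNReal) - 1) ^ 2)) (by fun_prop) (by fun_prop) ?_
    have := measurable_laplace h θ (α := ℝ × Space d) (t := fun p => t - p.1.toNNReal)
      (f := fun p => p.2) (by fun_prop) (by fun_prop)
    simp only [Function.uncurry_def]
    fun_prop
  · exact Continuous.intervalIntegrable (by fun_prop) _ _

/-- On the range of two bounded solutions the reaction term is Lipschitz with constant `L`.
Iterating the integral inequality for the difference gives the bound `2 K (L t)^n / n!` for every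
`n`. -/
lemma IsOneParticleSolution.unique (h : Setting m η φ V q b) {θ : ℝ} {v₁ v₂ : Space d → ℝ≥0 → ℝ}
    (h₁ : IsOneParticleSolution m η V q φ θ v₁) (h₂ : IsOneParticleSolution m η V q φ θ v₂) :
    v₁ = v₂ := by
  have := h.prob
  have hφ := h.measurable
  have hV := h.hV
  have hq := h.hq0
  have hb := h.pos
  funext x t
  obtain ⟨K₁, hK₁⟩ := h₁.bounded t
  obtain ⟨K₂, hK₂⟩ := h₂.bounded t
  set K := max K₁ K₂ with hKd
  have b₁ : ∀ s ≤ t, ∀ x, |v₁ x s| ≤ K := fun s hs x => (hK₁ s hs x).trans (le_max_left _ _)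
  have b₂ : ∀ s ≤ t, ∀ x, |v₂ x s| ≤ K := fun s hs x => (hK₂ s hs x).trans (le_max_right _ _)
  have hK0 : 0 ≤ K := (abs_nonneg _).trans (b₁ 0 zero_le x)
  set L := |θ| * b + V * q * (2 * K) with hL
  have hL0 : 0 ≤ L := by positivity
  have hm₁ := h₁.measurable
  have hm₂ := h₂.measurable
  have key : ∀ n : ℕ, ∀ s ≤ t, ∀ x, |v₁ x s - v₂ x s| ≤ 2 * K * ((L * s) ^ n / n.factorial) := by
    intro n
    induction n with
    | zero =>
      intro s hs x
      have := (abs_sub _ _).trans (add_le_add (b₁ s hs x) (b₂ s hs x))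
      simpa [two_mul] using this
    | succ n ih =>
      intro s hs x
      rw [h₁.equation, h₂.equation, equation_iff h hm₁ s (fun r hr => b₁ r (hr.trans hs)),
        equation_iff h hm₂ s (fun r hr => b₂ r (hr.trans hs)), ← intervalIntegral.integral_sub]
      rotate_left
      · refine IntervalIntegrable.continuousOn_mul (g := fun u : ℝ => Real.exp (-killRate V q * u))
          ?_ (by fun_prop)
        refine intervalIntegrable_of_bounded (K := |θ| * b + (|θ| * b * K + V * q * K ^ 2)) ?_
          (fun u => abs_semigroup_le (fun y => (abs_add_le _ _).trans
            (add_le_add (abs_const_mul_le h θ y) (reaction_le h y (b₁ _ (tsub_le_self.trans hs) _)))) _ _) _ _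
        refine measurable_semigroup h.markov (f := fun _ => x) (t := fun u : ℝ => u.toNNReal)
          (by fun_prop) (by fun_prop) ?_
        have : Measurable fun p : ℝ × Space d => v₁ p.2 (s - p.1.toNNReal) :=
          hm₁.comp (by fun_prop : Measurable fun p : ℝ × Space d => (p.2, s - p.1.toNNReal))
        simp only [Function.uncurry_def]
        fun_prop
      · refine IntervalIntegrable.continuousOn_mul (g := fun u : ℝ => Real.exp (-killRate V q * u))
          ?_ (by fun_prop)
        refine intervalIntegrable_of_bounded (K := |θ| * b + (|θ| * b * K + V * q * K ^ 2)) ?_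
          (fun u => abs_semigroup_le (fun y => (abs_add_le _ _).trans
            (add_le_add (abs_const_mul_le h θ y) (reaction_le h y (b₂ _ (tsub_le_self.trans hs) _)))) _ _) _ _
        refine measurable_semigroup h.markov (f := fun _ => x) (t := fun u : ℝ => u.toNNReal)
          (by fun_prop) (by fun_prop) ?_
        have : Measurable fun p : ℝ × Space d => v₂ p.2 (s - p.1.toNNReal) :=
          hm₂.comp (by fun_prop : Measurable fun p : ℝ × Space d => (p.2, s - p.1.toNNReal))
        simp only [Function.uncurry_def]
        fun_prop
      have hle : ∀ u ∈ Ioc (0 : ℝ) s, ‖Real.exp (-killRate V q * u) * semigroup m η u.toNNReal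
          (fun y => θ * φ y + (θ * φ y * v₁ y (s - u.toNNReal) + V * q * v₁ y (s - u.toNNReal) ^ 2)) x -
          Real.exp (-killRate V q * u) * semigroup m η u.toNNReal
          (fun y => θ * φ y + (θ * φ y * v₂ y (s - u.toNNReal) + V * q * v₂ y (s - u.toNNReal) ^ 2)) x‖ ≤
          L * (2 * K * ((L * (s - u)) ^ n / n.factorial)) := by
        intro u hu
        have hsu : s - u.toNNReal ≤ t := tsub_le_self.trans hs
        have c₁ : Measurable fun y => v₁ y (s - u.toNNReal) :=
          hm₁.comp (measurable_id.prodMk measurable_const)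
        have c₂ : Measurable fun y => v₂ y (s - u.toNNReal) :=
          hm₂.comp (measurable_id.prodMk measurable_const)
        rw [← mul_sub, ← semigroup_sub h (by fun_prop) (by fun_prop)
          (fun y => (abs_add_le _ _).trans
            (add_le_add (abs_const_mul_le h θ y) (reaction_le h y (b₁ _ hsu _))))
          (fun y => (abs_add_le _ _).trans
            (add_le_add (abs_const_mul_le h θ y) (reaction_le h y (b₂ _ hsu _)))), Real.norm_eq_abs,
          ← one_mul (L * _)]
        refine abs_mul_le_mul ?_ (abs_semigroup_le (fun y => ?_) _ _)
        · rw [Real.abs_exp]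
          refine Real.exp_le_one_iff.2 ?_
          have := mul_nonneg h.killRate_pos.le hu.1.le
          linarith
        · have e : θ * φ y + (θ * φ y * v₁ y (s - u.toNNReal) + V * q * v₁ y (s - u.toNNReal) ^ 2) -
              (θ * φ y + (θ * φ y * v₂ y (s - u.toNNReal) + V * q * v₂ y (s - u.toNNReal) ^ 2)) =
              (θ * φ y + V * q * (v₁ y (s - u.toNNReal) + v₂ y (s - u.toNNReal))) *
                (v₁ y (s - u.toNNReal) - v₂ y (s - u.toNNReal)) := by ring
          rw [e]
          refine abs_mul_le_mul ?_ ?_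
          · refine (abs_add_le _ _).trans (add_le_add (abs_const_mul_le h θ y)
              (abs_mul_le_mul (by rw [abs_of_nonneg (by positivity)]) ?_))
            rw [two_mul]
            exact (abs_add_le _ _).trans (add_le_add (b₁ _ hsu _) (b₂ _ hsu _))
          · have := ih _ hsu y
            rwa [NNReal.coe_sub (Real.toNNReal_le_iff_le_coe.2 hu.2), Real.coe_toNNReal u hu.1.le] at this
      refine (intervalIntegral.norm_integral_le_of_norm_le s.coe_nonneg
        (ae_of_all _ hle) ?_).trans ?_
      · exact Continuous.intervalIntegrable (by fun_prop) _ _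
      · have e3 : ∫ u in (0 : ℝ)..s, L * (2 * K * ((L * (s - u)) ^ n / n.factorial)) =
            ∫ u in (0 : ℝ)..s, L * (2 * K * ((L * u) ^ n / n.factorial)) := by
          have := intervalIntegral.integral_comp_sub_left (a := 0) (b := s)
            (fun u => L * (2 * K * ((L * u) ^ n / n.factorial))) (s : ℝ)
          rwa [sub_self, sub_zero] at this
        rw [e3]
        have e4 : ∀ u : ℝ, L * (2 * K * ((L * u) ^ n / n.factorial)) =
            (L ^ (n + 1) * (2 * K) / n.factorial) * u ^ n := fun u => by
          rw [mul_pow]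
          ring
        simp_rw [e4]
        rw [intervalIntegral.integral_const_mul, integral_pow, Nat.factorial_succ]
        push_cast
        rw [zero_pow (Nat.succ_ne_zero n), sub_zero, mul_pow]
        refine le_of_eq ?_
        field_simp
  have hlim : Tendsto (fun n : ℕ => 2 * K * ((L * t) ^ n / n.factorial)) atTop (𝓝 (2 * K * 0)) :=
    (FloorSemiring.tendsto_pow_div_factorial_atTop (L * t)).const_mul _
  have := ge_of_tendsto hlim (Eventually.of_forall fun n => key n t le_rfl x)
  rw [mul_zero] at this
  exact sub_eq_zero.1 (abs_eq_zero.1 (le_antisymm this (abs_nonneg _)))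

lemma existsUnique_oneParticleSolution (h : Setting m η φ V q b) {θ : ℝ}
    (hc : θ * b < criticalRate V q) : ∃! v, IsOneParticleSolution m η V q φ θ v :=
  ⟨_, isOneParticleSolution_laplace h hc, fun _ hv =>
    hv.unique h (isOneParticleSolution_laplace h hc)⟩

lemma oneParticle_eq (h : Setting m η φ V q b) {θ : ℝ} (hc : θ * b < criticalRate V q) :
    oneParticle m η V q φ θ = fun x t => laplace m η φ V q θ x t - 1 := by
  have hex : ∃ v, IsOneParticleSolution m η V q φ θ v := ⟨_, isOneParticleSolution_laplace h hc⟩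
  rw [oneParticle, dif_pos hex]
  exact hex.choose_spec.unique h (isOneParticleSolution_laplace h hc)

lemma measurable_jTot_right (h : Setting m η φ V q b) (x : Space d) :
    Measurable fun z => jTot η φ x z :=
  (measurable_jTot h).comp (by fun_prop : Measurable fun z : Marks S => (x, z))

lemma integrable_exp_jTot (h : Setting m η φ V q b) {θ : ℝ} (hc : θ * b < criticalRate V q)
    (x : Space d) : Integrable (fun z => Real.exp (θ * jTot η φ x z)) (famLaw m V q) := by
  have := h.isProb_famLaw
  have hm := measurable_jTot_right h x
  obtain ⟨θ', hθ', hc', hle⟩ : ∃ θ' : ℝ, 0 < θ' ∧ θ' * b < criticalRate V q ∧ θ ≤ θ' := by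
    rcases le_or_gt θ 0 with h0 | h0
    · obtain ⟨θ', h1, h2⟩ := exists_subcritical h
      exact ⟨θ', h1, h2, h0.trans h1.le⟩
    · exact ⟨θ, h0, hc, le_rfl⟩
  have hint : Integrable (fun z => Real.exp (θ' * jTot η φ x z)) (famLaw m V q) := by
    refine ⟨by fun_prop, ?_⟩
    rw [hasFiniteIntegral_iff_ofReal (ae_of_all _ fun z => (Real.exp_pos _).le)]
    obtain ⟨M, -, -, hM⟩ := lintegral_expE_totOcc_le h hθ' hc'
    refine lt_of_le_of_lt ?_ ((hM x).trans_lt ENNReal.ofReal_lt_top)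
    refine lintegral_mono_ae ?_
    filter_upwards [totOcc_lt_top h x] with z hz
    rw [ofReal_exp_jTot hθ'.le hz]
  refine hint.mono' (by fun_prop) (ae_of_all _ fun z => ?_)
  rw [Real.norm_eq_abs, Real.abs_exp]
  exact Real.exp_le_exp.2 (mul_le_mul_of_nonneg_right hle (jTot_nonneg _ _))

lemma tendsto_jOcc (h : Setting m η φ V q b) {x : Space d} {z : Marks S}
    (hz : totOcc η φ x z < ∞) :
    Tendsto (fun t : ℝ≥0 => jOcc η φ t x z) atTop (𝓝 (jTot η φ x z)) := by
  refine (ENNReal.tendsto_toReal hz.ne).comp ?_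
  have hd := measurable_dens_time h.markov h.measurable ⊤ x z
  refine tendsto_lintegral_filter_of_dominated_convergence (fun u => 1 * dens η φ ⊤ x z u) ?_ ?_ hz.ne ?_
  · exact Eventually.of_forall fun t => (measurable_upTo t).mul hd
  · exact Eventually.of_forall fun t => ae_of_all _ fun u => mul_le_mul_left (upTo_le_one _ _) _
  · refine ae_of_all _ fun u => tendsto_const_nhds.congr' ?_
    filter_upwards [eventually_ge_atTop u.toNNReal] with t ht
    have : u ≤ t := Real.toNNReal_le_iff_le_coe.1 ht
    simp [upTo, this]

lemma laplace_eq_integral (h : Setting m η φ V q b) (θ : ℝ) (x : Space d) (t : ℝ≥0) :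
    laplace m η φ V q θ x t = ∫ z, Real.exp (θ * jOcc η φ t x z) ∂(famLaw m V q) := by
  have hm := measurable_jOcc h (α := Marks S) (t := fun _ => t) (f := fun _ => x)
      (z := fun z => z) (by fun_prop) (by fun_prop) (by fun_prop)
  rw [integral_eq_lintegral_of_nonneg_ae (ae_of_all _ fun z => (Real.exp_pos _).le) (by fun_prop)]
  rfl

/-- The occupation up to `t` increases to the total occupation. The envelope `exp (θ J) + 1` serves
for both signs of `θ`. -/
lemma tendsto_oneParticle (h : Setting m η φ V q b) {θ : ℝ} (hc : θ * b < criticalRate V q)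
    (x : Space d) : Tendsto (fun t => oneParticle m η V q φ θ x t) atTop
      (𝓝 (mgf (jTot η φ x) (famLaw m V q) θ - 1)) := by
  have := h.isProb_famLaw
  simp only [oneParticle_eq h hc, laplace_eq_integral h, mgf]
  refine Tendsto.sub_const ?_ 1
  have hm : ∀ t : ℝ≥0, Measurable fun z => jOcc η φ t x z := fun t =>
    measurable_jOcc h (α := Marks S) (t := fun _ => t) (f := fun _ => x)
      (z := fun z => z) (by fun_prop) (by fun_prop) (by fun_prop)
  have hm' := measurable_jTot_right h x
  refine tendsto_integral_filter_of_dominated_convergence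
    (fun z => Real.exp (θ * jTot η φ x z) + 1) ?_ ?_ ?_ ?_
  · exact Eventually.of_forall fun t => by have := hm t; fun_prop
  · refine Eventually.of_forall fun t => ?_
    filter_upwards [totOcc_lt_top h x] with z hz
    rw [Real.norm_eq_abs, Real.abs_exp]
    rcases le_or_gt θ 0 with h0 | h0
    · have : Real.exp (θ * jOcc η φ t x z) ≤ 1 :=
        Real.exp_le_one_iff.2 (mul_nonpos_of_nonpos_of_nonneg h0 (jOcc_nonneg _ _ _))
      linarith [Real.exp_pos (θ * jTot η φ x z)]
    · have : Real.exp (θ * jOcc η φ t x z) ≤ Real.exp (θ * jTot η φ x z) :=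
        Real.exp_le_exp.2 (mul_le_mul_of_nonneg_left (jOcc_le_jTot hz) h0.le)
      linarith
  · exact (integrable_exp_jTot h hc x).add (integrable_const 1)
  · filter_upwards [totOcc_lt_top h x] with z hz
    exact (Real.continuous_exp.tendsto _).comp ((tendsto_jOcc h hz).const_mul θ)

lemma vLim_eq (h : Setting m η φ V q b) {θ : ℝ} (hc : θ * b < criticalRate V q) (x : Space d) :
    vLim m η V q φ x θ = mgf (jTot η φ x) (famLaw m V q) θ - 1 :=
  (tendsto_oneParticle h hc x).limUnder_eq

lemma mem_interior_integrableExpSet (h : Setting m η φ V q b) {θ : ℝ}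
    (hc : θ * b < criticalRate V q) (x : Space d) :
    θ ∈ interior (integrableExpSet (jTot η φ x) (famLaw m V q)) := by
  have ho : IsOpen {θ : ℝ | θ * b < criticalRate V q} :=
    isOpen_lt (by fun_prop) continuous_const
  exact interior_maximal (fun θ' hθ' => integrable_exp_jTot h hθ' x) ho hc

lemma hasDerivAt_vLim (h : Setting m η φ V q b) {θ : ℝ} (hc : θ * b < criticalRate V q)
    (x : Space d) : HasDerivAt (fun ϑ => vLim m η V q φ x ϑ)
      (∫ z, jTot η φ x z * Real.exp (θ * jTot η φ x z) ∂(famLaw m V q)) θ := by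
  have h1 := (hasDerivAt_mgf (mem_interior_integrableExpSet h hc x)).sub_const 1
  refine h1.congr_of_eventuallyEq ?_
  have ho : IsOpen {θ : ℝ | θ * b < criticalRate V q} :=
    isOpen_lt (by fun_prop) continuous_const
  filter_upwards [ho.mem_nhds hc] with ϑ hϑ
  exact vLim_eq h hϑ x

end RealRenewal

/-! ### Resolvent inequalities from the Markov property. -/

section Resolvent

variable {d : ℕ} {S : Type*} [MeasurableSpace S] {m : Measure S} [IsProbabilityMeasure m]
  {η : Space d → ℝ≥0 → S → Space d}

lemma measurable_lintegral_motion (hη : IsMarkovFamily m η) {f : Space d → ℝ≥0∞} (hf : Measurable f)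
    {α : Type*} [MeasurableSpace α] {x : α → Space d} {t : α → ℝ≥0} (hx : Measurable x)
    (ht : Measurable t) : Measurable fun a => ∫⁻ w, f (η (x a) (t a) w) ∂m := by
  have hmη := hη.measurable
  exact Measurable.lintegral_prod_right' (f := fun p : α × S => f (η (x p.1) (t p.1) p.2)) (by fun_prop)

/-- The Markov property for functions with values in `[0,∞]`. -/
lemma lintegral_markov (hη : IsMarkovFamily m η) (x : Space d) (t s : ℝ≥0) {f h : Space d → ℝ≥0∞}
    (hf : Measurable f) (hh : Measurable h) :
    ∫⁻ w, f (η x t w) * h (η x (t + s) w) ∂m =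
      ∫⁻ w, f (η x t w) * ∫⁻ w', h (η (η x t w) s w') ∂m ∂m := by
  have hmη := hη.measurable
  have hmt : Measurable (η x t) := by fun_prop
  have hms : Measurable (η x (t + s)) := by fun_prop
  have hker : ∀ {h : Space d → ℝ≥0∞}, Measurable h →
      Measurable fun w => ∫⁻ w', h (η (η x t w) s w') ∂m := fun hh =>
    measurable_lintegral_motion hη hh hmt measurable_const
  have key : ∀ A : Set (Space d), MeasurableSet A → ∫⁻ w in η x t ⁻¹' A, h (η x (t + s) w) ∂m =
      ∫⁻ w in η x t ⁻¹' A, ∫⁻ w', h (η (η x t w) s w') ∂m ∂m := by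
    intro A hA
    refine Measurable.ennreal_induction (motive := fun h => ∫⁻ w in η x t ⁻¹' A, h (η x (t + s) w) ∂m =
      ∫⁻ w in η x t ⁻¹' A, ∫⁻ w', h (η (η x t w) s w') ∂m ∂m) ?_ ?_ ?_ hh
    · intro c B hB
      have hpast : MeasurableSet[past η x t] (η x t ⁻¹' A) := measurable_past x le_rfl hA
      have h1 := hη.markov x t s B hB _ hpast
      have h2 : ∀ w, B.indicator (fun _ => c) (η x (t + s) w) =
          c * (η x (t + s) ⁻¹' B).indicator 1 w := fun w => by
        by_cases hw : η x (t + s) w ∈ B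
        · rw [indicator_of_mem hw, indicator_of_mem (mem_preimage.2 hw), Pi.one_apply, mul_one]
        · rw [indicator_of_notMem hw, indicator_of_notMem (fun h' => hw (mem_preimage.1 h')), mul_zero]
      have h3 : ∀ w, ∫⁻ w', B.indicator (fun _ => c) (η (η x t w) s w') ∂m =
          c * m {w' | η (η x t w) s w' ∈ B} := fun w => by
        have hm' : Measurable (η (η x t w) s) := by fun_prop
        exact lintegral_indicator_const_comp hm' hB c
      simp_rw [h2, h3]
      rw [lintegral_const_mul _ (measurable_one.indicator (hms hB)), lintegral_indicator_one (hms hB),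
        Measure.restrict_apply (hms hB), lintegral_const_mul, ← h1, inter_comm]
      · rfl
      · have := hker (measurable_one.indicator hB)
        convert this using 2 with w
        have hm' : Measurable (η (η x t w) s) := by fun_prop
        exact ((lintegral_indicator_const_comp hm' hB 1).trans (one_mul _)).symm
    · intro f g _ hf hg ihf ihg
      simp only [Pi.add_apply]
      have e : ∀ w, ∫⁻ w', f (η (η x t w) s w') + g (η (η x t w) s w') ∂m =
          ∫⁻ w', f (η (η x t w) s w') ∂m + ∫⁻ w', g (η (η x t w) s w') ∂m := fun w =>
        lintegral_add_left (by fun_prop) _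
      simp_rw [e]
      have hfc : Measurable fun w => f (η x (t + s) w) := hf.comp hms
      rw [lintegral_add_left hfc, lintegral_add_left (hker hf), ihf, ihg]
    · intro F hF hmono ih
      have e : ∀ w, ∫⁻ w', ⨆ n, F n (η (η x t w) s w') ∂m =
          ⨆ n, ∫⁻ w', F n (η (η x t w) s w') ∂m := fun w =>
        lintegral_iSup (fun n => by have := hF n; fun_prop) fun a b hab w' => hmono hab _
      simp_rw [e]
      have hfc : ∀ n, Measurable fun w => F n (η x (t + s) w) := fun n => (hF n).comp hms
      rw [lintegral_iSup hfc fun a b hab w' => hmono hab _,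
        lintegral_iSup (fun n => hker (hF n)) fun a b hab w => lintegral_mono fun w' => hmono hab _]
      simp_rw [ih]
  have mh1 : Measurable fun w => h (η x (t + s) w) := hh.comp hms
  have mh2 := hker hh
  refine Measurable.ennreal_induction (motive := fun f => ∫⁻ w, f (η x t w) * h (η x (t + s) w) ∂m =
    ∫⁻ w, f (η x t w) * ∫⁻ w', h (η (η x t w) s w') ∂m ∂m) ?_ ?_ ?_ hf
  · intro c A hA
    have e : ∀ (k : S → ℝ≥0∞) w, A.indicator (fun _ => c) (η x t w) * k w =
        c * (η x t ⁻¹' A).indicator k w := fun k w => by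
      by_cases hw : η x t w ∈ A
      · rw [indicator_of_mem hw, indicator_of_mem (mem_preimage.2 hw)]
      · rw [indicator_of_notMem hw, indicator_of_notMem (fun h' => hw (mem_preimage.1 h')), mul_zero,
          zero_mul]
    simp only [e fun w => h (η x (t + s) w), e fun w => ∫⁻ w', h (η (η x t w) s w') ∂m]
    rw [lintegral_const_mul _ (mh1.indicator (hmt hA)), lintegral_const_mul _ (mh2.indicator (hmt hA)),
      lintegral_indicator (hmt hA), lintegral_indicator (hmt hA), key A hA]
  · intro f g _ hf hg ihf ihg
    simp only [Pi.add_apply, add_mul]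
    have hfc : Measurable fun w => f (η x t w) := hf.comp hmt
    have n1 : Measurable fun w => f (η x t w) * h (η x (t + s) w) := hfc.mul mh1
    have n2 : Measurable fun w => f (η x t w) * ∫⁻ w', h (η (η x t w) s w') ∂m := hfc.mul mh2
    rw [lintegral_add_left n1, lintegral_add_left n2, ihf, ihg]
  · intro F hF hmono ih
    simp only [ENNReal.iSup_mul]
    have hfc : ∀ n, Measurable fun w => F n (η x t w) := fun n => (hF n).comp hmt
    have n1 : ∀ n, Measurable fun w => F n (η x t w) * h (η x (t + s) w) := fun n => (hfc n).mul mh1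
    have n2 : ∀ n, Measurable fun w => F n (η x t w) * ∫⁻ w', h (η (η x t w) s w') ∂m := fun n =>
      (hfc n).mul mh2
    rw [lintegral_iSup n1 fun a b hab w => mul_le_mul_left (hmono hab _) _,
      lintegral_iSup n2 fun a b hab w => mul_le_mul_left (hmono hab _) _]
    simp_rw [ih]

/-- The resolvent `R_κ f (x) = ∫_0^∞ e^{-κt} T_t f (x) dt`, for functions with values in `[0,∞]`. -/
def resolvent (m : Measure S) (η : Space d → ℝ≥0 → S → Space d) (κ : ℝ) (f : Space d → ℝ≥0∞)
    (x : Space d) : ℝ≥0∞ :=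
  ∫⁻ t in Ioi (0 : ℝ), ENNReal.ofReal (Real.exp (-κ * t)) * ∫⁻ w, f (η x t.toNNReal w) ∂m

lemma measurable_resolvent (hη : IsMarkovFamily m η) (κ : ℝ) {f : Space d → ℝ≥0∞}
    (hf : Measurable f) : Measurable (resolvent m η κ f) := by
  have h1 := measurable_lintegral_motion hη hf (α := Space d × ℝ) (x := fun p => p.1)
    (t := fun p => p.2.toNNReal) (by fun_prop) (by fun_prop)
  exact Measurable.lintegral_prod_right' (f := fun p : Space d × ℝ =>
    ENNReal.ofReal (Real.exp (-κ * p.2)) * ∫⁻ w, f (η p.1 p.2.toNNReal w) ∂m) (by fun_prop)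

lemma resolvent_mono (κ : ℝ) {f g : Space d → ℝ≥0∞} (h : ∀ y, f y ≤ g y) (x : Space d) :
    resolvent m η κ f x ≤ resolvent m η κ g x :=
  lintegral_mono fun _ => mul_le_mul_right (lintegral_mono fun _ => h _) _

lemma resolvent_const_mul (hη : IsMarkovFamily m η) (κ : ℝ) (c : ℝ≥0∞) {f : Space d → ℝ≥0∞}
    (hf : Measurable f) (x : Space d) :
    resolvent m η κ (fun y => c * f y) x = c * resolvent m η κ f x := by
  have hmη := hη.measurable
  have h1 := measurable_lintegral_motion hη hf (α := ℝ) (x := fun _ => x)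
    (t := fun t => t.toNNReal) (by fun_prop) (by fun_prop)
  simp only [resolvent]
  rw [← lintegral_const_mul _ (by fun_prop)]
  refine lintegral_congr fun t => ?_
  rw [lintegral_const_mul _ (by fun_prop), mul_left_comm]

lemma resolvent_add (hη : IsMarkovFamily m η) (κ : ℝ) {f g : Space d → ℝ≥0∞}
    (hf : Measurable f) (x : Space d) :
    resolvent m η κ (fun y => f y + g y) x = resolvent m η κ f x + resolvent m η κ g x := by
  have hmη := hη.measurable
  have h1 := measurable_lintegral_motion hη hf (α := ℝ) (x := fun _ => x)
    (t := fun t => t.toNNReal) (by fun_prop) (by fun_prop)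
  simp only [resolvent]
  rw [← lintegral_add_left (by fun_prop)]
  refine lintegral_congr fun t => ?_
  rw [lintegral_add_left (by fun_prop), mul_add]

lemma sq_lintegral_le {α : Type*} [MeasurableSpace α] (μ : Measure α) [IsProbabilityMeasure μ]
    {F : α → ℝ≥0∞} (hF : Measurable F) : (∫⁻ w, F w ∂μ) ^ 2 ≤ ∫⁻ w, F w ^ 2 ∂μ := by
  have h := ENNReal.lintegral_mul_le_Lp_mul_Lq μ Real.HolderConjugate.two_two hF.aemeasurable
    (aemeasurable_const (b := (1 : ℝ≥0∞)))
  simp only [Pi.mul_apply, mul_one, ENNReal.one_rpow, lintegral_const, measure_univ] at h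
  calc (∫⁻ w, F w ∂μ) ^ 2 ≤ ((∫⁻ w, F w ^ (2 : ℝ) ∂μ) ^ (1 / 2 : ℝ)) ^ 2 := pow_le_pow_left' h 2
    _ = ∫⁻ w, F w ^ 2 ∂μ := by
      rw [← ENNReal.rpow_natCast, ← ENNReal.rpow_mul]
      norm_num

lemma lintegral_Ioi_shift (s : ℝ) (k : ℝ → ℝ≥0∞) :
    ∫⁻ r in Ioi (0 : ℝ), k (s + r) = ∫⁻ t in Ioi s, k t := by
  rw [← lintegral_indicator measurableSet_Ioi, ← lintegral_indicator measurableSet_Ioi,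
    ← lintegral_add_left_eq_self (fun t => (Ioi s).indicator k t) s]
  refine lintegral_congr fun r => ?_
  simp only [indicator, mem_Ioi, lt_add_iff_pos_right]

/-- The square of an integral over a half-line as an integral over ordered pairs. -/
lemma sq_lintegral_Ioi_eq {k : ℝ → ℝ≥0∞} (hk : Measurable k) :
    (∫⁻ t in Ioi (0 : ℝ), k t) ^ 2 =
      2 * ∫⁻ s in Ioi (0 : ℝ), k s * ∫⁻ r in Ioi (0 : ℝ), k (s + r) := by
  set k' : ℝ → ℝ≥0∞ := (Ioi (0 : ℝ)).indicator k with hk'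
  have mk' : Measurable k' := hk.indicator measurableSet_Ioi
  have e1 : ∫⁻ t in Ioi (0 : ℝ), k t = ∫⁻ t, k' t := (lintegral_indicator measurableSet_Ioi _).symm
  have e2 : ∫⁻ s in Ioi (0 : ℝ), k s * ∫⁻ r in Ioi (0 : ℝ), k (s + r) =
      ∫⁻ s, k' s * ∫⁻ t in Ioi s, k' t := by
    rw [← lintegral_indicator measurableSet_Ioi]
    refine lintegral_congr fun s => ?_
    by_cases hs : s ∈ Ioi (0 : ℝ)
    · rw [indicator_of_mem hs, lintegral_Ioi_shift, hk', indicator_of_mem hs]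
      congr 1
      refine setLIntegral_congr_fun measurableSet_Ioi fun t ht => ?_
      rw [indicator_of_mem (show t ∈ Ioi (0 : ℝ) from lt_trans (mem_Ioi.1 hs) ht)]
    · rw [indicator_of_notMem hs, hk', indicator_of_notMem hs, zero_mul]
  -- Reflection across the diagonal, which is a null set.
  have e3 : ∫⁻ s, k' s * ∫⁻ t in Iic s, k' t = ∫⁻ s, k' s * ∫⁻ t in Ioi s, k' t := by
    have h1 : ∀ s, k' s * ∫⁻ t in Iic s, k' t =
        ∫⁻ t, {p : ℝ × ℝ | p.2 ≤ p.1}.indicator (fun p => k' p.1 * k' p.2) (s, t) := fun s => by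
      rw [← lintegral_indicator measurableSet_Iic, ← lintegral_const_mul _ (mk'.indicator measurableSet_Iic)]
      refine lintegral_congr fun t => ?_
      simp only [indicator, mem_Iic, mem_ofPred_eq]
      split_ifs <;> simp
    have h2 : ∀ s, k' s * ∫⁻ t in Ioi s, k' t = k' s * ∫⁻ t in Ici s, k' t := fun s => by
      rw [setLIntegral_congr Ioi_ae_eq_Ici]
    have h3 : ∀ s, k' s * ∫⁻ t in Ici s, k' t =
        ∫⁻ t, {p : ℝ × ℝ | p.2 ≤ p.1}.indicator (fun p => k' p.1 * k' p.2) (t, s) := fun s => by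
      rw [← lintegral_indicator measurableSet_Ici, ← lintegral_const_mul _ (mk'.indicator measurableSet_Ici)]
      refine lintegral_congr fun t => ?_
      simp only [indicator, mem_Ici, mem_ofPred_eq]
      split_ifs <;> simp [mul_comm]
    simp_rw [h2, h1, h3]
    rw [lintegral_lintegral_swap]
    exact (Measurable.indicator (by fun_prop)
      (measurableSet_le measurable_snd measurable_fst)).aemeasurable
  rw [e1, e2, two_mul]
  nth_rewrite 2 [← e3]
  rw [pow_two, ← lintegral_mul_const _ mk', ← lintegral_add_left]
  · refine lintegral_congr fun s => ?_
    rw [← mul_add, ← lintegral_union measurableSet_Iic (by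
      rw [Set.disjoint_left]
      exact fun t h1 h2 => not_lt.2 (mem_Iic.1 h2) (mem_Ioi.1 h1)), union_comm, Iic_union_Ioi, Measure.restrict_univ]
  · refine mk'.mul ?_
    have : Measurable fun p : ℝ × ℝ => {p : ℝ × ℝ | p.1 < p.2}.indicator (fun p => k' p.2) p :=
      Measurable.indicator (by fun_prop) (measurableSet_lt measurable_fst measurable_snd)
    have h4 : ∀ s, ∫⁻ t in Ioi s, k' t =
        ∫⁻ t, {p : ℝ × ℝ | p.1 < p.2}.indicator (fun p => k' p.2) (s, t) := fun s =>
      (lintegral_indicator measurableSet_Ioi _).symm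
    simp_rw [h4]
    exact this.lintegral_prod_right'

/-- Cauchy-Schwarz moves the square inside the expectation over the path. The square of the time
integral is twice the integral over pairs `s < s + r`, the discount factors combine to `exp (-2κs)
exp (-κr)`, and the Markov property at time `s` turns the later factor into `R_κ g`. -/
lemma sq_resolvent_le (hη : IsMarkovFamily m η) (κ : ℝ) {g : Space d → ℝ≥0∞} (hg : Measurable g)
    (x : Space d) : resolvent m η κ g x ^ 2 ≤
      2 * resolvent m η (2 * κ) (fun y => g y * resolvent m η κ g y) x := by
  have hmη := hη.measurable
  have e0 : resolvent m η κ g x = ∫⁻ w, (∫⁻ t in Ioi (0 : ℝ),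
      ENNReal.ofReal (Real.exp (-κ * t)) * g (η x t.toNNReal w)) ∂m := by
    rw [lintegral_lintegral_swap]
    · refine lintegral_congr fun t => ?_
      rw [lintegral_const_mul _ (by fun_prop)]
    · exact (by fun_prop : Measurable fun p : S × ℝ =>
        ENNReal.ofReal (Real.exp (-κ * p.2)) * g (η x p.2.toNNReal p.1)).aemeasurable
  rw [e0]
  refine (sq_lintegral_le m ?_).trans ?_
  · exact Measurable.lintegral_prod_right' (f := fun p : S × ℝ =>
      ENNReal.ofReal (Real.exp (-κ * p.2)) * g (η x p.2.toNNReal p.1)) (by fun_prop)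
  have e1 : ∀ w, (∫⁻ t in Ioi (0 : ℝ), ENNReal.ofReal (Real.exp (-κ * t)) * g (η x t.toNNReal w)) ^ 2 =
      2 * ∫⁻ s in Ioi (0 : ℝ), ∫⁻ r in Ioi (0 : ℝ), ENNReal.ofReal (Real.exp (-(2 * κ) * s)) *
        (ENNReal.ofReal (Real.exp (-κ * r)) *
          (g (η x s.toNNReal w) * g (η x (s + r).toNNReal w))) := by
    intro w
    rw [sq_lintegral_Ioi_eq (k := fun t => ENNReal.ofReal (Real.exp (-κ * t)) * g (η x t.toNNReal w))
      (by fun_prop)]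
    congr 1
    refine lintegral_congr fun s => ?_
    rw [← lintegral_const_mul _ (by fun_prop)]
    refine lintegral_congr fun r => ?_
    have : ENNReal.ofReal (Real.exp (-(2 * κ) * s)) * ENNReal.ofReal (Real.exp (-κ * r)) =
        ENNReal.ofReal (Real.exp (-κ * s)) * ENNReal.ofReal (Real.exp (-κ * (s + r))) := by
      rw [← ENNReal.ofReal_mul (Real.exp_pos _).le, ← ENNReal.ofReal_mul (Real.exp_pos _).le,
        ← Real.exp_add, ← Real.exp_add]
      congr 2
      ring
    rw [← mul_assoc (ENNReal.ofReal (Real.exp (-(2 * κ) * s))), this]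
    ring
  simp_rw [e1]
  have hm3 : Measurable fun p : (S × ℝ) × ℝ => ENNReal.ofReal (Real.exp (-(2 * κ) * p.1.2)) *
        (ENNReal.ofReal (Real.exp (-κ * p.2)) *
          (g (η x p.1.2.toNNReal p.1.1) * g (η x (p.1.2 + p.2).toNNReal p.1.1))) := by fun_prop
  have hm2 : Measurable fun p : S × ℝ => ∫⁻ r in Ioi (0 : ℝ), ENNReal.ofReal (Real.exp (-(2 * κ) * p.2)) *
        (ENNReal.ofReal (Real.exp (-κ * r)) *
          (g (η x p.2.toNNReal p.1) * g (η x (p.2 + r).toNNReal p.1))) :=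
    Measurable.lintegral_prod_right' hm3
  rw [lintegral_const_mul _ (Measurable.lintegral_prod_right' hm2)]
  refine le_of_eq ?_
  congr 1
  rw [lintegral_lintegral_swap hm2.aemeasurable, resolvent]
  refine setLIntegral_congr_fun measurableSet_Ioi fun s hs => ?_
  have hs0 : (0 : ℝ) ≤ s := le_of_lt hs
  have hR := measurable_resolvent hη κ hg
  have hm4 : Measurable fun p : S × ℝ => ENNReal.ofReal (Real.exp (-(2 * κ) * s)) *
        (ENNReal.ofReal (Real.exp (-κ * p.2)) *
          (g (η x s.toNNReal p.1) * g (η x (s + p.2).toNNReal p.1))) := by fun_prop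
  simp only []
  rw [lintegral_lintegral_swap hm4.aemeasurable]
  have hker : Measurable fun p : S × ℝ => ∫⁻ w', g (η (η x s.toNNReal p.1) p.2.toNNReal w') ∂m :=
    measurable_lintegral_motion hη hg (by fun_prop) (by fun_prop)
  have e2 : ∀ r ∈ Ioi (0 : ℝ), ∫⁻ w, ENNReal.ofReal (Real.exp (-(2 * κ) * s)) *
        (ENNReal.ofReal (Real.exp (-κ * r)) *
          (g (η x s.toNNReal w) * g (η x (s + r).toNNReal w))) ∂m =
      ENNReal.ofReal (Real.exp (-(2 * κ) * s)) * ∫⁻ w, ENNReal.ofReal (Real.exp (-κ * r)) *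
        (g (η x s.toNNReal w) * ∫⁻ w', g (η (η x s.toNNReal w) r.toNNReal w') ∂m) ∂m := by
    intro r hr
    have hk1 : Measurable fun w => ∫⁻ w', g (η (η x s.toNNReal w) r.toNNReal w') ∂m :=
      measurable_lintegral_motion hη hg (by fun_prop) (by fun_prop)
    rw [lintegral_const_mul _ (by fun_prop), lintegral_const_mul _ (by fun_prop),
      lintegral_const_mul _ (by fun_prop), Real.toNNReal_add hs0 (le_of_lt hr),
      lintegral_markov hη x _ _ hg hg]
  rw [setLIntegral_congr_fun measurableSet_Ioi e2, lintegral_const_mul]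
  · congr 1
    rw [lintegral_lintegral_swap]
    · refine lintegral_congr fun w => ?_
      rw [resolvent, ← lintegral_const_mul]
      · refine lintegral_congr fun r => ?_
        rw [mul_left_comm]
      · have := measurable_lintegral_motion hη hg (α := ℝ) (x := fun _ => η x s.toNNReal w)
          (t := fun r => r.toNNReal) (by fun_prop) (by fun_prop)
        fun_prop
    · refine Measurable.aemeasurable ?_
      have := hker.comp (measurable_swap (α := ℝ) (β := S))
      simp only [Function.comp_def, Prod.swap] at this
      simp only [Function.uncurry_def]
      fun_prop
  · refine Measurable.lintegral_prod_right' (f := fun p : ℝ × S => ENNReal.ofReal (Real.exp (-κ * p.1)) *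
        (g (η x s.toNNReal p.2) * ∫⁻ w', g (η (η x s.toNNReal p.2) p.1.toNNReal w') ∂m)) ?_
    have := hker.comp (measurable_swap (α := ℝ) (β := S))
    simp only [Function.comp_def, Prod.swap] at this
    fun_prop

/-- Both resolvents together form the double integral of `exp (-κr) exp (-κ(r+s)) T_{r+s} f`. For
fixed `r` the integral over `s` is part of `R_κ f`, and the remaining factor integrates to `1/κ`. -/
lemma resolvent_resolvent_le (hη : IsMarkovFamily m η) {κ : ℝ} (hκ : 0 < κ) {f : Space d → ℝ≥0∞}
    (hf : Measurable f) (x : Space d) :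
    resolvent m η κ (resolvent m η (2 * κ) f) x ≤ ENNReal.ofReal κ⁻¹ * resolvent m η κ f x := by
  have hmη := hη.measurable
  have hT : Measurable fun t : ℝ => ∫⁻ w, f (η x t.toNNReal w) ∂m :=
    measurable_lintegral_motion hη hf measurable_const (by fun_prop)
  have e1 : ∀ s ∈ Ioi (0 : ℝ), ENNReal.ofReal (Real.exp (-κ * s)) *
      ∫⁻ w, resolvent m η (2 * κ) f (η x s.toNNReal w) ∂m =
      ∫⁻ r in Ioi (0 : ℝ), ENNReal.ofReal (Real.exp (-κ * r)) *
        (ENNReal.ofReal (Real.exp (-κ * (r + s))) * ∫⁻ w, f (η x (r + s).toNNReal w) ∂m) := by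
    intro s hs
    have hk : Measurable fun p : S × ℝ => ∫⁻ w', f (η (η x s.toNNReal p.1) p.2.toNNReal w') ∂m :=
      measurable_lintegral_motion hη hf (by fun_prop) (by fun_prop)
    simp only [resolvent]
    rw [lintegral_lintegral_swap (by
      simp only [Function.uncurry_def]; exact Measurable.aemeasurable (by fun_prop)),
      ← lintegral_const_mul]
    · refine setLIntegral_congr_fun measurableSet_Ioi fun r hr => ?_
      have hk1 : Measurable fun w => ∫⁻ w', f (η (η x s.toNNReal w) r.toNNReal w') ∂m :=
        measurable_lintegral_motion hη hf (by fun_prop) (by fun_prop)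
      have := lintegral_markov hη x s.toNNReal r.toNNReal (f := fun _ => 1) measurable_const hf
      simp only [one_mul] at this
      rw [lintegral_const_mul _ hk1, ← this, ← Real.toNNReal_add (le_of_lt hs) (le_of_lt hr), add_comm s r,
        ← mul_assoc, ← mul_assoc, ← ENNReal.ofReal_mul (Real.exp_pos _).le,
        ← ENNReal.ofReal_mul (Real.exp_pos _).le, ← Real.exp_add, ← Real.exp_add]
      congr 3
      ring
    · refine Measurable.lintegral_prod_right' (f := fun p : ℝ × S =>
        ENNReal.ofReal (Real.exp (-(2 * κ) * p.1)) *
          ∫⁻ w', f (η (η x s.toNNReal p.2) p.1.toNNReal w') ∂m) ?_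
      have := hk.comp (measurable_swap (α := ℝ) (β := S))
      simp only [Function.comp_def, Prod.swap] at this
      fun_prop
  rw [resolvent, setLIntegral_congr_fun measurableSet_Ioi e1, lintegral_lintegral_swap]
  · calc ∫⁻ r in Ioi (0 : ℝ), ∫⁻ s in Ioi (0 : ℝ), ENNReal.ofReal (Real.exp (-κ * r)) *
        (ENNReal.ofReal (Real.exp (-κ * (r + s))) * ∫⁻ w, f (η x (r + s).toNNReal w) ∂m) ≤
        ∫⁻ r in Ioi (0 : ℝ), ENNReal.ofReal (Real.exp (-κ * r)) * resolvent m η κ f x := by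
          refine setLIntegral_mono' measurableSet_Ioi fun r hr => ?_
          rw [lintegral_const_mul _ (by fun_prop), lintegral_Ioi_shift r fun t =>
            ENNReal.ofReal (Real.exp (-κ * t)) * ∫⁻ w, f (η x t.toNNReal w) ∂m]
          exact mul_le_mul_right (lintegral_mono_set (Ioi_subset_Ioi (le_of_lt hr))) _
      _ = ENNReal.ofReal κ⁻¹ * resolvent m η κ f x := by
          rw [lintegral_mul_const _ (by fun_prop)]
          congr 1
          have h1 := lintegral_exp_tail hκ 0
          simp only [mul_zero, neg_zero, Real.exp_zero] at h1
          have h2 : ∀ r : ℝ, ENNReal.ofReal (Real.exp (-κ * r)) =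
              ENNReal.ofReal κ⁻¹ * ENNReal.ofReal (κ * Real.exp (-(κ * r))) := fun r => by
            rw [← ENNReal.ofReal_mul (by positivity), neg_mul, inv_mul_cancel_left₀ hκ.ne']
          simp_rw [h2]
          rw [lintegral_const_mul _ (by fun_prop), h1]
          simp
  · simp only [Function.uncurry_def]
    exact Measurable.aemeasurable (by fun_prop)

end Resolvent

/-! ### Comparison of exponential moments with the mean occupation. -/

section Comparison

variable {d : ℕ} {S : Type*} [MeasurableSpace S] {m : Measure S}
  {η : Space d → ℝ≥0 → S → Space d} {φ : Space d → ℝ} {V q b : ℝ}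

lemma lintegral_exp_neg_Ioi {κ : ℝ} (hκ : 0 < κ) :
    ∫⁻ r in Ioi (0 : ℝ), ENNReal.ofReal (Real.exp (-κ * r)) = ENNReal.ofReal κ⁻¹ := by
  have h1 := lintegral_exp_tail hκ 0
  simp only [mul_zero, neg_zero, Real.exp_zero] at h1
  have h2 : ∀ r : ℝ, ENNReal.ofReal (Real.exp (-κ * r)) =
      ENNReal.ofReal κ⁻¹ * ENNReal.ofReal (κ * Real.exp (-(κ * r))) := fun r => by
    rw [← ENNReal.ofReal_mul (by positivity), neg_mul, inv_mul_cancel_left₀ hκ.ne']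
  simp_rw [h2]
  rw [lintegral_const_mul _ (by fun_prop), h1]
  simp

/-- The limit of the solution of the one-particle equation, as a Laplace transform. -/
def gain (m : Measure S) (η : Space d → ℝ≥0 → S → Space d) (φ : Space d → ℝ) (V q θ : ℝ)
    (x : Space d) : ℝ := mgf (jTot η φ x) (famLaw m V q) θ - 1

lemma measurable_gain (h : Setting m η φ V q b) (θ : ℝ) : Measurable (gain m η φ V q θ) := by
  have := h.isProb_famLaw
  have hm := measurable_jTot h
  refine Measurable.sub_const ?_ 1
  refine measurable_integral_param (F := fun x z => Real.exp (θ * jTot η φ x z)) ?_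
  simp only [Function.uncurry_def]
  fun_prop

lemma gain_eq_integral (h : Setting m η φ V q b) {θ : ℝ} (hc : θ * b < criticalRate V q)
    (x : Space d) : gain m η φ V q θ x = ∫ z, (Real.exp (θ * jTot η φ x z) - 1) ∂(famLaw m V q) := by
  have := h.isProb_famLaw
  rw [integral_sub (integrable_exp_jTot h hc x) (integrable_const 1), gain, mgf]
  simp

lemma ofReal_gain (h : Setting m η φ V q b) {θ : ℝ} (hθ : 0 ≤ θ) (hc : θ * b < criticalRate V q)
    (x : Space d) : ENNReal.ofReal (gain m η φ V q θ x) =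
      ∫⁻ z, ENNReal.ofReal (Real.exp (θ * jTot η φ x z) - 1) ∂(famLaw m V q) := by
  have := h.isProb_famLaw
  have hi : Integrable (fun z => Real.exp (θ * jTot η φ x z) - 1) (famLaw m V q) :=
    (integrable_exp_jTot h hc x).sub (integrable_const 1)
  rw [gain_eq_integral h hc, ofReal_integral_eq_lintegral_ofReal hi]
  refine ae_of_all _ fun z => ?_
  have := Real.one_le_exp (mul_nonneg hθ (jTot_nonneg (η := η) (φ := φ) x z))
  simp only [Pi.zero_apply]
  linarith

lemma gain_nonneg (h : Setting m η φ V q b) {θ : ℝ} (hθ : 0 ≤ θ) (hc : θ * b < criticalRate V q)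
    (x : Space d) : 0 ≤ gain m η φ V q θ x := by
  rw [gain_eq_integral h hc]
  refine integral_nonneg fun z => ?_
  have := Real.one_le_exp (mul_nonneg hθ (jTot_nonneg (η := η) (φ := φ) x z))
  simp only [Pi.zero_apply]
  linarith

/-- The inequality `2 V q k < Q` makes the absorption constant in `exists_gain_le_meanOcc` smaller
than one. -/
lemma exists_gain_le (h : Setting m η φ V q b) {θ : ℝ} (hθ : 0 < θ) (hc : θ * b < criticalRate V q) :
    ∃ k : ℝ, 0 ≤ k ∧ 2 * (V * q) * k < killRate V q ∧ ∀ x, gain m η φ V q θ x ≤ k := by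
  have := h.isProb_famLaw
  obtain ⟨M, hM1, hMQ, hM⟩ := lintegral_expE_totOcc_le h hθ hc
  refine ⟨M - 1, by linarith, hMQ, fun x => sub_le_sub_right ?_ 1⟩
  rw [mgf, integral_eq_lintegral_of_nonneg_ae (ae_of_all _ fun z => (Real.exp_pos _).le)
    (integrable_exp_jTot h hc x).aestronglyMeasurable]
  refine ENNReal.toReal_le_of_le_ofReal (by linarith) (le_trans ?_ (hM x))
  refine lintegral_mono_ae ?_
  filter_upwards [totOcc_lt_top h x] with z hz
  rw [ofReal_exp_jTot hθ.le hz]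

lemma oneParticle_nonneg (h : Setting m η φ V q b) {θ : ℝ} (hθ : 0 ≤ θ)
    (hc : θ * b < criticalRate V q) (x : Space d) (t : ℝ≥0) :
    0 ≤ oneParticle m η V q φ θ x t := by
  have := h.isProb_famLaw
  have hm := measurable_jOcc h (α := Marks S) (t := fun _ => (t : ℝ)) (f := fun _ => x)
      (z := fun z => z) (by fun_prop) (by fun_prop) (by fun_prop)
  rw [oneParticle_eq h hc, sub_nonneg, laplace_eq_integral h]
  have hi : Integrable (fun z => Real.exp (θ * jOcc η φ t x z)) (famLaw m V q) := by
    refine (integrable_exp_jTot h hc x).mono' (by fun_prop) ?_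
    filter_upwards [totOcc_lt_top h x] with z hz
    rw [Real.norm_eq_abs, Real.abs_exp]
    exact Real.exp_le_exp.2 (mul_le_mul_of_nonneg_left (jOcc_le_jTot hz) hθ)
  calc (1 : ℝ) = ∫ _, 1 ∂(famLaw m V q) := by simp
    _ ≤ _ := integral_mono (integrable_const 1) hi fun z =>
      Real.one_le_exp (mul_nonneg hθ (jOcc_nonneg _ _ _))

lemma oneParticle_le_gain (h : Setting m η φ V q b) {θ : ℝ} (hθ : 0 ≤ θ)
    (hc : θ * b < criticalRate V q) (x : Space d) (t : ℝ≥0) :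
    oneParticle m η V q φ θ x t ≤ gain m η φ V q θ x := by
  simp only [oneParticle_eq h hc, gain, mgf, laplace_eq_integral h]
  refine sub_le_sub_right (integral_mono_of_nonneg (ae_of_all _ fun z => (Real.exp_pos _).le)
    (integrable_exp_jTot h hc x) ?_) 1
  filter_upwards [totOcc_lt_top h x] with z hz
  exact Real.exp_le_exp.2 (mul_le_mul_of_nonneg_left (jOcc_le_jTot hz) hθ)

/-- The right-hand side of the stationary equation. -/
def source (φ : Space d → ℝ) (V q θ : ℝ) (y : Space d) (v : ℝ) : ℝ :=
  θ * φ y + (θ * φ y * v + V * q * v ^ 2)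

lemma source_mono (h : Setting m η φ V q b) {θ : ℝ} (hθ : 0 ≤ θ) (y : Space d) {v v' : ℝ}
    (h0 : 0 ≤ v) (hv : v ≤ v') : source φ V q θ y v ≤ source φ V q θ y v' := by
  have h1 := mul_nonneg hθ (h.nonneg y)
  have h2 := mul_nonneg h.hV.le h.hq0
  have h3 := pow_le_pow_left₀ h0 hv 2
  unfold source
  nlinarith [mul_le_mul_of_nonneg_left hv h1, mul_le_mul_of_nonneg_left h3 h2]

lemma source_nonneg (h : Setting m η φ V q b) {θ : ℝ} (hθ : 0 ≤ θ) (y : Space d) {v : ℝ}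
    (h0 : 0 ≤ v) : 0 ≤ source φ V q θ y v := by
  have h1 := mul_nonneg hθ (h.nonneg y)
  have h2 := mul_nonneg h.hV.le h.hq0
  unfold source
  positivity

lemma measurable_source (h : Setting m η φ V q b) (θ : ℝ) {α : Type*} [MeasurableSpace α]
    {y : α → Space d} {v : α → ℝ} (hy : Measurable y) (hv : Measurable v) :
    Measurable fun a => source φ V q θ (y a) (v a) := by
  have hφ := h.measurable
  unfold source
  fun_prop

/-- The stationary equation. -/
lemma gain_eq_resolvent (h : Setting m η φ V q b) {θ : ℝ} (hθ : 0 < θ)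
    (hc : θ * b < criticalRate V q) (x : Space d) :
    ENNReal.ofReal (gain m η φ V q θ x) = resolvent m η (killRate V q)
      (fun y => ENNReal.ofReal (source φ V q θ y (gain m η φ V q θ y))) x := by
  have := h.prob
  have hη := h.markov
  have hmη := hη.measurable
  have hgm := measurable_gain h θ
  obtain ⟨k, hk0, -, hk⟩ := exists_gain_le h hθ hc
  set v := oneParticle m η V q φ θ with hv
  have hsol : IsOneParticleSolution m η V q φ θ v := by
    rw [hv, oneParticle_eq h hc]
    exact isOneParticleSolution_laplace h hc
  have hvm : Measurable (Function.uncurry v) := hsol.measurable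
  have hv0 : ∀ x t, 0 ≤ v x t := fun x t => oneParticle_nonneg h hθ.le hc x t
  have hvk : ∀ x t, v x t ≤ k := fun x t => (oneParticle_le_gain h hθ.le hc x t).trans (hk x)
  have hva : ∀ x t, |v x t| ≤ k := fun x t => by
    rw [abs_of_nonneg (hv0 x t)]
    exact hvk x t
  set B := source φ V q θ with hB
  set μ := ((volume.restrict (Ioi (0 : ℝ))).prod m) with hμ
  have hBm : ∀ {α : Type _} [MeasurableSpace α] {y : α → Space d} {v : α → ℝ}, Measurable y →
      Measurable v → Measurable fun a => B (y a) (v a) := fun hy hv => measurable_source h θ hy hv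
  have hFm : ∀ n : ℕ, Measurable fun p : ℝ × S => (Iic (n : ℝ)).indicator (fun u =>
      ENNReal.ofReal (Real.exp (-killRate V q * u)) * ENNReal.ofReal (B (η x p.1.toNNReal p.2)
        (v (η x p.1.toNNReal p.2) ((n : ℝ≥0) - p.1.toNNReal)))) p.1 := by
    intro n
    have h1 : Measurable fun p : ℝ × S => v (η x p.1.toNNReal p.2) ((n : ℝ≥0) - p.1.toNNReal) :=
      hvm.comp ((by fun_prop : Measurable fun p : ℝ × S => η x p.1.toNNReal p.2).prodMk (by fun_prop))
    have h2 : Measurable fun p : ℝ × S => B (η x p.1.toNNReal p.2)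
        (v (η x p.1.toNNReal p.2) ((n : ℝ≥0) - p.1.toNNReal)) := measurable_source h θ (by fun_prop) h1
    have h3 : Measurable ((Prod.fst ⁻¹' (Iic (n : ℝ))).indicator fun p : ℝ × S =>
      ENNReal.ofReal (Real.exp (-killRate V q * p.1)) * ENNReal.ofReal (B (η x p.1.toNNReal p.2)
        (v (η x p.1.toNNReal p.2) ((n : ℝ≥0) - p.1.toNNReal)))) :=
      Measurable.indicator (by fun_prop) (measurable_fst measurableSet_Iic)
    exact h3
  have hGm : Measurable fun p : ℝ × S => B (η x p.1.toNNReal p.2) (gain m η φ V q θ (η x p.1.toNNReal p.2)) :=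
    measurable_source h θ (by fun_prop) (by fun_prop)
  have hBk : ∀ y v, 0 ≤ v → v ≤ k → B y v ≤ θ * b + (θ * b * k + V * q * k ^ 2) := by
    intro y v h0 h1
    refine (source_mono h hθ.le y h0 h1).trans ?_
    simp only [source]
    have := mul_le_mul_of_nonneg_left (h.bound y) hθ.le
    have := mul_le_mul_of_nonneg_right this hk0
    linarith
  -- The evolution equation at time `n` is written as one integral over time and path, with the
  -- integrand set to zero after `n`, so that all `n` share the same domain.
  have hint : ∀ n : ℕ, ENNReal.ofReal (v x n) = ∫⁻ p, (Iic (n : ℝ)).indicator (fun u =>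
      ENNReal.ofReal (Real.exp (-killRate V q * u)) * ENNReal.ofReal (B (η x p.1.toNNReal p.2)
        (v (η x p.1.toNNReal p.2) ((n : ℝ≥0) - p.1.toNNReal)))) p.1 ∂μ := by
    intro n
    have e1 := equation_iff h hvm (θ := θ) (n : ℝ≥0) (fun s _ y => hva y s) x
    have hBn : Measurable fun p : ℝ × Space d => B p.2 (v p.2 ((n : ℝ≥0) - p.1.toNNReal)) :=
      measurable_source h θ measurable_snd
        (hvm.comp (by fun_prop : Measurable fun p : ℝ × Space d => (p.2, (n : ℝ≥0) - p.1.toNNReal)))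
    have hsm : Measurable fun u : ℝ => semigroup m η u.toNNReal
        (fun y => B y (v y ((n : ℝ≥0) - u.toNNReal))) x :=
      measurable_semigroup hη measurable_const (by fun_prop) hBn
    have hs0 : ∀ u : ℝ, 0 ≤ semigroup m η u.toNNReal (fun y => B y (v y ((n : ℝ≥0) - u.toNNReal))) x :=
      fun u => integral_nonneg fun w => source_nonneg h hθ.le _ (hv0 _ _)
    rw [hsol.equation, e1, intervalIntegral.integral_of_le (NNReal.coe_nonneg _),
      ofReal_integral_eq_lintegral_ofReal]
    · rw [hμ, lintegral_prod _ (hFm n).aemeasurable, ← lintegral_indicator measurableSet_Ioi,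
        ← lintegral_indicator measurableSet_Ioc]
      refine lintegral_congr fun u => ?_
      by_cases hu : u ∈ Ioi (0 : ℝ)
      · by_cases hun : u ∈ Iic (n : ℝ)
        · rw [indicator_of_mem hu, indicator_of_mem (show u ∈ Ioc (0 : ℝ) (n : ℝ≥0) from ⟨hu, by simpa using hun⟩)]
          simp only [indicator_of_mem hun]
          have hBw : Measurable fun w => B (η x u.toNNReal w) (v (η x u.toNNReal w) ((n : ℝ≥0) - u.toNNReal)) :=
            hBn.comp (by fun_prop : Measurable fun w => (u, η x u.toNNReal w))
          rw [lintegral_const_mul _ (by fun_prop), ENNReal.ofReal_mul (Real.exp_pos _).le]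
          congr 1
          refine ofReal_integral_eq_lintegral_ofReal (integrable_of_bounded' hBw
            (K := θ * b + (θ * b * k + V * q * k ^ 2)) fun w => ?_)
            (ae_of_all _ fun w => source_nonneg h hθ.le _ (hv0 _ _))
          change |source φ V q θ _ (v _ _)| ≤ _
          rw [abs_of_nonneg (source_nonneg h hθ.le _ (hv0 _ _))]
          exact hBk _ _ (hv0 _ _) (hvk _ _)
        · rw [indicator_of_mem hu, indicator_of_notMem (fun h' => hun (by simpa using h'.2))]
          simp only [indicator_of_notMem hun]
          simp
      · rw [indicator_of_notMem hu, indicator_of_notMem (fun h' => hu h'.1)]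
    · refine (intervalIntegrable_iff_integrableOn_Ioc_of_le (NNReal.coe_nonneg _)).1 ?_
      refine IntervalIntegrable.continuousOn_mul (g := fun u : ℝ => Real.exp (-killRate V q * u))
        (intervalIntegrable_of_bounded (K := θ * b + (θ * b * k + V * q * k ^ 2)) hsm (fun u =>
          abs_semigroup_le (fun y => ?_) _ _) _ _) (by fun_prop)
      rw [abs_of_nonneg (source_nonneg h hθ.le _ (hv0 _ _))]
      exact hBk _ _ (hv0 _ _) (hvk _ _)
    · exact ae_of_all _ fun u => mul_nonneg (Real.exp_pos _).le (hs0 u)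
  have hres : resolvent m η (killRate V q)
      (fun y => ENNReal.ofReal (B y (gain m η φ V q θ y))) x =
      ∫⁻ p, ENNReal.ofReal (Real.exp (-killRate V q * p.1)) * ENNReal.ofReal (B (η x p.1.toNNReal p.2)
        (gain m η φ V q θ (η x p.1.toNNReal p.2))) ∂μ := by
    rw [hμ, lintegral_prod _ (by fun_prop), resolvent]
    refine lintegral_congr fun u => ?_
    have : Measurable fun w => B (η x u.toNNReal w) (gain m η φ V q θ (η x u.toNNReal w)) :=
      measurable_source h θ (by fun_prop) (by fun_prop)
    exact (lintegral_const_mul _ this.ennreal_ofReal).symm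
  have hfin : ∫⁻ p, ENNReal.ofReal (Real.exp (-killRate V q * p.1)) * ENNReal.ofReal (B (η x p.1.toNNReal p.2)
        (gain m η φ V q θ (η x p.1.toNNReal p.2))) ∂μ ≠ ∞ := by
    refine ((lintegral_mono fun p => mul_le_mul_right (ENNReal.ofReal_le_ofReal
      (hBk _ _ (gain_nonneg h hθ.le hc _) (hk _))) _).trans_lt ?_).ne
    rw [lintegral_mul_const _ (by fun_prop), hμ, lintegral_prod _ (by fun_prop)]
    simp only [lintegral_const, measure_univ, mul_one]
    rw [lintegral_exp_neg_Ioi h.killRate_pos]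
    exact ENNReal.mul_lt_top ENNReal.ofReal_lt_top ENNReal.ofReal_lt_top
  have hlim1 : Tendsto (fun n : ℕ => ENNReal.ofReal (v x n)) atTop
      (𝓝 (ENNReal.ofReal (gain m η φ V q θ x))) :=
    ENNReal.tendsto_ofReal ((tendsto_oneParticle h hc x).comp
      (tendsto_natCast_atTop_atTop (R := ℝ≥0)))
  rw [hres]
  -- Letting `n → ∞` in the evolution equation is dominated by the limiting integrand itself: the
  -- solution lies below `gain`, and the source term is monotone.
  refine tendsto_nhds_unique hlim1 ?_
  simp_rw [hint]
  refine tendsto_lintegral_of_dominated_convergence _ hFm (fun n => ae_of_all _ fun p => ?_) hfin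
    (ae_of_all _ fun p => ?_)
  · simp only [indicator]
    split_ifs
    · exact mul_le_mul_right (ENNReal.ofReal_le_ofReal (source_mono h hθ.le _ (hv0 _ _)
        (oneParticle_le_gain h hθ.le hc _ _))) _
    · exact zero_le
  · have h1 : Tendsto (fun n : ℕ => (n : ℝ≥0) - p.1.toNNReal) atTop atTop := by
      refine tendsto_atTop.2 fun c => ?_
      filter_upwards [(tendsto_natCast_atTop_atTop (R := ℝ≥0)).eventually_ge_atTop (c + p.1.toNNReal)] with n hn
      exact le_tsub_of_add_le_right hn
    have h2 := (tendsto_oneParticle h hc (η x p.1.toNNReal p.2)).comp h1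
    have h3 : Continuous (B (η x p.1.toNNReal p.2)) := by
      change Continuous fun v => source φ V q θ (η x p.1.toNNReal p.2) v
      unfold source
      fun_prop
    have h4 := (ENNReal.tendsto_ofReal ((h3.tendsto _).comp h2))
    refine (ENNReal.Tendsto.const_mul h4 (Or.inr ENNReal.ofReal_ne_top)).congr' ?_
    filter_upwards [(tendsto_natCast_atTop_atTop (R := ℝ)).eventually_ge_atTop p.1] with n hn
    rw [indicator_of_mem (show p.1 ∈ Iic (n : ℝ) from hn)]
    rfl

/-- The mean occupation `U = R_Q φ`. -/
def meanOcc (m : Measure S) (η : Space d → ℝ≥0 → S → Space d) (φ : Space d → ℝ) (V q : ℝ)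
    (x : Space d) : ℝ≥0∞ := resolvent m η (killRate V q) (fun y => ENNReal.ofReal (φ y)) x

lemma meanOcc_le_gain (h : Setting m η φ V q b) {θ : ℝ} (hθ : 0 < θ)
    (hc : θ * b < criticalRate V q) (x : Space d) :
    ENNReal.ofReal θ * meanOcc m η φ V q x ≤ ENNReal.ofReal (gain m η φ V q θ x) := by
  have := h.prob
  have hφ := h.measurable
  rw [gain_eq_resolvent h hθ hc, meanOcc, ← resolvent_const_mul h.markov _ _ (by fun_prop)]
  refine resolvent_mono _ (fun y => ?_) x
  rw [← ENNReal.ofReal_mul hθ.le]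
  refine ENNReal.ofReal_le_ofReal ?_
  have h1 := mul_nonneg hθ.le (h.nonneg y)
  have h2 := mul_nonneg h.hV.le h.hq0
  have h3 := gain_nonneg h hθ.le hc y
  unfold source
  have : 0 ≤ θ * φ y * gain m η φ V q θ y + V * q * gain m η φ V q θ y ^ 2 := by positivity
  linarith

/-- Write `v = R_Q g` for the stationary equation, with `0 ≤ v ≤ k`. Then `v² ≤ 2 R_{2Q}(g v) ≤ 2k
R_{2Q} g`, and applying `R_Q` gives `R_Q(v²) ≤ (2k/Q) v`. The quadratic term of the equation is
therefore at most `ρ v` with `ρ = 2 V q k / Q < 1` and can be absorbed, leaving a multiple of `R_Q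
φ`. -/
lemma exists_gain_le_meanOcc (h : Setting m η φ V q b) {θ : ℝ} (hθ : 0 < θ)
    (hc : θ * b < criticalRate V q) :
    ∃ C : ℝ, 0 < C ∧ ∀ x, ENNReal.ofReal (gain m η φ V q θ x) ≤
      ENNReal.ofReal C * meanOcc m η φ V q x := by
  have := h.prob
  have hη := h.markov
  have hφ := h.measurable
  have hQ := h.killRate_pos
  have hV := h.hV
  have hq0 := h.hq0
  have hgm := measurable_gain h θ
  obtain ⟨k, hk0, hkQ, hk⟩ := exists_gain_le h hθ hc
  set Q := killRate V q with hQd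
  set v : Space d → ℝ≥0∞ := fun x => ENNReal.ofReal (gain m η φ V q θ x) with hv
  set g : Space d → ℝ≥0∞ := fun y => ENNReal.ofReal (source φ V q θ y (gain m η φ V q θ y)) with hg
  have hvm : Measurable v := by fun_prop
  have hsm : Measurable g := (measurable_source h θ measurable_id hgm).ennreal_ofReal
  have hvR : resolvent m η Q g = v := funext fun x => (gain_eq_resolvent h hθ hc x).symm
  have hvk : ∀ x, v x ≤ ENNReal.ofReal k := fun x => ENNReal.ofReal_le_ofReal (hk x)
  have h1 : ∀ x, v x ^ 2 ≤ 2 * ENNReal.ofReal k * resolvent m η (2 * Q) g x := by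
    intro x
    have e := sq_resolvent_le hη Q hsm x
    rw [hvR] at e
    refine e.trans ?_
    rw [mul_assoc, ← resolvent_const_mul hη _ _ hsm]
    refine mul_le_mul_right (resolvent_mono _ (fun y => ?_) x) _
    rw [mul_comm]
    exact mul_le_mul_left (hvk y) _
  have h2 : ∀ x, resolvent m η Q (fun y => v y ^ 2) x ≤
      2 * ENNReal.ofReal k * (ENNReal.ofReal Q⁻¹ * v x) := by
    intro x
    refine (resolvent_mono _ h1 x).trans ?_
    rw [resolvent_const_mul hη _ _ (measurable_resolvent hη _ hsm), ← hvR]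
    exact mul_le_mul_right (resolvent_resolvent_le hη hQ hsm x) _
  have h3 : ∀ y, g y ≤ ENNReal.ofReal (θ * (1 + k)) * ENNReal.ofReal (φ y) +
      ENNReal.ofReal (V * q) * v y ^ 2 := by
    intro y
    have h0 := gain_nonneg h hθ.le hc y
    have hφ0 := h.nonneg y
    rw [← ENNReal.ofReal_pow h0, ← ENNReal.ofReal_mul (by positivity), ← ENNReal.ofReal_mul (by positivity),
      ← ENNReal.ofReal_add (by positivity) (by positivity)]
    refine ENNReal.ofReal_le_ofReal ?_
    unfold source
    have := mul_le_mul_of_nonneg_left (hk y) (mul_nonneg hθ.le hφ0)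
    linarith
  set ρ := 2 * (V * q) * k / Q with hρ
  have hρ0 : 0 ≤ ρ := by positivity
  have hρ1 : ρ < 1 := (div_lt_one hQ).2 hkQ
  have h4 : ∀ x, v x ≤ ENNReal.ofReal (θ * (1 + k)) * meanOcc m η φ V q x + ENNReal.ofReal ρ * v x := by
    intro x
    calc v x = resolvent m η Q g x := by rw [hvR]
      _ ≤ resolvent m η Q (fun y => ENNReal.ofReal (θ * (1 + k)) * ENNReal.ofReal (φ y) +
          ENNReal.ofReal (V * q) * v y ^ 2) x := resolvent_mono _ h3 x
      _ = ENNReal.ofReal (θ * (1 + k)) * meanOcc m η φ V q x +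
          ENNReal.ofReal (V * q) * resolvent m η Q (fun y => v y ^ 2) x := by
        rw [resolvent_add hη _ (by fun_prop), resolvent_const_mul hη _ _ (by fun_prop),
          resolvent_const_mul hη _ _ (by fun_prop)]
        rfl
      _ ≤ _ := by
        refine add_le_add le_rfl ((mul_le_mul_right (h2 x) _).trans (le_of_eq ?_))
        have : ENNReal.ofReal ρ = ENNReal.ofReal (V * q) * (2 * ENNReal.ofReal k * ENNReal.ofReal Q⁻¹) := by
          have h2' : (2 : ℝ≥0∞) = ENNReal.ofReal 2 := by simp
          rw [h2', ← ENNReal.ofReal_mul (by norm_num), ← ENNReal.ofReal_mul (by positivity),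
            ← ENNReal.ofReal_mul (by positivity)]
          congr 1
          rw [hρ]
          ring
        rw [this]
        ring
  -- The constant solves `v ≤ θ (1 + k) U + ρ v` for `v`.
  refine ⟨θ * (1 + k) / (1 - ρ), div_pos (by positivity) (by linarith), fun x => ?_⟩
  by_cases hU : meanOcc m η φ V q x = ∞
  · rw [hU, ENNReal.mul_top]
    · exact le_top
    · rw [Ne, ENNReal.ofReal_eq_zero, not_le]
      exact div_pos (by positivity) (by linarith)
  · have h0 := gain_nonneg h hθ.le hc x
    have h5 := h4 x
    have hu := ENNReal.ofReal_toReal hU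
    have hu0 : 0 ≤ (meanOcc m η φ V q x).toReal := ENNReal.toReal_nonneg
    rw [← hu] at h5 ⊢
    simp only [hv] at h5
    rw [← ENNReal.ofReal_mul (by positivity), ← ENNReal.ofReal_mul (by positivity),
      ← ENNReal.ofReal_add (by positivity) (by positivity), ENNReal.ofReal_le_ofReal_iff (by positivity)] at h5
    rw [← ENNReal.ofReal_mul (div_pos (by positivity) (by linarith)).le]
    refine ENNReal.ofReal_le_ofReal ?_
    rw [div_mul_eq_mul_div, le_div_iff₀ (by linarith)]
    linarith

/-- `x - 1 - (1 - x⁻¹) ≤ 2 (x ^ n - 1) / (n (n - 1))` for `x ≥ 1`. -/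
lemma sub_le_pow_sub {x : ℝ} (hx : 1 ≤ x) {n : ℕ} (hn : 2 ≤ n) :
    x - 1 - 2 / (n * (n - 1)) * (x ^ n - 1) ≤ 1 - x⁻¹ := by
  have hx0 : 0 < x := by linarith
  have hn' : (2 : ℝ) ≤ n := by exact_mod_cast hn
  -- A Bernoulli inequality keeping the second-order term; the induction step uses the ordinary one.
  have hpow : ∀ n : ℕ, 1 + (n : ℝ) * (n - 1) / 2 * (x - 1) ^ 2 ≤ x ^ n := by
    intro n
    induction n with
    | zero => simp
    | succ n ih =>
      rw [pow_succ x n]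
      push_cast
      have hb : 1 + (n : ℝ) * (x - 1) ≤ x ^ n := by
        have := one_add_mul_le_pow (a := x - 1) (by linarith) n
        simpa using this
      nlinarith [mul_le_mul_of_nonneg_left hb (sub_nonneg.2 hx)]
  have h1 : (x - 1) ^ 2 ≤ 2 / (n * (n - 1)) * (x ^ n - 1) := by
    have h2 : (0 : ℝ) < n * (n - 1) := mul_pos (by linarith) (by linarith)
    rw [div_mul_eq_mul_div, le_div_iff₀ h2]
    have := hpow n
    linarith
  have h3 : x - 1 - (1 - x⁻¹) = (x - 1) ^ 2 * x⁻¹ := by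
    field_simp
  have h4 : (x - 1) ^ 2 * x⁻¹ ≤ (x - 1) ^ 2 :=
    mul_le_of_le_one_right (sq_nonneg _) (inv_le_one_of_one_le₀ hx)
  linarith

/-- The mean occupation is controlled by the Laplace transform at a small negative parameter. -/
lemma exists_meanOcc_le (h : Setting m η φ V q b) :
    ∃ ε C : ℝ, 0 < ε ∧ ε ≤ 1 ∧ 0 < C ∧ ∀ x, meanOcc m η φ V q x ≤
      ENNReal.ofReal C * ∫⁻ z, ENNReal.ofReal (1 - Real.exp (-(ε * jTot η φ x z))) ∂(famLaw m V q) := by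
  have := h.isProb_famLaw
  obtain ⟨θ, hθ, hc⟩ := exists_subcritical h
  obtain ⟨C, hC0, hC⟩ := exists_gain_le_meanOcc h hθ hc
  -- With `ε = θ / n` and `x = exp (ε J)` one has `x ^ n = exp (θ J)`. The condition `4C/θ < n - 1`
  -- makes the second-order error `2C/(n(n-1)) U` at most `(ε/2) U`, half of the lower bound `ε U`
  -- for the gain at `ε`. The condition `θ ≤ n` ensures `ε ≤ 1`.
  obtain ⟨N, hN⟩ := exists_nat_gt (max (4 * C / θ + 1) θ)
  set n := N + 2 with hn
  have hn2 : 2 ≤ n := by omega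
  have hnR : (2 : ℝ) ≤ n := by exact_mod_cast hn2
  have hNn : (N : ℝ) < n := by exact_mod_cast (by omega : N < n)
  have hn1 : 4 * C / θ < n - 1 := by
    have := (le_max_left _ _).trans_lt hN
    linarith
  have hnθ : θ ≤ n := ((le_max_right _ _).trans hN.le).trans hNn.le
  set ε := θ / n with hε
  have hε0 : 0 < ε := by positivity
  have hε1 : ε ≤ 1 := (div_le_one (by linarith)).2 hnθ
  have hεθ : ε * n = θ := by
    rw [hε]
    field_simp
  have hcε : ε * b < criticalRate V q := by
    refine lt_of_le_of_lt (mul_le_mul_of_nonneg_right ?_ h.pos.le) hc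
    rw [hε, div_le_iff₀ (by linarith)]
    nlinarith
  refine ⟨ε, 2 / ε, hε0, hε1, by positivity, fun x => ?_⟩
  have hUfin : meanOcc m η φ V q x ≠ ∞ := by
    intro hU
    have := meanOcc_le_gain h hθ hc x
    rw [hU, ENNReal.mul_top (by simpa using hθ), top_le_iff] at this
    exact ENNReal.ofReal_ne_top this
  have hu := ENNReal.ofReal_toReal hUfin
  have hu0 : 0 ≤ (meanOcc m η φ V q x).toReal := ENNReal.toReal_nonneg
  set u := (meanOcc m η φ V q x).toReal with hud
  have hi1 := integrable_exp_jTot h hcε x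
  have hi2 := integrable_exp_jTot h hc x
  have hi3 : Integrable (fun z => Real.exp (-(ε * jTot η φ x z))) (famLaw m V q) := by
    have hm := measurable_jTot_right h x
    refine (integrable_const (1 : ℝ)).mono' (by fun_prop) (ae_of_all _ fun z => ?_)
    rw [Real.norm_eq_abs, Real.abs_exp]
    exact Real.exp_le_one_iff.2 (by have := mul_nonneg hε0.le (jTot_nonneg (η := η) (φ := φ) x z); linarith)
  have key : gain m η φ V q ε x - 2 / (n * (n - 1)) * gain m η φ V q θ x ≤
      ∫ z, (1 - Real.exp (-(ε * jTot η φ x z))) ∂(famLaw m V q) := by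
    rw [gain_eq_integral h hcε, gain_eq_integral h hc, ← integral_const_mul, ← integral_sub]
    · refine integral_mono ?_ ?_ fun z => ?_
      · exact (hi1.sub (integrable_const 1)).sub ((hi2.sub (integrable_const 1)).const_mul _)
      · exact (integrable_const 1).sub hi3
      · have := sub_le_pow_sub (Real.one_le_exp (mul_nonneg hε0.le (jTot_nonneg (η := η) (φ := φ) x z))) hn2
        rw [← Real.exp_nat_mul, ← Real.exp_neg] at this
        have e : (n : ℝ) * (ε * jTot η φ x z) = θ * jTot η φ x z := by
          rw [← hεθ]
          ring
        rw [e] at this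
        exact this
    · exact hi1.sub (integrable_const 1)
    · exact (hi2.sub (integrable_const 1)).const_mul _
  have h1 : ε * u ≤ gain m η φ V q ε x := by
    have := meanOcc_le_gain h hε0 hcε x
    rwa [← hu, ← ENNReal.ofReal_mul hε0.le, ENNReal.ofReal_le_ofReal_iff (gain_nonneg h hε0.le hcε x)] at this
  have h2 : gain m η φ V q θ x ≤ C * u := by
    have := hC x
    rwa [← hu, ← ENNReal.ofReal_mul hC0.le, ENNReal.ofReal_le_ofReal_iff (by positivity)] at this
  have h3 : 2 / (n * (n - 1)) * (C * u) ≤ ε / 2 * u := by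
    rw [← mul_assoc]
    refine mul_le_mul_of_nonneg_right ?_ hu0
    have h4 : (0 : ℝ) < n - 1 := by linarith
    rw [hε, div_mul_eq_mul_div, div_div, div_le_div_iff₀ (by positivity) (by positivity)]
    rw [div_lt_iff₀ hθ] at hn1
    nlinarith
  have h5 : 2 / ((n : ℝ) * (n - 1)) * gain m η φ V q θ x ≤ 2 / (n * (n - 1)) * (C * u) :=
    mul_le_mul_of_nonneg_left h2 (div_nonneg (by norm_num) (mul_nonneg (by linarith) (by linarith)))
  have h6 : ε / 2 * u ≤ ∫ z, (1 - Real.exp (-(ε * jTot η φ x z))) ∂(famLaw m V q) := by linarith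
  have hi4 : Integrable (fun z => 1 - Real.exp (-(ε * jTot η φ x z))) (famLaw m V q) :=
    (integrable_const 1).sub hi3
  rw [← ofReal_integral_eq_lintegral_ofReal hi4, ← hu,
    ← ENNReal.ofReal_mul (by positivity)]
  · refine ENNReal.ofReal_le_ofReal ?_
    rw [div_mul_eq_mul_div, le_div_iff₀ hε0]
    linarith
  · refine ae_of_all _ fun z => ?_
    simp only [Pi.zero_apply, sub_nonneg, Real.exp_le_one_iff]
    have := mul_nonneg hε0.le (jTot_nonneg (η := η) (φ := φ) x z)
    linarith

/-- The product of Lebesgue measure and the law of the marks of a family. -/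
def famMeasure (m : Measure S) (V q : ℝ) : Measure (Space d × (Marks S)) :=
  (volume : Measure (Space d)).prod (famLaw m V q)

/-- Either the total occupation has a non-integrable Laplace functional, or it has all subcritical
exponential moments. -/
lemma integrable_exp_sub_one (h : Setting m η φ V q b)
    (hfin : ∫⁻ p : Space d × (Marks S), ENNReal.ofReal (1 - Real.exp (-jTot η φ p.1 p.2))
      ∂(famMeasure m V q) ≠ ∞) {θ : ℝ} (hc : θ * b < criticalRate V q) :
    Integrable (fun p : Space d × (Marks S) => Real.exp (θ * jTot η φ p.1 p.2) - 1)
      (famMeasure m V q) := by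
  have := h.isProb_famLaw
  have hm := measurable_jTot h
  refine ⟨by fun_prop, ?_⟩
  rw [hasFiniteIntegral_iff_norm]
  -- For `θ ≤ 0`, Bernoulli's inequality gives `1 - exp (-n J) ≤ n (1 - exp (-J))` with an integer
  -- `n ≥ -θ`.
  rcases le_or_gt θ 0 with hθ | hθ
  · obtain ⟨n, hn⟩ := exists_nat_ge (-θ)
    refine lt_of_le_of_lt (b := ∫⁻ p : Space d × (Marks S), (n : ℝ≥0∞) * ENNReal.ofReal
      (1 - Real.exp (-jTot η φ p.1 p.2)) ∂(famMeasure m V q)) ?_ ?_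
    · refine lintegral_mono fun p => ?_
      have h0 := jTot_nonneg (η := η) (φ := φ) p.1 p.2
      rw [← ENNReal.ofReal_natCast, ← ENNReal.ofReal_mul (by positivity)]
      refine ENNReal.ofReal_le_ofReal ?_
      rw [Real.norm_eq_abs, abs_sub_comm, abs_of_nonneg (by
        rw [sub_nonneg, Real.exp_le_one_iff]; exact mul_nonpos_of_nonpos_of_nonneg hθ h0)]
      have h1 := one_add_mul_le_pow (a := Real.exp (-jTot η φ p.1 p.2) - 1)
        (by have := Real.exp_pos (-jTot η φ p.1 p.2); linarith) n
      rw [add_sub_cancel, ← Real.exp_nat_mul] at h1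
      have h2 : Real.exp (n * -jTot η φ p.1 p.2) ≤ Real.exp (θ * jTot η φ p.1 p.2) :=
        Real.exp_le_exp.2 (by nlinarith)
      linarith
    · rw [lintegral_const_mul _ (by fun_prop)]
      exact ENNReal.mul_lt_top (ENNReal.natCast_lt_top n) hfin.lt_top
  -- For `θ > 0` the gain is bounded by the mean occupation, which is bounded by the Laplace
  -- functional at `ε ≤ 1`, and this is at most the one at `1`.
  · obtain ⟨C, hC0, hC⟩ := exists_gain_le_meanOcc h hθ hc
    obtain ⟨ε, C', hε, hε1, hC'0, hC'⟩ := exists_meanOcc_le h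
    have e1 : ∀ p : Space d × (Marks S), ENNReal.ofReal ‖Real.exp (θ * jTot η φ p.1 p.2) - 1‖ =
        ENNReal.ofReal (Real.exp (θ * jTot η φ p.1 p.2) - 1) := fun p => by
      have := Real.one_le_exp (mul_nonneg hθ.le (jTot_nonneg (η := η) (φ := φ) p.1 p.2))
      rw [Real.norm_eq_abs, abs_of_nonneg (by linarith)]
    simp_rw [e1]
    rw [famMeasure, lintegral_prod _ (by fun_prop)]
    simp_rw [← ofReal_gain h hθ.le hc]
    rw [famMeasure, lintegral_prod _ (by fun_prop)] at hfin
    refine lt_of_le_of_lt (b := ∫⁻ x, ENNReal.ofReal C * (ENNReal.ofReal C' *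
      ∫⁻ z, ENNReal.ofReal (1 - Real.exp (-(jTot η φ x z))) ∂(famLaw m V q))) ?_ ?_
    · refine lintegral_mono fun x => (hC x).trans (mul_le_mul_right ((hC' x).trans
        (mul_le_mul_right (lintegral_mono fun z => ENNReal.ofReal_le_ofReal ?_) _)) _)
      have h0 := jTot_nonneg (η := η) (φ := φ) x z
      have : Real.exp (-jTot η φ x z) ≤ Real.exp (-(ε * jTot η φ x z)) :=
        Real.exp_le_exp.2 (by nlinarith)
      linarith
    · have hm2 : Measurable fun x => ∫⁻ z, ENNReal.ofReal (1 - Real.exp (-(jTot η φ x z))) ∂(famLaw m V q) :=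
        Measurable.lintegral_prod_right' (f := fun p : Space d × (Marks S) =>
          ENNReal.ofReal (1 - Real.exp (-(jTot η φ p.1 p.2)))) (by fun_prop)
      rw [lintegral_const_mul _ (by fun_prop), lintegral_const_mul _ hm2]
      exact ENNReal.mul_lt_top ENNReal.ofReal_lt_top (ENNReal.mul_lt_top ENNReal.ofReal_lt_top hfin.lt_top)

end Comparison

/-! ### Exponential formula for Poisson fields: simple functions. -/

variable {Ω : Type*} [MeasurableSpace Ω] {X : Type*} [MeasurableSpace X] {P : Measure Ω}
  {ξ : ℕ → Ω → X} {Λ : Measure X}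

lemma IsPoissonField.measurable_count (h : IsPoissonField P ξ Λ) {B : Set X}
    (hB : MeasurableSet B) : Measurable fun ω => {n | ξ n ω ∈ B}.encard :=
  measurable_encard.comp (measurable_set_iff.2 fun n => (h.measurable n) hB |>.mem)

/-- The hypothesis `count_law` fixes only the masses of finite values. The Poisson law already has
total mass one, so no mass is left at infinity. -/
lemma IsPoissonField.map_count [IsProbabilityMeasure P] (h : IsPoissonField P ξ Λ) {B : Set X}
    (hB : MeasurableSet B) (hΛ : Λ B ≠ ∞) :
    P.map (fun ω => {n | ξ n ω ∈ B}.encard)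
      = (poissonMeasure (Λ B).toNNReal).map (Nat.cast : ℕ → ℕ∞) := by
  have hm := h.measurable_count hB
  have he : MeasurableEmbedding (Nat.cast : ℕ → ℕ∞) :=
    ⟨Nat.cast_injective, measurable_from_top, fun _ _ => MeasurableSpace.measurableSet_top⟩
  have := Measure.isProbabilityMeasure_map (μ := P) hm.aemeasurable
  have := Measure.isProbabilityMeasure_map (μ := poissonMeasure (Λ B).toNNReal)
    (f := (Nat.cast : ℕ → ℕ∞)) measurable_from_top.aemeasurable
  symm
  refine Measure.eq_of_le_of_isProbabilityMeasure ?_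
  have e : poissonMeasure (Λ B).toNNReal
      = (P.map (fun ω => {n | ξ n ω ∈ B}.encard)).comap (Nat.cast : ℕ → ℕ∞) := by
    refine Measure.ext_of_singleton fun k => ?_
    rw [he.comap_apply, Measure.map_apply hm MeasurableSpace.measurableSet_top,
      ← h.count_law B hB hΛ k, image_singleton]
    rfl
  rw [e, he.map_comap]
  exact Measure.restrict_le_self

lemma lintegral_exp_poissonMeasure (r : ℝ≥0) (c : ℝ) :
    ∫⁻ k : ℕ, ENNReal.ofReal (Real.exp (c * k)) ∂poissonMeasure r
      = ENNReal.ofReal (Real.exp (r * (Real.exp c - 1))) := by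
  have hs : HasSum (fun n : ℕ => Real.exp (-r) * ((r * Real.exp c) ^ n / n.factorial))
      (Real.exp (-r) * Real.exp (r * Real.exp c)) := by
    have := (NormedSpace.expSeries_div_hasSum_exp ((r : ℝ) * Real.exp c)).mul_left (Real.exp (-r))
    rwa [← Real.exp_eq_exp_ℝ] at this
  rw [lintegral_countable', show Real.exp (r * (Real.exp c - 1))
    = Real.exp (-r) * Real.exp (r * Real.exp c) by rw [← Real.exp_add]; ring_nf, ← hs.tsum_eq,
    ENNReal.ofReal_tsum_of_nonneg (fun n => by positivity) hs.summable]
  refine tsum_congr fun n => ?_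
  rw [poissonMeasure_singleton, ← ENNReal.ofReal_mul (by positivity), mul_comm c, Real.exp_nat_mul]
  congr 1
  ring

lemma expE_coe (a : ℝ≥0) : expE a = ENNReal.ofReal (Real.exp a) := by
  rw [← expE_ofReal a.coe_nonneg, ENNReal.ofReal_coe_nnreal]

lemma negE_coe (a : ℝ≥0) : negE a = ENNReal.ofReal (Real.exp (-a)) := by
  rw [← negE_ofReal a.coe_nonneg, ENNReal.ofReal_coe_nnreal]

lemma lintegral_expE_poissonMeasure (r : ℝ≥0) {a : ℝ≥0∞} (ha : a ≠ ∞) :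
    ∫⁻ k : ℕ, expE (a * k) ∂poissonMeasure r = expE ((expE a - 1) * r) := by
  lift a to ℝ≥0 using ha
  have h := lintegral_exp_poissonMeasure r a
  have e (k : ℕ) : expE (a * k) = ENNReal.ofReal (Real.exp (a * k)) := by
    simpa using expE_coe (a * k)
  simp only [e]
  rw [h, expE_coe, ← ENNReal.ofReal_one, ← ENNReal.ofReal_sub _ zero_le_one,
    ← ENNReal.ofReal_coe_nnreal, ← ENNReal.ofReal_mul (by simp), expE_ofReal, mul_comm]
  exact mul_nonneg (by simp) r.2

lemma lintegral_negE_poissonMeasure (r : ℝ≥0) {a : ℝ≥0∞} (ha : a ≠ ∞) :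
    ∫⁻ k : ℕ, negE (a * k) ∂poissonMeasure r = negE ((1 - negE a) * r) := by
  lift a to ℝ≥0 using ha
  have h := lintegral_exp_poissonMeasure r (-a)
  have e (k : ℕ) : negE (a * k) = ENNReal.ofReal (Real.exp (-a * k)) := by
    simpa using negE_coe (a * k)
  simp only [e]
  rw [h, negE_coe, ← ENNReal.ofReal_one, ← ENNReal.ofReal_sub _ (by positivity),
    ← ENNReal.ofReal_coe_nnreal, ← ENNReal.ofReal_mul (by simp), negE_ofReal]
  · congr 2; ring
  · exact mul_nonneg (by simp) r.2

lemma IsPoissonField.lintegral_count [IsProbabilityMeasure P] (h : IsPoissonField P ξ Λ) {B : Set X}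
    (hB : MeasurableSet B) (hΛ : Λ B ≠ ∞) (G : ℕ∞ → ℝ≥0∞) :
    ∫⁻ ω, G {n | ξ n ω ∈ B}.encard ∂P = ∫⁻ k : ℕ, G k ∂poissonMeasure (Λ B).toNNReal := by
  rw [← lintegral_map (f := G) measurable_from_top (h.measurable_count hB), h.map_count hB hΛ,
    lintegral_map measurable_from_top measurable_from_top]

lemma IsPoissonField.lintegral_exp_count [IsProbabilityMeasure P] (h : IsPoissonField P ξ Λ)
    {B : Set X} (hB : MeasurableSet B) (hΛ : Λ B ≠ ∞) {a b : ℝ≥0∞} (ha : a ≠ ∞) (hb : b ≠ ∞)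
    (hab : a = 0 ∨ b = 0) :
    ∫⁻ ω, expE (a * ({n | ξ n ω ∈ B}.encard : ℝ≥0∞)) * negE (b * ({n | ξ n ω ∈ B}.encard : ℝ≥0∞)) ∂P
      = expE ((expE a - 1) * Λ B) * negE ((1 - negE b) * Λ B) := by
  rw [h.lintegral_count hB hΛ (fun j => expE (a * (j : ℝ≥0∞)) * negE (b * (j : ℝ≥0∞))),
    ← ENNReal.coe_toNNReal hΛ]
  rcases hab with rfl | rfl
  · simpa using lintegral_negE_poissonMeasure _ hb
  · simpa using lintegral_expE_poissonMeasure _ ha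

lemma expE_sum {ι : Type*} (s : Finset ι) (f : ι → ℝ≥0∞) :
    expE (∑ i ∈ s, f i) = ∏ i ∈ s, expE (f i) := by
  induction s using Finset.cons_induction with
  | empty => simp
  | cons j s hj ih => rw [Finset.sum_cons, Finset.prod_cons, expE_add, ih]

lemma negE_sum {ι : Type*} (s : Finset ι) (f : ι → ℝ≥0∞) :
    negE (∑ i ∈ s, f i) = ∏ i ∈ s, negE (f i) := by
  induction s using Finset.cons_induction with
  | empty => simp
  | cons j s hj ih => rw [Finset.sum_cons, Finset.prod_cons, negE_add, ih]

lemma tsum_indicator_eq_encard (B : Set X) (x : ℕ → X) :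
    ∑' n, B.indicator (1 : X → ℝ≥0∞) (x n) = ({n | x n ∈ B}.encard : ℝ≥0∞) := by
  rw [← ENNReal.tsum_set_one, tsum_subtype {n | x n ∈ B} (fun _ => (1 : ℝ≥0∞))]
  rfl

open Classical in
/-- The nonzero values of a simple function. -/
def nonzeroRange {β : Type*} [Zero β] (s : SimpleFunc X β) : Finset β := s.range.filter (· ≠ 0)

lemma sum_indicator_nonzeroRange {β : Type*} [Zero β] (s : SimpleFunc X β) {g : β → ℝ≥0∞}
    (hg : g 0 = 0) (x : X) :
    ∑ v ∈ nonzeroRange s, g v * (s ⁻¹' {v}).indicator (1 : X → ℝ≥0∞) x = g (s x) := by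
  classical
  by_cases hx : s x = 0
  · rw [hx, hg]
    refine Finset.sum_eq_zero fun v hv => ?_
    rw [indicator_of_notMem, mul_zero]
    simp only [nonzeroRange, Finset.mem_filter] at hv
    simpa [hx] using hv.2.symm
  · rw [Finset.sum_eq_single (s x)]
    · simp
    · intro v _ hv
      rw [indicator_of_notMem, mul_zero]
      simpa using hv.symm
    · intro h
      simp [nonzeroRange, hx] at h

lemma tsum_simpleFunc {β : Type*} [Zero β] (s : SimpleFunc X β) {g : β → ℝ≥0∞}
    (hg : g 0 = 0) (x : ℕ → X) :
    ∑' n, g (s (x n))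
      = ∑ v ∈ nonzeroRange s, g v * ({n | x n ∈ s ⁻¹' {v}}.encard : ℝ≥0∞) := by
  simp_rw [← sum_indicator_nonzeroRange s hg, ← tsum_indicator_eq_encard, ← ENNReal.tsum_mul_left]
  exact Summable.tsum_finsetSum fun _ _ => ENNReal.summable

lemma lintegral_simpleFunc {β : Type*} [Zero β] (s : SimpleFunc X β) {g : β → ℝ≥0∞}
    (hg : g 0 = 0) : ∫⁻ x, g (s x) ∂Λ = ∑ v ∈ nonzeroRange s, g v * Λ (s ⁻¹' {v}) := by
  simp_rw [← sum_indicator_nonzeroRange s hg]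
  rw [lintegral_finsetSum']
  · refine Finset.sum_congr rfl fun v _ => ?_
    rw [lintegral_const_mul _ (measurable_one.indicator (s.measurableSet_fiber v)),
      lintegral_indicator_one (s.measurableSet_fiber v)]
  · exact fun v _ => ((measurable_one.indicator (s.measurableSet_fiber v)).const_mul _).aemeasurable

/-- The counts of the level sets are independent Poisson variables, so the expectation is a product
of Poisson transforms. A pair-valued simple function gives common level sets for the positive and
the negative exponent, of which at most one is nonzero at each point. -/
lemma IsPoissonField.lintegral_exp_simpleFunc [IsProbabilityMeasure P] (h : IsPoissonField P ξ Λ)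
    (s : SimpleFunc X (ℝ≥0∞ × ℝ≥0∞)) (h1 : ∀ x, (s x).1 ≠ ∞) (h2 : ∀ x, (s x).2 ≠ ∞)
    (h0 : ∀ x, (s x).1 = 0 ∨ (s x).2 = 0) (hs : Λ {x | s x ≠ 0} ≠ ∞) :
    ∫⁻ ω, expE (∑' n, (s (ξ n ω)).1) * negE (∑' n, (s (ξ n ω)).2) ∂P
      = expE (∫⁻ x, (expE (s x).1 - 1) ∂Λ) * negE (∫⁻ x, (1 - negE (s x).2) ∂Λ) := by
  rw [lintegral_simpleFunc s (g := fun v => expE v.1 - 1) (by simp),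
    lintegral_simpleFunc s (g := fun v => 1 - negE v.2) (by simp), expE_sum, negE_sum,
    ← Finset.prod_mul_distrib]
  simp_rw [tsum_simpleFunc s (g := Prod.fst) rfl, tsum_simpleFunc s (g := Prod.snd) rfl, expE_sum,
    negE_sum, ← Finset.prod_mul_distrib]
  set R := nonzeroRange s with hR
  have hmem (v) (hv : v ∈ R) : v ≠ 0 ∧ ∃ x, s x = v := by
    simpa [hR, nonzeroRange, and_comm] using hv
  have hfin (v) (hv : v ∈ R) : Λ (s ⁻¹' {v}) ≠ ∞ := by
    refine ne_top_of_le_ne_top hs (measure_mono fun x hx => ?_)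
    rw [mem_preimage, mem_singleton_iff] at hx
    simpa [hx] using (hmem v hv).1
  let e := R.equivFin
  have key (F : ℝ≥0∞ × ℝ≥0∞ → ℝ≥0∞) :
      ∏ v ∈ R, F v = ∏ i : Fin R.card, F (e.symm i) := by
    rw [← Finset.prod_coe_sort, ← Equiv.prod_comp e.symm]
  have hind := h.count_indep R.card (fun i => s ⁻¹' {(e.symm i : ℝ≥0∞ × ℝ≥0∞)})
    (fun i => s.measurableSet_fiber _) (fun i j hij => by
      refine Disjoint.preimage _ (disjoint_singleton.2 fun h => hij ?_)
      exact e.symm.injective (Subtype.ext h))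
  rw [key]
  simp_rw [key]
  have hind' := hind.comp (fun i (j : ℕ∞) => expE ((e.symm i : ℝ≥0∞ × ℝ≥0∞).1 * (j : ℝ≥0∞)) *
    negE ((e.symm i : ℝ≥0∞ × ℝ≥0∞).2 * (j : ℝ≥0∞))) (fun i => measurable_from_top)
  have := lintegral_prod_eq_prod_lintegral_of_indepFun Finset.univ _ hind'
    (fun i => measurable_from_top.comp (h.measurable_count (s.measurableSet_fiber _)))
  simp only [Function.comp_apply] at this
  rw [this]
  refine Finset.prod_congr rfl fun i _ => ?_
  obtain ⟨-, x, hx⟩ := hmem _ (e.symm i).2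
  exact h.lintegral_exp_count (s.measurableSet_fiber _) (hfin _ (e.symm i).2)
    (hx ▸ h1 x) (hx ▸ h2 x) (hx ▸ h0 x)

/-! ### Monotone approximation and limits of exponentials. -/

section Aux

variable {Ω : Type*} [MeasurableSpace Ω] {X : Type*} [MeasurableSpace X] {P : Measure Ω}

lemma tendsto_tsum_of_monotone {f : ℕ → ℕ → ℝ≥0∞} (hf : ∀ n, Monotone fun k => f k n)
    {g : ℕ → ℝ≥0∞} (hg : ∀ n, ⨆ k, f k n = g n) :
    Tendsto (fun k => ∑' n, f k n) atTop (𝓝 (∑' n, g n)) := by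
  have h : ∑' n, g n = ⨆ k, ∑' n, f k n := by
    simp_rw [← hg, ← lintegral_count]
    exact lintegral_iSup (fun _ => measurable_from_top) fun _ _ hij n => hf n hij
  rw [h]
  exact tendsto_atTop_iSup fun _ _ hij => ENNReal.tsum_le_tsum fun n => hf n hij

lemma expE_ne_top {a : ℝ≥0∞} (h : a ≠ ∞) : expE a ≠ ∞ := by
  lift a to ℝ≥0 using h
  rw [expE_coe]
  exact ENNReal.ofReal_ne_top

lemma negE_ne_top (a : ℝ≥0∞) : negE a ≠ ∞ := ne_top_of_le_ne_top ENNReal.one_ne_top (negE_le_one a)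

lemma tendsto_expE_mul_negE {ι : Type*} {l : Filter ι} {A B : ι → ℝ≥0∞} {a b : ℝ≥0∞}
    (hA : Tendsto A l (𝓝 a)) (hB : Tendsto B l (𝓝 b)) (ha : a ≠ ∞) :
    Tendsto (fun i => expE (A i) * negE (B i)) l (𝓝 (expE a * negE b)) :=
  ENNReal.Tendsto.mul ((continuous_expE.tendsto _).comp hA) (Or.inr (negE_ne_top _))
    ((continuous_negE.tendsto _).comp hB) (Or.inr (expE_ne_top ha))

lemma ae_ne_top_of_lintegral_expE {A : Ω → ℝ≥0∞} (hA : Measurable A)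
    (h : ∫⁻ ω, expE (A ω) ∂P ≠ ∞) : ∀ᵐ ω ∂P, A ω ≠ ∞ := by
  filter_upwards [ae_lt_top (measurable_expE.comp hA) h] with ω hω h'
  simp [h', expE_top] at hω

lemma tendsto_lintegral_expE_mul_negE {A B : ℕ → Ω → ℝ≥0∞} {a b : Ω → ℝ≥0∞}
    (mA : ∀ k, Measurable (A k)) (mB : ∀ k, Measurable (B k)) (ma : Measurable a)
    (hle : ∀ k ω, A k ω ≤ a ω)
    (hA : ∀ ω, Tendsto (fun k => A k ω) atTop (𝓝 (a ω)))
    (hB : ∀ ω, Tendsto (fun k => B k ω) atTop (𝓝 (b ω))) (h : ∫⁻ ω, expE (a ω) ∂P ≠ ∞) :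
    Tendsto (fun k => ∫⁻ ω, expE (A k ω) * negE (B k ω) ∂P) atTop
      (𝓝 (∫⁻ ω, expE (a ω) * negE (b ω) ∂P)) := by
  refine tendsto_lintegral_of_dominated_convergence (fun ω => expE (a ω))
    (fun k => (measurable_expE.comp (mA k)).mul (measurable_negE.comp (mB k)))
    (fun k => ae_of_all _ fun ω => ?_) h ?_
  · exact (mul_le_of_le_one_right' (negE_le_one _)).trans (expE_mono (hle k ω))
  · filter_upwards [ae_ne_top_of_lintegral_expE ma h] with ω hω
    exact tendsto_expE_mul_negE (hA ω) (hB ω) hω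

/-- Bounded approximations of a nonnegative function that are supported by sets of finite
measure. -/
def finApprox (Λ : Measure X) [SigmaFinite Λ] (f : X → ℝ≥0∞) (k : ℕ) : SimpleFunc X ℝ≥0∞ :=
  (SimpleFunc.eapprox f k).restrict (spanningSets Λ k)

section

variable {Λ : Measure X} [SigmaFinite Λ] {f : X → ℝ≥0∞}

lemma finApprox_apply (k : ℕ) (x : X) :
    finApprox Λ f k x = (spanningSets Λ k).indicator (SimpleFunc.eapprox f k) x :=
  SimpleFunc.restrict_apply _ (measurableSet_spanningSets Λ k) x

lemma finApprox_ne_top (k : ℕ) (x : X) : finApprox Λ f k x ≠ ∞ := by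
  rw [finApprox_apply]
  by_cases hx : x ∈ spanningSets Λ k
  · rw [indicator_of_mem hx]
    exact (SimpleFunc.eapprox_lt_top f k x).ne
  · simp [indicator_of_notMem hx]

lemma finApprox_mono (x : X) : Monotone fun k => finApprox Λ f k x := by
  intro i j hij
  simp only [finApprox_apply]
  exact (indicator_le_indicator_of_subset (monotone_spanningSets Λ hij) (fun _ => zero_le) x).trans
    (indicator_le_indicator (SimpleFunc.monotone_eapprox f hij x))

lemma iSup_finApprox (hf : Measurable f) (x : X) : ⨆ k, finApprox Λ f k x = f x := by
  refine tendsto_nhds_unique (tendsto_atTop_iSup (finApprox_mono x)) ?_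
  have h := tendsto_atTop_iSup (fun i j hij => SimpleFunc.monotone_eapprox f hij x)
  rw [SimpleFunc.iSup_eapprox_apply hf] at h
  refine h.congr' ?_
  filter_upwards [eventually_mem_spanningSets Λ x] with k hk
  rw [finApprox_apply, indicator_of_mem hk]

lemma finApprox_eq_zero (hf : Measurable f) {x : X} (hx : f x = 0) (k : ℕ) :
    finApprox Λ f k x = 0 := by
  rw [← nonpos_iff_eq_zero, ← hx, ← iSup_finApprox (Λ := Λ) hf x]
  exact le_iSup (fun k => finApprox Λ f k x) k

end

end Aux

/-! ### Exponential formula for measurable functions. -/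

section PoissonExponential

variable {Ω : Type*} [MeasurableSpace Ω] {X : Type*} [MeasurableSpace X] {P : Measure Ω}
  {ξ : ℕ → Ω → X} {Λ : Measure X} [IsProbabilityMeasure P] [SigmaFinite Λ] {α β : X → ℝ≥0∞}

lemma IsPoissonField.lintegral_exp_finApprox (h : IsPoissonField P ξ Λ) (hα : Measurable α)
    (hβ : Measurable β) (h0 : ∀ x, α x = 0 ∨ β x = 0) (k : ℕ) :
    ∫⁻ ω, expE (∑' n, finApprox Λ α k (ξ n ω)) * negE (∑' n, finApprox Λ β k (ξ n ω)) ∂P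
      = expE (∫⁻ x, (expE (finApprox Λ α k x) - 1) ∂Λ)
        * negE (∫⁻ x, (1 - negE (finApprox Λ β k x)) ∂Λ) := by
  have hsub : {x | (finApprox Λ α k).pair (finApprox Λ β k) x ≠ 0} ⊆ spanningSets Λ k := by
    intro x hx
    by_contra hk
    apply hx
    simp [SimpleFunc.pair_apply, finApprox_apply, indicator_of_notMem hk]
  simpa using h.lintegral_exp_simpleFunc ((finApprox Λ α k).pair (finApprox Λ β k))
    (fun x => finApprox_ne_top k x) (fun x => finApprox_ne_top k x)
    (fun x => (h0 x).imp (fun hx => finApprox_eq_zero hα hx k) fun hx => finApprox_eq_zero hβ hx k)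
    (ne_top_of_le_ne_top (measure_spanningSets_lt_top Λ k).ne (measure_mono hsub))

lemma tendsto_lintegral_expE_finApprox (hα : Measurable α) :
    Tendsto (fun k => ∫⁻ x, (expE (finApprox Λ α k x) - 1) ∂Λ) atTop
      (𝓝 (∫⁻ x, (expE (α x) - 1) ∂Λ)) := by
  have hm : Monotone fun k => fun x => expE (finApprox Λ α k x) - 1 :=
    fun i j hij x => tsub_le_tsub_right (expE_mono (finApprox_mono x hij)) 1
  refine lintegral_tendsto_of_tendsto_of_monotone
    (fun k => ((measurable_expE.comp (finApprox Λ α k).measurable).sub_const 1).aemeasurable)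
    (ae_of_all _ fun x i j hij => hm hij x) (ae_of_all _ fun x => ?_)
  have h := tendsto_atTop_iSup (finApprox_mono (Λ := Λ) (f := α) x)
  rw [iSup_finApprox hα] at h
  exact ENNReal.Tendsto.sub ((continuous_expE.tendsto _).comp h) tendsto_const_nhds
    (Or.inr ENNReal.one_ne_top)

lemma tendsto_lintegral_negE_finApprox (hβ : Measurable β) :
    Tendsto (fun k => ∫⁻ x, (1 - negE (finApprox Λ β k x)) ∂Λ) atTop
      (𝓝 (∫⁻ x, (1 - negE (β x)) ∂Λ)) := by
  have hm : Monotone fun k => fun x => 1 - negE (finApprox Λ β k x) :=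
    fun i j hij x => tsub_le_tsub_left (negE_anti (finApprox_mono x hij)) 1
  refine lintegral_tendsto_of_tendsto_of_monotone
    (fun k => ((measurable_negE.comp (finApprox Λ β k).measurable).const_sub 1).aemeasurable)
    (ae_of_all _ fun x i j hij => hm hij x) (ae_of_all _ fun x => ?_)
  have h := tendsto_atTop_iSup (finApprox_mono (Λ := Λ) (f := β) x)
  rw [iSup_finApprox hβ] at h
  exact ENNReal.Tendsto.sub tendsto_const_nhds ((continuous_negE.tendsto _).comp h)
    (Or.inl ENNReal.one_ne_top)

lemma IsPoissonField.measurable_tsum (h : IsPoissonField P ξ Λ) (hα : Measurable α) :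
    Measurable fun ω => ∑' n, α (ξ n ω) :=
  Measurable.tsum fun n => hα.comp (h.measurable n)

lemma IsPoissonField.tendsto_tsum_finApprox (hα : Measurable α) (ω : Ω) :
    Tendsto (fun k => ∑' n, finApprox Λ α k (ξ n ω)) atTop (𝓝 (∑' n, α (ξ n ω))) :=
  tendsto_tsum_of_monotone (fun _ => finApprox_mono _) fun _ => iSup_finApprox hα _

/-- Monotone convergence from the bounded approximations of finite support. No integrability is
required, and both sides may be infinite. -/
lemma IsPoissonField.lintegral_expE_tsum (h : IsPoissonField P ξ Λ) (hα : Measurable α) :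
    ∫⁻ ω, expE (∑' n, α (ξ n ω)) ∂P = expE (∫⁻ x, (expE (α x) - 1) ∂Λ) := by
  have hk (k : ℕ) : ∫⁻ ω, expE (∑' n, finApprox Λ α k (ξ n ω)) ∂P
      = expE (∫⁻ x, (expE (finApprox Λ α k x) - 1) ∂Λ) := by
    have h0 (x : X) : finApprox Λ (fun _ => (0 : ℝ≥0∞)) k x = 0 :=
      finApprox_eq_zero measurable_const rfl k
    simpa [h0] using h.lintegral_exp_finApprox hα measurable_const (β := fun _ => 0)
      (fun _ => Or.inr rfl) k
  refine tendsto_nhds_unique ?_ ((continuous_expE.tendsto _).comp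
    (tendsto_lintegral_expE_finApprox hα))
  simp only [Function.comp_def, ← hk]
  refine lintegral_tendsto_of_tendsto_of_monotone (fun k => (measurable_expE.comp
      (h.measurable_tsum (finApprox Λ α k).measurable)).aemeasurable)
    (ae_of_all _ fun ω i j hij => expE_mono (ENNReal.tsum_le_tsum fun n => finApprox_mono _ hij))
    (ae_of_all _ fun ω => (continuous_expE.tendsto _).comp
      (IsPoissonField.tendsto_tsum_finApprox hα ω))

/-- With both signs present the approximations are no longer monotone. Dominated convergence applies
with the exponential of the positive sum as envelope, whose integrability follows from
`lintegral_expE_tsum` and `hfin`. -/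
lemma IsPoissonField.lintegral_exp_tsum (h : IsPoissonField P ξ Λ) (hα : Measurable α)
    (hβ : Measurable β) (h0 : ∀ x, α x = 0 ∨ β x = 0) (hfin : ∫⁻ x, (expE (α x) - 1) ∂Λ ≠ ∞) :
    ∫⁻ ω, expE (∑' n, α (ξ n ω)) * negE (∑' n, β (ξ n ω)) ∂P
      = expE (∫⁻ x, (expE (α x) - 1) ∂Λ) * negE (∫⁻ x, (1 - negE (β x)) ∂Λ) := by
  refine tendsto_nhds_unique ?_ (tendsto_expE_mul_negE (tendsto_lintegral_expE_finApprox hα)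
    (tendsto_lintegral_negE_finApprox hβ) hfin)
  simp only [← h.lintegral_exp_finApprox hα hβ h0]
  refine tendsto_lintegral_expE_mul_negE
    (fun k => h.measurable_tsum (finApprox Λ α k).measurable)
    (fun k => h.measurable_tsum (finApprox Λ β k).measurable) (h.measurable_tsum hα)
    (fun k ω => ENNReal.tsum_le_tsum fun n => ?_)
    (IsPoissonField.tendsto_tsum_finApprox hα) (IsPoissonField.tendsto_tsum_finApprox hβ) ?_
  · rw [← iSup_finApprox (Λ := Λ) hα]
    exact le_iSup (fun k => finApprox Λ α k _) k
  · rw [h.lintegral_expE_tsum hα]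
    exact expE_ne_top hfin

end PoissonExponential

/-! ### Positive and negative parts of the logarithm. -/

section LogParts

/-- The positive part of the logarithm. -/
def logPos (K : ℝ≥0∞) : ℝ≥0∞ := (ENNReal.log K).toENNReal

/-- The negative part of the logarithm. -/
def logNeg (K : ℝ≥0∞) : ℝ≥0∞ := (-ENNReal.log K).toENNReal

lemma expE_logPos (K : ℝ≥0∞) : expE (logPos K) = max 1 K := by
  rw [expE, logPos, EReal.coe_toENNReal_eq_max, EReal.exp_monotone.map_max]
  simp

lemma negE_logNeg (K : ℝ≥0∞) : negE (logNeg K) = min 1 K := by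
  have h : -max 0 (-ENNReal.log K) = min 0 (ENNReal.log K) := by
    rcases le_total 0 (ENNReal.log K) with h | h
    · rw [min_eq_left h, max_eq_left (by simpa using h), neg_zero]
    · rw [min_eq_right h, max_eq_right (by simpa using h), neg_neg]
  rw [negE, logNeg, EReal.coe_toENNReal_eq_max, h, EReal.exp_monotone.map_min]
  simp

lemma logPos_eq_zero_or (K : ℝ≥0∞) : logPos K = 0 ∨ logNeg K = 0 := by
  rcases le_total (ENNReal.log K) 0 with h | h
  · exact Or.inl (EReal.toENNReal_of_nonpos h)
  · exact Or.inr (EReal.toENNReal_of_nonpos (by simpa using h))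

lemma measurable_logPos : Measurable logPos :=
  measurable_ereal_toENNReal.comp ENNReal.continuous_log.measurable

lemma measurable_logNeg : Measurable logNeg :=
  measurable_ereal_toENNReal.comp ENNReal.continuous_log.measurable.neg

/-- This puts an averaged factor `K`, which may be smaller or larger than one, into the form with
disjoint positive and negative exponents that the unmarked formula requires. -/
lemma expE_logPos_mul_negE_logNeg (K : ℝ≥0∞) : expE (logPos K) * negE (logNeg K) = K := by
  rw [expE_logPos, negE_logNeg]
  rcases le_total 1 K with h | h
  · rw [max_eq_right h, min_eq_left h, mul_one]
  · rw [max_eq_left h, min_eq_right h, one_mul]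

end LogParts

/-! ### Exponential formula with independent marks. -/

section MarkedPoisson

variable {Ω : Type*} [MeasurableSpace Ω] {X : Type*} [MeasurableSpace X] {P : Measure Ω}
  {E : Type*} [MeasurableSpace E] {π : Measure E} [IsProbabilityMeasure π]
  {ξ : ℕ → Ω → X} {Λ : Measure X} [IsProbabilityMeasure P] [SigmaFinite Λ] {ζ : ℕ → Ω → E}

lemma lintegral_prod_infinitePi (g : ℕ → E → ℝ≥0∞) (hg : ∀ n, Measurable (g n)) (N : ℕ) :
    ∫⁻ z, ∏ n ∈ Finset.range N, g n (z n) ∂(Measure.infinitePi fun _ : ℕ => π)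
      = ∏ n ∈ Finset.range N, ∫⁻ z, g n z ∂π := by
  have h := lintegral_prod_eq_prod_lintegral_of_indepFun (Finset.range N) (fun n (z : ℕ → E) => g n (z n))
    (iIndepFun_infinitePi (P := fun _ : ℕ => π) (X := g) hg)
    (fun n => (hg n).comp (measurable_pi_apply n))
  rw [h]
  refine Finset.prod_congr rfl fun n _ => ?_
  exact (measurePreserving_eval_infinitePi (fun _ : ℕ => π) n).lintegral_comp (hg n)

/-- Given the points, the marks are i.i.d. with law `π`, so each factor of a finite product can be
averaged over its own mark. -/
lemma lintegral_prod_marks (hξ : ∀ n, Measurable (ξ n)) (hζ : ∀ n, Measurable (ζ n))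
    (hind : IndepFun (fun ω n => ξ n ω) (fun ω n => ζ n ω) P)
    (hlaw : P.map (fun ω n => ζ n ω) = Measure.infinitePi fun _ => π)
    {f : X × E → ℝ≥0∞} (hf : Measurable f) (N : ℕ) :
    ∫⁻ ω, ∏ n ∈ Finset.range N, f (ξ n ω, ζ n ω) ∂P
      = ∫⁻ ω, ∏ n ∈ Finset.range N, (∫⁻ z, f (ξ n ω, z) ∂π) ∂P := by
  have m1 : Measurable fun ω n => ξ n ω := measurable_pi_lambda _ hξ
  have m2 : Measurable fun ω n => ζ n ω := measurable_pi_lambda _ hζ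
  have hmap := hind.map_prod_eq_prod_map_map m1.aemeasurable m2.aemeasurable
  have := Measure.isProbabilityMeasure_map (μ := P) m1.aemeasurable
  have mF : Measurable fun p : (ℕ → X) × (ℕ → E) => ∏ n ∈ Finset.range N, f (p.1 n, p.2 n) := by
    refine Finset.measurable_prod _ fun n _ => hf.comp ?_
    fun_prop
  have mK : Measurable fun x : ℕ → X => ∏ n ∈ Finset.range N, ∫⁻ z, f (x n, z) ∂π :=
    Finset.measurable_prod _ fun n _ => hf.lintegral_prod_right'.comp (measurable_pi_apply n)
  calc ∫⁻ ω, ∏ n ∈ Finset.range N, f (ξ n ω, ζ n ω) ∂P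
      = ∫⁻ p, ∏ n ∈ Finset.range N, f (p.1 n, p.2 n)
          ∂((P.map fun ω n => ξ n ω).prod (Measure.infinitePi fun _ => π)) := by
        rw [← hlaw, ← hmap, lintegral_map mF (m1.prodMk m2)]
    _ = ∫⁻ x, ∏ n ∈ Finset.range N, (∫⁻ z, f (x n, z) ∂π) ∂(P.map fun ω n => ξ n ω) := by
        rw [lintegral_prod _ mF.aemeasurable]
        refine lintegral_congr fun x => ?_
        exact lintegral_prod_infinitePi (fun n z => f (x n, z))
          (fun n => hf.comp measurable_prodMk_left) N
    _ = _ := lintegral_map mK m1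

lemma tendsto_sum_range (f : ℕ → ℝ≥0∞) :
    Tendsto (fun N => ∑ n ∈ Finset.range N, f n) atTop (𝓝 (∑' n, f n)) :=
  ENNReal.summable.hasSum.tendsto_sum_nat

/-- Averaging over the marks replaces the exponent by the logarithm of the averaged factor, which is
at least one here. The unmarked formula then applies. The identity holds for finitely many points
and passes to the limit monotonically. -/
lemma IsPoissonField.lintegral_expE_marks (h : IsPoissonField P ξ Λ) (hζ : ∀ n, Measurable (ζ n))
    (hind : IndepFun (fun ω n => ξ n ω) (fun ω n => ζ n ω) P)
    (hlaw : P.map (fun ω n => ζ n ω) = Measure.infinitePi fun _ => π)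
    {a : X × E → ℝ≥0∞} (ha : Measurable a) :
    ∫⁻ ω, expE (∑' n, a (ξ n ω, ζ n ω)) ∂P
      = expE (∫⁻ x, ((∫⁻ z, expE (a (x, z)) ∂π) - 1) ∂Λ) := by
  have mK : Measurable fun x => ∫⁻ z, expE (a (x, z)) ∂π :=
    (measurable_expE.comp ha).lintegral_prod_right'
  have hK (x : X) : 1 ≤ ∫⁻ z, expE (a (x, z)) ∂π := by
    calc (1 : ℝ≥0∞) = ∫⁻ _, 1 ∂π := by simp
      _ ≤ _ := lintegral_mono fun z => one_le_expE _
  have eK (x : X) : expE (logPos (∫⁻ z, expE (a (x, z)) ∂π)) = ∫⁻ z, expE (a (x, z)) ∂π := by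
    rw [expE_logPos, max_eq_right (hK x)]
  have hmain := h.lintegral_expE_tsum (measurable_logPos.comp mK)
  simp only [Function.comp_apply, eK] at hmain
  rw [← hmain]
  have hN (N : ℕ) : ∫⁻ ω, expE (∑ n ∈ Finset.range N, a (ξ n ω, ζ n ω)) ∂P
      = ∫⁻ ω, expE (∑ n ∈ Finset.range N, logPos (∫⁻ z, expE (a (ξ n ω, z)) ∂π)) ∂P := by
    simp_rw [expE_sum, eK]
    exact lintegral_prod_marks h.measurable hζ hind hlaw (measurable_expE.comp ha) N
  have hconv (F : ℕ → Ω → ℝ≥0∞) (hF : ∀ n, Measurable (F n)) :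
      Tendsto (fun N => ∫⁻ ω, expE (∑ n ∈ Finset.range N, F n ω) ∂P) atTop
        (𝓝 (∫⁻ ω, expE (∑' n, F n ω) ∂P)) := by
    refine lintegral_tendsto_of_tendsto_of_monotone (fun k => (measurable_expE.comp
        (Finset.measurable_fun_sum _ fun n _ => hF n)).aemeasurable)
      (ae_of_all _ fun ω i j hij => expE_mono (Finset.sum_le_sum_of_subset
        (Finset.range_mono hij)))
      (ae_of_all _ fun ω => (continuous_expE.tendsto _).comp (tendsto_sum_range _))
  have h1 := hconv (fun n ω => a (ξ n ω, ζ n ω))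
    (fun n => ha.comp ((h.measurable n).prodMk (hζ n)))
  have h2 := hconv (fun n ω => logPos (∫⁻ z, expE (a (ξ n ω, z)) ∂π))
    (fun n => (measurable_logPos.comp mK).comp (h.measurable n))
  simp only [hN] at h1
  exact tendsto_nhds_unique h1 h2

/-- The exponential formula for a marked Poisson random field. -/
lemma IsPoissonField.lintegral_exp_marks (h : IsPoissonField P ξ Λ) (hζ : ∀ n, Measurable (ζ n))
    (hind : IndepFun (fun ω n => ξ n ω) (fun ω n => ζ n ω) P)
    (hlaw : P.map (fun ω n => ζ n ω) = Measure.infinitePi fun _ => π)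
    {a b : X × E → ℝ≥0∞} (ha : Measurable a) (hb : Measurable b)
    (hfin : ∫⁻ x, ((∫⁻ z, expE (a (x, z)) ∂π) - 1) ∂Λ ≠ ∞) :
    ∫⁻ ω, expE (∑' n, a (ξ n ω, ζ n ω)) * negE (∑' n, b (ξ n ω, ζ n ω)) ∂P
      = expE (∫⁻ x, ((∫⁻ z, expE (a (x, z)) * negE (b (x, z)) ∂π) - 1) ∂Λ)
        * negE (∫⁻ x, (1 - ∫⁻ z, expE (a (x, z)) * negE (b (x, z)) ∂π) ∂Λ) := by
  set K : X → ℝ≥0∞ := fun x => ∫⁻ z, expE (a (x, z)) * negE (b (x, z)) ∂π with hKdef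
  have mf : Measurable fun p => expE (a p) * negE (b p) :=
    (measurable_expE.comp ha).mul (measurable_negE.comp hb)
  have mK : Measurable K := mf.lintegral_prod_right'
  have hKle (x : X) : K x ≤ ∫⁻ z, expE (a (x, z)) ∂π :=
    lintegral_mono fun z => mul_le_of_le_one_right' (negE_le_one _)
  have hKfin : ∫⁻ x, (K x - 1) ∂Λ ≠ ∞ :=
    ne_top_of_le_ne_top hfin (lintegral_mono fun x => tsub_le_tsub_right (hKle x) 1)
  have e1 (x : X) : expE (logPos (K x)) - 1 = K x - 1 := by
    rw [expE_logPos]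
    rcases le_total 1 (K x) with h | h
    · rw [max_eq_right h]
    · rw [max_eq_left h, tsub_self, tsub_eq_zero_of_le h]
  have e2 (x : X) : 1 - negE (logNeg (K x)) = 1 - K x := by
    rw [negE_logNeg]
    rcases le_total 1 (K x) with h | h
    · rw [min_eq_left h, tsub_self, tsub_eq_zero_of_le h]
    · rw [min_eq_right h]
  have mp := measurable_logPos.comp mK
  have mn := measurable_logNeg.comp mK
  have hmain := h.lintegral_exp_tsum mp mn (fun x => logPos_eq_zero_or _)
    (by simpa only [Function.comp_apply, e1] using hKfin)
  simp only [Function.comp_apply, e1, e2] at hmain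
  rw [← hmain]
  -- For the first `N` points the marks can be averaged out exactly. Writing the averaged factors as
  -- exponentials produces the integrand of the unmarked formula.
  have hN (N : ℕ) : ∫⁻ ω, expE (∑ n ∈ Finset.range N, a (ξ n ω, ζ n ω)) *
        negE (∑ n ∈ Finset.range N, b (ξ n ω, ζ n ω)) ∂P
      = ∫⁻ ω, expE (∑ n ∈ Finset.range N, logPos (K (ξ n ω))) *
        negE (∑ n ∈ Finset.range N, logNeg (K (ξ n ω))) ∂P := by
    simp_rw [expE_sum, negE_sum, ← Finset.prod_mul_distrib, expE_logPos_mul_negE_logNeg]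
    exact lintegral_prod_marks h.measurable hζ hind hlaw mf N
  have mab (c : X × E → ℝ≥0∞) (hc : Measurable c) (n : ℕ) :
      Measurable fun ω => c (ξ n ω, ζ n ω) := hc.comp ((h.measurable n).prodMk (hζ n))
  -- The limit `N → ∞` is taken on both sides separately, each dominated by the exponential of its
  -- positive sum.
  have hconv (F G : ℕ → Ω → ℝ≥0∞) (hF : ∀ n, Measurable (F n)) (hG : ∀ n, Measurable (G n))
      (hI : ∫⁻ ω, expE (∑' n, F n ω) ∂P ≠ ∞) :
      Tendsto (fun N => ∫⁻ ω, expE (∑ n ∈ Finset.range N, F n ω) *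
        negE (∑ n ∈ Finset.range N, G n ω) ∂P) atTop
        (𝓝 (∫⁻ ω, expE (∑' n, F n ω) * negE (∑' n, G n ω) ∂P)) :=
    tendsto_lintegral_expE_mul_negE (fun k => Finset.measurable_fun_sum _ fun n _ => hF n)
      (fun k => Finset.measurable_fun_sum _ fun n _ => hG n) (Measurable.tsum hF)
      (fun k ω => ENNReal.sum_le_tsum _) (fun ω => tendsto_sum_range _)
      (fun ω => tendsto_sum_range _) hI
  have h1 := hconv (fun n ω => a (ξ n ω, ζ n ω)) (fun n ω => b (ξ n ω, ζ n ω)) (mab a ha)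
    (mab b hb) (by rw [h.lintegral_expE_marks hζ hind hlaw ha]; exact expE_ne_top hfin)
  have h2 := hconv (fun n ω => logPos (K (ξ n ω))) (fun n ω => logNeg (K (ξ n ω)))
    (fun n => mp.comp (h.measurable n)) (fun n => mn.comp (h.measurable n)) (by
      have := h.lintegral_expE_tsum mp
      simp only [Function.comp_apply, e1] at this
      rw [this]
      exact expE_ne_top hKfin)
  simp only [hN] at h1
  exact tendsto_nhds_unique h1 h2

end MarkedPoisson

/-! ### The families of the immigrants. -/

section Families

variable {d : ℕ} {S : Type*} [MeasurableSpace S] {Ω : Type*} [MeasurableSpace Ω]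
  {P : Measure Ω} {m : Measure S} {V q H : ℝ} {ξ : ℕ → Ω → ℝ × Space d}
  {Z : ℕ × List Bool → Ω → Mark S} [IsProbabilityMeasure P]

/-- The marks of the family of the `n`-th immigrant. -/
def family (Z : ℕ × List Bool → Ω → Mark S) (n : ℕ) (ω : Ω) : Marks S :=
  fun w => Z (n, w) ω

lemma IsBranchingData.measurable_family (h : IsBranchingData P m V q H ξ Z) (n : ℕ) :
    Measurable (family Z n) := measurable_pi_lambda _ fun w => h.mark_measurable (n, w)

lemma IsBranchingData.indepFun_family (h : IsBranchingData P m V q H ξ Z) :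
    IndepFun (fun ω n => ξ n ω) (fun ω n => family Z n ω) P :=
  h.indep.comp (φ := id) (ψ := fun (z : ℕ × List Bool → Mark S) n w => z (n, w)) measurable_id
    (by fun_prop)

/-- Currying an i.i.d. array indexed by immigrants and words gives an i.i.d. sequence of families.
-/
lemma IsBranchingData.map_family (h : IsBranchingData P m V q H ξ Z)
    [IsProbabilityMeasure (markLaw m V q)] :
    P.map (fun ω n => family Z n ω) = Measure.infinitePi fun _ => famLaw m V q := by
  have e := h.mark_indep.map_fun_eq_infinitePi_map h.mark_measurable
  have e2 : (fun p => P.map (Z p)) = fun _ : ℕ × List Bool => markLaw m V q :=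
    funext h.mark_law
  rw [e2] at e
  have e3 := Measure.infinitePi_map_curry (fun (_ : ℕ) (_ : List Bool) => markLaw m V q)
  rw [← e, Measure.map_map (by fun_prop)
    (measurable_pi_lambda _ h.mark_measurable)] at e3
  exact e3

end Families

/-! ### The population as a sum over immigrants. -/

section Bridge

variable {d : ℕ} {S : Type*} [MeasurableSpace S] {m : Measure S}
  {η : Space d → ℝ≥0 → S → Space d} {φ : Space d → ℝ} {V q b : ℝ}

/-- The functional `⟨N_s, φ⟩`. -/
def popDens (η : Space d → ℝ≥0 → S → Space d) (φ : Space d → ℝ) (x : ℕ → ℝ × Space d)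
    (z : ℕ × List Bool → Mark S) (s : ℝ) : ℝ≥0∞ :=
  ∫⁻ y, ENNReal.ofReal (φ y) ∂(population η x z s)

lemma popDens_eq (hφ : Measurable φ) (x : ℕ → ℝ × Space d) (z : ℕ × List Bool → Mark S) (s : ℝ) :
    popDens η φ x z s = ∑' n, dens η φ ⊤ (x n).2 (fun w => z (n, w)) (s - (x n).1) := by
  rw [popDens, population, lintegral_sum_measure, ENNReal.tsum_prod']
  refine tsum_congr fun n => ?_
  rw [dens]
  refine tsum_congr fun w => ?_
  rw [if_pos (ENat.natCast_lt_top _)]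
  exact lintegral_particleMeasure hφ w (x n) (fun w => z (n, w)) s

/-- The weighted occupation of the family with marks `p.2` of a particle born at `p.1`. -/
def shiftOcc (η : Space d → ℝ≥0 → S → Space d) (φ : Space d → ℝ) (g : ℝ → ℝ≥0∞)
    (p : (ℝ × Space d) × (Marks S)) : ℝ≥0∞ :=
  famOcc η φ (fun u => g (u + p.1.1)) ⊤ p.1.2 p.2

lemma measurable_shiftOcc (h : Setting m η φ V q b) {g : ℝ → ℝ≥0∞} (hg : Measurable g) :
    Measurable (shiftOcc η φ g) :=
  measurable_famOcc h.markov h.measurable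
    (g := fun (p : (ℝ × Space d) × (Marks S)) u => g (u + p.1.1))
    (hg.comp (by fun_prop : Measurable fun a : ((ℝ × Space d) × (Marks S)) × ℝ =>
      a.2 + a.1.1.1)) ⊤ (by fun_prop) (by fun_prop)

lemma measurable_popDens (h : Setting m η φ V q b) (x : ℕ → ℝ × Space d)
    (z : ℕ × List Bool → Mark S) : Measurable (popDens η φ x z) := by
  rw [show popDens η φ x z = fun s => ∑' n, dens η φ ⊤ (x n).2 (fun w => z (n, w)) (s - (x n).1)
    from funext fun s => popDens_eq h.measurable x z s]
  refine Measurable.tsum fun n => ?_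
  exact (measurable_dens_time h.markov h.measurable ⊤ _ _).comp (measurable_id.sub_const _)

lemma lintegral_popDens (h : Setting m η φ V q b) {g : ℝ → ℝ≥0∞} (hg : Measurable g)
    (x : ℕ → ℝ × Space d) (z : ℕ × List Bool → Mark S) :
    ∫⁻ s, g s * popDens η φ x z s = ∑' n, shiftOcc η φ g (x n, fun w => z (n, w)) := by
  have hd (n : ℕ) : Measurable fun s => g s *
      dens η φ ⊤ (x n).2 (fun w => z (n, w)) (s - (x n).1) :=
    hg.mul ((measurable_dens_time h.markov h.measurable ⊤ (x n).2 (fun w => z (n, w))).comp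
      (measurable_id.sub_const _))
  simp_rw [popDens_eq h.measurable, ← ENNReal.tsum_mul_left]
  rw [lintegral_tsum fun n => (hd n).aemeasurable]
  refine tsum_congr fun n => ?_
  rw [shiftOcc, famOcc, ← lintegral_sub_right_eq_self
    (fun u => g (u + (x n).1) * dens η φ ⊤ (x n).2 (fun w => z (n, w)) u) (x n).1]
  simp

/-- The substitution `σ = τ / T` passes to macroscopic birth times, and its Jacobian supplies the
speed `T` of the large deviations. -/
lemma lintegral_immigration {H T : ℝ} (hH : 0 ≤ H) (hT : 0 < T) {F : ℝ × Space d → ℝ≥0∞}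
    (hF : Measurable F) :
    ∫⁻ p, F (p.1 / T, p.2)
      ∂(ENNReal.ofReal H • ((volume.restrict (Ici (0 : ℝ))).prod (volume : Measure (Space d))))
      = ENNReal.ofReal (H * T) * ∫⁻ σ in Ici 0, ∫⁻ x, F (σ, x) := by
  have mF : Measurable fun p : ℝ × Space d => F (p.1 / T, p.2) := hF.comp (by fun_prop)
  have mG : Measurable fun σ => ∫⁻ x, F (σ, x) := hF.lintegral_prod_right'
  rw [lintegral_smul_measure, lintegral_prod _ mF.aemeasurable, smul_eq_mul, ENNReal.ofReal_mul hH,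
    mul_assoc]
  congr 1
  rw [← lintegral_indicator measurableSet_Ici, ← lintegral_indicator measurableSet_Ici]
  set G : ℝ → ℝ≥0∞ := (Ici 0).indicator fun σ => ∫⁻ x, F (σ, x) with hG
  have mG' : Measurable G := mG.indicator measurableSet_Ici
  have e : ((Ici (0 : ℝ)).indicator fun τ => ∫⁻ x, F (τ / T, x)) = fun τ => G (T⁻¹ * τ) := by
    funext τ
    rw [hG]
    by_cases hτ : 0 ≤ τ
    · rw [indicator_of_mem (mem_Ici.2 hτ), indicator_of_mem (mem_Ici.2 (by positivity)),
        div_eq_inv_mul]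
    · rw [indicator_of_notMem (by simpa using hτ), indicator_of_notMem]
      rw [mem_Ici, not_le]
      exact mul_neg_of_pos_of_neg (by positivity) (not_le.1 hτ)
  rw [e, ← lintegral_map (f := G) (g := fun τ => T⁻¹ * τ) mG' (by fun_prop),
    Real.map_volume_mul_left (by positivity), lintegral_smul_measure, inv_inv, abs_of_pos hT,
    smul_eq_mul]

end Bridge

/-! ### Weighted occupation of a family on the macroscopic scale. -/

section Tilt

variable {d : ℕ} {S : Type*} [MeasurableSpace S] {m : Measure S}
  {η : Space d → ℝ≥0 → S → Space d} {φ : Space d → ℝ} {V q b : ℝ} {χ : ℝ → ℝ} {C c : ℝ}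

/-- Measurable weights with values in `[-C, c]` that vanish outside `[0, 1)` and are continuous from
the right on `[0, 1)`. -/
structure IsWeight (χ : ℝ → ℝ) (C c : ℝ) : Prop where
  measurable : Measurable χ
  lower : ∀ u, -C ≤ χ u
  upper : ∀ u, χ u ≤ c
  zero : ∀ u, u ∉ Ico (0 : ℝ) 1 → χ u = 0
  right : ∀ u ∈ Ico (0 : ℝ) 1, ContinuousWithinAt χ (Ici u) u

lemma IsWeight.C_nonneg (hχ : IsWeight χ C c) : 0 ≤ C := by
  have := hχ.lower 2
  rw [hχ.zero 2 (by simp)] at this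
  linarith

lemma IsWeight.c_nonneg (hχ : IsWeight χ C c) : 0 ≤ c := by
  have := hχ.upper 2
  rwa [hχ.zero 2 (by simp)] at this

/-- The family has a finite total occupation, and nonnegative lifetimes. -/
def IsProper (η : Space d → ℝ≥0 → S → Space d) (φ : Space d → ℝ) (x : Space d)
    (z : Marks S) : Prop := totOcc η φ x z < ∞ ∧ ∀ w, 0 ≤ (z w).2.1

lemma ae_isProper (h : Setting m η φ V q b) (x : Space d) :
    ∀ᵐ z ∂(famLaw m V q), IsProper η φ x z :=
  (totOcc_lt_top h x).and (ae_lifetime_nonneg h)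

lemma ae_isProper_famMeasure (h : Setting m η φ V q b) :
    ∀ᵐ p ∂(famMeasure m V q), IsProper η φ p.1 p.2 := by
  have := h.isProb_famLaw
  have hm : MeasurableSet {p : Space d × (Marks S) | IsProper η φ p.1 p.2} := by
    refine (measurableSet_lt (measurable_totOcc h) measurable_const).inter ?_
    have : {p : Space d × (Marks S) | ∀ w, 0 ≤ (p.2 w).2.1}
        = ⋂ w, {p : Space d × (Marks S) | 0 ≤ (p.2 w).2.1} := by ext; simp
    rw [show (fun p : Space d × (Marks S) => ∀ w, 0 ≤ (p.2 w).2.1)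
      = {p : Space d × (Marks S) | ∀ w, 0 ≤ (p.2 w).2.1} from rfl, this]
    exact MeasurableSet.iInter fun w => measurableSet_le measurable_const (by fun_prop)
  rw [famMeasure, Measure.ae_prod_iff_ae_ae hm]
  exact ae_of_all _ fun x => ae_isProper h x

/-- The weighted occupation of a family, on the time scale `T`. -/
def tilt (η : Space d → ℝ≥0 → S → Space d) (φ : Space d → ℝ) (χ : ℝ → ℝ) (T σ : ℝ) (x : Space d)
    (z : Marks S) : ℝ := ∫ u, χ (σ + u / T) * (dens η φ ⊤ x z u).toReal

lemma measurable_tilt (h : Setting m η φ V q b) (hχ : Measurable χ) (T : ℝ) {α : Type*}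
    [MeasurableSpace α] {s : α → ℝ} {f : α → Space d} {z : α → Marks S}
    (hs : Measurable s) (hf : Measurable f) (hz : Measurable z) :
    Measurable fun a => tilt η φ χ T (s a) (f a) (z a) := by
  have : Measurable fun p : α × ℝ => χ (s p.1 + p.2 / T) *
      (dens η φ ⊤ (f p.1) (z p.1) p.2).toReal := by
    refine (hχ.comp (by fun_prop)).mul ?_
    exact ((measurable_dens h.markov h.measurable ⊤).comp
      (by fun_prop : Measurable fun p : α × ℝ => (f p.1, z p.1, p.2))).ennreal_toReal
  exact (this.stronglyMeasurable.integral_prod_right').measurable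

lemma totOcc_eq (x : Space d) (z : Marks S) :
    totOcc η φ x z = ∫⁻ u, dens η φ ⊤ x z u := by
  simp [totOcc, famOcc]

lemma integrable_dens (h : Setting m η φ V q b) {x : Space d} {z : Marks S}
    (hz : IsProper η φ x z) : Integrable fun u => (dens η φ ⊤ x z u).toReal :=
  integrable_toReal_of_lintegral_ne_top
    (measurable_dens_time h.markov h.measurable ⊤ x z).aemeasurable
    (by rw [← totOcc_eq]; exact hz.1.ne)

lemma ae_dens_lt_top (h : Setting m η φ V q b) {x : Space d} {z : Marks S}
    (hz : IsProper η φ x z) : ∀ᵐ u, dens η φ ⊤ x z u < ∞ :=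
  ae_lt_top (measurable_dens_time h.markov h.measurable ⊤ x z)
    (by rw [← totOcc_eq]; exact hz.1.ne)

lemma integral_dens (h : Setting m η φ V q b) {x : Space d} {z : Marks S}
    (hz : IsProper η φ x z) : ∫ u, (dens η φ ⊤ x z u).toReal = jTot η φ x z := by
  rw [integral_toReal (measurable_dens_time h.markov h.measurable ⊤ x z).aemeasurable
    (ae_dens_lt_top h hz), jTot, totOcc_eq]

lemma integrable_tilt (h : Setting m η φ V q b) (hχ : IsWeight χ C c) (T σ : ℝ) {x : Space d}
    {z : Marks S} (hz : IsProper η φ x z) :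
    Integrable fun u => χ (σ + u / T) * (dens η φ ⊤ x z u).toReal := by
  refine (integrable_dens h hz).bdd_mul (c := max C c)
    (hχ.measurable.comp (by fun_prop)).aestronglyMeasurable (ae_of_all _ fun u => ?_)
  rw [Real.norm_eq_abs, abs_le]
  have h1 := hχ.lower (σ + u / T)
  have h2 := hχ.upper (σ + u / T)
  exact ⟨by linarith [le_max_left C c], by linarith [le_max_right C c]⟩

lemma tilt_le (h : Setting m η φ V q b) (hχ : IsWeight χ C c) (T σ : ℝ) {x : Space d}
    {z : Marks S} (hz : IsProper η φ x z) :
    tilt η φ χ T σ x z ≤ c * jTot η φ x z := by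
  rw [← integral_dens h hz, ← integral_const_mul]
  exact integral_mono (integrable_tilt h hχ T σ hz) ((integrable_dens h hz).const_mul c)
    fun u => mul_le_mul_of_nonneg_right (hχ.upper _) ENNReal.toReal_nonneg

lemma le_tilt (h : Setting m η φ V q b) (hχ : IsWeight χ C c) (T σ : ℝ) {x : Space d}
    {z : Marks S} (hz : IsProper η φ x z) :
    -C * jTot η φ x z ≤ tilt η φ χ T σ x z := by
  rw [← integral_dens h hz, ← integral_const_mul]
  exact integral_mono ((integrable_dens h hz).const_mul (-C)) (integrable_tilt h hχ T σ hz)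
    fun u => mul_le_mul_of_nonneg_right (hχ.lower _) ENNReal.toReal_nonneg

lemma tilt_eq_zero (hχ : IsWeight χ C c) {T σ : ℝ} (hT : 0 < T) (hσ : 1 ≤ σ) {x : Space d}
    {z : Marks S} (hz : IsProper η φ x z) : tilt η φ χ T σ x z = 0 := by
  rw [tilt]
  refine integral_eq_zero_of_ae (ae_of_all _ fun u => ?_)
  rcases lt_or_ge u 0 with hu | hu
  · simp [dens_neg ⊤ x z hu hz.2]
  · have : 0 ≤ u / T := by positivity
    simp [hχ.zero (σ + u / T) (by simp; intro _; linarith)]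

/-- A family lives for a microscopic time, so `χ(σ + u/T)` tends to `χ(σ)` for each age `u ≥ 0`. The
approach is from the right, hence right-continuity of the weight is enough. The finite total
occupation provides the envelope. -/
lemma tendsto_tilt (h : Setting m η φ V q b) (hχ : IsWeight χ C c) {σ : ℝ} (hσ : σ ∈ Ico (0 : ℝ) 1)
    {x : Space d} {z : Marks S} (hz : IsProper η φ x z) :
    Tendsto (fun T => tilt η φ χ T σ x z) atTop (𝓝 (χ σ * jTot η φ x z)) := by
  rw [← integral_dens h hz, ← integral_const_mul]
  refine tendsto_integral_filter_of_dominated_convergence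
    (fun u => max C c * (dens η φ ⊤ x z u).toReal)
    (Eventually.of_forall fun T => (integrable_tilt h hχ T σ hz).1)
    (Eventually.of_forall fun T => ae_of_all _ fun u => ?_) ((integrable_dens h hz).const_mul _)
    (ae_of_all _ fun u => ?_)
  · rw [norm_mul, Real.norm_eq_abs, Real.norm_eq_abs, abs_of_nonneg ENNReal.toReal_nonneg]
    refine mul_le_mul_of_nonneg_right (abs_le.2 ⟨?_, ?_⟩) ENNReal.toReal_nonneg
    · linarith [hχ.lower (σ + u / T), le_max_left C c]
    · linarith [hχ.upper (σ + u / T), le_max_right C c]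
  · rcases lt_or_ge u 0 with hu | hu
    · simp [dens_neg ⊤ x z hu hz.2]
    · refine Tendsto.mul_const _ ?_
      refine (hχ.right σ hσ).tendsto.comp ?_
      refine tendsto_nhdsWithin_iff.2 ⟨?_, ?_⟩
      · simpa using (tendsto_const_nhds (x := σ)).add (tendsto_id.const_div_atTop u)
      · filter_upwards [eventually_ge_atTop 0] with T hT
        have : 0 ≤ u / T := by positivity
        simpa using this

/-- The two parts of the weight are integrated separately in `[0,∞]`. For a proper family both
integrals are finite, so they combine into the real number `tilt`. -/
lemma expE_mul_negE_shiftOcc (h : Setting m η φ V q b) (hχ : IsWeight χ C c) (T τ : ℝ) {x : Space d}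
    {z : Marks S} (hz : IsProper η φ x z) :
    expE (shiftOcc η φ (fun s => ENNReal.ofReal (χ (s / T))) ((τ, x), z)) *
      negE (shiftOcc η φ (fun s => ENNReal.ofReal (-χ (s / T))) ((τ, x), z))
      = ENNReal.ofReal (Real.exp (tilt η φ χ T (τ / T) x z)) := by
  have hi := integrable_tilt h hχ T (τ / T) hz
  have e (g : ℝ → ℝ) : shiftOcc η φ (fun s => ENNReal.ofReal (g (s / T))) ((τ, x), z)
      = ∫⁻ u, ENNReal.ofReal (g (τ / T + u / T) * (dens η φ ⊤ x z u).toReal) := by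
    rw [shiftOcc, famOcc]
    refine lintegral_congr_ae ?_
    filter_upwards [ae_dens_lt_top h hz] with u hu
    rw [ENNReal.ofReal_mul' ENNReal.toReal_nonneg, ENNReal.ofReal_toReal hu.ne, ← add_div, add_comm]
  have e1 := e χ
  have e2 := e fun u => -χ u
  simp only [neg_mul] at e2
  rw [tilt, integral_eq_lintegral_pos_part_sub_lintegral_neg_part hi, e1, e2, sub_eq_add_neg,
    Real.exp_add, ENNReal.ofReal_mul (by positivity), ← expE_ofReal ENNReal.toReal_nonneg,
    ← negE_ofReal ENNReal.toReal_nonneg, ENNReal.ofReal_toReal, ENNReal.ofReal_toReal]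
  · exact (hi.neg.lintegral_lt_top).ne
  · exact hi.lintegral_lt_top.ne

end Tilt

section OccupationProcess

variable {d : ℕ} {S : Type*} [MeasurableSpace S] {m : Measure S}
  {η : Space d → ℝ≥0 → S → Space d} {φ : Space d → ℝ} {V q b H : ℝ}
  {Ω : Type*} [MeasurableSpace Ω] {P : Measure Ω} [IsProbabilityMeasure P]
  {ξ : ℕ → Ω → ℝ × Space d} {Z : ℕ × List Bool → Ω → Mark S}

/-! ### Scaled cumulant generating functions and their limit. -/

section ScaledLaplace

variable {χ : ℝ → ℝ} {C c : ℝ}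

lemma Setting.sFinite_famMeasure (h : Setting m η φ V q b) :
    SFinite (famMeasure (d := d) m V q) := by
  have := h.isProb_famLaw
  unfold famMeasure
  infer_instance

/-- The integral of `⟨N_s, φ⟩` with the weight `g`. -/
def popOcc (η : Space d → ℝ≥0 → S → Space d) (φ : Space d → ℝ) (ξ : ℕ → Ω → ℝ × Space d)
    (Z : ℕ × List Bool → Ω → Mark S) (g : ℝ → ℝ≥0∞) (ω : Ω) : ℝ≥0∞ :=
  ∫⁻ s, g s * popDens η φ (fun n => ξ n ω) (fun p => Z p ω) s

lemma popOcc_eq (h : Setting m η φ V q b) {g : ℝ → ℝ≥0∞} (hg : Measurable g) (ω : Ω) :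
    popOcc η φ ξ Z g ω = ∑' n, shiftOcc η φ g (ξ n ω, family Z n ω) :=
  lintegral_popDens h hg _ _

lemma measurable_popOcc (h : Setting m η φ V q b) (hN : IsBranchingData P m V q H ξ Z)
    {g : ℝ → ℝ≥0∞} (hg : Measurable g) : Measurable (popOcc η φ ξ Z g) := by
  rw [show popOcc η φ ξ Z g = fun ω => ∑' n, shiftOcc η φ g (ξ n ω, family Z n ω) from
    funext fun ω => popOcc_eq h hg ω]
  exact Measurable.tsum fun n => (measurable_shiftOcc h hg).comp
    ((hN.immigration.measurable n).prodMk (hN.measurable_family n))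

/-- The exponential moment of the occupation with weight `χ (· / T)`. -/
def popExp (P : Measure Ω) (η : Space d → ℝ≥0 → S → Space d) (φ : Space d → ℝ)
    (ξ : ℕ → Ω → ℝ × Space d) (Z : ℕ × List Bool → Ω → Mark S) (χ : ℝ → ℝ) (T : ℝ) : ℝ≥0∞ :=
  ∫⁻ ω, expE (popOcc η φ ξ Z (fun s => ENNReal.ofReal (χ (s / T))) ω) *
    negE (popOcc η φ ξ Z (fun s => ENNReal.ofReal (-χ (s / T))) ω) ∂P

/-- The exponential moment of the weighted occupation of one family. -/
def tiltMgf (m : Measure S) (η : Space d → ℝ≥0 → S → Space d) (φ : Space d → ℝ) (V q : ℝ)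
    (χ : ℝ → ℝ) (T : ℝ) (p : ℝ × Space d) : ℝ≥0∞ :=
  ∫⁻ z, ENNReal.ofReal (Real.exp (tilt η φ χ T p.1 p.2 z)) ∂(famLaw m V q)

lemma measurable_tiltMgf (h : Setting m η φ V q b) (hχ : Measurable χ) (T : ℝ) :
    Measurable (tiltMgf m η φ V q χ T) := by
  have := h.isProb_famLaw
  have := measurable_tilt h hχ T (α := (ℝ × Space d) × (Marks S)) (s := fun a => a.1.1)
    (f := fun a => a.1.2) (z := fun a => a.2) (by fun_prop) (by fun_prop) (by fun_prop)
  exact Measurable.lintegral_prod_right' (f := fun r : (ℝ × Space d) × (Marks S) =>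
    ENNReal.ofReal (Real.exp (tilt η φ χ T r.1.1 r.1.2 r.2))) (by fun_prop)

lemma lintegral_shiftOcc (h : Setting m η φ V q b) (hχ : IsWeight χ C c) (T : ℝ)
    (p : ℝ × Space d) :
    ∫⁻ z, expE (shiftOcc η φ (fun s => ENNReal.ofReal (χ (s / T))) (p, z)) *
      negE (shiftOcc η φ (fun s => ENNReal.ofReal (-χ (s / T))) (p, z)) ∂(famLaw m V q)
      = tiltMgf m η φ V q χ T (p.1 / T, p.2) := by
  refine lintegral_congr_ae ?_
  filter_upwards [ae_isProper h p.2] with z hz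
  exact expE_mul_negE_shiftOcc h hχ T p.1 hz

lemma IsWeight.posPart (hχ : IsWeight χ C c) : IsWeight (fun u => max (χ u) 0) 0 c where
  measurable := hχ.measurable.max measurable_const
  lower u := by simp
  upper u := max_le (hχ.upper u) hχ.c_nonneg
  zero u hu := by simp [hχ.zero u hu]
  right u hu := (hχ.right u hu).max continuousWithinAt_const

/-- The marked exponential formula in macroscopic time. Finiteness is assumed only for the positive
part of the weight, so the negative exponent may be infinite; this is the case needed when the
Laplace functional is not integrable. -/
lemma popExp_eq (h : Setting m η φ V q b) (hN : IsBranchingData P m V q H ξ Z) (hH : 0 ≤ H)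
    (hχ : IsWeight χ C c) {T : ℝ} (hT : 0 < T)
    (hfin : ∫⁻ σ in Ici (0 : ℝ), ∫⁻ x, (tiltMgf m η φ V q (fun u => max (χ u) 0) T (σ, x) - 1) ≠ ∞) :
    popExp P η φ ξ Z χ T
      = expE (ENNReal.ofReal (H * T) *
          ∫⁻ σ in Ici (0 : ℝ), ∫⁻ x, (tiltMgf m η φ V q χ T (σ, x) - 1)) *
        negE (ENNReal.ofReal (H * T) *
          ∫⁻ σ in Ici (0 : ℝ), ∫⁻ x, (1 - tiltMgf m η φ V q χ T (σ, x))) := by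
  have := h.prob
  have := isProbabilityMeasure_markLaw m h.hV h.hq0 h.hq
  have := h.isProb_famLaw
  have m1 : Measurable fun s => ENNReal.ofReal (χ (s / T)) :=
    (hχ.measurable.comp (by fun_prop)).ennreal_ofReal
  have m2 : Measurable fun s => ENNReal.ofReal (-χ (s / T)) :=
    (hχ.measurable.comp (by fun_prop)).neg.ennreal_ofReal
  have epos (p : ℝ × Space d) :
      ∫⁻ z, expE (shiftOcc η φ (fun s => ENNReal.ofReal (χ (s / T))) (p, z)) ∂(famLaw m V q)
        = tiltMgf m η φ V q (fun u => max (χ u) 0) T (p.1 / T, p.2) := by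
    rw [← lintegral_shiftOcc h hχ.posPart T p]
    refine lintegral_congr fun z => ?_
    have e0 : (fun s => ENNReal.ofReal (-max (χ (s / T)) 0)) = fun _ => 0 := by
      funext s
      simp
    have e1 : (fun s => ENNReal.ofReal (max (χ (s / T)) 0)) = fun s => ENNReal.ofReal (χ (s / T)) := by
      funext s
      simp
    rw [e0, e1]
    simp [shiftOcc, famOcc]
  have : SigmaFinite (ENNReal.ofReal H •
      ((volume.restrict (Ici (0 : ℝ))).prod (volume : Measure (Space d)))) :=
    inferInstanceAs (SigmaFinite (H.toNNReal •
      ((volume.restrict (Ici (0 : ℝ))).prod (volume : Measure (Space d)))))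
  have hmain := hN.immigration.lintegral_exp_marks hN.measurable_family hN.indepFun_family
    hN.map_family (measurable_shiftOcc h m1) (measurable_shiftOcc h m2) (by
      simp_rw [epos]
      rw [lintegral_immigration hH hT (F := fun p =>
        tiltMgf m η φ V q (fun u => max (χ u) 0) T p - 1)
        ((measurable_tiltMgf h hχ.posPart.measurable T).sub_const 1)]
      exact ENNReal.mul_ne_top ENNReal.ofReal_ne_top hfin)
  simp_rw [lintegral_shiftOcc h hχ T] at hmain
  rw [lintegral_immigration hH hT (F := fun p => tiltMgf m η φ V q χ T p - 1)
      ((measurable_tiltMgf h hχ.measurable T).sub_const 1),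
    lintegral_immigration hH hT (F := fun p => 1 - tiltMgf m η φ V q χ T p)
      ((measurable_tiltMgf h hχ.measurable T).const_sub 1)] at hmain
  rw [← hmain, popExp]
  simp_rw [popOcc_eq h m1, popOcc_eq h m2]

/-- The Laplace functional of the total occupation is integrable over the place of birth. -/
def LaplaceFinite (m : Measure S) (η : Space d → ℝ≥0 → S → Space d) (φ : Space d → ℝ)
    (V q : ℝ) : Prop :=
  ∫⁻ p : Space d × (Marks S), ENNReal.ofReal (1 - Real.exp (-jTot η φ p.1 p.2))
      ∂(famMeasure m V q) ≠ ∞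

/-- This envelope depends only on the range of the weight, so it dominates `exp (tilt) - 1` for all
`T` simultaneously. -/
lemma integrable_bound (h : Setting m η φ V q b) (hfin : LaplaceFinite m η φ V q)
    (hc : c * b < criticalRate V q) (C : ℝ) (hC : 0 ≤ C) :
    Integrable (fun p : Space d × (Marks S) => (Real.exp (c * jTot η φ p.1 p.2) - 1) +
      (1 - Real.exp (-C * jTot η φ p.1 p.2))) (famMeasure m V q) := by
  have h1 := integrable_exp_sub_one h hfin hc
  have h2 := integrable_exp_sub_one h hfin (θ := -C) (by
    have := criticalRate_pos h.hV h.hq0 h.hq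
    have := h.pos
    nlinarith)
  refine (h1.sub h2).congr (ae_of_all _ fun p => ?_)
  simp only [Pi.sub_apply]
  ring

lemma abs_exp_sub_one_le {t j : ℝ} (hc : 0 ≤ c) (hC : 0 ≤ C) (hj : 0 ≤ j) (h1 : t ≤ c * j)
    (h2 : -C * j ≤ t) :
    |Real.exp t - 1| ≤ (Real.exp (c * j) - 1) + (1 - Real.exp (-C * j)) := by
  have h3 := Real.exp_le_exp.2 h1
  have h4 := Real.exp_le_exp.2 h2
  have h5 : 1 ≤ Real.exp (c * j) := Real.one_le_exp (by positivity)
  have h6 : Real.exp (-C * j) ≤ 1 := Real.exp_le_one_iff.2 (by nlinarith)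
  rw [abs_le]
  constructor <;> linarith

lemma integrable_tilt_sub_one (h : Setting m η φ V q b) (hfin : LaplaceFinite m η φ V q)
    (hχ : IsWeight χ C c) (hc : c * b < criticalRate V q) (T : ℝ) :
    Integrable (fun p : ℝ × Space d × (Marks S) =>
      Real.exp (tilt η φ χ T p.1 p.2.1 p.2.2) - 1)
      ((volume.restrict (Ico (0 : ℝ) 1)).prod (famMeasure m V q)) := by
  have := h.isProb_famLaw
  have mt := measurable_tilt h hχ.measurable T (α := ℝ × Space d × (Marks S))
    (s := fun a => a.1) (f := fun a => a.2.1) (z := fun a => a.2.2) (by fun_prop) (by fun_prop)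
    (by fun_prop)
  have := h.sFinite_famMeasure
  refine Integrable.mono' ((integrable_bound h hfin hc C hχ.C_nonneg).comp_snd
    (volume.restrict (Ico (0 : ℝ) 1))) (by fun_prop) ?_
  have hae := Measure.quasiMeasurePreserving_snd (μ := volume.restrict (Ico (0 : ℝ) 1))
    (ν := famMeasure (d := d) m V q) |>.ae (ae_isProper_famMeasure h)
  filter_upwards [hae] with p hp
  rw [Real.norm_eq_abs]
  exact abs_exp_sub_one_le hχ.c_nonneg hχ.C_nonneg (jTot_nonneg _ _) (tilt_le h hχ T p.1 hp)
    (le_tilt h hχ T p.1 hp)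

lemma integrable_weight_sub_one (h : Setting m η φ V q b) (hfin : LaplaceFinite m η φ V q)
    (hχ : IsWeight χ C c) (hc : c * b < criticalRate V q) :
    Integrable (fun p : ℝ × Space d × (Marks S) =>
      Real.exp (χ p.1 * jTot η φ p.2.1 p.2.2) - 1)
      ((volume.restrict (Ico (0 : ℝ) 1)).prod (famMeasure m V q)) := by
  have := h.sFinite_famMeasure
  have mj := measurable_jTot h
  have mχ := hχ.measurable
  refine Integrable.mono' ((integrable_bound h hfin hc C hχ.C_nonneg).comp_snd
    (volume.restrict (Ico (0 : ℝ) 1))) (by fun_prop) (ae_of_all _ fun p => ?_)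
  have hj := jTot_nonneg (η := η) (φ := φ) p.2.1 p.2.2
  exact abs_exp_sub_one_le hχ.c_nonneg hχ.C_nonneg hj
    (mul_le_mul_of_nonneg_right (hχ.upper _) hj) (mul_le_mul_of_nonneg_right (hχ.lower _) hj)

lemma integral_prod_prod {α β γ : Type*} [MeasurableSpace α] [MeasurableSpace β]
    [MeasurableSpace γ] {μ : Measure α} {ν : Measure β} {ρ : Measure γ} [SFinite μ] [SFinite ν]
    [SFinite ρ] {f : α × β × γ → ℝ} (hf : Integrable f (μ.prod (ν.prod ρ))) :
    Integrable (fun p : α × β => ∫ z, f (p.1, p.2, z) ∂ρ) (μ.prod ν) ∧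
      ∫ p : α × β, ∫ z, f (p.1, p.2, z) ∂ρ ∂(μ.prod ν) = ∫ p, f p ∂(μ.prod (ν.prod ρ)) := by
  have hassoc := measurePreserving_prodAssoc μ ν ρ
  have hf' := (hassoc.integrable_comp_emb (MeasurableEquiv.measurableEmbedding _)).2 hf
  refine ⟨hf'.integral_prod_left, ?_⟩
  rw [← hassoc.integral_comp (MeasurableEquiv.measurableEmbedding _)]
  exact (integral_prod _ hf').symm

/-- The scaled cumulant generating function at scale `T`. -/
def scaledCgf (m : Measure S) (η : Space d → ℝ≥0 → S → Space d) (φ : Space d → ℝ) (V q H : ℝ)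
    (χ : ℝ → ℝ) (T : ℝ) : ℝ :=
  H * ∫ p, (Real.exp (tilt η φ χ T p.1 p.2.1 p.2.2) - 1)
    ∂((volume.restrict (Ico (0 : ℝ) 1)).prod (famMeasure m V q))

/-- The limit of the scaled cumulant generating functions. -/
def limitCgf (m : Measure S) (η : Space d → ℝ≥0 → S → Space d) (φ : Space d → ℝ) (V q H : ℝ)
    (χ : ℝ → ℝ) : ℝ :=
  H * ∫ p : ℝ × Space d × (Marks S), (Real.exp (χ p.1 * jTot η φ p.2.1 p.2.2) - 1)
    ∂((volume.restrict (Ico (0 : ℝ) 1)).prod (famMeasure m V q))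

/-- Pointwise the weight of a family freezes at its macroscopic birth time by `tendsto_tilt`, and
the envelope of `integrable_bound` does not depend on `T`. -/
lemma tendsto_scaledCgf (h : Setting m η φ V q b) (hfin : LaplaceFinite m η φ V q)
    (hχ : IsWeight χ C c) (hc : c * b < criticalRate V q) :
    Tendsto (scaledCgf m η φ V q H χ) atTop (𝓝 (limitCgf m η φ V q H χ)) := by
  have := h.isProb_famLaw
  have := h.sFinite_famMeasure
  have hae := Measure.quasiMeasurePreserving_snd (μ := volume.restrict (Ico (0 : ℝ) 1))
    (ν := famMeasure (d := d) m V q) |>.ae (ae_isProper_famMeasure h)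
  have hae1 := Measure.quasiMeasurePreserving_fst (μ := volume.restrict (Ico (0 : ℝ) 1))
    (ν := famMeasure (d := d) m V q) |>.ae (ae_restrict_mem measurableSet_Ico)
  refine Tendsto.const_mul H (tendsto_integral_filter_of_dominated_convergence _
    (Eventually.of_forall fun T => (integrable_tilt_sub_one h hfin hχ hc T).1)
    (Eventually.of_forall fun T => ?_) ((integrable_bound h hfin hc C hχ.C_nonneg).comp_snd
    (volume.restrict (Ico (0 : ℝ) 1))) ?_)
  · filter_upwards [hae] with p hp
    rw [Real.norm_eq_abs]
    exact abs_exp_sub_one_le hχ.c_nonneg hχ.C_nonneg (jTot_nonneg _ _) (tilt_le h hχ T p.1 hp)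
      (le_tilt h hχ T p.1 hp)
  · filter_upwards [hae, hae1] with p hp hp1
    exact ((Real.continuous_exp.tendsto _).comp (tendsto_tilt h hχ hp1 hp)).sub_const 1

lemma tiltMgf_eq (h : Setting m η φ V q b) (hχ : IsWeight χ C c) (hc : c * b < criticalRate V q)
    (T σ : ℝ) (x : Space d) :
    0 ≤ 1 + ∫ z, (Real.exp (tilt η φ χ T σ x z) - 1) ∂(famLaw m V q) ∧
      tiltMgf m η φ V q χ T (σ, x) = ENNReal.ofReal
        (1 + ∫ z, (Real.exp (tilt η φ χ T σ x z) - 1) ∂(famLaw m V q)) := by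
  have := h.isProb_famLaw
  have mt := measurable_tilt h hχ.measurable T (α := Marks S) (s := fun _ => σ)
    (f := fun _ => x) (z := fun a => a) (by fun_prop) (by fun_prop) (by fun_prop)
  have hi : Integrable (fun z => Real.exp (tilt η φ χ T σ x z)) (famLaw m V q) := by
    refine (integrable_exp_jTot h hc x).mono' (by fun_prop) ?_
    filter_upwards [ae_isProper h x] with z hz
    rw [Real.norm_eq_abs, abs_of_pos (Real.exp_pos _)]
    exact Real.exp_le_exp.2 (tilt_le h hχ T σ hz)
  rw [tiltMgf, ← ofReal_integral_eq_lintegral_ofReal hi (ae_of_all _ fun z => (Real.exp_pos _).le),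
    integral_sub hi (integrable_const 1)]
  simpa using integral_nonneg fun z => (Real.exp_pos _).le

/-- Under the integrability assumption both exponents in `popExp_eq` are finite, and their
difference is the integral of the exponential moment of one family minus one. -/
lemma popExp_eq_exp (h : Setting m η φ V q b) (hfin : LaplaceFinite m η φ V q)
    (hN : IsBranchingData P m V q H ξ Z) (hH : 0 ≤ H) (hχ : IsWeight χ C c)
    (hc : c * b < criticalRate V q) {T : ℝ} (hT : 0 < T) :
    popExp P η φ ξ Z χ T = ENNReal.ofReal (Real.exp (T * scaledCgf m η φ V q H χ T)) := by
  have := h.isProb_famLaw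
  have := h.sFinite_famMeasure
  -- Stated for a general weight because it is applied to `χ` and also to its positive part, which
  -- supplies the finiteness required by `popExp_eq`.
  have key {χ : ℝ → ℝ} {C : ℝ} (hχ : IsWeight χ C c) :
      ∃ k : ℝ × Space d → ℝ, Integrable k ((volume.restrict (Ici (0 : ℝ))).prod volume) ∧
        (∀ p, 0 ≤ 1 + k p ∧ tiltMgf m η φ V q χ T p = ENNReal.ofReal (1 + k p)) ∧
        H * ∫ p, k p ∂((volume.restrict (Ici (0 : ℝ))).prod volume)
          = scaledCgf m η φ V q H χ T := by
    set k : ℝ × Space d → ℝ := fun p => ∫ z, (Real.exp (tilt η φ χ T p.1 p.2 z) - 1) ∂(famLaw m V q)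
      with hk
    obtain ⟨hkμ, hkint⟩ := integral_prod_prod (integrable_tilt_sub_one h hfin hχ hc T)
    set μ := (volume.restrict (Ico (0 : ℝ) 1)).prod (volume : Measure (Space d)) with hμ
    have hsplit : (volume.restrict (Ico (0 : ℝ) 1)).prod (volume : Measure (Space d))
        = ((volume.restrict (Ici (0 : ℝ))).prod volume).restrict (Iio 1 ×ˢ univ) := by
      rw [← Measure.prod_restrict, Measure.restrict_univ, Measure.restrict_restrict measurableSet_Iio,
        inter_comm, Ici_inter_Iio]
    -- Families of immigrants arriving after time `T` carry no weight, so the half-line of birth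
    -- times reduces to `[0, 1)`.
    have hk0 : ∀ p, p ∉ Iio (1 : ℝ) ×ˢ (univ : Set (Space d)) → k p = 0 := by
      intro p hp
      have hp1 : 1 ≤ p.1 := by simpa using hp
      refine integral_eq_zero_of_ae ?_
      filter_upwards [ae_isProper h p.2] with z hz
      simp [tilt_eq_zero hχ hT hp1 hz]
    refine ⟨k, ?_, fun p => tiltMgf_eq h hχ hc T p.1 p.2, ?_⟩
    · rw [hμ, hsplit] at hkμ
      exact IntegrableOn.integrable_of_forall_notMem_eq_zero hkμ hk0
    · rw [scaledCgf]
      congr 1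
      rw [← setIntegral_eq_integral_of_forall_compl_eq_zero (fun p hp => hk0 p hp), ← hsplit, ← hμ]
      exact hkint
  have e1 {M : ℝ≥0∞} {r : ℝ} (hM : 0 ≤ 1 + r ∧ M = ENNReal.ofReal (1 + r)) :
      M - 1 = ENNReal.ofReal r ∧ 1 - M = ENNReal.ofReal (-r) := by
    rw [hM.2, ← ENNReal.ofReal_one, ← ENNReal.ofReal_sub _ zero_le_one, ← ENNReal.ofReal_sub _ hM.1]
    constructor <;> congr 1 <;> ring
  have e2 {f : ℝ × Space d → ℝ} (hf : Integrable f ((volume.restrict (Ici (0 : ℝ))).prod volume)) :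
      ∫⁻ σ in Ici (0 : ℝ), ∫⁻ x, ENNReal.ofReal (f (σ, x))
        = ∫⁻ p, ENNReal.ofReal (f p) ∂((volume.restrict (Ici (0 : ℝ))).prod volume) :=
    (lintegral_prod _ hf.1.aemeasurable.ennreal_ofReal).symm
  obtain ⟨k, hk, hk1, hk2⟩ := key hχ
  obtain ⟨l, hl, hl1, -⟩ := key hχ.posPart
  rw [popExp_eq h hN hH hχ hT]
  · have hk3 (σ x) := (e1 (hk1 (σ, x))).1
    have hk4 (σ x) := (e1 (hk1 (σ, x))).2
    simp_rw [hk3, hk4]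
    have hneg := e2 hk.neg
    simp only [Pi.neg_apply] at hneg
    have hA := hk.lintegral_lt_top
    have hB := hk.neg.lintegral_lt_top
    simp only [Pi.neg_apply] at hB
    rw [e2 hk, hneg, ← hk2, integral_eq_lintegral_pos_part_sub_lintegral_neg_part hk]
    set A := ∫⁻ p, ENNReal.ofReal (k p) ∂((volume.restrict (Ici (0 : ℝ))).prod volume)
    set B := ∫⁻ p, ENNReal.ofReal (-k p) ∂((volume.restrict (Ici (0 : ℝ))).prod volume)
    have hHT : 0 ≤ H * T := mul_nonneg hH hT.le
    rw [← ENNReal.ofReal_toReal hA.ne, ← ENNReal.ofReal_toReal hB.ne, ← ENNReal.ofReal_mul hHT,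
      ← ENNReal.ofReal_mul hHT, expE_ofReal (mul_nonneg hHT ENNReal.toReal_nonneg),
      negE_ofReal (mul_nonneg hHT ENNReal.toReal_nonneg), ← ENNReal.ofReal_mul (Real.exp_pos _).le,
      ← Real.exp_add, ENNReal.toReal_ofReal ENNReal.toReal_nonneg,
      ENNReal.toReal_ofReal ENNReal.toReal_nonneg]
    congr 2
    ring
  · have hl3 (σ x) := (e1 (hl1 (σ, x))).1
    simp_rw [hl3]
    rw [e2 hl]
    exact hl.lintegral_lt_top.ne

end ScaledLaplace

/-! ### The case of a non-integrable Laplace functional. -/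

section InfiniteLaplace

/-- The weight `-1` on `[0, 1)`. -/
def minusOne : ℝ → ℝ := (Ico (0 : ℝ) 1).indicator fun _ => -1

lemma isWeight_minusOne : IsWeight minusOne 1 0 where
  measurable := measurable_const.indicator measurableSet_Ico
  lower u := by
    by_cases hu : u ∈ Ico (0 : ℝ) 1
    · rw [minusOne, indicator_of_mem hu]
    · rw [minusOne, indicator_of_notMem hu]; norm_num
  upper u := indicator_nonpos (fun _ _ => by norm_num) u
  zero u hu := indicator_of_notMem hu _
  right u hu := by
    refine (continuousWithinAt_const (b := (-1 : ℝ))).congr_of_eventuallyEq ?_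
      (indicator_of_mem hu _)
    filter_upwards [Ico_mem_nhdsGE hu.2] with v hv
    exact indicator_of_mem (s := Ico (0 : ℝ) 1) ⟨hu.1.trans hv.1, hv.2⟩ _

lemma tendsto_tiltMgf_minusOne (h : Setting m η φ V q b) {σ : ℝ} (hσ : σ ∈ Ico (0 : ℝ) 1)
    (x : Space d) :
    Tendsto (fun T => tiltMgf m η φ V q minusOne T (σ, x)) atTop
      (𝓝 (∫⁻ z, ENNReal.ofReal (Real.exp (-jTot η φ x z)) ∂(famLaw m V q))) := by
  have := h.isProb_famLaw
  have mt (T : ℝ) := measurable_tilt h isWeight_minusOne.measurable T (α := Marks S)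
    (s := fun _ => σ) (f := fun _ => x) (z := fun a => a) (by fun_prop) (by fun_prop) (by fun_prop)
  refine tendsto_lintegral_filter_of_dominated_convergence (fun _ => 1)
    (Eventually.of_forall fun T => by have := mt T; fun_prop)
    (Eventually.of_forall fun T => ?_) (by simp) ?_
  · filter_upwards [ae_isProper h x] with z hz
    rw [← ENNReal.ofReal_one]
    refine ENNReal.ofReal_le_ofReal (Real.exp_le_one_iff.2 ?_)
    simpa using tilt_le h isWeight_minusOne T σ hz
  · filter_upwards [ae_isProper h x] with z hz
    have := tendsto_tilt h isWeight_minusOne hσ hz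
    rw [minusOne, indicator_of_mem hσ, neg_one_mul] at this
    exact (ENNReal.continuous_ofReal.tendsto _).comp ((Real.continuous_exp.tendsto _).comp this)

lemma one_sub_laplace (h : Setting m η φ V q b) (x : Space d) :
    1 - ∫⁻ z, ENNReal.ofReal (Real.exp (-jTot η φ x z)) ∂(famLaw m V q)
      = ∫⁻ z, ENNReal.ofReal (1 - Real.exp (-jTot η φ x z)) ∂(famLaw m V q) := by
  have := h.isProb_famLaw
  have mj := measurable_jTot_right h x
  have h1 : ∀ z, ENNReal.ofReal (Real.exp (-jTot η φ x z)) ≤ 1 := fun z => by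
    rw [← ENNReal.ofReal_one]
    exact ENNReal.ofReal_le_ofReal (Real.exp_le_one_iff.2 (by simpa using jTot_nonneg x z))
  have hfin : ∫⁻ z, ENNReal.ofReal (Real.exp (-jTot η φ x z)) ∂(famLaw m V q) ≠ ∞ :=
    ne_top_of_le_ne_top ENNReal.one_ne_top ((lintegral_mono h1).trans (by simp))
  have e := lintegral_sub (μ := famLaw m V q) (f := fun _ => (1 : ℝ≥0∞)) (g := fun z =>
    ENNReal.ofReal (Real.exp (-jTot η φ x z))) (by fun_prop) hfin (ae_of_all _ h1)
  rw [lintegral_one, measure_univ] at e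
  rw [← e]
  refine lintegral_congr fun z => ?_
  rw [ENNReal.ofReal_sub _ (Real.exp_pos _).le, ENNReal.ofReal_one]

/-- Fatou's lemma along sequences: for each birth time in `[0, 1)` the integrand converges to `E(1 -
exp (-J))`, whose integral over space is infinite. -/
lemma tendsto_lintegral_one_sub_tiltMgf (h : Setting m η φ V q b)
    (hfin : ¬ LaplaceFinite m η φ V q) :
    Tendsto (fun T => ∫⁻ σ in Ici (0 : ℝ), ∫⁻ x, (1 - tiltMgf m η φ V q minusOne T (σ, x))) atTop
      (𝓝 ∞) := by
  have := h.isProb_famLaw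
  set μ := (volume.restrict (Ici (0 : ℝ))).prod (volume : Measure (Space d)) with hμ
  have mm (T : ℝ) : Measurable fun p => 1 - tiltMgf m η φ V q minusOne T p :=
    (measurable_tiltMgf h isWeight_minusOne.measurable T).const_sub 1
  have e1 (T : ℝ) : ∫⁻ σ in Ici (0 : ℝ), ∫⁻ x, (1 - tiltMgf m η φ V q minusOne T (σ, x))
      = ∫⁻ p, (1 - tiltMgf m η φ V q minusOne T p) ∂μ :=
    (lintegral_prod _ (mm T).aemeasurable).symm
  simp_rw [e1]
  refine tendsto_of_seq_tendsto fun u hu => ?_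
  refine tendsto_of_le_liminf_of_limsup_le ?_ le_top
  refine le_trans ?_ (lintegral_liminf_le fun n => mm (u n))
  have hJ : Measurable fun p : Space d × (Marks S) => jTot η φ p.1 p.2 :=
    measurable_jTot h
  rw [LaplaceFinite, not_not, famMeasure, lintegral_prod _ (by fun_prop)] at hfin
  rw [hμ, lintegral_prod _ (Measurable.liminf fun n => mm (u n)).aemeasurable]
  calc ∞ = ∫⁻ σ in Ico (0 : ℝ) 1, ∞ := by simp
    _ ≤ ∫⁻ σ in Ico (0 : ℝ) 1, ∫⁻ x,
        liminf (fun n => 1 - tiltMgf m η φ V q minusOne (u n) (σ, x)) atTop := by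
        refine setLIntegral_mono' measurableSet_Ico fun σ hσ => ?_
        rw [← hfin]
        refine lintegral_mono fun x => ?_
        rw [← one_sub_laplace h x]
        have ht := (tendsto_tiltMgf_minusOne h hσ x).comp hu
        exact (ENNReal.Tendsto.sub tendsto_const_nhds ht
          (Or.inl ENNReal.one_ne_top)).liminf_eq.ge
    _ ≤ _ := lintegral_mono_set Ico_subset_Ici_self

lemma tiltMgf_zero (h : Setting m η φ V q b) (T : ℝ) (p : ℝ × Space d) :
    tiltMgf m η φ V q (fun _ => 0) T p = 1 := by
  have := h.isProb_famLaw
  simp [tiltMgf, tilt]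

/-- If the Laplace functional is not integrable, then the occupation is larger than linear, up to
events of superexponentially small probability. -/
lemma eventually_popExp_minusOne_le (h : Setting m η φ V q b) (hfin : ¬ LaplaceFinite m η φ V q)
    (hN : IsBranchingData P m V q H ξ Z) (hH : 0 < H) (M : ℝ) :
    ∀ᶠ T in atTop, popExp P η φ ξ Z minusOne T ≤ ENNReal.ofReal (Real.exp (-(M * T))) := by
  have hlim := tendsto_lintegral_one_sub_tiltMgf h hfin
  filter_upwards [eventually_gt_atTop 0, hlim.eventually
    (Ioi_mem_nhds (show ENNReal.ofReal (|M| / H) < ∞ from ENNReal.ofReal_lt_top))] with T hT hB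
  have e0 : (fun u => max (minusOne u) 0) = fun _ => 0 :=
    funext fun u => max_eq_right (isWeight_minusOne.upper u)
  have hle (p) : tiltMgf m η φ V q minusOne T p - 1 = 0 := by
    have := h.isProb_famLaw
    refine tsub_eq_zero_of_le ?_
    calc tiltMgf m η φ V q minusOne T p ≤ ∫⁻ z, 1 ∂(famLaw m V q) := by
          refine lintegral_mono_ae ?_
          filter_upwards [ae_isProper h p.2] with z hz
          rw [← ENNReal.ofReal_one]
          refine ENNReal.ofReal_le_ofReal (Real.exp_le_one_iff.2 ?_)
          simpa using tilt_le h isWeight_minusOne T p.1 hz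
      _ = 1 := by simp
  rw [popExp_eq h hN hH.le isWeight_minusOne hT (by simp [e0, tiltMgf_zero h])]
  simp_rw [hle]
  simp only [lintegral_zero, mul_zero, expE_zero, one_mul]
  calc _ ≤ negE (ENNReal.ofReal (H * T) * ENNReal.ofReal (|M| / H)) :=
        negE_anti (mul_le_mul_right (le_of_lt hB) _)
    _ = ENNReal.ofReal (Real.exp (-(|M| * T))) := by
        rw [← ENNReal.ofReal_mul (by positivity), negE_ofReal (by positivity)]
        congr 3
        field_simp
    _ ≤ _ := by
        refine ENNReal.ofReal_le_ofReal (Real.exp_le_exp.2 ?_)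
        nlinarith [le_abs_self M]

end InfiniteLaplace

/-! ### The cumulant generating function and the range of its derivative. -/

section Cgf

variable {θ : ℝ} {χ : ℝ → ℝ} {C c : ℝ}

/-- The cumulant generating function per unit of time. -/
def cgf (m : Measure S) (η : Space d → ℝ≥0 → S → Space d) (φ : Space d → ℝ) (V q H θ : ℝ) : ℝ :=
  H * ∫ p, (Real.exp (θ * jTot η φ p.1 p.2) - 1) ∂(famMeasure m V q)

/-- The derivative of the cumulant generating function. -/
def cgfDeriv (m : Measure S) (η : Space d → ℝ≥0 → S → Space d) (φ : Space d → ℝ)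
    (V q H θ : ℝ) : ℝ :=
  H * ∫ p, jTot η φ p.1 p.2 * Real.exp (θ * jTot η φ p.1 p.2) ∂(famMeasure m V q)

lemma limitCgf_eq (h : Setting m η φ V q b) (hfin : LaplaceFinite m η φ V q)
    (hχ : IsWeight χ C c) (hc : c * b < criticalRate V q) :
    limitCgf m η φ V q H χ = ∫ σ in Ico (0 : ℝ) 1, cgf m η φ V q H (χ σ) := by
  have := h.sFinite_famMeasure
  rw [limitCgf, integral_prod _ (integrable_weight_sub_one h hfin hχ hc), ← integral_const_mul]
  rfl

lemma exists_subcritical_gt (h : Setting m η φ V q b) (hc : θ * b < criticalRate V q) :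
    ∃ δ : ℝ, 0 < δ ∧ (θ + 2 * δ) * b < criticalRate V q := by
  have hb := h.pos
  refine ⟨(criticalRate V q - θ * b) / (4 * b), div_pos (by linarith) (by linarith), ?_⟩
  have : 2 * ((criticalRate V q - θ * b) / (4 * b)) * b = (criticalRate V q - θ * b) / 2 := by
    field_simp
    ring
  rw [add_mul, this]
  linarith

/-- By convexity `j exp (θ j)` is at most `(exp ((θ + 2δ) j) - exp (θ j)) / (2δ)`, a difference of
integrable functions as long as `θ + 2δ` is subcritical. -/
lemma integrable_mul_exp (h : Setting m η φ V q b) (hfin : LaplaceFinite m η φ V q)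
    (hc : θ * b < criticalRate V q) :
    Integrable (fun p : Space d × (Marks S) =>
      jTot η φ p.1 p.2 * Real.exp (θ * jTot η φ p.1 p.2)) (famMeasure m V q) := by
  have mj := measurable_jTot h
  obtain ⟨δ, hδ, hδc⟩ := exists_subcritical_gt h hc
  have h1 := integrable_exp_sub_one h hfin hδc
  have h2 := integrable_exp_sub_one h hfin hc
  refine Integrable.mono' ((h1.sub h2).const_mul (1 / (2 * δ))) (by fun_prop)
    (ae_of_all _ fun p => ?_)
  have hj := jTot_nonneg (η := η) (φ := φ) p.1 p.2
  rw [Real.norm_eq_abs, abs_of_nonneg (by positivity)]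
  simp only [Pi.sub_apply, add_mul, Real.exp_add]
  have h3 := Real.add_one_le_exp (2 * δ * jTot η φ p.1 p.2)
  have h4 := Real.exp_pos (θ * jTot η φ p.1 p.2)
  rw [one_div, inv_mul_eq_div, le_div_iff₀ (by positivity)]
  nlinarith

lemma hasDerivAt_cgf (h : Setting m η φ V q b) (hfin : LaplaceFinite m η φ V q)
    (hc : θ * b < criticalRate V q) :
    HasDerivAt (cgf m η φ V q H) (cgfDeriv m η φ V q H θ) θ := by
  have mj := measurable_jTot h
  obtain ⟨δ, hδ, hδc⟩ := exists_subcritical_gt h hc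
  have hF (ϑ : ℝ) : AEStronglyMeasurable (fun p : Space d × (Marks S) =>
      Real.exp (ϑ * jTot η φ p.1 p.2) - 1) (famMeasure m V q) := by fun_prop
  have hb1 : ∀ᵐ p : Space d × (Marks S) ∂(famMeasure m V q), ∀ ϑ ∈ Metric.ball θ δ,
      ‖jTot η φ p.1 p.2 * Real.exp (ϑ * jTot η φ p.1 p.2)‖
        ≤ jTot η φ p.1 p.2 * Real.exp ((θ + 2 * δ) * jTot η φ p.1 p.2) := by
    refine ae_of_all _ fun p ϑ hϑ => ?_
    have hj := jTot_nonneg (η := η) (φ := φ) p.1 p.2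
    rw [Real.norm_eq_abs, abs_of_nonneg (mul_nonneg hj (Real.exp_pos _).le)]
    refine mul_le_mul_of_nonneg_left (Real.exp_le_exp.2 (mul_le_mul_of_nonneg_right ?_ hj)) hj
    rw [Metric.mem_ball, Real.dist_eq, abs_lt] at hϑ
    linarith
  have hb2 : ∀ᵐ p : Space d × (Marks S) ∂(famMeasure m V q), ∀ ϑ ∈ Metric.ball θ δ,
      HasDerivAt (fun ϑ => Real.exp (ϑ * jTot η φ p.1 p.2) - 1)
        (jTot η φ p.1 p.2 * Real.exp (ϑ * jTot η φ p.1 p.2)) ϑ := by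
    refine ae_of_all _ fun p ϑ _ => ?_
    have := ((hasDerivAt_id ϑ).mul_const (jTot η φ p.1 p.2)).exp.sub_const 1
    simpa [mul_comm] using this
  have key := hasDerivAt_integral_of_dominated_loc_of_deriv_le (𝕜 := ℝ) (μ := famMeasure m V q)
    (F := fun (ϑ : ℝ) (p : Space d × (Marks S)) => Real.exp (ϑ * jTot η φ p.1 p.2) - 1)
    (F' := fun (ϑ : ℝ) (p : Space d × (Marks S)) =>
      jTot η φ p.1 p.2 * Real.exp (ϑ * jTot η φ p.1 p.2))
    (Metric.ball_mem_nhds θ hδ) (Eventually.of_forall hF)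
    (integrable_exp_sub_one h hfin hc) (integrable_mul_exp h hfin hc).1 hb1
    (integrable_mul_exp h hfin hδc) hb2
  exact key.2.const_mul H

/-- At the parameters `-n` the derivative tends to zero, since `J exp (-n J)` tends to zero and is
dominated by the integrable `J`. Hence there is no gap of slopes above zero. -/
lemma exists_cgfDeriv_lt (h : Setting m η φ V q b) (hfin : LaplaceFinite m η φ V q) {s : ℝ}
    (hs : 0 < s) (ϑ : ℝ) :
    ∃ θ < ϑ, θ * b < criticalRate V q ∧ cgfDeriv m η φ V q H θ < s := by
  have mj := measurable_jTot h
  have hcr := criticalRate_pos h.hV h.hq0 h.hq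
  have hb := h.pos
  have ht : Tendsto (fun n : ℕ => cgfDeriv m η φ V q H (-(n : ℝ))) atTop (𝓝 0) := by
    have := tendsto_integral_of_dominated_convergence (μ := famMeasure m V q)
      (F := fun (n : ℕ) (p : Space d × (Marks S)) =>
        jTot η φ p.1 p.2 * Real.exp (-(n : ℝ) * jTot η φ p.1 p.2)) (f := fun _ => 0)
      (fun p => jTot η φ p.1 p.2 * Real.exp (0 * jTot η φ p.1 p.2))
      (fun n => by fun_prop) (integrable_mul_exp h hfin (by simpa using hcr)) (fun n =>
        ae_of_all _ fun p => ?_) (ae_of_all _ fun p => ?_)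
    · simpa [cgfDeriv] using this.const_mul H
    · have hj := jTot_nonneg (η := η) (φ := φ) p.1 p.2
      rw [Real.norm_eq_abs, abs_of_nonneg (by positivity)]
      refine mul_le_mul_of_nonneg_left (Real.exp_le_exp.2 (mul_le_mul_of_nonneg_right ?_ hj)) hj
      simp
    · rcases (jTot_nonneg (η := η) (φ := φ) p.1 p.2).eq_or_lt with hj | hj
      · simp [← hj]
      · have : Tendsto (fun n : ℕ => -(n : ℝ) * jTot η φ p.1 p.2) atTop atBot :=
          (tendsto_neg_atTop_atBot.comp tendsto_natCast_atTop_atTop).atBot_mul_const hj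
        simpa using (Real.tendsto_exp_atBot.comp this).const_mul (jTot η φ p.1 p.2)
  have h2 : ∀ᶠ n : ℕ in atTop, -(n : ℝ) < ϑ :=
    (tendsto_neg_atTop_atBot.comp tendsto_natCast_atTop_atTop).eventually_lt_atBot ϑ
  obtain ⟨n, hn, hn2⟩ := ((ht.eventually (gt_mem_nhds hs)).and h2).exists
  exact ⟨-n, hn2, by nlinarith [(Nat.cast_nonneg n : (0 : ℝ) ≤ n)], hn⟩

/-- Differentiating under the expectation for each place and then integrating over space identifies
the quantity that defines `A` with the derivative of the cumulant generating function. -/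
lemma lintegral_deriv_vLim (h : Setting m η φ V q b) (hfin : LaplaceFinite m η φ V q)
    (hH : 0 ≤ H) (hc : θ * b < criticalRate V q) :
    ENNReal.ofReal H * ∫⁻ x, ENNReal.ofReal (deriv (fun ϑ => vLim m η V q φ x ϑ) θ)
      = ENNReal.ofReal (cgfDeriv m η φ V q H θ) := by
  have := h.isProb_famLaw
  have mj := measurable_jTot h
  have hi := integrable_mul_exp h hfin hc
  have h0 (p : Space d × (Marks S)) :
      0 ≤ jTot η φ p.1 p.2 * Real.exp (θ * jTot η φ p.1 p.2) :=
    mul_nonneg (jTot_nonneg _ _) (Real.exp_pos _).le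
  rw [cgfDeriv, ENNReal.ofReal_mul hH, ofReal_integral_eq_lintegral_ofReal hi (ae_of_all _ h0)]
  congr 1
  rw [famMeasure, lintegral_prod _ (by fun_prop)]
  refine lintegral_congr_ae ?_
  filter_upwards [hi.prod_right_ae] with x hx
  rw [(hasDerivAt_vLim h hc x).deriv,
    ofReal_integral_eq_lintegral_ofReal hx (ae_of_all _ fun z => h0 (x, z))]

lemma exists_cgfDeriv_gt (h : Setting m η φ V q b) (hb : b = supNorm φ)
    (hfin : LaplaceFinite m η φ V q) (hH : 0 ≤ H) {s : ℝ} (hs : 0 < s)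
    (hsA : (s : EReal) < ((ENNReal.ofReal H * slopeA m η V q φ : ℝ≥0∞) : EReal)) :
    ∃ θ, θ * b < criticalRate V q ∧ s < cgfDeriv m η φ V q H θ := by
  have hs' : ENNReal.ofReal s < ENNReal.ofReal H * slopeA m η V q φ := by
    rwa [← EReal.coe_ennreal_lt_coe_ennreal_iff, EReal.coe_ennreal_ofReal, max_eq_left hs.le]
  have hHA : ENNReal.ofReal s / ENNReal.ofReal H < slopeA m η V q φ :=
    ENNReal.div_lt_of_lt_mul' hs'
  have hfr := frequently_lt_of_lt_limsup (by isBoundedDefault) hHA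
  obtain ⟨θ, hθ, hθ2⟩ := (hfr.and_eventually self_mem_nhdsWithin).exists
  have hc : θ * b < criticalRate V q := by
    rw [hb]
    have hθ3 : θ < thetaMax V q φ := hθ2
    rwa [thetaMax, lt_div_iff₀ (hb ▸ h.pos)] at hθ3
  refine ⟨θ, hc, ?_⟩
  have := lintegral_deriv_vLim h hfin hH hc
  by_contra hcon
  rw [not_lt] at hcon
  have h2 := ENNReal.ofReal_le_ofReal hcon
  rw [← this] at h2
  exact absurd hθ (not_lt.2 ((ENNReal.le_div_iff_mul_le (Or.inr (by
    rw [Ne, ENNReal.ofReal_eq_zero, not_le]; exact hs)) (Or.inl ENNReal.ofReal_ne_top)).2 (by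
      rwa [mul_comm])))

/-- Slopes near zero occur far to the left, and slopes above `s` occur near the threshold by the
definition of `A`. Derivatives have the intermediate value property, so continuity of `cgfDeriv` is
not needed. -/
lemma exists_cgfDeriv_eq (h : Setting m η φ V q b) (hb : b = supNorm φ)
    (hfin : LaplaceFinite m η φ V q) (hH : 0 ≤ H) {s : ℝ} (hs : 0 < s)
    (hsA : (s : EReal) < ((ENNReal.ofReal H * slopeA m η V q φ : ℝ≥0∞) : EReal)) :
    ∃ θ, θ * b < criticalRate V q ∧ cgfDeriv m η φ V q H θ = s := by
  obtain ⟨θ₁, h1, h1s⟩ := exists_cgfDeriv_gt h hb hfin hH hs hsA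
  obtain ⟨θ₀, h01, h0, h0s⟩ := exists_cgfDeriv_lt (H := H) h hfin hs θ₁
  have hbp := h.pos
  have hder : ∀ x ∈ Icc θ₀ θ₁, HasDerivWithinAt (cgf m η φ V q H) (cgfDeriv m η φ V q H x)
      (Icc θ₀ θ₁) x := fun x hx =>
    (hasDerivAt_cgf h hfin (by nlinarith [hx.2])).hasDerivWithinAt
  obtain ⟨x, hx, hxs⟩ := exists_hasDerivWithinAt_eq_of_gt_of_lt h01.le hder h0s h1s
  exact ⟨x, by nlinarith [hx.2], hxs⟩

end Cgf

/-! ### Comparison on the logarithmic scale. -/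

section LogScale

lemma inv_mul_log_exp {T : ℝ} (hT : 0 < T) (x : ℝ) :
    ((T⁻¹ : ℝ) : EReal) * ENNReal.log (ENNReal.ofReal (Real.exp (T * x))) = (x : EReal) := by
  rw [ENNReal.log_ofReal_of_pos (Real.exp_pos _), Real.log_exp, ← EReal.coe_mul,
    inv_mul_cancel_left₀ hT.ne']

lemma inv_mul_log_mono {T : ℝ} (hT : 0 < T) {a b : ℝ≥0∞} (hab : a ≤ b) :
    ((T⁻¹ : ℝ) : EReal) * ENNReal.log a ≤ ((T⁻¹ : ℝ) : EReal) * ENNReal.log b :=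
  mul_le_mul_of_nonneg_left (ENNReal.log_monotone hab)
    (EReal.coe_nonneg.2 (inv_nonneg.2 hT.le))

lemma limsup_inv_mul_log_le {p : ℝ → ℝ≥0∞} {x : ℝ → ℝ} {L : ℝ} (hx : Tendsto x atTop (𝓝 L))
    (hp : ∀ᶠ T in atTop, p T ≤ ENNReal.ofReal (Real.exp (T * x T))) :
    limsup (fun T : ℝ => ((T⁻¹ : ℝ) : EReal) * ENNReal.log (p T)) atTop ≤ (L : EReal) := by
  have hx' : Tendsto (fun T => (x T : EReal)) atTop (𝓝 (L : EReal)) :=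
    (continuous_coe_real_ereal.tendsto L).comp hx
  rw [← hx'.limsup_eq]
  refine limsup_le_limsup ?_
  filter_upwards [hp, eventually_gt_atTop 0] with T hT h0
  rw [← inv_mul_log_exp h0 (x T)]
  exact inv_mul_log_mono h0 hT

lemma le_liminf_inv_mul_log {p : ℝ → ℝ≥0∞} {L : ℝ}
    (hp : ∀ᶠ T in atTop, ENNReal.ofReal (Real.exp (T * L)) ≤ p T) :
    (L : EReal) ≤ liminf (fun T : ℝ => ((T⁻¹ : ℝ) : EReal) * ENNReal.log (p T)) atTop := by
  refine le_liminf_of_le (by isBoundedDefault) ?_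
  filter_upwards [hp, eventually_gt_atTop 0] with T hT h0
  rw [← inv_mul_log_exp h0 L]
  exact inv_mul_log_mono h0 hT

end LogScale

/-! ### Exponential tilting for finitely many coordinates. -/

section Tilting

variable {ι : Type*} [Fintype ι]

/-- The exponential moments of the vectors `X T` have the scaled cumulant generating function
`w * ∑ i, G (ϑ i)`, for parameters below `c₀`. -/
def HasScaledCgf (P : Measure Ω) (X : ℝ → Ω → ι → ℝ) (w : ℝ) (G : ℝ → ℝ) (c₀ : ℝ) : Prop :=
  ∀ ϑ : ι → ℝ, (∀ i, ϑ i < c₀) → ∃ ℓ : ℝ → ℝ, Tendsto ℓ atTop (𝓝 (w * ∑ i, G (ϑ i))) ∧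
    ∀ᶠ T in atTop, ∫⁻ ω, ENNReal.ofReal (Real.exp (T * ∑ i, ϑ i * X T ω i)) ∂P
      = ENNReal.ofReal (Real.exp (T * ℓ T))

variable {X : ℝ → Ω → ι → ℝ} {w c₀ : ℝ} {G : ℝ → ℝ} {θ s : ι → ℝ}

/-- The first-order expansion of `G` at each `θ i`, in both directions, has an error below `lam * ε
/ 2` for small `lam`. Finiteness of the index set gives a common `lam`. This is the gain that
concentrates the tilted law near `w * s i`. -/
lemma exists_perturbation (hw : 0 < w) (hθ : ∀ i, θ i < c₀) (hG : ∀ i, HasDerivAt G (s i) (θ i))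
    {ε : ℝ} (hε : 0 < ε) :
    ∃ lam : ℝ, 0 < lam ∧ ∀ i, θ i + lam < c₀ ∧
      w * (G (θ i + lam) - G (θ i)) ≤ lam * (w * s i + ε / 2) ∧
      w * (G (θ i - lam) - G (θ i)) ≤ lam * (-(w * s i) + ε / 2) := by
  have key (i : ι) : ∀ᶠ lam in 𝓝[>] (0 : ℝ), θ i + lam < c₀ ∧
      w * (G (θ i + lam) - G (θ i)) ≤ lam * (w * s i + ε / 2) ∧
      w * (G (θ i - lam) - G (θ i)) ≤ lam * (-(w * s i) + ε / 2) := by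
    have h1 : ∀ᶠ lam in 𝓝 (0 : ℝ), θ i + lam < c₀ := by
      have : Tendsto (fun lam => θ i + lam) (𝓝 0) (𝓝 (θ i)) := by
        simpa using (tendsto_const_nhds (x := θ i)).add (tendsto_id (α := ℝ) (x := 𝓝 0))
      exact this.eventually (gt_mem_nhds (hθ i))
    have h2 := (hasDerivAt_iff_isLittleO_nhds_zero.1 (hG i)).def (show 0 < ε / (2 * w) by positivity)
    have h3 : ∀ᶠ lam in 𝓝 (0 : ℝ), ‖G (θ i + -lam) - G (θ i) - (-lam) • s i‖
        ≤ ε / (2 * w) * ‖-lam‖ :=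
      (by simpa using (continuous_neg (G := ℝ)).tendsto 0 :
        Tendsto (fun x : ℝ => -x) (𝓝 0) (𝓝 0)).eventually h2
    filter_upwards [nhdsWithin_le_nhds h1, nhdsWithin_le_nhds h2, nhdsWithin_le_nhds h3,
      self_mem_nhdsWithin] with lam a1 a2 a3 a4
    have a4' : 0 < lam := a4
    rw [Real.norm_eq_abs, Real.norm_eq_abs, abs_of_pos a4', abs_le, smul_eq_mul] at a2
    rw [Real.norm_eq_abs, Real.norm_eq_abs, abs_neg, abs_of_pos a4', abs_le, smul_eq_mul,
      ← sub_eq_add_neg] at a3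
    have e : w * (ε / (2 * w) * lam) = lam * (ε / 2) := by field_simp
    refine ⟨a1, ?_, ?_⟩
    · have := mul_le_mul_of_nonneg_left a2.2 hw.le
      rw [e] at this
      nlinarith
    · have := mul_le_mul_of_nonneg_left a3.2 hw.le
      rw [e] at this
      nlinarith
  obtain ⟨lam, h1, h2⟩ := ((eventually_all.2 key).and self_mem_nhdsWithin).exists
  exact ⟨lam, h2, h1⟩

/-- Markov's inequality under the tilted law: on `A` the density for `θ` is at most `exp (-T y)`
times the density for `ϑ`. -/
lemma setLIntegral_tilted_le {T : ℝ} (hT : 0 ≤ T) (mX : ∀ i, Measurable fun ω => X T ω i)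
    (i : ι) {lam y : ℝ} (ϑ : ι → ℝ)
    (hϑ : ∀ ω, ∑ j, ϑ j * X T ω j = ∑ j, θ j * X T ω j + lam * X T ω i) {A : Set Ω}
    (hA : ∀ ω ∈ A, y ≤ lam * X T ω i) (mA : MeasurableSet A) :
    ∫⁻ ω in A, ENNReal.ofReal (Real.exp (T * ∑ j, θ j * X T ω j)) ∂P
      ≤ ENNReal.ofReal (Real.exp (T * -y)) *
        ∫⁻ ω, ENNReal.ofReal (Real.exp (T * ∑ j, ϑ j * X T ω j)) ∂P := by
  rw [← lintegral_const_mul _ (by fun_prop)]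
  refine le_trans (setLIntegral_mono' mA fun ω hω => ?_) (setLIntegral_le_lintegral A _)
  rw [← ENNReal.ofReal_mul (Real.exp_pos _).le, ← Real.exp_add, hϑ ω]
  refine ENNReal.ofReal_le_ofReal (Real.exp_le_exp.2 ?_)
  have := mul_le_mul_of_nonneg_left (hA ω hω) hT
  nlinarith

lemma eventually_setLIntegral_tilted_le (mX : ∀ T i, Measurable fun ω => X T ω i)
    (hM : HasScaledCgf P X w G c₀) (i : ι) {lam y g : ℝ} (ϑ : ι → ℝ) (hϑ0 : ∀ j, ϑ j < c₀)
    (hϑ : ∀ T ω, ∑ j, ϑ j * X T ω j = ∑ j, θ j * X T ω j + lam * X T ω i)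
    (hg : w * ∑ j, G (ϑ j) - y < g) :
    ∀ᶠ T in atTop, ∫⁻ ω in {ω | y ≤ lam * X T ω i},
      ENNReal.ofReal (Real.exp (T * ∑ j, θ j * X T ω j)) ∂P ≤ ENNReal.ofReal (Real.exp (T * g)) := by
  obtain ⟨ℓ, hℓ, hℓT⟩ := hM ϑ hϑ0
  filter_upwards [hℓT, (hℓ.sub_const y).eventually (gt_mem_nhds hg), eventually_ge_atTop 0]
    with T h1 h2 hT
  refine (setLIntegral_tilted_le hT (mX T) i ϑ (hϑ T) (fun ω hω => hω)
    (measurableSet_le measurable_const ((mX T i).const_mul lam))).trans ?_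
  rw [h1, ← ENNReal.ofReal_mul (Real.exp_pos _).le, ← Real.exp_add]
  refine ENNReal.ofReal_le_ofReal (Real.exp_le_exp.2 ?_)
  nlinarith

/-- The lower bound obtained by exponential tilting. -/
lemma eventually_le_measure_of_tilting (mX : ∀ T i, Measurable fun ω => X T ω i)
    (hM : HasScaledCgf P X w G c₀) (hw : 0 < w) (hθ : ∀ i, θ i < c₀)
    (hG : ∀ i, HasDerivAt G (s i) (θ i)) {ε : ℝ} (hε : 0 < ε) {L : ℝ}
    (hL : L < w * ∑ i, G (θ i) - ∑ i, θ i * (w * s i) - ε * ∑ i, |θ i|) :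
    ∀ᶠ T in atTop, ENNReal.ofReal (Real.exp (T * L)) ≤ P {ω | ∀ i, |X T ω i - w * s i| < ε} := by
  classical
  obtain ⟨lam, hlam, hl⟩ := exists_perturbation hw hθ hG hε
  set g := w * ∑ i, G (θ i) with hg
  set r := ∑ i, θ i * (w * s i) + ε * ∑ i, |θ i| with hr
  -- A further tilt of coordinate `i` by `r` bounds the tilted mass of a one-sided deviation. The
  -- margin `lam * ε / 2` is larger than the claimed decay `lam * ε / 4` to leave room for the
  -- convergence of the cumulants. It is used with `r = lam` and `r = -lam`.
  have hshift (i : ι) {r y : ℝ} (h0 : θ i + r < c₀)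
      (hy : w * (G (θ i + r) - G (θ i)) ≤ y - lam * ε / 2) :
      ∀ᶠ T in atTop, ∫⁻ ω in {ω | y ≤ r * X T ω i},
        ENNReal.ofReal (Real.exp (T * ∑ j, θ j * X T ω j)) ∂P
          ≤ ENNReal.ofReal (Real.exp (T * (g - lam * ε / 4))) := by
    have hsum (F : ι → ℝ → ℝ) : ∑ j, F j (Function.update θ i (θ i + r) j)
        = ∑ j, F j (θ j) + (F i (θ i + r) - F i (θ i)) := by
      rw [← Finset.add_sum_erase _ _ (Finset.mem_univ i),
        ← Finset.add_sum_erase _ (fun j => F j (θ j)) (Finset.mem_univ i),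
        Finset.sum_congr rfl (g := fun j => F j (θ j)) fun j hj => by
          rw [Function.update_of_ne (Finset.ne_of_mem_erase hj)], Function.update_self]
      ring
    refine eventually_setLIntegral_tilted_le mX hM i (Function.update θ i (θ i + r)) ?_
      (fun T ω => (hsum fun j x => x * X T ω j).trans (by ring)) ?_
    · intro j
      rcases eq_or_ne j i with rfl | hj
      · simpa using h0
      · simpa [hj] using hθ j
    · rw [hsum fun _ => G, mul_add]
      nlinarith [mul_pos hlam hε]
  have hup (i : ι) := hshift i (r := lam) (y := lam * (w * s i + ε)) (hl i).1
    ((hl i).2.1.trans (by linarith))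
  have hdown (i : ι) := hshift i (r := -lam) (y := -lam * (w * s i - ε))
    (by linarith [hθ i]) (by rw [← sub_eq_add_neg]; exact (hl i).2.2.trans (by linarith))
  obtain ⟨ℓ, hℓ, hℓT⟩ := hM θ hθ
  -- The first bound keeps the deviating mass, of rate `g - lam * ε / 4`, negligible against `exp (T
  -- (g - κ))`. The second gives `r + L ≤ g - 2κ`, where the extra `κ` pays for a factor one half.
  set κ := min (lam * ε / 8) ((g - r - L) / 2) with hκ
  have hκ0 : 0 < κ := lt_min (by positivity) (by rw [hr]; linarith)
  have hκ1 : κ ≤ lam * ε / 8 := min_le_left _ _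
  have hκ2 : κ ≤ (g - r - L) / 2 := min_le_right _ _
  set N : ℝ := 2 * Fintype.card ι with hN
  have hexp1 : ∀ᶠ T : ℝ in atTop, N * Real.exp (T * (-(lam * ε / 8))) ≤ 1 / 2 := by
    have : Tendsto (fun T : ℝ => N * Real.exp (T * (-(lam * ε / 8)))) atTop (𝓝 (N * 0)) :=
      (Real.tendsto_exp_atBot.comp (tendsto_id.atTop_mul_const_of_neg
        (by simpa using (by positivity : 0 < lam * ε / 8)))).const_mul N
    rw [mul_zero] at this
    exact (this.eventually (gt_mem_nhds (by norm_num : (0 : ℝ) < 1 / 2))).mono fun _ => le_of_lt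
  have hexp2 : ∀ᶠ T : ℝ in atTop, Real.exp (T * (-κ)) ≤ 1 / 2 := by
    have : Tendsto (fun T : ℝ => Real.exp (T * (-κ))) atTop (𝓝 0) :=
      Real.tendsto_exp_atBot.comp (tendsto_id.atTop_mul_const_of_neg (by simpa using hκ0))
    exact (this.eventually (gt_mem_nhds (by norm_num : (0 : ℝ) < 1 / 2))).mono fun _ => le_of_lt
  filter_upwards [eventually_all.2 hup, eventually_all.2 hdown, hℓT,
    hℓ.eventually (lt_mem_nhds (show g - κ < g by linarith)), hexp1, hexp2, eventually_gt_atTop 0]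
    with T u1 u2 u3 u4 u5 u6 hT
  set K : Ω → ℝ≥0∞ := fun ω => ENNReal.ofReal (Real.exp (T * ∑ j, θ j * X T ω j)) with hK
  set E : Set Ω := {ω | ∀ i, |X T ω i - w * s i| < ε} with hE
  have mE : MeasurableSet E := by
    rw [hE, ofPred_forall]
    refine MeasurableSet.iInter fun i => measurableSet_lt ?_ measurable_const
    have := mX T i
    fun_prop
  -- On the target event the exponent differs from its central value by at most `ε ∑ |θ i|`, so
  -- undoing the tilt costs at most `exp (T r)`.
  have b1 : ∫⁻ ω in E, K ω ∂P ≤ ENNReal.ofReal (Real.exp (T * r)) * P E := by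
    rw [← setLIntegral_const]
    refine setLIntegral_mono' mE fun ω hω => ENNReal.ofReal_le_ofReal (Real.exp_le_exp.2 ?_)
    refine mul_le_mul_of_nonneg_left ?_ hT.le
    rw [hr, Finset.mul_sum, ← Finset.sum_add_distrib]
    refine Finset.sum_le_sum fun i _ => ?_
    have h1 : θ i * (X T ω i - w * s i) ≤ |θ i| * ε := by
      refine (le_abs_self _).trans ?_
      rw [abs_mul]
      exact mul_le_mul_of_nonneg_left (hω i).le (abs_nonneg _)
    nlinarith
  have b2 : ∫⁻ ω in Eᶜ, K ω ∂P ≤ ENNReal.ofReal (N * Real.exp (T * (g - lam * ε / 4))) := by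
    have hsub : Eᶜ ⊆ ⋃ i, ({ω | lam * (w * s i + ε) ≤ lam * X T ω i} ∪
        {ω | -lam * (w * s i - ε) ≤ -lam * X T ω i}) := by
      intro ω hω
      simp only [hE, mem_compl_iff, mem_ofPred_eq, not_forall, not_lt] at hω
      obtain ⟨i, hi⟩ := hω
      refine mem_iUnion.2 ⟨i, ?_⟩
      rcases le_abs.1 hi with hi | hi
      · exact Or.inl (mul_le_mul_of_nonneg_left (by linarith) hlam.le)
      · refine Or.inr ?_
        show -lam * (w * s i - ε) ≤ -lam * X T ω i
        nlinarith
    calc ∫⁻ ω in Eᶜ, K ω ∂P ≤ ∑ i : ι, (ENNReal.ofReal (Real.exp (T * (g - lam * ε / 4))) +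
          ENNReal.ofReal (Real.exp (T * (g - lam * ε / 4)))) := by
          refine (lintegral_mono_set hsub).trans ((lintegral_iUnion_le _ _).trans ?_)
          rw [tsum_fintype]
          refine Finset.sum_le_sum fun i _ => (lintegral_union_le _ _ _).trans ?_
          exact add_le_add (u1 i) (u2 i)
      _ = _ := by
          rw [Finset.sum_const, Finset.card_univ, nsmul_eq_mul, ← ENNReal.ofReal_natCast,
            ← ENNReal.ofReal_add (by positivity) (by positivity),
            ← ENNReal.ofReal_mul (by positivity)]
          congr 1
          rw [hN]
          ring
  have b3 := lintegral_add_compl (μ := P) K mE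
  rw [u3] at b3
  set p := (P E).toReal with hp
  have b4 : Real.exp (T * ℓ T) ≤ Real.exp (T * r) * p + N * Real.exp (T * (g - lam * ε / 4)) := by
    rw [← ENNReal.ofReal_le_ofReal_iff (by positivity), ← b3,
      ENNReal.ofReal_add (by positivity) (by positivity), ENNReal.ofReal_mul (by positivity),
      ENNReal.ofReal_toReal (measure_ne_top P E)]
    exact add_le_add b1 b2
  rw [← ENNReal.ofReal_toReal (measure_ne_top P E)]
  refine ENNReal.ofReal_le_ofReal ?_
  have c1 : Real.exp (T * (g - κ)) ≤ Real.exp (T * ℓ T) :=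
    Real.exp_le_exp.2 (mul_le_mul_of_nonneg_left u4.le hT.le)
  have c2 : N * Real.exp (T * (g - lam * ε / 4)) ≤ 1 / 2 * Real.exp (T * (g - κ)) := by
    calc N * Real.exp (T * (g - lam * ε / 4))
        = N * Real.exp (T * (-(lam * ε / 8))) * Real.exp (T * (g - lam * ε / 8)) := by
          rw [mul_assoc N, ← Real.exp_add]
          congr 2
          ring
      _ ≤ 1 / 2 * Real.exp (T * (g - κ)) := by
          refine mul_le_mul u5 (Real.exp_le_exp.2 ?_) (Real.exp_pos _).le (by norm_num)
          exact mul_le_mul_of_nonneg_left (by linarith) hT.le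
  have c3 : Real.exp (T * (g - 2 * κ)) ≤ 1 / 2 * Real.exp (T * (g - κ)) := by
    calc Real.exp (T * (g - 2 * κ)) = Real.exp (T * (-κ)) * Real.exp (T * (g - κ)) := by
          rw [← Real.exp_add]
          congr 1
          ring
      _ ≤ _ := mul_le_mul_of_nonneg_right u6 (Real.exp_pos _).le
  have c4 : Real.exp (T * (g - 2 * κ)) ≤ Real.exp (T * r) * p := by linarith
  have c5 : Real.exp (T * r) * Real.exp (T * L) ≤ Real.exp (T * (g - 2 * κ)) := by
    rw [← Real.exp_add]
    refine Real.exp_le_exp.2 ?_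
    have : T * (r + L) ≤ T * (g - 2 * κ) := mul_le_mul_of_nonneg_left (by linarith) hT.le
    linarith
  exact le_of_mul_le_mul_left (c5.trans c4) (Real.exp_pos _)

end Tilting

/-! ### Tail functions of signed measures as weights. -/

section Tail

variable {μ : Measure unitInterval} {ν : SignedMeasure unitInterval}

/-- The tail function `μ((u, 1])` of a measure on `[0,1]`. -/
def tailOf (μ : Measure unitInterval) (u : ℝ) : ℝ≥0∞ := μ {t | u < (t : ℝ)}

lemma antitone_tailOf : Antitone (tailOf μ) := fun _ _ h =>
  measure_mono fun _ ht => h.trans_lt ht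

lemma measurable_tailOf : Measurable (tailOf μ) := antitone_tailOf.measurable

lemma tailOf_ne_top [IsFiniteMeasure μ] (u : ℝ) : tailOf μ u ≠ ∞ := measure_ne_top _ _

/-- The complement of the tail is a distribution function, continuous from the right because the
half-lines `t ≤ v` decrease to `t ≤ u` as `v` decreases to `u`. -/
lemma continuousWithinAt_tailOf [IsFiniteMeasure μ] (u : ℝ) :
    ContinuousWithinAt (fun v => (tailOf μ v).toReal) (Ici u) u := by
  rw [← continuousWithinAt_Ioi_iff_Ici]
  have mle (v : ℝ) : MeasurableSet {t : unitInterval | (t : ℝ) ≤ v} :=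
    measurableSet_le measurable_subtype_coe measurable_const
  have e (v : ℝ) : (tailOf μ v).toReal = μ.real univ - μ.real {t : unitInterval | (t : ℝ) ≤ v} := by
    rw [← measureReal_compl (mle v), tailOf, Measure.real]
    congr 2
    ext t
    simp
  simp_rw [ContinuousWithinAt, e]
  refine Tendsto.const_sub _ ?_
  have h := tendsto_measure_biInter_gt (μ := μ) (s := fun v : ℝ => {t : unitInterval | (t : ℝ) ≤ v})
    (a := u) (fun v _ => (mle v).nullMeasurableSet) (fun i j _ hij t ht => le_trans ht hij)
    ⟨u + 1, by simp, measure_ne_top _ _⟩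
  have e2 : ⋂ r > u, {t : unitInterval | (t : ℝ) ≤ r} = {t : unitInterval | (t : ℝ) ≤ u} := by
    ext t
    simpa using ⟨fun h => le_of_forall_gt_imp_ge_of_dense h, fun h r hr => h.trans hr.le⟩
  rw [e2] at h
  exact (ENNReal.tendsto_toReal (measure_ne_top _ _)).comp h

/-- The function `χ_ν`, extended by zero outside `[0, 1)`. -/
def chiExt (ν : SignedMeasure unitInterval) : ℝ → ℝ :=
  (Ico (0 : ℝ) 1).indicator fun u => (tailOf ν.toJordanDecomposition.posPart u).toReal -
    (tailOf ν.toJordanDecomposition.negPart u).toReal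

lemma chiExt_coe (t : unitInterval) : chiExt ν t = chi ν t := by
  rw [chi, SignedMeasure.apply_eq_posPart_real_sub_negPart_real _ measurableSet_Ioi, chiExt]
  by_cases ht : (t : ℝ) ∈ Ico (0 : ℝ) 1
  · rw [indicator_of_mem ht]
    rfl
  · have ht1 : t = 1 := by
      refine le_antisymm t.2.2 ?_
      by_contra hcon
      exact ht ⟨t.2.1, not_le.1 hcon⟩
    rw [indicator_of_notMem ht, ht1, show Ioi (1 : unitInterval) = ∅ from ?_]
    · simp
    · ext s
      simpa using (show s ≤ 1 from s.2.2)

/-- The total mass of a signed measure. -/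
def totalMass (ν : SignedMeasure unitInterval) : ℝ :=
  ν.toJordanDecomposition.posPart.real univ + ν.toJordanDecomposition.negPart.real univ

lemma totalMass_nonneg : 0 ≤ totalMass ν := add_nonneg measureReal_nonneg measureReal_nonneg

lemma tailOf_toReal_le [IsFiniteMeasure μ] (u : ℝ) : (tailOf μ u).toReal ≤ μ.real univ :=
  measureReal_mono (subset_univ _)

/-- The bound is `max c 0` since the extension vanishes outside `[0, 1)` even when `c` is negative.
-/
lemma isWeight_chiExt {c : ℝ} (hc : ∀ s, chi ν s ≤ c) :
    IsWeight (chiExt ν) (totalMass ν) (max c 0) where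
  measurable := (measurable_tailOf.ennreal_toReal.sub measurable_tailOf.ennreal_toReal).indicator
    measurableSet_Ico
  lower u := by
    rw [chiExt]
    by_cases hu : u ∈ Ico (0 : ℝ) 1
    · rw [indicator_of_mem hu]
      have h1 := tailOf_toReal_le (μ := ν.toJordanDecomposition.negPart) u
      have h2 : 0 ≤ (tailOf ν.toJordanDecomposition.posPart u).toReal := ENNReal.toReal_nonneg
      have h3 : 0 ≤ ν.toJordanDecomposition.posPart.real univ := measureReal_nonneg
      rw [totalMass]
      linarith
    · rw [indicator_of_notMem hu, neg_nonpos]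
      exact totalMass_nonneg
  upper u := by
    by_cases hu : u ∈ Ico (0 : ℝ) 1
    · have := hc ⟨u, hu.1, hu.2.le⟩
      rw [← chiExt_coe] at this
      exact this.trans (le_max_left _ _)
    · rw [chiExt, indicator_of_notMem hu]
      exact le_max_right _ _
  zero u hu := indicator_of_notMem hu _
  right u hu := by
    refine ((continuousWithinAt_tailOf u).sub (continuousWithinAt_tailOf u)).congr_of_eventuallyEq ?_
      (indicator_of_mem hu _)
    filter_upwards [Ico_mem_nhdsGE hu.2] with v hv
    exact indicator_of_mem (s := Ico (0 : ℝ) 1) ⟨hu.1.trans hv.1, hv.2⟩ _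

/-- Fubini: the density at time `s` is counted for those `t` with `s < T t`, a set of `μ`-mass equal
to the tail at `s / T`. Replacing closed intervals by half-open ones makes this inequality strict,
as in `μ((u, 1])`. -/
lemma lintegral_occupation [IsFiniteMeasure μ] {D : ℝ → ℝ≥0∞} (hD : Measurable D) {T : ℝ}
    (hT : 0 < T) :
    ∫⁻ t : unitInterval, (∫⁻ s in Icc 0 (T * t), D s) ∂μ
      = ∫⁻ s, (Ico (0 : ℝ) 1).indicator (tailOf μ) (s / T) * D s := by
  have h1 (t : unitInterval) : ∫⁻ s in Icc 0 (T * t), D s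
      = ∫⁻ s, (Ico 0 (T * t)).indicator 1 s * D s := by
    rw [restrict_Ico_eq_restrict_Icc.symm, ← lintegral_indicator measurableSet_Ico]
    refine lintegral_congr fun s => ?_
    by_cases hs : s ∈ Ico 0 (T * (t : ℝ)) <;> simp [hs]
  have hm : Measurable fun p : unitInterval × ℝ =>
      (Ico 0 (T * (p.1 : ℝ))).indicator (1 : ℝ → ℝ≥0∞) p.2 := by
    have : MeasurableSet {p : unitInterval × ℝ | 0 ≤ p.2 ∧ p.2 < T * (p.1 : ℝ)} :=
      (measurableSet_le measurable_const measurable_snd).inter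
        (measurableSet_lt measurable_snd (by fun_prop))
    exact (measurable_one (α := ℝ≥0∞)).indicator this
  simp_rw [h1]
  rw [lintegral_lintegral_swap (hm.mul (hD.comp measurable_snd)).aemeasurable]
  refine lintegral_congr fun s => ?_
  have hms : Measurable fun t : unitInterval => (Ico 0 (T * (t : ℝ))).indicator (1 : ℝ → ℝ≥0∞) s :=
    hm.comp (measurable_prodMk_right (y := s))
  rw [lintegral_mul_const _ hms]
  congr 1
  by_cases hs : s / T ∈ Ico (0 : ℝ) 1
  · rw [indicator_of_mem hs, tailOf, ← lintegral_indicator_one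
      (measurableSet_lt measurable_const measurable_subtype_coe)]
    refine lintegral_congr fun t => ?_
    have h0 : 0 ≤ s := by simpa [div_nonneg_iff, hT.le, hT.not_ge] using hs.1
    by_cases ht : s / T < t
    · rw [indicator_of_mem (show t ∈ {t : unitInterval | s / T < (t : ℝ)} from ht),
        indicator_of_mem (show s ∈ Ico 0 (T * (t : ℝ)) from ⟨h0, (div_lt_iff₀' hT).1 ht⟩)]
      rfl
    · rw [indicator_of_notMem (show t ∉ {t : unitInterval | s / T < (t : ℝ)} from ht),
        indicator_of_notMem fun h => ht ((div_lt_iff₀' hT).2 h.2)]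
  · rw [indicator_of_notMem hs, lintegral_eq_zero_iff hms]
    refine ae_of_all _ fun t => indicator_of_notMem (fun h => hs ⟨div_nonneg h.1 hT.le, ?_⟩) _
    rw [div_lt_one hT]
    exact h.2.trans_le (mul_le_of_le_one_right hT.le t.2.2)

end Tail

/-! ### The Chernoff bound for occupation paths. -/

section Chernoff

lemma popOcc_tail (h : Setting m η φ V q b) {μ : Measure unitInterval} [IsFiniteMeasure μ] {T : ℝ}
    (hT : 0 < T) (ω : Ω) {g : C(unitInterval, ℝ)}
    (hg : ∀ t : unitInterval,
      ((occupation (population η (fun n => ξ n ω) (fun p => Z p ω)) φ T T t : ℝ≥0∞) : EReal)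
        = ((g t : ℝ) : EReal)) :
    popOcc η φ ξ Z (fun s => (Ico (0 : ℝ) 1).indicator (tailOf μ) (s / T)) ω
      = ENNReal.ofReal (T * ∫ t, g t ∂μ) := by
  have mD := measurable_popDens h (fun n => ξ n ω) (fun p => Z p ω)
  have g0 (t : unitInterval) : 0 ≤ g t := by
    rw [← EReal.coe_nonneg, ← hg t]
    exact EReal.coe_ennreal_nonneg _
  have e (t : unitInterval) : ∫⁻ s in Icc 0 (T * t), popDens η φ (fun n => ξ n ω) (fun p => Z p ω) s
      = ENNReal.ofReal T * ENNReal.ofReal (g t) := by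
    have h1 : occupation (population η (fun n => ξ n ω) (fun p => Z p ω)) φ T T t
        = ENNReal.ofReal (g t) := by
      rw [← EReal.coe_ennreal_eq_coe_ennreal_iff, hg t, EReal.coe_ennreal_ofReal,
        max_eq_left (g0 t)]
    rw [← h1, occupation, ENNReal.mul_div_cancel (by simpa using hT) ENNReal.ofReal_ne_top]
    rfl
  rw [popOcc, ← lintegral_occupation mD hT]
  simp_rw [e]
  have hi : Integrable (fun t => g t) μ := g.continuous.integrable_of_hasCompactSupport
    (HasCompactSupport.of_compactSpace _)
  rw [lintegral_const_mul _ (by fun_prop), ← ofReal_integral_eq_lintegral_ofReal hi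
    (ae_of_all _ g0), ← ENNReal.ofReal_mul hT.le]

lemma popOcc_add (h : Setting m η φ V q b) {g₁ g₂ : ℝ → ℝ≥0∞} (h1 : Measurable g₁) (ω : Ω) :
    popOcc η φ ξ Z (fun s => g₁ s + g₂ s) ω = popOcc η φ ξ Z g₁ ω + popOcc η φ ξ Z g₂ ω := by
  simp only [popOcc, add_mul]
  exact lintegral_add_left (h1.mul (measurable_popDens h _ _)) _

lemma popOcc_mono {g₁ g₂ : ℝ → ℝ≥0∞} (h : ∀ s, g₁ s ≤ g₂ s) (ω : Ω) :
    popOcc η φ ξ Z g₁ ω ≤ popOcc η φ ξ Z g₂ ω :=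
  lintegral_mono fun s => mul_le_mul_left (h s) _

lemma integral_le_of_mem_ball {f g : C(unitInterval, ℝ)} {r : ℝ} (hg : g ∈ Metric.ball f r)
    (μ : Measure unitInterval) [IsFiniteMeasure μ] :
    |∫ t, g t ∂μ - ∫ t, f t ∂μ| ≤ r * μ.real univ := by
  have hi (f : C(unitInterval, ℝ)) : Integrable (fun t => f t) μ :=
    f.continuous.integrable_of_hasCompactSupport (HasCompactSupport.of_compactSpace _)
  rw [← integral_sub (hi g) (hi f), ← Real.norm_eq_abs]
  refine norm_integral_le_of_norm_le_const (ae_of_all _ fun t => ?_)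
  rw [← dist_eq_norm]
  exact ((ContinuousMap.dist_apply_le_dist t).trans (Metric.mem_ball.1 hg).le)

/-- On the event the exponent is exactly `T ⟨g, ν⟩` for the occupation path `g`, and `⟨g, ν⟩`
differs from `⟨f, ν⟩` by at most `r` times the total mass of `ν`. -/
lemma exp_le_of_mem_occupationEvent (h : Setting m η φ V q b) {T : ℝ} (hT : 0 < T)
    (ν : SignedMeasure unitInterval) {c : ℝ} (hc : ∀ s, chi ν s ≤ c) {f : C(unitInterval, ℝ)}
    {r : ℝ} {ω : Ω} (hω : ω ∈ occupationEvent η ξ Z φ T (Metric.ball f r)) :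
    ENNReal.ofReal (Real.exp (T * (pairing f ν - r * totalMass ν)))
      ≤ expE (popOcc η φ ξ Z (fun s => ENNReal.ofReal (chiExt ν (s / T))) ω) *
        negE (popOcc η φ ξ Z (fun s => ENNReal.ofReal (-chiExt ν (s / T))) ω) := by
  obtain ⟨g, hgf, hg⟩ := hω
  set μ₁ := ν.toJordanDecomposition.posPart
  set μ₂ := ν.toJordanDecomposition.negPart
  have hχ := isWeight_chiExt hc
  have e1 := popOcc_tail (μ := μ₁) h hT ω hg
  have e2 := popOcc_tail (μ := μ₂) h hT ω hg
  have g0 (t : unitInterval) : 0 ≤ g t := by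
    rw [← EReal.coe_nonneg, ← hg t]
    exact EReal.coe_ennreal_nonneg _
  have m1 : Measurable fun s => ENNReal.ofReal (chiExt ν (s / T)) :=
    (hχ.measurable.comp (by fun_prop)).ennreal_ofReal
  have m2 : Measurable fun s => ENNReal.ofReal (-chiExt ν (s / T)) :=
    (hχ.measurable.comp (by fun_prop)).neg.ennreal_ofReal
  set A := popOcc η φ ξ Z (fun s => ENNReal.ofReal (chiExt ν (s / T))) ω
  set B := popOcc η φ ξ Z (fun s => ENNReal.ofReal (-chiExt ν (s / T))) ω
  -- The tails of the two Jordan parts may overlap, so the positive part of `χ_ν` is in general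
  -- smaller than the tail of the positive part of `ν`. The identity is stated additively to avoid
  -- subtraction in `[0,∞]`, and the two inequalities give finiteness.
  have key (u : ℝ) : ENNReal.ofReal (chiExt ν u) + (Ico (0 : ℝ) 1).indicator (tailOf μ₂) u
      = ENNReal.ofReal (-chiExt ν u) + (Ico (0 : ℝ) 1).indicator (tailOf μ₁) u ∧
      ENNReal.ofReal (chiExt ν u) ≤ (Ico (0 : ℝ) 1).indicator (tailOf μ₁) u ∧
      ENNReal.ofReal (-chiExt ν u) ≤ (Ico (0 : ℝ) 1).indicator (tailOf μ₂) u := by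
    by_cases hu : u ∈ Ico (0 : ℝ) 1
    · simp only [chiExt, indicator_of_mem hu]
      have r1 : tailOf μ₁ u = ENNReal.ofReal (tailOf μ₁ u).toReal :=
        (ENNReal.ofReal_toReal (tailOf_ne_top u)).symm
      have r2 : tailOf μ₂ u = ENNReal.ofReal (tailOf μ₂ u).toReal :=
        (ENNReal.ofReal_toReal (tailOf_ne_top u)).symm
      have p1 : 0 ≤ (tailOf μ₁ u).toReal := ENNReal.toReal_nonneg
      have p2 : 0 ≤ (tailOf μ₂ u).toReal := ENNReal.toReal_nonneg
      set x := (tailOf μ₁ u).toReal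
      set y := (tailOf μ₂ u).toReal
      rw [r1, r2]
      refine ⟨?_, ENNReal.ofReal_le_ofReal (by linarith), ENNReal.ofReal_le_ofReal (by linarith)⟩
      rcases le_total x y with hxy | hxy
      · rw [ENNReal.ofReal_of_nonpos (by linarith), zero_add,
          ← ENNReal.ofReal_add (by linarith) p1]
        congr 1
        ring
      · rw [ENNReal.ofReal_of_nonpos (p := -(x - y)) (by linarith), zero_add,
          ← ENNReal.ofReal_add (by linarith) p2]
        congr 1
        ring
    · simp [chiExt, indicator_of_notMem hu]
  have hsum : A + ENNReal.ofReal (T * ∫ t, g t ∂μ₂) = B + ENNReal.ofReal (T * ∫ t, g t ∂μ₁) := by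
    rw [← e1, ← e2, ← popOcc_add h m1, ← popOcc_add h m2]
    congr 1
    funext s
    exact (key (s / T)).1
  have hA : A ≠ ∞ := ne_top_of_le_ne_top ENNReal.ofReal_ne_top
    ((popOcc_mono (fun s => (key (s / T)).2.1) ω).trans e1.le)
  have hB : B ≠ ∞ := ne_top_of_le_ne_top ENNReal.ofReal_ne_top
    ((popOcc_mono (fun s => (key (s / T)).2.2) ω).trans e2.le)
  have i1 : 0 ≤ T * ∫ t, g t ∂μ₁ := mul_nonneg hT.le (integral_nonneg g0)
  have i2 : 0 ≤ T * ∫ t, g t ∂μ₂ := mul_nonneg hT.le (integral_nonneg g0)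
  have hreal := congrArg ENNReal.toReal hsum
  rw [ENNReal.toReal_add hA ENNReal.ofReal_ne_top, ENNReal.toReal_add hB ENNReal.ofReal_ne_top,
    ENNReal.toReal_ofReal i1, ENNReal.toReal_ofReal i2] at hreal
  rw [← ENNReal.ofReal_toReal hA, ← ENNReal.ofReal_toReal hB, expE_ofReal ENNReal.toReal_nonneg,
    negE_ofReal ENNReal.toReal_nonneg, ← ENNReal.ofReal_mul (Real.exp_pos _).le, ← Real.exp_add]
  refine ENNReal.ofReal_le_ofReal (Real.exp_le_exp.2 ?_)
  have b1 := abs_le.1 (integral_le_of_mem_ball hgf μ₁)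
  have b2 := abs_le.1 (integral_le_of_mem_ball hgf μ₂)
  have : A.toReal + -B.toReal = T * (∫ t, g t ∂μ₁ - ∫ t, g t ∂μ₂) := by linarith
  rw [this, pairing, totalMass]
  refine mul_le_mul_of_nonneg_left ?_ hT.le
  linarith [b1.1, b2.2]

/-- The Chernoff bound for the occupation path. -/
lemma measure_occupationEvent_le (h : Setting m η φ V q b) (hN : IsBranchingData P m V q H ξ Z)
    {T : ℝ} (hT : 0 < T) (ν : SignedMeasure unitInterval) {c : ℝ} (hc : ∀ s, chi ν s ≤ c)
    (f : C(unitInterval, ℝ)) (r : ℝ) {x : ℝ}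
    (hx : popExp P η φ ξ Z (chiExt ν) T ≤ ENNReal.ofReal (Real.exp (T * x))) :
    P (occupationEvent η ξ Z φ T (Metric.ball f r))
      ≤ ENNReal.ofReal (Real.exp (T * (x - pairing f ν + r * totalMass ν))) := by
  have hχ := isWeight_chiExt hc
  have m1 : Measurable fun s => ENNReal.ofReal (chiExt ν (s / T)) :=
    (hχ.measurable.comp (by fun_prop)).ennreal_ofReal
  have m2 : Measurable fun s => ENNReal.ofReal (-chiExt ν (s / T)) :=
    (hχ.measurable.comp (by fun_prop)).neg.ennreal_ofReal
  have hmk := mul_meas_ge_le_lintegral (μ := P)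
    ((measurable_expE.comp (measurable_popOcc h hN m1)).mul
      (measurable_negE.comp (measurable_popOcc h hN m2)))
    (ENNReal.ofReal (Real.exp (T * (pairing f ν - r * totalMass ν))))
  have hle := (mul_le_mul_right (measure_mono (μ := P) fun ω hω =>
    exp_le_of_mem_occupationEvent h hT ν hc hω) _).trans (hmk.trans hx)
  have e : ENNReal.ofReal (Real.exp (T * x))
      = ENNReal.ofReal (Real.exp (T * (pairing f ν - r * totalMass ν))) *
        ENNReal.ofReal (Real.exp (T * (x - pairing f ν + r * totalMass ν))) := by
    rw [← ENNReal.ofReal_mul (Real.exp_pos _).le, ← Real.exp_add]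
    congr 2
    ring
  rw [e] at hle
  exact (ENNReal.mul_le_mul_iff_right (by simpa using Real.exp_pos _) ENNReal.ofReal_ne_top).1 hle

end Chernoff

/-! ### Linearity of the pairing, and atomic measures. -/

section Atoms

variable {f : C(unitInterval, ℝ)}

lemma integrable_continuousMap (f : C(unitInterval, ℝ)) (μ : Measure unitInterval)
    [IsFiniteMeasure μ] : Integrable (fun t => f t) μ :=
  f.continuous.integrable_of_hasCompactSupport (HasCompactSupport.of_compactSpace _)

/-- Two representations of `ν` as differences have equal cross sums of positive measures, so the
pairing does not depend on the representation. This gives additivity without knowing the Jordan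
decomposition of a sum. -/
lemma pairing_eq {ν : SignedMeasure unitInterval} {μ μ' : Measure unitInterval} [IsFiniteMeasure μ]
    [IsFiniteMeasure μ'] (hν : ν = μ.toSignedMeasure - μ'.toSignedMeasure) :
    pairing f ν = ∫ t, f t ∂μ - ∫ t, f t ∂μ' := by
  have h1 := ν.toSignedMeasure_toJordanDecomposition
  rw [JordanDecomposition.toSignedMeasure] at h1
  set μ₁ := ν.toJordanDecomposition.posPart with hμ₁
  set μ₂ := ν.toJordanDecomposition.negPart with hμ₂
  have h2 : (μ₁ + μ').toSignedMeasure = (μ + μ₂).toSignedMeasure := by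
    rw [Measure.toSignedMeasure_add, Measure.toSignedMeasure_add]
    have h3 := h1.trans hν
    rw [sub_eq_sub_iff_add_eq_add] at h3
    exact h3
  have h4 : μ₁ + μ' = μ + μ₂ := Measure.toSignedMeasure_eq_toSignedMeasure_iff.1 h2
  have h5 : ∫ t, f t ∂(μ₁ + μ') = ∫ t, f t ∂(μ + μ₂) := by rw [h4]
  rw [integral_add_measure (integrable_continuousMap f _) (integrable_continuousMap f _),
    integral_add_measure (integrable_continuousMap f _) (integrable_continuousMap f _)] at h5
  rw [pairing]
  linarith

lemma pairing_zero : pairing f 0 = 0 := by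
  rw [pairing_eq (μ := 0) (μ' := 0) (by simp)]
  simp

lemma pairing_add (ν ν' : SignedMeasure unitInterval) :
    pairing f (ν + ν') = pairing f ν + pairing f ν' := by
  have h1 := ν.toSignedMeasure_toJordanDecomposition
  have h2 := ν'.toSignedMeasure_toJordanDecomposition
  rw [JordanDecomposition.toSignedMeasure] at h1 h2
  have h3 : ν + ν' = (ν.toJordanDecomposition.posPart +
      ν'.toJordanDecomposition.posPart).toSignedMeasure -
      (ν.toJordanDecomposition.negPart + ν'.toJordanDecomposition.negPart).toSignedMeasure := by
    rw [Measure.toSignedMeasure_add, Measure.toSignedMeasure_add]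
    nth_rw 1 [← h1, ← h2]
    abel
  rw [pairing_eq h3, integral_add_measure (integrable_continuousMap f _)
    (integrable_continuousMap f _), integral_add_measure (integrable_continuousMap f _)
    (integrable_continuousMap f _), pairing, pairing]
  ring

/-- The signed measure `r δ_t`. -/
def atom (r : ℝ) (t : unitInterval) : SignedMeasure unitInterval :=
  r • (Measure.dirac t).toSignedMeasure

lemma pairing_atom (r : ℝ) (t : unitInterval) : pairing f (atom r t) = r * f t := by
  have e (r : ℝ≥0) : (r • Measure.dirac t).toSignedMeasure
      = (r : ℝ) • (Measure.dirac t).toSignedMeasure := Measure.toSignedMeasure_smul _ r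
  rcases le_total 0 r with hr | hr
  · rw [pairing_eq (μ := r.toNNReal • Measure.dirac t) (μ' := 0)]
    · simp [NNReal.smul_def, hr]
    · rw [e, Measure.toSignedMeasure_zero, sub_zero, Real.coe_toNNReal _ hr, atom]
  · rw [pairing_eq (μ' := (-r).toNNReal • Measure.dirac t) (μ := 0)]
    · simp [NNReal.smul_def, hr]
    · rw [e, Measure.toSignedMeasure_zero, zero_sub, Real.coe_toNNReal _ (by linarith), atom,
        ← neg_eq_iff_eq_neg]
      ext A hA
      simp [hA]

lemma chi_add (ν ν' : SignedMeasure unitInterval) (s : unitInterval) :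
    chi (ν + ν') s = chi ν s + chi ν' s := rfl

lemma chi_atom (r : ℝ) (t s : unitInterval) :
    chi (atom r t) s = r * (Ioi s).indicator 1 t := by
  rw [chi, atom, _root_.smul_apply, smul_eq_mul,
    Measure.toSignedMeasure_apply_measurable measurableSet_Ioi, Measure.real,
    Measure.dirac_apply' _ measurableSet_Ioi]
  by_cases h : t ∈ Ioi s <;> simp [h]

lemma pairing_sum {ι : Type*} (s : Finset ι) (ν : ι → SignedMeasure unitInterval) :
    pairing f (∑ i ∈ s, ν i) = ∑ i ∈ s, pairing f (ν i) := by
  induction s using Finset.cons_induction with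
  | empty => simp [pairing_zero]
  | cons j s hj ih => rw [Finset.sum_cons, Finset.sum_cons, pairing_add, ih]

lemma chi_sum {ι : Type*} (s : Finset ι) (ν : ι → SignedMeasure unitInterval) (u : unitInterval) :
    chi (∑ i ∈ s, ν i) u = ∑ i ∈ s, chi (ν i) u := by
  induction s using Finset.cons_induction with
  | empty => simp [chi]
  | cons j s hj ih => rw [Finset.sum_cons, Finset.sum_cons, chi_add, ih]

lemma chiExt_eq_of_chi {ν : SignedMeasure unitInterval} {χ : ℝ → ℝ}
    (h0 : ∀ u, u ∉ Ico (0 : ℝ) 1 → χ u = 0) (h : ∀ t : unitInterval, (t : ℝ) < 1 → chi ν t = χ t) :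
    chiExt ν = χ := by
  funext u
  by_cases hu : u ∈ Ico (0 : ℝ) 1
  · have := chiExt_coe (ν := ν) ⟨u, hu.1, hu.2.le⟩
    rw [h ⟨u, hu.1, hu.2.le⟩ hu.2] at this
    exact this
  · rw [h0 u hu, chiExt, indicator_of_notMem hu]

lemma chiExt_atom_neg_one : chiExt (atom (-1) 1) = minusOne := by
  refine chiExt_eq_of_chi isWeight_minusOne.zero fun t ht => ?_
  rw [chi_atom, minusOne, indicator_of_mem (show (t : ℝ) ∈ Ico (0 : ℝ) 1 from ⟨t.2.1, ht⟩),
    indicator_of_mem (show (1 : unitInterval) ∈ Ioi t from ht)]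
  simp

end Atoms

/-! ### The functional `Λ` and degenerate values of `Λ*`. -/

section RateIdentities

variable {ν : SignedMeasure unitInterval}

lemma lt_thetaMax_iff (h : Setting m η φ V q b) (hb : b = supNorm φ) {c : ℝ} :
    c < thetaMax V q φ ↔ c * b < criticalRate V q := by
  rw [thetaMax, ← hb, lt_div_iff₀ h.pos]

lemma max_zero_mul_lt (h : Setting m η φ V q b) {c : ℝ} (hc : c * b < criticalRate V q) :
    max c 0 * b < criticalRate V q := by
  rcases max_choice c 0 with e | e <;> rw [e]
  · exact hc
  · simpa using criticalRate_pos h.hV h.hq0 h.hq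

lemma vLim_eq_integral (h : Setting m η φ V q b) {θ : ℝ} (hc : θ * b < criticalRate V q)
    (x : Space d) :
    vLim m η V q φ x θ = ∫ z, (Real.exp (θ * jTot η φ x z) - 1) ∂(famLaw m V q) := by
  rw [vLim_eq h hc, ← gain_eq_integral h hc x]
  rfl

lemma Lambda_eq : Lambda m η V q H φ ν =
    ((ENNReal.ofReal H * ∫⁻ t in Ico (0 : ℝ) 1, ∫⁻ x,
      ENNReal.ofReal (vLim m η V q φ x (chiExt ν t)) : ℝ≥0∞) : EReal) -
    ((ENNReal.ofReal H * ∫⁻ t in Ico (0 : ℝ) 1, ∫⁻ x,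
      ENNReal.ofReal (-vLim m η V q φ x (chiExt ν t)) : ℝ≥0∞) : EReal) := by
  rw [Lambda]
  simp_rw [← chiExt_coe, unitInterval.volume_def]
  rw [lintegral_subtype_comap measurableSet_Icc
    (fun t => ∫⁻ x, ENNReal.ofReal (vLim m η V q φ x (chiExt ν t))),
    lintegral_subtype_comap measurableSet_Icc
    (fun t => ∫⁻ x, ENNReal.ofReal (-vLim m η V q φ x (chiExt ν t))),
    restrict_Ico_eq_restrict_Icc]

/-- Since `v_φ` is the expectation of `exp (χ J) - 1`, Fubini applies, and integrability makes the
extended difference of positive and negative parts a real integral. -/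
lemma Lambda_eq_limitCgf (h : Setting m η φ V q b) (hfin : LaplaceFinite m η φ V q) (hH : 0 ≤ H)
    {c : ℝ} (hχ : ∀ s, chi ν s ≤ c) (hc : c * b < criticalRate V q) :
    Lambda m η V q H φ ν = (limitCgf m η φ V q H (chiExt ν) : EReal) := by
  have := h.isProb_famLaw
  have := h.sFinite_famMeasure
  have hw := isWeight_chiExt hχ
  obtain ⟨hkμ, hkint⟩ := integral_prod_prod
    (integrable_weight_sub_one h hfin hw (max_zero_mul_lt h hc))
  set μ := (volume.restrict (Ico (0 : ℝ) 1)).prod (volume : Measure (Space d)) with hμ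
  set k : ℝ × Space d → ℝ := fun p => ∫ z, (Real.exp (chiExt ν p.1 * jTot η φ p.2 z) - 1)
    ∂(famLaw m V q) with hk
  have hv (t x) : vLim m η V q φ x (chiExt ν t) = k (t, x) := by
    refine vLim_eq_integral h ?_ x
    have := hw.upper t
    have := h.pos
    nlinarith [max_zero_mul_lt h hc]
  have hlim : limitCgf m η φ V q H (chiExt ν) = H * ∫ p, k p ∂μ := by rw [hkint, limitCgf, famMeasure]
  have e2 {f : ℝ × Space d → ℝ} (hf : Integrable f μ) :
      ∫⁻ σ in Ico (0 : ℝ) 1, ∫⁻ x, ENNReal.ofReal (f (σ, x)) = ∫⁻ p, ENNReal.ofReal (f p) ∂μ :=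
    (lintegral_prod _ hf.1.aemeasurable.ennreal_ofReal).symm
  have hneg := e2 hkμ.neg
  have hA := hkμ.lintegral_lt_top
  have hB := hkμ.neg.lintegral_lt_top
  simp only [Pi.neg_apply] at hneg hB
  rw [Lambda_eq, hlim]
  simp_rw [hv]
  rw [e2 hkμ, hneg, integral_eq_lintegral_pos_part_sub_lintegral_neg_part hkμ, mul_sub]
  set A := ∫⁻ p, ENNReal.ofReal (k p) ∂μ
  set B := ∫⁻ p, ENNReal.ofReal (-k p) ∂μ
  have e3 {A : ℝ≥0∞} (hA : A ≠ ∞) : ((ENNReal.ofReal H * A : ℝ≥0∞) : EReal)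
      = ((H * A.toReal : ℝ) : EReal) := by
    rw [← ENNReal.ofReal_toReal hA, ← ENNReal.ofReal_mul hH, EReal.coe_ennreal_ofReal,
      max_eq_left (mul_nonneg hH ENNReal.toReal_nonneg), ENNReal.toReal_ofReal ENNReal.toReal_nonneg]
  rw [e3 hA.ne, e3 hB.ne, EReal.coe_sub]

/-- For `ν = -δ_1` the function `χ_ν` equals `-1` on `[0, 1)`, so `Λ(ν) = -∞`. This single test
measure makes the supremum infinite for every `f`. -/
lemma LambdaStar_eq_top_of_not_laplaceFinite (h : Setting m η φ V q b) (hb : b = supNorm φ)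
    (hfin : ¬ LaplaceFinite m η φ V q) (hH : 0 < H) (f : C(unitInterval, ℝ)) :
    LambdaStar m η V q H φ f = ⊤ := by
  have := h.isProb_famLaw
  have mj := measurable_jTot h
  have hcr := criticalRate_pos h.hV h.hq0 h.hq
  have hchi : ∀ s, chi (atom (-1) 1) s ≤ 0 := fun s => by
    rw [← chiExt_coe, chiExt_atom_neg_one]
    exact isWeight_minusOne.upper _
  have hadm : atom (-1) 1 ∈ admissible V q φ :=
    ⟨0, (lt_thetaMax_iff h hb).2 (by simpa using hcr), hchi⟩
  have hv (x : Space d) : vLim m η V q φ x (-1)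
      = ∫ z, (Real.exp (-jTot η φ x z) - 1) ∂(famLaw m V q) := by
    have hb0 := h.pos
    rw [vLim_eq_integral h (by linarith)]
    simp
  have hint (x : Space d) : Integrable (fun z => Real.exp (-jTot η φ x z) - 1) (famLaw m V q) := by
    have hb0 := h.pos
    have := integrable_exp_jTot h (θ := -1) (by linarith) x
    simp only [neg_mul, one_mul] at this
    exact this.sub (integrable_const 1)
  have hle (x z) : Real.exp (-jTot η φ x z) - 1 ≤ 0 :=
    sub_nonpos.2 (Real.exp_le_one_iff.2 (by simpa using jTot_nonneg x z))
  have hinner (t : ℝ) (ht : t ∈ Ico (0 : ℝ) 1) :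
      (∫⁻ x, ENNReal.ofReal (vLim m η V q φ x (chiExt (atom (-1) 1) t)) = 0) ∧
      ∫⁻ x, ENNReal.ofReal (-vLim m η V q φ x (chiExt (atom (-1) 1) t)) = ∞ := by
    rw [chiExt_atom_neg_one, minusOne, indicator_of_mem ht]
    simp_rw [hv]
    constructor
    · rw [lintegral_eq_zero_of_ae_eq_zero]
      exact ae_of_all _ fun x => ENNReal.ofReal_of_nonpos (integral_nonpos fun z => hle x z)
    · rw [LaplaceFinite, not_not, famMeasure, lintegral_prod _ (by fun_prop)] at hfin
      rw [← hfin]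
      refine lintegral_congr fun x => ?_
      have hneg : Integrable (fun z => -(Real.exp (-jTot η φ x z) - 1)) (famLaw m V q) :=
        (hint x).neg
      rw [← integral_neg, ofReal_integral_eq_lintegral_ofReal hneg
        (ae_of_all _ fun z => neg_nonneg.2 (hle x z))]
      simp
  have hLam : Lambda m η V q H φ (atom (-1) 1) = ⊥ := by
    rw [Lambda_eq, setLIntegral_congr_fun measurableSet_Ico fun t ht => (hinner t ht).1,
      setLIntegral_congr_fun measurableSet_Ico fun t ht => (hinner t ht).2]
    simp [ENNReal.mul_top, hH]
  rw [LambdaStar, eq_top_iff]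
  refine le_trans ?_ (le_iSup₂_of_le (atom (-1) 1) hadm le_rfl)
  rw [hLam]
  simp

/-- When `χ_ν` vanishes, `ν` is admissible and `Λ(ν) = 0`. The cases of interest are `ν = 0` and
multiples of `δ_0`, whose mass no interval `(s, 1]` sees. -/
lemma pairing_le_LambdaStar_of_chi_eq_zero (h : Setting m η φ V q b) (hb : b = supNorm φ)
    (f : C(unitInterval, ℝ)) (hν : ∀ s, chi ν s = 0) :
    ((pairing f ν : ℝ) : EReal) ≤ LambdaStar m η V q H φ f := by
  have := h.isProb_famLaw
  have hcr := criticalRate_pos h.hV h.hq0 h.hq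
  have hadm : ν ∈ admissible V q φ :=
    ⟨0, (lt_thetaMax_iff h hb).2 (by simpa using hcr), fun s => (hν s).le⟩
  refine le_trans ?_ (le_iSup₂_of_le ν hadm le_rfl)
  have hv (x : Space d) : vLim m η V q φ x 0 = 0 := by
    rw [vLim_eq_integral h (by simpa using hcr)]
    simp
  simp [Lambda, hν, hv]

lemma zero_le_LambdaStar (h : Setting m η φ V q b) (hb : b = supNorm φ) (f : C(unitInterval, ℝ)) :
    0 ≤ LambdaStar m η V q H φ f := by
  simpa [pairing_zero] using pairing_le_LambdaStar_of_chi_eq_zero (H := H) h hb f (ν := 0) fun _ => rfl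

/-- Multiples of `δ_0` cost nothing, and their pairing with `f` is unbounded above unless `f 0 = 0`.
-/
lemma LambdaStar_eq_top_of_apply_zero_ne (h : Setting m η φ V q b) (hb : b = supNorm φ)
    {f : C(unitInterval, ℝ)} (hf : f 0 ≠ 0) : LambdaStar m η V q H φ f = ⊤ := by
  rw [EReal.eq_top_iff_forall_lt]
  intro y
  refine lt_of_lt_of_le ?_ (pairing_le_LambdaStar_of_chi_eq_zero h hb f
    (ν := atom ((y + 1) / f 0) 0) fun s => ?_)
  · rw [pairing_atom, div_mul_cancel₀ _ hf, EReal.coe_lt_coe_iff]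
    linarith
  · rw [chi_atom, indicator_of_notMem (by simp), mul_zero]

end RateIdentities

/-! ### The local upper bound. -/

section UpperBound

lemma limsup_measure_ball_le (h : Setting m η φ V q b) (hN : IsBranchingData P m V q H ξ Z)
    (ν : SignedMeasure unitInterval) {c : ℝ} (hc : ∀ s, chi ν s ≤ c)
    (f : C(unitInterval, ℝ)) (r : ℝ) {x : ℝ → ℝ} {y L : ℝ} (hx : Tendsto x atTop (𝓝 y))
    (hP : ∀ᶠ T in atTop, popExp P η φ ξ Z (chiExt ν) T ≤ ENNReal.ofReal (Real.exp (T * x T)))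
    (hL : y - pairing f ν + r * totalMass ν ≤ L) :
    limsup (fun T : ℝ => ((T⁻¹ : ℝ) : EReal) *
      ENNReal.log (P (occupationEvent η ξ Z φ T (Metric.ball f r)))) atTop ≤ (L : EReal) := by
  refine (limsup_inv_mul_log_le ((hx.sub_const (pairing f ν)).add_const (r * totalMass ν)) ?_).trans
    (EReal.coe_le_coe_iff.2 hL)
  filter_upwards [hP, eventually_gt_atTop 0] with T hPT hT
  exact measure_occupationEvent_le h hN hT ν hc f r hPT

/-- A test measure with `⟨f, ν⟩ - Λ(ν) > L` is fixed, and the radius is chosen so small that the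
variation of `⟨g, ν⟩` over the ball stays within the gap. -/
lemma exists_limsup_measure_ball_le (h : Setting m η φ V q b) (hb : b = supNorm φ)
    (hN : IsBranchingData P m V q H ξ Z) (hH : 0 < H) (f : C(unitInterval, ℝ)) {L : ℝ}
    (hL : (L : EReal) < LambdaStar m η V q H φ f) :
    ∃ r : ℝ, 0 < r ∧ limsup (fun T : ℝ => ((T⁻¹ : ℝ) : EReal) *
      ENNReal.log (P (occupationEvent η ξ Z φ T (Metric.ball f r)))) atTop ≤ ((-L : ℝ) : EReal) := by
  by_cases hfin : LaplaceFinite m η φ V q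
  · rw [LambdaStar] at hL
    obtain ⟨ν, hL⟩ := lt_iSup_iff.1 hL
    obtain ⟨⟨c, hc, hχ⟩, hL⟩ := lt_iSup_iff.1 hL
    rw [lt_thetaMax_iff h hb] at hc
    rw [Lambda_eq_limitCgf h hfin hH.le hχ hc, ← EReal.coe_sub, EReal.coe_lt_coe_iff] at hL
    set gap := pairing f ν - limitCgf m η φ V q H (chiExt ν) - L with hgap
    have hg : 0 < gap := by rw [hgap]; linarith
    have htm := totalMass_nonneg (ν := ν)
    have hw := isWeight_chiExt hχ
    have hc' := max_zero_mul_lt h hc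
    -- The radius times the total mass is at most the gap; the added one covers `ν = 0`.
    refine ⟨gap / (totalMass ν + 1), by positivity, limsup_measure_ball_le h hN ν hχ f _
      (tendsto_scaledCgf (H := H) h hfin hw hc') ?_ ?_⟩
    · filter_upwards [eventually_gt_atTop 0] with T hT
      exact (popExp_eq_exp h hfin hN hH.le hw hc' hT).le
    · have : gap / (totalMass ν + 1) * totalMass ν ≤ gap := by
        rw [div_mul_eq_mul_div, div_le_iff₀ (by positivity)]
        nlinarith
      rw [hgap] at this ⊢
      linarith
  · have hχ : ∀ s, chi (atom (-1) 1) s ≤ 0 := fun s => by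
      rw [← chiExt_coe, chiExt_atom_neg_one]
      exact isWeight_minusOne.upper _
    set ν := atom (-1) 1 with hν
    -- Here every exponential rate is available, so the constant is chosen to give exactly `-L` with
    -- radius one.
    refine ⟨1, one_pos, limsup_measure_ball_le h hN ν hχ f 1
      (tendsto_const_nhds (x := pairing f ν - totalMass ν - L)) ?_ (by linarith)⟩
    rw [hν, chiExt_atom_neg_one, ← hν]
    filter_upwards [eventually_popExp_minusOne_le h hfin hN hH
      (-(pairing f ν - totalMass ν - L))] with T hT
    refine hT.trans_eq ?_
    congr 2
    ring

end UpperBound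

/-! ### Step functions on a uniform grid. -/

section StepWeights

variable {n : ℕ}

/-- The cells of the uniform partition of `[0, 1)` into `n` intervals. -/
def cell (n i : ℕ) : Set ℝ := Ico ((i : ℝ) / n) (((i + 1 : ℕ) : ℝ) / n)

/-- The points of the uniform grid. -/
def grid (n i : ℕ) : unitInterval := projIcc 0 1 zero_le_one ((i : ℝ) / n)

lemma coe_grid (hn : 0 < n) {i : ℕ} (hi : i ≤ n) : (grid n i : ℝ) = (i : ℝ) / n := by
  have hn' : (0 : ℝ) < n := by exact_mod_cast hn
  have hi' : (i : ℝ) ≤ n := by exact_mod_cast hi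
  rw [grid, projIcc_of_mem zero_le_one ⟨by positivity, (div_le_one hn').2 hi'⟩]

lemma measurableSet_cell (n i : ℕ) : MeasurableSet (cell n i) := measurableSet_Ico

lemma mem_cell_iff (hn : 0 < n) {i : ℕ} {u : ℝ} : u ∈ cell n i ↔ 0 ≤ u ∧ ⌊u * n⌋₊ = i := by
  have hn' : (0 : ℝ) < n := by exact_mod_cast hn
  rw [cell, mem_Ico, div_le_iff₀ hn', lt_div_iff₀ hn', Nat.cast_add, Nat.cast_one]
  constructor
  · rintro ⟨h1, h2⟩
    have h0 : 0 ≤ u * n := (Nat.cast_nonneg i).trans h1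
    exact ⟨nonneg_of_mul_nonneg_left h0 hn', (Nat.floor_eq_iff h0).2 ⟨h1, h2⟩⟩
  · rintro ⟨h0, h1⟩
    exact (Nat.floor_eq_iff (by positivity)).1 h1

lemma cell_subset (hn : 0 < n) (i : Fin n) : cell n i ⊆ Ico 0 1 := by
  have hn' : (0 : ℝ) < n := by exact_mod_cast hn
  refine Ico_subset_Ico (by positivity) ((div_le_one hn').2 ?_)
  exact_mod_cast i.2

lemma exists_mem_cell (hn : 0 < n) {u : ℝ} (hu : u ∈ Ico (0 : ℝ) 1) : ∃ i : Fin n, u ∈ cell n i := by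
  have hn' : (0 : ℝ) < n := by exact_mod_cast hn
  refine ⟨⟨⌊u * n⌋₊, ?_⟩, (mem_cell_iff hn).2 ⟨hu.1, rfl⟩⟩
  rw [Nat.floor_lt (mul_nonneg hu.1 hn'.le)]
  nlinarith [hu.2]

lemma sum_indicator_cell (hn : 0 < n) {β : Type*} [AddCommMonoid β] (a : Fin n → β) {i : Fin n}
    {u : ℝ} (hu : u ∈ cell n i) : ∑ j : Fin n, (cell n j).indicator (fun _ => a j) u = a i := by
  rw [Finset.sum_eq_single i, indicator_of_mem hu]
  · intro j _ hj
    refine indicator_of_notMem (fun hj' => hj (Fin.ext ?_)) _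
    rw [← ((mem_cell_iff hn).1 hu).2, ← ((mem_cell_iff hn).1 hj').2]
  · simp

lemma sum_indicator_cell_of_notMem (hn : 0 < n) {β : Type*} [AddCommMonoid β] (a : Fin n → β)
    {u : ℝ} (hu : u ∉ Ico (0 : ℝ) 1) :
    ∑ j : Fin n, (cell n j).indicator (fun _ => a j) u = 0 :=
  Finset.sum_eq_zero fun j _ => indicator_of_notMem (fun hj => hu (cell_subset hn j hj)) _

/-- The step function with value `ϑ i` on the `i`-th cell. -/
def stepFun (ϑ : Fin n → ℝ) (u : ℝ) : ℝ := ∑ i : Fin n, (cell n i).indicator (fun _ => ϑ i) u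

lemma stepFun_of_mem (hn : 0 < n) (ϑ : Fin n → ℝ) {i : Fin n} {u : ℝ} (hu : u ∈ cell n i) :
    stepFun ϑ u = ϑ i := sum_indicator_cell hn ϑ hu

lemma isWeight_stepFun (hn : 0 < n) {ϑ : Fin n → ℝ} {c : ℝ} (hc0 : 0 ≤ c) (hc : ∀ i, ϑ i ≤ c) :
    IsWeight (stepFun ϑ) (∑ i, |ϑ i|) c where
  measurable := Finset.measurable_sum _ fun i _ => measurable_const.indicator measurableSet_Ico
  lower u := by
    by_cases hu : u ∈ Ico (0 : ℝ) 1
    · obtain ⟨i, hi⟩ := exists_mem_cell hn hu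
      rw [stepFun_of_mem hn ϑ hi]
      have := Finset.single_le_sum (f := fun i => |ϑ i|) (fun i _ => abs_nonneg _) (Finset.mem_univ i)
      have h2 := neg_abs_le (ϑ i)
      linarith
    · rw [stepFun, sum_indicator_cell_of_notMem hn ϑ hu]
      simpa using Finset.sum_nonneg fun i _ => abs_nonneg (ϑ i)
  upper u := by
    by_cases hu : u ∈ Ico (0 : ℝ) 1
    · obtain ⟨i, hi⟩ := exists_mem_cell hn hu
      rw [stepFun_of_mem hn ϑ hi]
      exact hc i
    · rwa [stepFun, sum_indicator_cell_of_notMem hn ϑ hu]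
  zero u hu := sum_indicator_cell_of_notMem hn ϑ hu
  right u hu := by
    obtain ⟨i, hi⟩ := exists_mem_cell hn hu
    refine (continuousWithinAt_const (b := ϑ i)).congr_of_eventuallyEq ?_ (stepFun_of_mem hn ϑ hi)
    filter_upwards [Ico_mem_nhdsGE hi.2] with v hv
    exact stepFun_of_mem hn ϑ ⟨hi.1.trans hv.1, hv.2⟩

lemma ofReal_stepFun (hn : 0 < n) (ϑ : Fin n → ℝ) (u : ℝ) :
    ENNReal.ofReal (stepFun ϑ u)
      = ∑ i : Fin n, ENNReal.ofReal (ϑ i) * (cell n i).indicator 1 u := by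
  have e (i : Fin n) : ENNReal.ofReal (ϑ i) * (cell n i).indicator 1 u
      = (cell n i).indicator (fun _ => ENNReal.ofReal (ϑ i)) u := by
    by_cases h : u ∈ cell n i <;> simp [h]
  simp_rw [e]
  by_cases hu : u ∈ Ico (0 : ℝ) 1
  · obtain ⟨i, hi⟩ := exists_mem_cell hn hu
    rw [stepFun_of_mem hn ϑ hi, sum_indicator_cell hn _ hi]
  · rw [stepFun, sum_indicator_cell_of_notMem hn ϑ hu, sum_indicator_cell_of_notMem hn _ hu,
      ENNReal.ofReal_zero]

lemma neg_stepFun (ϑ : Fin n → ℝ) (u : ℝ) : -stepFun ϑ u = stepFun (fun i => -ϑ i) u := by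
  rw [stepFun, stepFun, ← Finset.sum_neg_distrib]
  refine Finset.sum_congr rfl fun i _ => ?_
  by_cases h : u ∈ cell n i <;> simp [h]

/-- The signed measure whose tail function is the step function with values `ϑ`. -/
def stepMeasure (ϑ : Fin n → ℝ) : SignedMeasure unitInterval :=
  ∑ i : Fin n, (atom (ϑ i) (grid n (i + 1)) + atom (-ϑ i) (grid n i))

lemma pairing_stepMeasure (f : C(unitInterval, ℝ)) (ϑ : Fin n → ℝ) :
    pairing f (stepMeasure ϑ) = ∑ i : Fin n, ϑ i * (f (grid n (i + 1)) - f (grid n i)) := by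
  rw [stepMeasure, pairing_sum]
  refine Finset.sum_congr rfl fun i _ => ?_
  rw [pairing_add, pairing_atom, pairing_atom]
  ring

/-- The interval `(t, 1]` contains the right end point of a cell but not the left one precisely when
`t` lies in the cell. Otherwise the two opposite atoms cancel or are both missed. -/
lemma chiExt_stepMeasure (hn : 0 < n) (ϑ : Fin n → ℝ) : chiExt (stepMeasure ϑ) = stepFun ϑ := by
  refine chiExt_eq_of_chi (fun u hu => sum_indicator_cell_of_notMem hn ϑ hu) fun t ht => ?_
  rw [stepMeasure, chi_sum, stepFun]
  refine Finset.sum_congr rfl fun i _ => ?_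
  rw [chi_add, chi_atom, chi_atom]
  have m1 : grid n (i + 1) ∈ Ioi t ↔ (t : ℝ) < ((i + 1 : ℕ) : ℝ) / n := by
    rw [mem_Ioi, ← Subtype.coe_lt_coe, coe_grid hn i.2]
  have m0 : grid n i ∈ Ioi t ↔ (t : ℝ) < (i : ℝ) / n := by
    rw [mem_Ioi, ← Subtype.coe_lt_coe, coe_grid hn i.2.le]
  have hle : ((i : ℕ) : ℝ) / n ≤ ((i + 1 : ℕ) : ℝ) / n := by gcongr; simp
  by_cases h0 : (t : ℝ) < (i : ℝ) / n
  · rw [indicator_of_mem (m1.2 (h0.trans_le hle)), indicator_of_mem (m0.2 h0),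
      indicator_of_notMem fun h => h.1.not_gt h0]
    simp
  · rw [indicator_of_notMem (s := Ioi t) (a := grid n i) fun h => h0 (m0.1 h)]
    by_cases h1 : (t : ℝ) < ((i + 1 : ℕ) : ℝ) / n
    · rw [indicator_of_mem (m1.2 h1), indicator_of_mem (s := cell n i) ⟨not_lt.1 h0, h1⟩]
      simp
    · rw [indicator_of_notMem (s := Ioi t) fun h => h1 (m1.1 h),
        indicator_of_notMem (s := cell n i) fun h => h1 h.2]
      simp

lemma setIntegral_stepFun (hn : 0 < n) (G : ℝ → ℝ) (ϑ : Fin n → ℝ) :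
    ∫ σ in Ico (0 : ℝ) 1, G (stepFun ϑ σ) = 1 / n * ∑ i, G (ϑ i) := by
  have hn' : (0 : ℝ) < n := by exact_mod_cast hn
  have e : ∀ σ ∈ Ico (0 : ℝ) 1, G (stepFun ϑ σ)
      = ∑ i : Fin n, (cell n i).indicator (fun _ => G (ϑ i)) σ := fun σ hσ => by
    obtain ⟨i, hi⟩ := exists_mem_cell hn hσ
    rw [stepFun_of_mem hn ϑ hi, sum_indicator_cell hn _ hi]
  rw [setIntegral_congr_fun measurableSet_Ico e, integral_finsetSum _ fun i _ =>
    (integrable_const (G (ϑ i))).indicator (measurableSet_cell n i), Finset.mul_sum]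
  refine Finset.sum_congr rfl fun i _ => ?_
  rw [integral_indicator (measurableSet_cell n i),
    Measure.restrict_restrict (measurableSet_cell n i),
    inter_eq_left.2 (cell_subset hn i), setIntegral_const, cell, Real.volume_real_Ico_of_le,
    smul_eq_mul]
  · congr 1
    push_cast
    ring
  · gcongr; simp

lemma exists_grid_le (hn : 0 < n) (t : unitInterval) :
    t = grid n n ∨ ∃ k < n, grid n k ≤ t ∧ t ≤ grid n (k + 1) := by
  have hn' : (0 : ℝ) < n := by exact_mod_cast hn
  by_cases ht : (t : ℝ) < 1
  · obtain ⟨i, hi⟩ := exists_mem_cell hn ⟨t.2.1, ht⟩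
    refine Or.inr ⟨i, i.2, ?_, ?_⟩
    · rw [← Subtype.coe_le_coe, coe_grid hn i.2.le]
      exact hi.1
    · rw [← Subtype.coe_le_coe, coe_grid hn i.2]
      exact hi.2.le
  · refine Or.inl (Subtype.ext ?_)
    rw [coe_grid hn le_rfl, div_self hn'.ne']
    exact le_antisymm t.2.2 (not_lt.1 ht)

/-- Between neighbouring grid points a monotone `g` is caught between its grid values, while `f`
varies by at most `ρ`. Hence no equicontinuity of occupation paths is needed. -/
lemma dist_le_of_grid (hn : 0 < n) {f g : C(unitInterval, ℝ)} {a ρ : ℝ} (hρ : 0 ≤ ρ)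
    (hg : Monotone g) (h : ∀ k ≤ n, |g (grid n k) - f (grid n k)| ≤ a)
    (hf : ∀ s t : unitInterval, dist s t ≤ 1 / n → dist (f s) (f t) ≤ ρ) :
    dist g f ≤ a + ρ := by
  have hn' : (0 : ℝ) < n := by exact_mod_cast hn
  have ha : 0 ≤ a := (abs_nonneg _).trans (h 0 (Nat.zero_le n))
  refine (ContinuousMap.dist_le (add_nonneg ha hρ)).2 fun t => ?_
  rw [Real.dist_eq]
  rcases exists_grid_le hn t with rfl | ⟨k, hk, h1, h2⟩
  · exact (h n le_rfl).trans (by linarith)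
  · have e1 := abs_le.1 (h k hk.le)
    have e2 := abs_le.1 (h (k + 1) hk)
    have hstep : ((grid n (k + 1) : unitInterval) : ℝ) - grid n k = 1 / n := by
      rw [coe_grid hn hk, coe_grid hn hk.le]
      push_cast
      ring
    have h1' : (grid n k : ℝ) ≤ t := h1
    have h2' : (t : ℝ) ≤ grid n (k + 1) := h2
    have d1 := hf t (grid n k) (by
      rw [Subtype.dist_eq, Real.dist_eq, abs_of_nonneg (by linarith)]; linarith)
    have d2 := hf t (grid n (k + 1)) (by
      rw [Subtype.dist_eq, Real.dist_eq, abs_of_nonpos (by linarith)]; linarith)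
    rw [Real.dist_eq] at d1 d2
    have d1 := abs_le.1 d1
    have d2 := abs_le.1 d2
    have g1 := hg h1
    have g2 := hg h2
    exact abs_le.2 ⟨by linarith [e1.1, d1.2], by linarith [e2.2, d2.1]⟩

lemma abs_grid_sub_le {f g : C(unitInterval, ℝ)} {ε : ℝ} (h0 : g (grid n 0) = f (grid n 0))
    (h : ∀ i : Fin n, |g (grid n (i + 1)) - g (grid n i) -
      (f (grid n (i + 1)) - f (grid n i))| ≤ ε) {k : ℕ} (hk : k ≤ n) :
    |g (grid n k) - f (grid n k)| ≤ k * ε := by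
  induction k with
  | zero => simp [h0]
  | succ k ih =>
    have h1 := ih (by omega)
    have h2 := h ⟨k, hk⟩
    calc _ = |(g (grid n k) - f (grid n k)) + (g (grid n (k + 1)) - g (grid n k) -
        (f (grid n (k + 1)) - f (grid n k)))| := by congr 1; ring
      _ ≤ k * ε + ε := (abs_add_le _ _).trans (add_le_add h1 h2)
      _ = _ := by push_cast; ring

/-- The mean value theorem realises each difference quotient as a value of the derivative, so the
slope inherits its strict bounds. -/
lemma exists_slopes (hn : 0 < n) {f : C(unitInterval, ℝ)} {a c : EReal} (hf : f ∈ slopeClass a c)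
    (i : Fin n) : ∃ s : ℝ, a < s ∧ (s : EReal) < c ∧
      f (grid n (i + 1)) - f (grid n i) = 1 / n * s := by
  have hn' : (0 : ℝ) < n := by exact_mod_cast hn
  obtain ⟨f', hf'⟩ := hf
  set x : ℝ := ((i : ℕ) : ℝ) / n with hx
  set y : ℝ := ((i + 1 : ℕ) : ℝ) / n with hy
  have hxy : y - x = 1 / n := by rw [hx, hy]; push_cast; ring
  have hlt : x < y := by
    have : 0 < 1 / (n : ℝ) := by positivity
    linarith
  have hx0 : 0 ≤ x := by positivity
  have hy1 : y ≤ 1 := (div_le_one hn').2 (by exact_mod_cast i.2)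
  obtain ⟨z, hz, hs⟩ := exists_hasDerivAt_eq_slope (IccExtend zero_le_one f) f' hlt
    (f.continuous.Icc_extend').continuousOn fun z hz =>
      (hf' z ⟨hx0.trans hz.1.le, hz.2.le.trans hy1⟩).1.hasDerivAt
        (Icc_mem_nhds (hx0.trans_lt hz.1) (hz.2.trans_le hy1))
  obtain ⟨-, h1, h2⟩ := hf' z ⟨hx0.trans hz.1.le, hz.2.le.trans hy1⟩
  refine ⟨f' z, h1, h2, ?_⟩
  rw [hs, hxy]
  have e1 : IccExtend zero_le_one f x = f (grid n i) := rfl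
  have e2 : IccExtend zero_le_one f y = f (grid n (i + 1)) := rfl
  rw [e1, e2]
  field_simp

end StepWeights

/-! ### Joint exponential moments of the increments. -/

section Increments

variable {n : ℕ}

/-- The occupation during the `i`-th cell of `[0, T)`. -/
def cellOcc (η : Space d → ℝ≥0 → S → Space d) (φ : Space d → ℝ) (ξ : ℕ → Ω → ℝ × Space d)
    (Z : ℕ × List Bool → Ω → Mark S) (n : ℕ) (T : ℝ) (i : ℕ) (ω : Ω) : ℝ≥0∞ :=
  popOcc η φ ξ Z (fun s => (cell n i).indicator 1 (s / T)) ω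

/-- The increment of the rescaled occupation over the `i`-th cell. -/
def increment (η : Space d → ℝ≥0 → S → Space d) (φ : Space d → ℝ) (ξ : ℕ → Ω → ℝ × Space d)
    (Z : ℕ × List Bool → Ω → Mark S) (n : ℕ) (T : ℝ) (ω : Ω) (i : Fin n) : ℝ :=
  (cellOcc η φ ξ Z n T i ω).toReal / T

lemma measurable_cellIndicator (n i : ℕ) (T : ℝ) :
    Measurable fun s : ℝ => (cell n i).indicator (1 : ℝ → ℝ≥0∞) (s / T) :=
  (measurable_one.indicator (measurableSet_cell n i)).comp (measurable_id.div_const T)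

lemma measurable_increment (h : Setting m η φ V q b) (hN : IsBranchingData P m V q H ξ Z) (T : ℝ)
    (i : Fin n) : Measurable fun ω => increment η φ ξ Z n T ω i :=
  (measurable_popOcc h hN (measurable_cellIndicator n i T)).ennreal_toReal.div_const T

lemma popOcc_stepFun (h : Setting m η φ V q b) (hn : 0 < n) (ϑ : Fin n → ℝ) (T : ℝ) (ω : Ω) :
    popOcc η φ ξ Z (fun s => ENNReal.ofReal (stepFun ϑ (s / T))) ω
      = ∑ i : Fin n, ENNReal.ofReal (ϑ i) * cellOcc η φ ξ Z n T i ω := by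
  have mD := measurable_popDens h (fun n => ξ n ω) (fun p => Z p ω)
  simp_rw [popOcc, ofReal_stepFun hn, Finset.sum_mul, mul_assoc]
  have mi (i : Fin n) : Measurable fun s : ℝ => (cell n i).indicator (1 : ℝ → ℝ≥0∞) (s / T) *
      popDens η φ (fun n => ξ n ω) (fun p => Z p ω) s := (measurable_cellIndicator n i T).mul mD
  rw [lintegral_finsetSum _ fun i _ => (mi i).const_mul _]
  refine Finset.sum_congr rfl fun i _ => ?_
  rw [lintegral_const_mul _ (mi i)]
  rfl

/-- A positive constant weight below the threshold has a finite exponential moment, and this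
dominates the occupation of each cell. -/
lemma ae_cellOcc_ne_top (h : Setting m η φ V q b) (hfin : LaplaceFinite m η φ V q)
    (hN : IsBranchingData P m V q H ξ Z) (hH : 0 ≤ H) (hn : 0 < n) {T : ℝ} (hT : 0 < T) :
    ∀ᵐ ω ∂P, ∀ i : Fin n, cellOcc η φ ξ Z n T i ω ≠ ∞ := by
  have hcr := criticalRate_pos h.hV h.hq0 h.hq
  have hb := h.pos
  set c := criticalRate V q / b / 2 with hc
  have hc0 : 0 < c := by positivity
  have hcb : c * b < criticalRate V q := by
    rw [hc]
    field_simp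
    linarith
  have hw := isWeight_stepFun hn (ϑ := fun _ => c) hc0.le fun _ => le_rfl
  have hexp := popExp_eq_exp h hfin hN hH hw hcb hT
  have e0 (ω : Ω) : popOcc η φ ξ Z (fun s => ENNReal.ofReal (-stepFun (fun _ : Fin n => c) (s / T))) ω
      = 0 := by
    simp_rw [neg_stepFun]
    rw [popOcc_stepFun h hn]
    simp [hc0.le]
  simp only [popExp, e0, negE_zero, mul_one] at hexp
  have m1 : Measurable fun s => ENNReal.ofReal (stepFun (fun _ : Fin n => c) (s / T)) :=
    (hw.measurable.comp (by fun_prop)).ennreal_ofReal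
  have hae := ae_lt_top (measurable_expE.comp (measurable_popOcc h hN m1))
    (hexp.trans_ne ENNReal.ofReal_ne_top)
  filter_upwards [hae] with ω hω i htop
  have e1 : popOcc η φ ξ Z (fun s => ENNReal.ofReal (stepFun (fun _ : Fin n => c) (s / T))) ω = ∞ := by
    rw [popOcc_stepFun h hn, ENNReal.sum_eq_top]
    refine ⟨i, Finset.mem_univ i, ?_⟩
    rw [htop, ENNReal.mul_top (by simpa using hc0)]
  rw [Function.comp_apply, e1, expE_top] at hω
  exact hω.ne rfl

lemma popExp_stepFun (h : Setting m η φ V q b) (hfin : LaplaceFinite m η φ V q)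
    (hN : IsBranchingData P m V q H ξ Z) (hH : 0 ≤ H) (hn : 0 < n) (ϑ : Fin n → ℝ) {T : ℝ}
    (hT : 0 < T) : popExp P η φ ξ Z (stepFun ϑ) T
      = ∫⁻ ω, ENNReal.ofReal (Real.exp (T * ∑ i, ϑ i * increment η φ ξ Z n T ω i)) ∂P := by
  refine lintegral_congr_ae ?_
  filter_upwards [ae_cellOcc_ne_top h hfin hN hH hn hT] with ω hω
  simp_rw [neg_stepFun]
  rw [popOcc_stepFun h hn, popOcc_stepFun h hn]
  have e (ϑ : Fin n → ℝ) : ∑ i, ENNReal.ofReal (ϑ i) * cellOcc η φ ξ Z n T i ω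
      = ENNReal.ofReal (∑ i, max (ϑ i) 0 * (cellOcc η φ ξ Z n T i ω).toReal) := by
    rw [ENNReal.ofReal_sum_of_nonneg fun i _ => by positivity]
    refine Finset.sum_congr rfl fun i _ => ?_
    rw [ENNReal.ofReal_mul (le_max_right _ _), ENNReal.ofReal_toReal (hω i), ENNReal.ofReal_max,
      ENNReal.ofReal_zero, max_eq_left zero_le]
  rw [e, e, expE_ofReal (Finset.sum_nonneg fun i _ => by positivity),
    negE_ofReal (Finset.sum_nonneg fun i _ => by positivity),
    ← ENNReal.ofReal_mul (Real.exp_pos _).le, ← Real.exp_add, ← sub_eq_add_neg,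
    ← Finset.sum_sub_distrib, Finset.mul_sum]
  congr 2
  refine Finset.sum_congr rfl fun i _ => ?_
  rw [← sub_mul, increment]
  have : max (ϑ i) 0 - max (-ϑ i) 0 = ϑ i := max_zero_sub_max_neg_zero_eq_self _
  rw [this]
  field_simp

lemma limitCgf_stepFun (h : Setting m η φ V q b) (hfin : LaplaceFinite m η φ V q) (hn : 0 < n)
    {ϑ : Fin n → ℝ} {c : ℝ} (hc0 : 0 ≤ c) (hϑ : ∀ i, ϑ i ≤ c) (hc : c * b < criticalRate V q) :
    limitCgf m η φ V q H (stepFun ϑ) = 1 / n * ∑ i, cgf m η φ V q H (ϑ i) := by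
  rw [limitCgf_eq h hfin (isWeight_stepFun hn hc0 hϑ) hc, setIntegral_stepFun hn]

lemma exists_bound (h : Setting m η φ V q b) {ϑ : Fin n → ℝ}
    (hϑ : ∀ i, ϑ i * b < criticalRate V q) :
    ∃ c, 0 ≤ c ∧ (∀ i, ϑ i ≤ c) ∧ c * b < criticalRate V q := by
  refine ⟨Finset.sup' (insert 0 (Finset.univ.image ϑ)) (Finset.insert_nonempty _ _) id,
    Finset.le_sup' id (Finset.mem_insert_self _ _), fun i => Finset.le_sup' id
    (Finset.mem_insert_of_mem (Finset.mem_image_of_mem ϑ (Finset.mem_univ i))), ?_⟩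
  rw [← lt_div_iff₀ h.pos, Finset.sup'_lt_iff]
  intro x hx
  rw [id, lt_div_iff₀ h.pos]
  rcases Finset.mem_insert.1 hx with rfl | hx
  · simpa using criticalRate_pos h.hV h.hq0 h.hq
  · obtain ⟨i, -, rfl⟩ := Finset.mem_image.1 hx
    exact hϑ i

/-- A step weight turns the weighted occupation into a linear combination of increments, so the
limit of the scaled cumulants is the average of `cgf` over the cells. -/
lemma hasScaledCgf_increment (h : Setting m η φ V q b) (hfin : LaplaceFinite m η φ V q)
    (hN : IsBranchingData P m V q H ξ Z) (hH : 0 ≤ H) (hn : 0 < n) :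
    HasScaledCgf P (increment η φ ξ Z n) (1 / n) (cgf m η φ V q H) (criticalRate V q / b) := by
  intro ϑ hϑ
  obtain ⟨c, hc0, hc, hcb⟩ := exists_bound h (ϑ := ϑ) fun i => (lt_div_iff₀ h.pos).1 (hϑ i)
  have hw := isWeight_stepFun hn hc0 hc
  refine ⟨scaledCgf m η φ V q H (stepFun ϑ), ?_, ?_⟩
  · rw [← limitCgf_stepFun h hfin hn hc0 hc hcb]
    exact tendsto_scaledCgf h hfin hw hcb
  · filter_upwards [eventually_gt_atTop 0] with T hT
    rw [← popExp_stepFun h hfin hN hH hn ϑ hT, popExp_eq_exp h hfin hN hH hw hcb hT]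

/-- The measure `stepMeasure ϑ` is an admissible competitor in the supremum. This compares the cost
of the discretised problem with `Λ*(f)`. -/
lemma pairing_sub_le_LambdaStar (h : Setting m η φ V q b) (hb : b = supNorm φ)
    (hfin : LaplaceFinite m η φ V q) (hH : 0 ≤ H) (hn : 0 < n) (f : C(unitInterval, ℝ))
    {ϑ : Fin n → ℝ} (hϑ : ∀ i, ϑ i * b < criticalRate V q) :
    ((∑ i : Fin n, ϑ i * (f (grid n (i + 1)) - f (grid n i)) -
      1 / n * ∑ i, cgf m η φ V q H (ϑ i) : ℝ) : EReal) ≤ LambdaStar m η V q H φ f := by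
  obtain ⟨c, hc0, hc, hcb⟩ := exists_bound h hϑ
  have hχ : ∀ s, chi (stepMeasure ϑ) s ≤ c := fun s => by
    rw [← chiExt_coe, chiExt_stepMeasure hn]
    exact (isWeight_stepFun hn hc0 hc).upper _
  refine le_trans ?_ (le_iSup₂_of_le (stepMeasure ϑ) ⟨c, (lt_thetaMax_iff h hb).2 hcb, hχ⟩ le_rfl)
  rw [Lambda_eq_limitCgf h hfin hH hχ hcb, chiExt_stepMeasure hn,
    limitCgf_stepFun h hfin hn hc0 hc hcb, pairing_stepMeasure, EReal.coe_sub]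

end Increments

/-! ### The occupation as a continuous path. -/

section Path

variable {D : ℝ → ℝ≥0∞} {T : ℝ}

lemma exists_continuousMap_primitive (mD : Measurable D) (hT : 0 < T)
    (hfin : ∫⁻ s in Icc 0 T, D s ≠ ∞) : ∃ g : C(unitInterval, ℝ), ∀ t : unitInterval,
      (∫⁻ s in Icc 0 (T * t), D s) / ENNReal.ofReal T = ENNReal.ofReal (g t) ∧ 0 ≤ g t := by
  have hI : IntegrableOn (fun s => (D s).toReal) (Icc 0 T) :=
    integrable_toReal_of_lintegral_ne_top mD.aemeasurable hfin
  have hcont := intervalIntegral.continuousOn_primitive (a := 0) (b := T) hI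
  have hmap : ∀ t : unitInterval, T * (t : ℝ) ∈ Icc 0 T := fun t =>
    ⟨mul_nonneg hT.le t.2.1, mul_le_of_le_one_right hT.le t.2.2⟩
  refine ⟨⟨fun t => (∫ s in Ioc 0 (T * (t : ℝ)), (D s).toReal) / T,
    (hcont.comp_continuous (by fun_prop) hmap).div_const T⟩, fun t => ?_⟩
  have hsub : Icc 0 (T * (t : ℝ)) ⊆ Icc 0 T := Icc_subset_Icc_right (hmap t).2
  have hfin' : ∫⁻ s in Icc 0 (T * (t : ℝ)), D s ≠ ∞ :=
    ne_top_of_le_ne_top hfin (lintegral_mono_set hsub)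
  have hpos : 0 ≤ ∫ s in Ioc 0 (T * (t : ℝ)), (D s).toReal :=
    integral_nonneg fun s => ENNReal.toReal_nonneg
  refine ⟨?_, div_nonneg hpos hT.le⟩
  simp only [ContinuousMap.coe_mk]
  rw [ENNReal.ofReal_div_of_pos hT, restrict_Ioc_eq_restrict_Icc,
    integral_toReal mD.aemeasurable (ae_lt_top mD hfin'), ENNReal.ofReal_toReal hfin']

end Path

/-! ### The lower bound. -/

section LowerBound

variable {n : ℕ} {T : ℝ}

lemma cellOcc_eq (hT : 0 < T) (i : ℕ) (ω : Ω) : cellOcc η φ ξ Z n T i ω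
    = ∫⁻ s in Ico (T * ((i : ℝ) / n)) (T * (((i + 1 : ℕ) : ℝ) / n)),
      popDens η φ (fun n => ξ n ω) (fun p => Z p ω) s := by
  rw [cellOcc, popOcc, ← lintegral_indicator measurableSet_Ico]
  refine lintegral_congr fun s => ?_
  by_cases hs : s / T ∈ cell n i
  · rw [indicator_of_mem hs, indicator_of_mem (s := Ico _ _)]
    · simp
    · exact ⟨(le_div_iff₀' hT).1 hs.1, (div_lt_iff₀' hT).1 hs.2⟩
  · rw [indicator_of_notMem hs, indicator_of_notMem (s := Ico _ _), zero_mul]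
    exact fun h => hs ⟨(le_div_iff₀' hT).2 h.1, (div_lt_iff₀' hT).2 h.2⟩

lemma setLIntegral_grid_succ (hn : 0 < n) (hT : 0 < T) {i : ℕ} (hi : i < n) (ω : Ω) :
    ∫⁻ s in Icc 0 (T * (grid n (i + 1) : ℝ)), popDens η φ (fun n => ξ n ω) (fun p => Z p ω) s
      = (∫⁻ s in Icc 0 (T * (grid n i : ℝ)), popDens η φ (fun n => ξ n ω) (fun p => Z p ω) s) +
        cellOcc η φ ξ Z n T i ω := by
  rw [cellOcc_eq hT, coe_grid hn hi, coe_grid hn hi.le, restrict_Ico_eq_restrict_Icc.symm,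
    restrict_Ico_eq_restrict_Icc.symm, ← lintegral_union measurableSet_Ico
    (Ico_disjoint_Ico_same), Ico_union_Ico_eq_Ico (by positivity)]
  have : ((i : ℕ) : ℝ) / n ≤ ((i + 1 : ℕ) : ℝ) / n := by gcongr; simp
  exact mul_le_mul_of_nonneg_left this hT.le

lemma setLIntegral_grid_ne_top (hn : 0 < n) (hT : 0 < T) {ω : Ω}
    (hω : ∀ i : Fin n, cellOcc η φ ξ Z n T i ω ≠ ∞) {k : ℕ} (hk : k ≤ n) :
    ∫⁻ s in Icc 0 (T * (grid n k : ℝ)), popDens η φ (fun n => ξ n ω) (fun p => Z p ω) s ≠ ∞ := by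
  induction k with
  | zero => simp [coe_grid hn (Nat.zero_le n)]
  | succ k ih =>
    rw [setLIntegral_grid_succ hn hT hk]
    exact ENNReal.add_ne_top.2 ⟨ih (by omega), hω ⟨k, hk⟩⟩

lemma exists_occupation_path (h : Setting m η φ V q b) (hn : 0 < n) (hT : 0 < T) {ω : Ω}
    (hω : ∀ i : Fin n, cellOcc η φ ξ Z n T i ω ≠ ∞) : ∃ g : C(unitInterval, ℝ),
    (∀ t : unitInterval,
      ((occupation (population η (fun n => ξ n ω) (fun p => Z p ω)) φ T T t : ℝ≥0∞) : EReal)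
        = ((g t : ℝ) : EReal)) ∧ Monotone g ∧ g (grid n 0) = 0 ∧
    ∀ i : Fin n, g (grid n (i + 1)) - g (grid n i) = increment η φ ξ Z n T ω i := by
  have mD := measurable_popDens h (fun n => ξ n ω) (fun p => Z p ω)
  have hfin := setLIntegral_grid_ne_top hn hT hω le_rfl
  rw [coe_grid hn le_rfl, div_self (by exact_mod_cast hn.ne'), mul_one] at hfin
  obtain ⟨g, hg⟩ := exists_continuousMap_primitive mD hT hfin
  have hg' (t : unitInterval) : g t = (∫⁻ s in Icc 0 (T * (t : ℝ)),
      popDens η φ (fun n => ξ n ω) (fun p => Z p ω) s).toReal / T := by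
    rw [← ENNReal.toReal_ofReal (hg t).2, ← (hg t).1, ENNReal.toReal_div,
      ENNReal.toReal_ofReal hT.le]
  refine ⟨g, fun t => ?_, fun s t hst => ?_, ?_, fun i => ?_⟩
  · rw [← max_eq_left (hg t).2, ← EReal.coe_ennreal_ofReal, ← (hg t).1]
    rfl
  · rw [← ENNReal.ofReal_le_ofReal_iff (hg t).2, ← (hg s).1, ← (hg t).1]
    refine ENNReal.div_le_div_right (lintegral_mono_set (Icc_subset_Icc_right ?_)) _
    exact mul_le_mul_of_nonneg_left hst hT.le
  · rw [hg', coe_grid hn (Nat.zero_le n)]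
    simp
  · rw [hg', hg', setLIntegral_grid_succ hn hT i.2, ENNReal.toReal_add
      (setLIntegral_grid_ne_top hn hT hω i.2.le) (hω i), increment]
    ring

/-- Errors of the increments add up to at most `n * ε` at the grid points, and monotonicity extends
the closeness to all of `[0, 1]` at the further cost `ρ`. -/
lemma le_measure_occupationEvent (h : Setting m η φ V q b) (hfin : LaplaceFinite m η φ V q)
    (hN : IsBranchingData P m V q H ξ Z) (hH : 0 ≤ H) (hn : 0 < n) (hT : 0 < T)
    {f : C(unitInterval, ℝ)} (hf0 : f 0 = 0) {ε ρ r : ℝ} (hρ : 0 ≤ ρ) (hr : n * ε + ρ < r)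
    (hf : ∀ s t : unitInterval, dist s t ≤ 1 / n → dist (f s) (f t) ≤ ρ)
    {U : Set C(unitInterval, ℝ)} (hU : Metric.ball f r ⊆ U) :
    P {ω | ∀ i : Fin n, |increment η φ ξ Z n T ω i - (f (grid n (i + 1)) - f (grid n i))| < ε}
      ≤ P (occupationEvent η ξ Z φ T U) := by
  refine measure_mono_ae ?_
  filter_upwards [ae_cellOcc_ne_top h hfin hN hH hn hT] with ω hω hinc
  obtain ⟨g, hg, hmono, hg0, hgi⟩ := exists_occupation_path h hn hT hω
  have h0 : grid n 0 = 0 := Subtype.ext (by simp [coe_grid hn (Nat.zero_le n)])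
  have hε : 0 ≤ ε := (abs_nonneg _).trans (hinc ⟨0, hn⟩).le
  refine ⟨g, hU ?_, hg⟩
  refine (dist_le_of_grid hn hρ hmono (fun k hk => ?_) hf).trans_lt hr
  refine (abs_grid_sub_le (by rw [hg0, h0, hf0]) (fun i => ?_) hk).trans
    (mul_le_mul_of_nonneg_right (by exact_mod_cast hk) hε)
  rw [hgi]
  exact (hinc i).le

/-- The increments of `f` over a fine grid are made typical by tilting, with parameters whose
derivatives `G'` match the slopes of `f`. The cost of the tilt is bounded by `Λ*(f)` through a step
measure. -/
lemma neg_LambdaStar_le_liminf (h : Setting m η φ V q b) (hb : b = supNorm φ)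
    (hN : IsBranchingData P m V q H ξ Z) (hH : 0 < H) {U : Set C(unitInterval, ℝ)} (hU : IsOpen U)
    {f : C(unitInterval, ℝ)} (hfU : f ∈ U)
    (hf : f ∈ slopeClass 0 ((ENNReal.ofReal H * slopeA m η V q φ : ℝ≥0∞) : EReal)) :
    -LambdaStar m η V q H φ f ≤ liminf (fun T : ℝ =>
      ((T⁻¹ : ℝ) : EReal) * ENNReal.log (P (occupationEvent η ξ Z φ T U))) atTop := by
  -- If the Laplace functional is not integrable, or if `f 0 ≠ 0`, then `Λ*(f)` is infinite and the
  -- claim is void.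
  by_cases hfin : LaplaceFinite m η φ V q
  swap
  · simp [LambdaStar_eq_top_of_not_laplaceFinite h hb hfin hH f]
  by_cases hf0 : f 0 = 0
  swap
  · simp [LambdaStar_eq_top_of_apply_zero_ne (H := H) h hb hf0]
  refine le_of_forall_lt fun y hy => ?_
  obtain ⟨L, hyL, hL⟩ := EReal.lt_iff_exists_real_btwn.1 hy
  refine hyL.trans_le ?_
  obtain ⟨r, hr, hball⟩ := Metric.isOpen_iff.1 hU f hfU
  obtain ⟨δ, hδ, hunif⟩ := Metric.uniformContinuous_iff.1
    (CompactSpace.uniformContinuous_of_continuous f.continuous) (r / 2) (by linarith)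
  obtain ⟨k, hk⟩ := exists_nat_one_div_lt hδ
  set n := k + 1 with hn
  have hn0 : 0 < n := Nat.succ_pos k
  have hn' : (0 : ℝ) < n := by exact_mod_cast hn0
  choose s hs0 hsA hs using fun i => exists_slopes hn0 hf i
  choose θ hθ hθs using fun i => exists_cgfDeriv_eq h hb hfin hH.le (s := s i)
    (by exact_mod_cast hs0 i) (hsA i)
  have hle := pairing_sub_le_LambdaStar h hb hfin hH.le hn0 f hθ
  set R := ∑ i : Fin n, θ i * (f (grid n (i + 1)) - f (grid n i)) -
      1 / n * ∑ i, cgf m η φ V q H (θ i) with hR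
  have hLR : L < -R := by
    have := hL.trans_le (EReal.neg_le_neg_iff.2 hle)
    exact_mod_cast this
  set K := ∑ i, |θ i| with hK
  have hK0 : 0 ≤ K := Finset.sum_nonneg fun i _ => abs_nonneg _
  -- The first bound keeps the accumulated grid error below `r/4`, which together with the
  -- oscillation `r/2` stays inside the ball. The second keeps the tilting error `ε ∑ |θ i|` below
  -- the slack `-R - L`.
  set ε := min (r / (4 * n)) ((-R - L) / (2 * (K + 1))) with hε
  have hε0 : 0 < ε := lt_min (by positivity) (div_pos (by linarith) (by positivity))
  have hε1 : n * ε ≤ r / 4 := by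
    have := mul_le_mul_of_nonneg_left (min_le_left (r / (4 * n)) ((-R - L) / (2 * (K + 1)))) hn'.le
    refine this.trans_eq ?_
    field_simp
  have hε2 : ε * K < -R - L := by
    have h1 := min_le_right (r / (4 * n)) ((-R - L) / (2 * (K + 1)))
    rw [← hε, le_div_iff₀ (by positivity)] at h1
    nlinarith
  have htilt := eventually_le_measure_of_tilting (measurable_increment h hN)
    (hasScaledCgf_increment h hfin hN hH.le hn0) (w := 1 / n) (by positivity)
    (θ := θ) (s := s) (fun i => (lt_div_iff₀ h.pos).2 (hθ i))
    (fun i => hθs i ▸ hasDerivAt_cgf h hfin (hθ i)) hε0 (L := L) (by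
      simp_rw [← hs]
      linarith)
  refine le_liminf_inv_mul_log ?_
  filter_upwards [htilt, eventually_gt_atTop 0] with T hT1 hT
  refine hT1.trans ?_
  simp_rw [← hs]
  refine le_measure_occupationEvent h hfin hN hH.le hn0 hT hf0 (ρ := r / 2) (r := r) (by positivity)
    (by linarith) (fun u v huv => ?_) hball
  refine (hunif (huv.trans_lt ?_)).le
  rw [hn]
  exact_mod_cast hk

end LowerBound

lemma bddAbove_abs_schwartz {d : ℕ} (φ : 𝓢(Space d, ℝ)) : BddAbove (range fun x => |φ x|) :=
  ⟨‖φ.toBoundedContinuousFunction‖, by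
    rintro _ ⟨x, rfl⟩
    exact φ.toBoundedContinuousFunction.norm_coe_le_norm x⟩

lemma setting_of_schwartz {d : ℕ} {S : Type*} [MeasurableSpace S] {m : Measure S}
    [IsProbabilityMeasure m] {η : Space d → ℝ≥0 → S → Space d} (hη : IsMarkovFamily m η)
    {V q : ℝ} (hV : 0 < V) (hq0 : 0 ≤ q) (hq : q < 1 / 2) {φ : 𝓢(Space d, ℝ)} (hφ : ∀ x, 0 ≤ φ x)
    (hφ0 : φ ≠ 0) : Setting m η φ V q (supNorm φ) where
  prob := inferInstance
  markov := hη
  measurable := φ.continuous.measurable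
  nonneg := hφ
  pos := by
    obtain ⟨x, hx⟩ := DFunLike.ne_iff.1 hφ0
    exact (abs_pos.2 hx).trans_le (le_ciSup (bddAbove_abs_schwartz φ) x)
  bound x := (le_abs_self _).trans (le_ciSup (bddAbove_abs_schwartz φ) x)
  hV := hV
  hq0 := hq0
  hq := hq

end OccupationProcess

end BranchingLDP
end

theorem mainTheorem2 {d : ℕ} {S : Type*} [MeasurableSpace S] (m : Measure S)
    [IsProbabilityMeasure m] (η : Space d → ℝ≥0 → S → Space d) (hη : IsMarkovFamily m η)
    (hA1 : AlmostUniformlyStochCont m η) (hA2 : SchwartzSubsetDomain m η)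
    (hA3 : FeynmanKacFeller m η)
    (V q H : ℝ) (hV : 0 < V) (hq0 : 0 ≤ q) (hq : q < 1 / 2) (hH : 0 < H)
    {Ω : Type*} [MeasurableSpace Ω] (P : Measure Ω) [IsProbabilityMeasure P]
    (ξ : ℕ → Ω → ℝ × Space d) (Z : ℕ × List Bool → Ω → Mark S)
    (hN : IsBranchingData P m V q H ξ Z)
    (φ : 𝓢(Space d, ℝ)) (hφ : ∀ x, 0 ≤ φ x) (hφ0 : φ ≠ 0) :
    -- the one-particle equation is well posed, its limit exists and is differentiable in `θ`
    (∀ θ : ℝ, θ < thetaMax V q φ →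
      (∃! v, IsOneParticleSolution m η V q φ θ v) ∧
      ∀ x, (∃ l : ℝ, Tendsto (fun t => oneParticle m η V q φ θ x t) atTop (𝓝 l)) ∧
        DifferentiableAt ℝ (fun ϑ => vLim m η V q φ x ϑ) θ) ∧
    -- lower bound
    (∀ U : Set C(unitInterval, ℝ), IsOpen U →
      -(⨅ f ∈ U ∩ slopeClass 0 ((ENNReal.ofReal H * slopeA m η V q φ : ℝ≥0∞) : EReal),
          LambdaStar m η V q H φ f) ≤
        liminf (fun T : ℝ =>
          ((T⁻¹ : ℝ) : EReal) * ENNReal.log (P (occupationEvent η ξ Z φ T U))) atTop) ∧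
    -- local upper bound
    (∀ f ∈ slopeClass 0 ((ENNReal.ofReal H * slopeA m η V q φ : ℝ≥0∞) : EReal),
      (LambdaStar m η V q H φ f ≠ ⊤ → ∀ δ : ℝ, 0 < δ → ∃ r : ℝ, 0 < r ∧
        limsup (fun T : ℝ => ((T⁻¹ : ℝ) : EReal) *
          ENNReal.log (P (occupationEvent η ξ Z φ T (Metric.ball f r)))) atTop ≤
            (δ : EReal) - LambdaStar m η V q H φ f) ∧
      (LambdaStar m η V q H φ f = ⊤ → ∀ M : ℝ, ∃ r : ℝ, 0 < r ∧
        limsup (fun T : ℝ => ((T⁻¹ : ℝ) : EReal) *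
          ENNReal.log (P (occupationEvent η ξ Z φ T (Metric.ball f r)))) atTop ≤
            -(M : EReal))) := by
  have h := setting_of_schwartz hη hV hq0 hq hφ hφ0
  refine ⟨fun θ hθ => ?_, fun U hU => ?_, fun f _ => ⟨fun hfin δ hδ => ?_, fun htop M => ?_⟩⟩
  · rw [lt_thetaMax_iff h rfl] at hθ
    exact ⟨existsUnique_oneParticleSolution h hθ, fun x => ⟨⟨_, tendsto_oneParticle h hθ x⟩,
      (hasDerivAt_vLim h hθ x).differentiableAt⟩⟩
  · rw [EReal.neg_le]
    refine le_iInf₂ fun f hf => ?_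
    rw [EReal.neg_le]
    exact neg_LambdaStar_le_liminf h rfl hN hH hU hf.1 hf.2
  · have hbot : LambdaStar m η V q H φ f ≠ ⊥ :=
      ne_bot_of_le_ne_bot EReal.zero_ne_bot (zero_le_LambdaStar h rfl f)
    lift LambdaStar m η V q H φ f to ℝ using ⟨hfin, hbot⟩ with l hl
    -- `Λ*(f)` is nonnegative and not infinite here, hence a real number `l`, and the level `l - δ`
    -- lies strictly below it.
    obtain ⟨r, hr, hle⟩ := exists_limsup_measure_ball_le h rfl hN hH f (L := l - δ) (by
      rw [← hl, EReal.coe_lt_coe_iff]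
      linarith)
    refine ⟨r, hr, hle.trans_eq ?_⟩
    rw [neg_sub, EReal.coe_sub]
  · obtain ⟨r, hr, hle⟩ := exists_limsup_measure_ball_le h rfl hN hH f (L := M) (by
      rw [htop]
      exact EReal.coe_lt_top M)
    exact ⟨r, hr, hle.trans_eq (EReal.coe_neg M)⟩
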